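/- Let $(\mathcal V,g)$ be an oriented and time-oriented 4-dimensional spacetime of signature $(-,+,+,+)$ satisfying $G_{ab}=8\pi(T^{EM}_{ab}+T^M_{ab})-\Lambda g_{ab}$, where $\Lambda\ge 0$, $T^{EM}_{ab}=\frac1{4\pi}\left(F_{ac}F_b{}^c-\frac14 g_{ab}F_{cd}F^{cd}\right)$ for a smooth 2-form $F$, and $T^M_{ab}$ satisfies the dominant energy condition. Let $S$ be a spacelike embedded 2-sphere with induced metric $q$ and smooth future-directed null normals $\ell,k$, $\ell^ak_a=-1$, and put $\theta^{(\ell)}=q^{ab}\nabla_a\ell_b$, $\Omega_a=-k^cq^d{}_a\nabla_d\ell_c$, $E_\perp=\ell^ak^bF_{ab}$, $B_\perp=\ell^ak^b\,{}^*\!F_{ab}$. Assume that $S$ is axisymmetric: there is a nontrivial vector field $\eta^a$ on $S$ with closed integral curves of parameter length $2\pi$ such that $\mathcal L_\eta q_{ab}=\mathcal L_\eta\Omega_a=\mathcal L_\eta E_\perp=\mathcal L_\eta B_\perp=0$. Assume moreover that one of the following holds. (I) $S$ is a stable axisymmetric MOTS: $\theta^{(\ell)}=0$, and there are axisymmetric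 functions $\gamma\ge0$, $\beta>0$ on $S$ such that $\delta_X\theta^{(\ell)}\ge0$ for $X^a=\gamma\ell^a-\beta k^a$, where $\delta_X$ is the infinitesimal variation under a deformation of $S$ along $X$. (II) $S$ is a stable axisymmetric minimal surface in a maximal slice: $S$ lies in a spacelike hypersurface $\Sigma$ with future unit normal $n$ and trace-free second fundamental form, $\ell=n+e_1$ and $k=\frac12(n-e_1)$ with $e_1$ a unit normal of $S$ in $\Sigma$, the mean curvature of $S$ in $\Sigma$ vanishes, and the second variation of area satisfies $\delta^2_{\alpha e_1}A\ge0$ for all axisymmetric functions $\alpha$ on $S$. Let $(\theta,\varphi)$ be spherical coordinates on $S$ (given by a diffeomorphism from the unit sphere) with $\eta^a=\partial_\varphi$ in which $$q=e^{2c-\sigma}d\theta^2+e^{\sigma}\sin^2\theta\,d\varphi^2$$ with a constant $c$ and a smooth axisymmetric function $\sigma$ on $S$, and put $\eta=\eta^a\eta_a=e^\sigma\sin^2\theta$. Let $\Omega_a=\epsilon_{ab}D^b\tilde\omega+D_a\lambda$ be a Hodge decomposition with smooth $\tilde\omega,\lambda$ ($\epsilon_{ab}$ the area form of $q$), and let $\psi,\chi,\omega$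 be smooth axisymmetric functions on $S$ with (a prime denoting $\partial_\theta$) $$\psi'=-E_\perp e^c\sin\theta,\qquad \chi'=-B_\perp e^c\sin\theta,\qquad \omega'=2\eta\,\tilde\omega'-2\chi\psi'+2\psi\chi'.$$ Then the area $A$ of $S$ satisfies $$A\ \ge\ 4\pi\, e^{\frac{\mathcal M-8}{8}},$$ where $$\mathcal M=\frac1{2\pi}\int_{S^2}\left[4\sigma+|D\sigma|^2+\frac{|D\omega+2\chi D\psi-2\psi D\chi|^2}{\eta^2}+4\,\frac{|D\psi|^2+|D\chi|^2}{\eta}\right]dS_0,$$ $dS_0=\sin\theta\,d\theta\,d\varphi$, the norms are those of the standard round metric on $S^2$, and the integrand is integrable. -/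

import Mathlib

open scoped Manifold ContDiff

universe v s w

noncomputable section

/-! ### Coordinate tensor calculus -/

/-- The model space `ℝⁿ`. -/
abbrev E (n : ℕ) : Type := EuclideanSpace ℝ (Fin n)

/-- The standard basis vectors of `ℝⁿ`. -/
def basisVec {n : ℕ} (i : Fin n) : E n := EuclideanSpace.single i 1

/-- The Gram matrix `q_{ij}` of a bilinear form. -/
def gram {n : ℕ} (q : E n → E n → ℝ) : Matrix (Fin n) (Fin n) ℝ :=
  Matrix.of fun i j => q (basisVec i) (basisVec j)

/-- The metric trace `q^{ij} B_{ij}`, with `q^{ij}` the inverse of `q_{ij}`. -/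
def metricTrace {n : ℕ} (q B : E n → E n → ℝ) : ℝ :=
  ∑ i, ∑ j, (gram q)⁻¹ i j * B (basisVec i) (basisVec j)

/-- A field of continuous bilinear forms on the tangent spaces of a 4-manifold. -/
abbrev BilinField (V : Type*) [TopologicalSpace V] [ChartedSpace (E 4) V] : Type _ :=
  ∀ x : V, TangentSpace (𝓡 4) x →L[ℝ] TangentSpace (𝓡 4) x →L[ℝ] ℝ

/-- Smoothness of a field of bilinear forms, as a section of the corresponding vector bundle. -/
def SmoothBilin {V : Type*} [TopologicalSpace V] [ChartedSpace (E 4) V]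
    [IsManifold (𝓡 4) ∞ V] (g : BilinField V) : Prop :=
  ContMDiff (𝓡 4) ((𝓡 4).prod 𝓘(ℝ, E 4 →L[ℝ] E 4 →L[ℝ] ℝ)) ∞
    (fun x : V => Bundle.TotalSpace.mk' (E 4 →L[ℝ] E 4 →L[ℝ] ℝ)
      (E := fun x : V => TangentSpace (𝓡 4) x →L[ℝ] TangentSpace (𝓡 4) x →L[ℝ] ℝ) x (g x))

section Curvature

variable {V : Type*} [TopologicalSpace V] [ChartedSpace (E 4) V]

/-- The coordinate vector at chart position `y` with components `u`, in the preferred chart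
at `p`. -/
def coordVec (p : V) (y u : E 4) : TangentSpace (𝓡 4) ((extChartAt (𝓡 4) p).symm y) :=
  mfderiv 𝓘(ℝ, E 4) (𝓡 4) (extChartAt (𝓡 4) p).symm y u

/-- The metric components at chart position `y`, in the preferred chart at `p`. -/
def chartMetric (g : BilinField V) (p : V) (y u v : E 4) : ℝ :=
  g ((extChartAt (𝓡 4) p).symm y) (coordVec p y u) (coordVec p y v)

/-- The Christoffel symbols of the Levi-Civita connection, in the preferred chart at `p`:
`Γ(u,v)^i = ½ g^{ij} (∂_u g_{vj} + ∂_v g_{uj} - ∂_j g_{uv})`. -/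
def christoffel (g : BilinField V) (p : V) (y u v : E 4) : E 4 :=
  ∑ i, ∑ j, ((gram (chartMetric g p y))⁻¹ i j * ((1 / 2) *
    (fderiv ℝ (fun z => chartMetric g p z v (basisVec j)) y u
      + fderiv ℝ (fun z => chartMetric g p z u (basisVec j)) y v
      - fderiv ℝ (fun z => chartMetric g p z u v) y (basisVec j)))) • basisVec i

/-- The Riemann tensor at `p`: `R(u,v)w = ∇_u ∇_v w - ∇_v ∇_u w - ∇_[u,v] w`. At `p` itself the
tangent space is identified with `ℝ⁴` by the preferred chart at `p`. -/
def riemann (g : BilinField V) (p : V) (u v w : E 4) : E 4 :=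
  let y := extChartAt (𝓡 4) p p
  fderiv ℝ (fun z => christoffel g p z v w) y u - fderiv ℝ (fun z => christoffel g p z u w) y v
    + christoffel g p y u (christoffel g p y v w) - christoffel g p y v (christoffel g p y u w)

/-- The Ricci tensor `Ric(v,w) = tr (u ↦ R(u,v)w)`. -/
def ricci (g : BilinField V) (p : V) (v w : E 4) : ℝ :=
  ∑ i, (riemann g p (basisVec i) v w) i

/-- The scalar curvature. -/
def scalarCurv (g : BilinField V) (p : V) : ℝ :=
  metricTrace (fun u v : E 4 => g p u v) (ricci g p)

/-- The Einstein tensor `G = Ric - ½ R g`. -/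
def einsteinTensor (g : BilinField V) (p : V) (u v : E 4) : ℝ :=
  ricci g p u v - (1 / 2) * scalarCurv g p * g p u v

/-- The Levi-Civita covariant derivative `∇_v Y` at `x` of a vector field `Y` along a map
`f : X → V`, where `v` is tangent to `X`: in the preferred chart at `f x`,
`∇_v Y = ∂_v Y + Γ(df v, Y)`. -/
def covAlong (g : BilinField V) {m : ℕ} {X : Type*} [TopologicalSpace X] [ChartedSpace (E m) X]
    (f : X → V) (Y : ∀ x, TangentSpace (𝓡 4) (f x)) (x : X) (v : TangentSpace (𝓡 m) x) :
    TangentSpace (𝓡 4) (f x) :=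
  let components : X → E 4 :=
    fun z => mfderiv (𝓡 4) 𝓘(ℝ, E 4) (extChartAt (𝓡 4) (f x)) (f z) (Y z)
  let dY : E 4 := mfderiv (𝓡 m) 𝓘(ℝ, E 4) components x v
  let result : E 4 :=
    dY + christoffel g (f x) (extChartAt (𝓡 4) (f x) (f x)) (mfderiv (𝓡 m) (𝓡 4) f x v) (Y x)
  result

/-- The pullback of the metric by a map. -/
def inducedMetric (g : BilinField V) {m : ℕ} {X : Type*} [TopologicalSpace X]
    [ChartedSpace (E m) X] (f : X → V) (x : X) (u v : TangentSpace (𝓡 m) x) : ℝ :=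
  g (f x) (mfderiv (𝓡 m) (𝓡 4) f x u) (mfderiv (𝓡 m) (𝓡 4) f x v)

/-- The trace `q^{ab} ∇_a L_b` over the tangent space of the surface `f`, where `q` is the induced
metric and `L` is a vector field along `f`: the expansion of `f` along `L`. -/
def expansion (g : BilinField V) {S : Type*} [TopologicalSpace S] [ChartedSpace (E 2) S]
    (f : S → V) (L : ∀ s, TangentSpace (𝓡 4) (f s)) (s : S) : ℝ :=
  metricTrace (n := 2) (fun u v => inducedMetric g f s u v)
    (fun u v => g (f s) (covAlong g f L s u) (mfderiv (𝓡 2) (𝓡 4) f s v))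

/-- The stress-energy tensor of the electromagnetic field `F`,
`(1/4π) (F_{ac} F_b^c - ¼ g_{ab} F_{cd} F^{cd})`. -/
def emStress (g F : BilinField V) (p : V) (u v : E 4) : ℝ :=
  1 / (4 * Real.pi) *
    (metricTrace (fun a b : E 4 => g p a b) (fun a b => F p u a * F p v b)
      - (1 / 4) * g p u v * metricTrace (fun a b : E 4 => g p a b)
          (fun a b => metricTrace (fun c d : E 4 => g p c d) (fun c d => F p a c * F p b d)))

/-- The Hodge dual `*F_{ab} = ½ ε_{abcd} F^{cd}`. -/
def hodgeDual (g F : BilinField V) (ε : ∀ x : V, TangentSpace (𝓡 4) x [⋀^Fin 4]→ₗ[ℝ] ℝ)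
    (p : V) (u v : E 4) : ℝ :=
  (1 / 2) * metricTrace (fun a b : E 4 => g p a b)
    (fun a a' => metricTrace (fun c d : E 4 => g p c d)
      (fun c c' => ε p (![u, v, a, c] : Fin 4 → E 4) * F p a' c'))

end Curvature

/-! ### Spacetimes and surfaces -/

/-- An oriented and time-oriented Lorentzian 4-manifold of signature `(-,+,+,+)` that satisfies the
Einstein equations `G = 8π (T^EM + T^M) - Λ g` with `Λ ≥ 0`, where `T^EM` is the stress-energy of
a 2-form `F` and the matter part `T^M` satisfies the dominant energy condition. -/
structure EMSpacetime (V : Type*) [TopologicalSpace V] [ChartedSpace (E 4) V]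
    [IsManifold (𝓡 4) ∞ V] where
  /-- the metric -/
  g : BilinField V
  g_smooth : SmoothBilin g
  g_symm : ∀ x u v, g x u v = g x v u
  g_lorentz : ∀ x, ∃ t, g x t t < 0 ∧ ∀ v, g x t v = 0 → v ≠ 0 → 0 < g x v v
  /-- the time orientation, a timelike vector field declared to be future-directed -/
  T : ∀ x : V, TangentSpace (𝓡 4) x
  T_cont : Continuous (fun x : V => (⟨x, T x⟩ : TangentBundle (𝓡 4) V))
  T_timelike : ∀ x, g x (T x) (T x) < 0
  /-- the volume form of the metric and the orientation -/
  vol : ∀ x : V, TangentSpace (𝓡 4) x [⋀^Fin 4]→ₗ[ℝ] ℝ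
  vol_cont : ∀ p : V, ContinuousOn (fun y : E 4 => vol ((extChartAt (𝓡 4) p).symm y)
    (fun i => coordVec p y (basisVec i))) (extChartAt (𝓡 4) p).target
  vol_normalized : ∀ (x : V) (v : Fin 4 → TangentSpace (𝓡 4) x),
    vol x v ^ 2 = - Matrix.det (Matrix.of fun i j => g x (v i) (v j))
  /-- the electromagnetic field tensor -/
  F : BilinField V
  F_smooth : SmoothBilin F
  F_antisymm : ∀ x u v, F x u v = - F x v u
  /-- the stress-energy tensor of the non-electromagnetic matter -/
  TM : BilinField V
  /-- the cosmological constant -/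
  Λ : ℝ
  Λ_nonneg : 0 ≤ Λ
  einstein : ∀ (x : V) (u v : TangentSpace (𝓡 4) x),
    einsteinTensor g x u v = 8 * Real.pi * (emStress g F x u v + TM x u v) - Λ * g x u v
  /-- the dominant energy condition: `T^M(u,v) ≥ 0` for all future-directed causal `u`, `v` -/
  dominant : ∀ (x : V) (u v : TangentSpace (𝓡 4) x), g x u u ≤ 0 → g x (T x) u < 0 →
    g x v v ≤ 0 → g x (T x) v < 0 → 0 ≤ TM x u v

/-- An embedded spacelike surface with smooth future-directed null normals `ℓ`, `k` with
`g(ℓ,k) = -1`. -/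
structure FramedSurface {V : Type*} [TopologicalSpace V] [ChartedSpace (E 4) V]
    [IsManifold (𝓡 4) ∞ V] (M : EMSpacetime V)
    (S : Type*) [TopologicalSpace S] [ChartedSpace (E 2) S] [IsManifold (𝓡 2) ∞ S] where
  /-- the embedding -/
  emb : S → V
  emb_smooth : ContMDiff (𝓡 2) (𝓡 4) ∞ emb
  emb_embedding : Topology.IsEmbedding emb
  spacelike : ∀ (s : S) (v : TangentSpace (𝓡 2) s), v ≠ 0 → 0 < inducedMetric M.g emb s v v
  /-- the outgoing null normal -/
  ell : ∀ s, TangentSpace (𝓡 4) (emb s)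
  /-- the ingoing null normal -/
  k : ∀ s, TangentSpace (𝓡 4) (emb s)
  ell_smooth : ContMDiff (𝓡 2) (𝓡 4).tangent ∞
    (fun s => (⟨emb s, ell s⟩ : TangentBundle (𝓡 4) V))
  k_smooth : ContMDiff (𝓡 2) (𝓡 4).tangent ∞
    (fun s => (⟨emb s, k s⟩ : TangentBundle (𝓡 4) V))
  ell_null : ∀ s, M.g (emb s) (ell s) (ell s) = 0
  k_null : ∀ s, M.g (emb s) (k s) (k s) = 0
  ell_normal : ∀ s v, M.g (emb s) (ell s) (mfderiv (𝓡 2) (𝓡 4) emb s v) = 0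
  k_normal : ∀ s v, M.g (emb s) (k s) (mfderiv (𝓡 2) (𝓡 4) emb s v) = 0
  ell_k : ∀ s, M.g (emb s) (ell s) (k s) = -1
  ell_future : ∀ s, M.g (emb s) (M.T (emb s)) (ell s) < 0
  k_future : ∀ s, M.g (emb s) (M.T (emb s)) (k s) < 0

section Surface

variable {V : Type*} [TopologicalSpace V] [ChartedSpace (E 4) V] [IsManifold (𝓡 4) ∞ V]
  {M : EMSpacetime V} {S : Type*} [TopologicalSpace S] [ChartedSpace (E 2) S]
  [IsManifold (𝓡 2) ∞ S]

/-- The induced metric `q_{ab}`. -/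
def FramedSurface.q (P : FramedSurface M S) (s : S) (u v : TangentSpace (𝓡 2) s) : ℝ :=
  inducedMetric M.g P.emb s u v

/-- The normal fundamental form `Ω_a = - k^c q^d_a ∇_d ℓ_c`. -/
def FramedSurface.Omega (P : FramedSurface M S) (s : S) (v : TangentSpace (𝓡 2) s) : ℝ :=
  - M.g (P.emb s) (P.k s) (covAlong M.g P.emb P.ell s v)

/-- The electric flux density `E_⊥ = ℓ^a k^b F_{ab}`. -/
def FramedSurface.Eperp (P : FramedSurface M S) (s : S) : ℝ :=
  M.F (P.emb s) (P.ell s) (P.k s)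

/-- The magnetic flux density `B_⊥ = ℓ^a k^b *F_{ab}`. -/
def FramedSurface.Bperp (P : FramedSurface M S) (s : S) : ℝ :=
  hodgeDual M.g M.F M.vol (P.emb s) (P.ell s) (P.k s)

/-- Axisymmetry of the surface: a vector field `η`, not identically zero, with closed integral
curves of parameter length `2π` (apart from its zeros), whose Lie derivative annihilates
`q`, `Ω`, `E_⊥` and `B_⊥`. Lie derivatives are derivatives of pullbacks along the flow of `η`. -/
structure AxialSymmetry (P : FramedSurface M S) where
  /-- the axial Killing field -/
  eta : ∀ s : S, TangentSpace (𝓡 2) s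
  eta_smooth : ContMDiff (𝓡 2) (𝓡 2).tangent ∞ (fun s => (⟨s, eta s⟩ : TangentBundle (𝓡 2) S))
  eta_nontrivial : ∃ s, eta s ≠ 0
  /-- the flow of `η` -/
  flow : ℝ → S → S
  flow_smooth : ContMDiff (𝓘(ℝ, ℝ).prod (𝓡 2)) (𝓡 2) ∞ (fun z : ℝ × S => flow z.1 z.2)
  flow_zero : ∀ s, flow 0 s = s
  flow_integral : ∀ s, IsMIntegralCurve (fun t => flow t s) eta
  closed : ∀ s, flow (2 * Real.pi) s = s
  minimal_period : ∀ s, eta s ≠ 0 → ∀ t, 0 < t → t < 2 * Real.pi → flow t s ≠ s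
  lie_q : ∀ (s : S) (u v : TangentSpace (𝓡 2) s),
    deriv (fun t => P.q (flow t s) (mfderiv (𝓡 2) (𝓡 2) (flow t) s u)
      (mfderiv (𝓡 2) (𝓡 2) (flow t) s v)) 0 = 0
  lie_Omega : ∀ (s : S) (v : TangentSpace (𝓡 2) s),
    deriv (fun t => P.Omega (flow t s) (mfderiv (𝓡 2) (𝓡 2) (flow t) s v)) 0 = 0
  lie_Eperp : ∀ s : S, deriv (fun t => P.Eperp (flow t s)) 0 = 0
  lie_Bperp : ∀ s : S, deriv (fun t => P.Bperp (flow t s)) 0 = 0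

/-- Smooth axisymmetric functions on the surface. -/
def AxialSymmetry.SmoothAxisymmetric {P : FramedSurface M S} (A : AxialSymmetry P)
    (f : S → ℝ) : Prop :=
  ContMDiff (𝓡 2) 𝓘(ℝ, ℝ) ∞ f ∧ ∀ t s, f (A.flow t s) = f s

/-- A stable axisymmetric marginally outer trapped surface: `θ^(ℓ) = 0`, and there is an outgoing
vector `X = γ ℓ - β k` with axisymmetric `γ ≥ 0`, `β > 0` and `δ_X θ^(ℓ) ≥ 0`. Here `δ_X θ^(ℓ)`
is the derivative at `t = 0` of the expansion along null normals `L_t`, `L_0 = ℓ`, of a family of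
surfaces `f_t` with `f_0` the given surface and velocity `X` at `t = 0`. As `θ^(ℓ) = 0`, it depends
neither on the choice of `L_t` nor on that of a family with velocity `X`. -/
def IsStableMOTS (P : FramedSurface M S) (A : AxialSymmetry P) : Prop :=
  (∀ s, expansion M.g P.emb P.ell s = 0) ∧
  ∃ γ β : S → ℝ, A.SmoothAxisymmetric γ ∧ A.SmoothAxisymmetric β ∧
    (∀ s, 0 ≤ γ s) ∧ (∀ s, 0 < β s) ∧
    ∃ (f : ℝ → S → V) (L : ∀ t s, TangentSpace (𝓡 4) (f t s)),
      ContMDiff (𝓘(ℝ, ℝ).prod (𝓡 2)) (𝓡 4) ∞ (fun z : ℝ × S => f z.1 z.2) ∧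
      ContMDiff (𝓘(ℝ, ℝ).prod (𝓡 2)) (𝓡 4).tangent ∞
        (fun z : ℝ × S => (⟨f z.1 z.2, L z.1 z.2⟩ : TangentBundle (𝓡 4) V)) ∧
      (∀ s, (⟨f 0 s, L 0 s⟩ : TangentBundle (𝓡 4) V) = ⟨P.emb s, P.ell s⟩) ∧
      (∀ s, (⟨f 0 s, mfderiv 𝓘(ℝ, ℝ) (𝓡 4) (fun t => f t s) 0 (1 : ℝ)⟩ : TangentBundle (𝓡 4) V)
        = ⟨P.emb s, γ s • P.ell s - β s • P.k s⟩) ∧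
      (∀ t s, M.g (f t s) (L t s) (L t s) = 0) ∧
      (∀ t s v, M.g (f t s) (L t s) (mfderiv (𝓡 2) (𝓡 4) (f t) s v) = 0) ∧
      ∀ s, 0 ≤ deriv (fun t => expansion M.g (f t) (L t) s) 0

/-! ### Spherical coordinates and area -/

/-- The point of the unit sphere with polar angle `θ` and azimuth `φ`. -/
def spherePoint (θ φ : ℝ) : Metric.sphere (0 : E 3) 1 :=
  ⟨!₂[Real.sin θ * Real.cos φ, Real.sin θ * Real.sin φ, Real.cos θ], by
    have h : (Real.sin θ * Real.cos φ) ^ 2 + (Real.sin θ * Real.sin φ) ^ 2 + Real.cos θ ^ 2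
        = 1 := by
      have h1 := Real.sin_sq_add_cos_sq θ
      have h2 := Real.sin_sq_add_cos_sq φ
      linear_combination h1 + Real.sin θ ^ 2 * h2
    simp [EuclideanSpace.norm_eq, Fin.sum_univ_three, h]⟩

/-- A diffeomorphism from the unit sphere onto the surface. -/
abbrev SphereParam (S : Type*) [TopologicalSpace S] [ChartedSpace (E 2) S] : Type _ :=
  Diffeomorph (𝓡 2) (𝓡 2) (Metric.sphere (0 : E 3) 1) S ∞

/-- The point of the surface with spherical coordinates `(θ, φ)`. -/
def SphereParam.pt (Ψ : SphereParam S) (θ φ : ℝ) : S := Ψ (spherePoint θ φ)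

/-- The coordinate vector `∂_θ`. -/
def SphereParam.dθ (Ψ : SphereParam S) (θ φ : ℝ) : TangentSpace (𝓡 2) (SphereParam.pt Ψ θ φ) :=
  mfderiv 𝓘(ℝ, ℝ) (𝓡 2) (fun t => SphereParam.pt Ψ t φ) θ (1 : ℝ)

/-- The coordinate vector `∂_φ`. -/
def SphereParam.dφ (Ψ : SphereParam S) (θ φ : ℝ) : TangentSpace (𝓡 2) (SphereParam.pt Ψ θ φ) :=
  mfderiv 𝓘(ℝ, ℝ) (𝓡 2) (fun t => SphereParam.pt Ψ θ t) φ (1 : ℝ)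

/-- `∂f/∂θ`. -/
def SphereParam.pθ (Ψ : SphereParam S) (f : S → ℝ) (θ φ : ℝ) : ℝ :=
  deriv (fun t => f (SphereParam.pt Ψ t φ)) θ

/-- `∂f/∂φ`. -/
def SphereParam.pφ (Ψ : SphereParam S) (f : S → ℝ) (θ φ : ℝ) : ℝ :=
  deriv (fun t => f (SphereParam.pt Ψ θ t)) φ

/-- The coordinate domain `0 < θ < π`, `0 < φ < 2π`, of full measure in the sphere. -/
def coordDomain : Set (ℝ × ℝ) := Set.Ioo 0 Real.pi ×ˢ Set.Ioo 0 (2 * Real.pi)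

/-- The area `∫ √(det q) dθ dφ` of a metric `q`. (The value is the same for all `Ψ`.) -/
def area (Ψ : SphereParam S) (q : ∀ s : S, TangentSpace (𝓡 2) s → TangentSpace (𝓡 2) s → ℝ) :
    ℝ :=
  ∫ z in coordDomain,
    let s := SphereParam.pt Ψ z.1 z.2
    let a := SphereParam.dθ Ψ z.1 z.2
    let b := SphereParam.dφ Ψ z.1 z.2
    Real.sqrt (q s a a * q s b b - q s a b * q s b a)

end Surface

/-! ### Minimal surfaces in maximal slices -/

/-- A maximal slice: an embedded spacelike hypersurface with smooth future-directed unit normal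
`n`, whose second fundamental form `K(u,v) = - g(∇_u n, v)` has vanishing trace. -/
structure MaximalSlice {V : Type*} [TopologicalSpace V] [ChartedSpace (E 4) V]
    [IsManifold (𝓡 4) ∞ V] (M : EMSpacetime V)
    (N : Type*) [TopologicalSpace N] [ChartedSpace (E 3) N] [IsManifold (𝓡 3) ∞ N] where
  /-- the embedding -/
  emb : N → V
  emb_smooth : ContMDiff (𝓡 3) (𝓡 4) ∞ emb
  emb_embedding : Topology.IsEmbedding emb
  spacelike : ∀ (y : N) (v : TangentSpace (𝓡 3) y), v ≠ 0 → 0 < inducedMetric M.g emb y v v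
  /-- the unit normal -/
  n : ∀ y, TangentSpace (𝓡 4) (emb y)
  n_smooth : ContMDiff (𝓡 3) (𝓡 4).tangent ∞ (fun y => (⟨emb y, n y⟩ : TangentBundle (𝓡 4) V))
  n_unit : ∀ y, M.g (emb y) (n y) (n y) = -1
  n_normal : ∀ y v, M.g (emb y) (n y) (mfderiv (𝓡 3) (𝓡 4) emb y v) = 0
  n_future : ∀ y, M.g (emb y) (M.T (emb y)) (n y) < 0
  maximal : ∀ y, metricTrace (n := 3) (fun u v => inducedMetric M.g emb y u v)
    (fun u v => - M.g (emb y) (covAlong M.g emb n y u) (mfderiv (𝓡 3) (𝓡 4) emb y v)) = 0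

/-- A stable axisymmetric minimal surface in a maximal slice `N`. The surface is a map `j` into
`N` with unit normal `ν` in `N`, and, with `e₁` the image of `ν` in the spacetime, its null normals
are `ℓ = n + e₁` and `k = (n - e₁)/2`. Its mean curvature in `N` vanishes; this is the trace of
`g(∇_u e₁, v)` over the tangent space of the surface, as `∇_u e₁` and the covariant derivative of
`ν` in `N` differ by a multiple of `n`. Stability says that the second variation of area
`δ²_{α e₁} A`, the second derivative at `t = 0` of the area of a family of surfaces in `N` with
velocity `α e₁` at `t = 0`, is nonnegative for all axisymmetric `α`; as the surface is minimal, it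
does not depend on the choice of a family with velocity `α e₁`. -/
def IsStableMinimal {V : Type*} [TopologicalSpace V] [ChartedSpace (E 4) V]
    [IsManifold (𝓡 4) ∞ V] {M : EMSpacetime V} {S : Type*} [TopologicalSpace S]
    [ChartedSpace (E 2) S] [IsManifold (𝓡 2) ∞ S]
    (P : FramedSurface M S) (A : AxialSymmetry P) (Ψ : SphereParam S) : Prop :=
  ∃ (N : Type w) (_ : TopologicalSpace N) (_ : ChartedSpace (E 3) N) (_ : IsManifold (𝓡 3) ∞ N)
    (H : MaximalSlice M N) (j : S → N) (ν : ∀ s, TangentSpace (𝓡 3) (j s)),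
    let f : S → V := fun s => H.emb (j s)
    let e₁ : ∀ s, TangentSpace (𝓡 4) (f s) := fun s => mfderiv (𝓡 3) (𝓡 4) H.emb (j s) (ν s)
    ContMDiff (𝓡 2) (𝓡 3) ∞ j ∧
    ContMDiff (𝓡 2) (𝓡 3).tangent ∞ (fun s => (⟨j s, ν s⟩ : TangentBundle (𝓡 3) N)) ∧
    (∀ s, M.g (f s) (e₁ s) (e₁ s) = 1) ∧
    (∀ s v, M.g (f s) (e₁ s) (mfderiv (𝓡 2) (𝓡 4) f s v) = 0) ∧
    (∀ s, (⟨f s, H.n (j s) + e₁ s⟩ : TangentBundle (𝓡 4) V) = ⟨P.emb s, P.ell s⟩) ∧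
    (∀ s, (⟨f s, (1 / 2 : ℝ) • (H.n (j s) - e₁ s)⟩ : TangentBundle (𝓡 4) V)
      = ⟨P.emb s, P.k s⟩) ∧
    (∀ s, expansion M.g f e₁ s = 0) ∧
    ∀ α : S → ℝ, A.SmoothAxisymmetric α →
      ∃ J : ℝ → S → N,
        ContMDiff (𝓘(ℝ, ℝ).prod (𝓡 2)) (𝓡 3) ∞ (fun z : ℝ × S => J z.1 z.2) ∧
        (∀ s, J 0 s = j s) ∧
        (∀ s, (⟨J 0 s, mfderiv 𝓘(ℝ, ℝ) (𝓡 3) (fun t => J t s) 0 (1 : ℝ)⟩ :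
          TangentBundle (𝓡 3) N) = ⟨j s, α s • ν s⟩) ∧
        0 ≤ iteratedDeriv 2
          (fun t => area Ψ (inducedMetric M.g (fun s => H.emb (J t s)))) 0

/-! ### Quasilocal potentials and the functional -/

section Potentials

variable {V : Type*} [TopologicalSpace V] [ChartedSpace (E 4) V] [IsManifold (𝓡 4) ∞ V]
  {M : EMSpacetime V} {S : Type*} [TopologicalSpace S] [ChartedSpace (E 2) S]
  [IsManifold (𝓡 2) ∞ S]

/-- Spherical coordinates `(θ, φ)` are adapted to the axisymmetric surface, with constant `c` and
function `σ`, if `η = ∂_φ` and `q = e^{2c-σ} dθ² + e^σ sin²θ dφ²`. -/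
structure IsAdapted (P : FramedSurface M S) (A : AxialSymmetry P) (Ψ : SphereParam S)
    (c : ℝ) (σ : S → ℝ) : Prop where
  flow_eq : ∀ t θ φ, A.flow t (SphereParam.pt Ψ θ φ) = SphereParam.pt Ψ θ (φ + t)
  smooth : A.SmoothAxisymmetric σ
  q_θθ : ∀ θ φ, 0 < θ → θ < Real.pi →
    P.q (SphereParam.pt Ψ θ φ) (SphereParam.dθ Ψ θ φ) (SphereParam.dθ Ψ θ φ)
      = Real.exp (2 * c - σ (SphereParam.pt Ψ θ φ))
  q_θφ : ∀ θ φ, 0 < θ → θ < Real.pi →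
    P.q (SphereParam.pt Ψ θ φ) (SphereParam.dθ Ψ θ φ) (SphereParam.dφ Ψ θ φ) = 0
  q_φφ : ∀ θ φ, 0 < θ → θ < Real.pi →
    P.q (SphereParam.pt Ψ θ φ) (SphereParam.dφ Ψ θ φ) (SphereParam.dφ Ψ θ φ)
      = Real.exp (σ (SphereParam.pt Ψ θ φ)) * Real.sin θ ^ 2

/-- The functions `σ, om (for ω), ψ, χ` are quasilocal potentials of the surface in the spherical
coordinates `Ψ`: the metric has the form above, `Ω_a = ε_{ab} D^b τ + D_a lam` is a Hodge
decomposition of the normal fundamental form, with `ε = e^c sin θ dθ ∧ dφ`, and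
`∂_θ ψ = - E_⊥ e^c sin θ`, `∂_θ χ = - B_⊥ e^c sin θ`,
`∂_θ om = 2 η ∂_θ τ - 2 χ ∂_θ ψ + 2 ψ ∂_θ χ`, where `η = e^σ sin²θ` is the square of the norm of
the axial Killing field. -/
structure IsPotentials (P : FramedSurface M S) (A : AxialSymmetry P) (Ψ : SphereParam S)
    (c : ℝ) (σ τ lam om ψ χ : S → ℝ) : Prop where
  adapted : IsAdapted P A Ψ c σ
  τ_smooth : ContMDiff (𝓡 2) 𝓘(ℝ, ℝ) ∞ τ
  lam_smooth : ContMDiff (𝓡 2) 𝓘(ℝ, ℝ) ∞ lam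
  om_smooth : A.SmoothAxisymmetric om
  ψ_smooth : A.SmoothAxisymmetric ψ
  χ_smooth : A.SmoothAxisymmetric χ
  hodge_θ : ∀ θ φ, 0 < θ → θ < Real.pi →
    P.Omega (SphereParam.pt Ψ θ φ) (SphereParam.dθ Ψ θ φ)
      = Real.exp c * Real.sin θ
          * (SphereParam.pφ Ψ τ θ φ / (Real.exp (σ (SphereParam.pt Ψ θ φ)) * Real.sin θ ^ 2))
        + SphereParam.pθ Ψ lam θ φ
  hodge_φ : ∀ θ φ, 0 < θ → θ < Real.pi →
    P.Omega (SphereParam.pt Ψ θ φ) (SphereParam.dφ Ψ θ φ)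
      = - (Real.exp c * Real.sin θ
          * (SphereParam.pθ Ψ τ θ φ / Real.exp (2 * c - σ (SphereParam.pt Ψ θ φ))))
        + SphereParam.pφ Ψ lam θ φ
  ψ_eq : ∀ θ φ, 0 < θ → θ < Real.pi →
    SphereParam.pθ Ψ ψ θ φ
      = - P.Eperp (SphereParam.pt Ψ θ φ) * Real.exp c * Real.sin θ
  χ_eq : ∀ θ φ, 0 < θ → θ < Real.pi →
    SphereParam.pθ Ψ χ θ φ
      = - P.Bperp (SphereParam.pt Ψ θ φ) * Real.exp c * Real.sin θ
  om_eq : ∀ θ φ, 0 < θ → θ < Real.pi →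
    SphereParam.pθ Ψ om θ φ
      = 2 * (Real.exp (σ (SphereParam.pt Ψ θ φ)) * Real.sin θ ^ 2) * SphereParam.pθ Ψ τ θ φ
        - 2 * χ (SphereParam.pt Ψ θ φ) * SphereParam.pθ Ψ ψ θ φ
        + 2 * ψ (SphereParam.pt Ψ θ φ) * SphereParam.pθ Ψ χ θ φ

/-- The squared norm `a² + b²/sin²θ` of the covector `a dθ + b dφ` in the standard round metric. -/
def roundNormSq (θ a b : ℝ) : ℝ := a ^ 2 + b ^ 2 / Real.sin θ ^ 2

/-- The integrand of the functional, including the weight `sin θ` of the round area element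
`dS₀ = sin θ dθ dφ`. -/
def functionalIntegrand (Ψ : SphereParam S) (σ om ψ χ : S → ℝ) (z : ℝ × ℝ) : ℝ :=
  let θ := z.1
  let φ := z.2
  let s := SphereParam.pt Ψ θ φ
  let η := Real.exp (σ s) * Real.sin θ ^ 2
  (4 * σ s + roundNormSq θ (SphereParam.pθ Ψ σ θ φ) (SphereParam.pφ Ψ σ θ φ)
    + roundNormSq θ
        (SphereParam.pθ Ψ om θ φ + 2 * χ s * SphereParam.pθ Ψ ψ θ φ
          - 2 * ψ s * SphereParam.pθ Ψ χ θ φ)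
        (SphereParam.pφ Ψ om θ φ + 2 * χ s * SphereParam.pφ Ψ ψ θ φ
          - 2 * ψ s * SphereParam.pφ Ψ χ θ φ) / η ^ 2
    + 4 * (roundNormSq θ (SphereParam.pθ Ψ ψ θ φ) (SphereParam.pφ Ψ ψ θ φ)
        + roundNormSq θ (SphereParam.pθ Ψ χ θ φ) (SphereParam.pφ Ψ χ θ φ)) / η) * Real.sin θ

/-- The functional `𝓜 = (1/2π) ∫ [4σ + |Dσ|² + |Dω + 2χDψ - 2ψDχ|²/η² + 4(|Dψ|² + |Dχ|²)/η] dS₀`. -/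
def functionalM (Ψ : SphereParam S) (σ om ψ χ : S → ℝ) : ℝ :=
  1 / (2 * Real.pi) * ∫ z in coordDomain, functionalIntegrand Ψ σ om ψ χ z

end Potentials

end

set_option maxSynthPendingDepth 3

noncomputable section

/-! ### Metric traces in frames -/

/-! Write a = e^{2c-σ} and b = e^σ sin²θ for the components of q, so that √(ab) = e^c sin θ and A =
4π e^c. By axisymmetry only functions of θ matter. The equation for ω' says ω' + 2χψ' - 2ψχ' = 2ητ',
where τ is the Hodge potential, so 𝓜 = 4N with N = ∫₀^π sin θ [σ + σ'²/4 + τ'² + (ψ'² + χ'²)/η] dθ.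
The claim becomes N ≤ 2 + 2c (`IsPotentials.area_bound`).

Case (I). The variation of θ^(ℓ) along X, divided by β, yields 0 ≤ K - (E_⊥² + B_⊥²) - Ω_φ²/b + div
V - |V|², where K is the Gauss curvature of q and V is the meridional covector Ω_θ - (log β)'. This
is multiplied by a sin θ, that is, by the area density and the squared test function e^{c-σ}. With Φ
= `poleTerm`, a sin θ K = Φ' - sin θ (σ + σ'²/2); the flux and Ω_φ terms become those of the
potentials; and the terms in V become (sin θ V)' + sin θ (σ'²/4 - (V - σ'/2)²). Hence the integrand
of N is at most (sin θ V + Φ)', and N ≤ Φ(π) - Φ(0) = 2 + σ(0) + σ(π). Smoothness of q at the poles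
forces σ = c there (`IsAdapted.profile_pole`), which gives 2 + 2c.

Case (II). The corresponding lapse is α = e^{c-σ/2}, with α² = a. The second derivative of the area
density is bounded pointwise by √(ab) [|Dα|² + α²(K - E_⊥² - B_⊥²) - α²|Ω|²] plus the divergence of
the tangential acceleration of the family. The divergence integrates to zero, and the rest is e^c
times the difference of Φ' and the integrand of N, up to a term of good sign.

Both pointwise inequalities come from commuting covariant derivatives along the family and from the
Gauss equation (`AxialFamily.expansion_variation`, `AxialFamily.area_variation`). The field
equations enter through `EMSpacetime.curvature_bounds`: in a null frame the Einstein tensor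
satisfies G(ℓ,k) ≥ E_⊥² + B_⊥² and G(ℓ,ℓ), G(k,k) ≥ 0. The tensor calculus is done in the chart at
one point of the surface; `EMSpacetime.covAlong_chart` makes the covariant derivatives independent
of the chart. The singular coordinate field ∂_φ is handled by writing it as sin θ times a field that
stays smooth along each meridian through the poles. -/

/-- Bilinearity of a function of two vectors of `ℝⁿ`. -/
structure IsBilin {n : ℕ} (B : E n → E n → ℝ) : Prop where
  add_left : ∀ u u' v, B (u + u') v = B u v + B u' v
  smul_left : ∀ (r : ℝ) u v, B (r • u) v = r * B u v
  add_right : ∀ u v v', B u (v + v') = B u v + B u v'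
  smul_right : ∀ (r : ℝ) u v, B u (r • v) = r * B u v

theorem sum_basisVec {n : ℕ} (u : E n) : ∑ i, u i • basisVec i = u := by
  ext j
  simp [basisVec, Finset.sum_apply, Pi.single_apply]

theorem IsBilin.clm {n : ℕ} (B : E n →L[ℝ] E n →L[ℝ] ℝ) : IsBilin fun u v => B u v := by
  constructor <;> intros <;> simp

theorem IsBilin.sum_left {n : ℕ} {B : E n → E n → ℝ} (hB : IsBilin B) {ι : Type*}
    (s : Finset ι) (c : ι → ℝ) (u : ι → E n) (v : E n) :
    B (∑ i ∈ s, c i • u i) v = ∑ i ∈ s, c i * B (u i) v := by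
  classical
  induction s using Finset.induction_on with
  | empty => simpa using hB.smul_left 0 0 v
  | insert a s ha ih => rw [Finset.sum_insert ha, Finset.sum_insert ha, hB.add_left,
      hB.smul_left, ih]

theorem IsBilin.flip {n : ℕ} {B : E n → E n → ℝ} (hB : IsBilin B) : IsBilin fun u v => B v u :=
  ⟨fun _ _ _ => hB.add_right _ _ _, fun _ _ _ => hB.smul_right _ _ _,
    fun _ _ _ => hB.add_left _ _ _, fun _ _ _ => hB.smul_left _ _ _⟩

theorem IsBilin.sum_right {n : ℕ} {B : E n → E n → ℝ} (hB : IsBilin B) {ι : Type*}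
    (s : Finset ι) (c : ι → ℝ) (u : ι → E n) (v : E n) :
    B v (∑ i ∈ s, c i • u i) = ∑ i ∈ s, c i * B v (u i) :=
  hB.flip.sum_left s c u v

/-- The components of a family of vectors. -/
def frameMatrix {n : ℕ} (b : Fin n → E n) : Matrix (Fin n) (Fin n) ℝ :=
  Matrix.of fun i j => b i j

theorem IsBilin.frame {n : ℕ} {B : E n → E n → ℝ} (hB : IsBilin B) (b : Fin n → E n) :
    (Matrix.of fun i j => B (b i) (b j)) =
      frameMatrix b * gram B * (frameMatrix b).transpose := by
  ext i j
  simp only [Matrix.of_apply, Matrix.mul_apply, frameMatrix, gram, Matrix.transpose_apply]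
  conv_lhs => rw [← sum_basisVec (b i), ← sum_basisVec (b j)]
  rw [hB.sum_right]
  refine Finset.sum_congr rfl fun k _ => ?_
  rw [hB.sum_left, mul_comm]

theorem metricTrace_eq_trace {n : ℕ} (q B : E n → E n → ℝ) :
    metricTrace q B = ((gram q)⁻¹ * (gram B).transpose).trace := by
  simp [metricTrace, Matrix.trace, Matrix.mul_apply, gram]

/-- The frame's Gram matrix is P g Pᵀ, and a one-sided inverse of a square matrix is two-sided, so
the factors may be rotated cyclically. The vectors need not be assumed a basis: invertibility of
their Gram matrix forces it. -/
theorem gram_inverse_of_frame {n : ℕ} {q : E n → E n → ℝ} (hq : IsBilin q) (b : Fin n → E n)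
    (Qi : Matrix (Fin n) (Fin n) ℝ) (hQ : Qi * (Matrix.of fun i j => q (b i) (b j)) = 1) :
    (gram q)⁻¹ = (frameMatrix b).transpose * Qi * frameMatrix b ∧ IsUnit (gram q).det := by
  rw [hq.frame b] at hQ
  set P := frameMatrix b
  have h1 : (Qi * P * gram q) * P.transpose = 1 := by simpa only [Matrix.mul_assoc] using hQ
  have h2 : P.transpose * (Qi * P * gram q) = 1 := mul_eq_one_comm.mp h1
  have h3 : (P.transpose * Qi * P) * gram q = 1 := by
    simpa only [Matrix.mul_assoc] using h2
  refine ⟨Matrix.inv_eq_left_inv h3, ?_⟩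
  exact (Matrix.isUnit_iff_isUnit_det _).mp (IsUnit.of_mul_eq_one_right _ h3)

/-- A metric trace may be computed in any frame, from the inverse `Qi` of the frame's Gram
matrix. -/
theorem metricTrace_frame {n : ℕ} {q B : E n → E n → ℝ} (hq : IsBilin q) (hB : IsBilin B)
    (b : Fin n → E n) (Qi : Matrix (Fin n) (Fin n) ℝ)
    (hQ : Qi * (Matrix.of fun i j => q (b i) (b j)) = 1) :
    metricTrace q B = ∑ i, ∑ j, Qi i j * B (b i) (b j) := by
  rw [metricTrace_eq_trace, (gram_inverse_of_frame hq b Qi hQ).1]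
  have : ∑ i, ∑ j, Qi i j * B (b i) (b j)
      = (Qi * (Matrix.of fun i j => B (b i) (b j)).transpose).trace := by
    simp [Matrix.trace, Matrix.mul_apply]
  rw [this, hB.frame b, Matrix.transpose_mul, Matrix.transpose_mul, Matrix.transpose_transpose,
    Matrix.mul_assoc, Matrix.mul_assoc, Matrix.trace_mul_comm]
  simp only [Matrix.mul_assoc]

/-- Contracting with the inverse metric undoes the lowering of an index. It is what allows an inner
product to be expanded in a frame. -/
theorem metricTrace_mul {n : ℕ} {q : E n → E n → ℝ} (hq : IsBilin q) (hdet : IsUnit (gram q).det)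
    (hs : ∀ u v, q u v = q v u) (A B : E n) :
    metricTrace q (fun u v => q A u * q B v) = q A B := by
  have hcol : ∀ v k, ∑ j, q v (basisVec j) * (gram q)⁻¹ j k = v k := by
    intro v k
    have h1 : gram q * (gram q)⁻¹ = 1 := Matrix.mul_nonsing_inv _ hdet
    have : ∀ j, q v (basisVec j) = ∑ i, v i * gram q i j := by
      intro j
      conv_lhs => rw [← sum_basisVec v]
      rw [hq.sum_left]; rfl
    simp only [this, Finset.sum_mul]
    rw [Finset.sum_comm]
    have h2 : ∀ i, ∑ j, v i * gram q i j * (gram q)⁻¹ j k = v i * (1 : Matrix _ _ ℝ) i k := by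
      intro i
      rw [← h1, Matrix.mul_apply, Finset.mul_sum]
      exact Finset.sum_congr rfl fun _ _ => by ring
    simp [h2, Matrix.one_apply]
  unfold metricTrace
  rw [Finset.sum_comm]
  have : ∀ j, ∑ i, (gram q)⁻¹ i j * (q A (basisVec i) * q B (basisVec j))
      = A j * q B (basisVec j) := by
    intro j
    rw [← hcol A j, Finset.sum_mul]
    exact Finset.sum_congr rfl fun _ _ => by ring
  simp only [this]
  rw [← hq.sum_right, sum_basisVec, hs]

/-- Turns the coordinate trace that defines the Ricci tensor into a metric trace, which can then be
evaluated in a null frame. -/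
theorem trace_eq_metricTrace {n : ℕ} {q : E n → E n → ℝ} (hq : IsBilin q)
    (hdet : IsUnit (gram q).det) (hs : ∀ u v, q u v = q v u) (T : E n → E n) :
    ∑ i, (T (basisVec i)) i = metricTrace q (fun u v => q (T u) v) := by
  have hcol : ∀ v k, ∑ j, (gram q)⁻¹ k j * q v (basisVec j) = v k := by
    intro v k
    have h1 : (gram q)⁻¹ * gram q = 1 := Matrix.nonsing_inv_mul _ hdet
    have : ∀ j, q v (basisVec j) = ∑ i, v i * gram q j i := by
      intro j
      conv_lhs => rw [← sum_basisVec v]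
      rw [hq.sum_left]
      exact Finset.sum_congr rfl fun _ _ => by rw [hs]; rfl
    simp only [this, Finset.mul_sum]
    rw [Finset.sum_comm]
    have h2 : ∀ i, ∑ j, (gram q)⁻¹ k j * (v i * gram q j i) = v i * (1 : Matrix _ _ ℝ) k i := by
      intro i
      rw [← h1, Matrix.mul_apply, Finset.mul_sum]
      exact Finset.sum_congr rfl fun _ _ => by ring
    simp [h2, Matrix.one_apply]
  unfold metricTrace
  exact Finset.sum_congr rfl fun i _ => (hcol _ _).symm


/-! ### Levi-Civita connections on open subsets of a vector space -/

/-- A smooth metric `G` and its Levi-Civita connection `Γ` on an open set `U`. -/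
structure LeviCivita {X : Type*} [NormedAddCommGroup X] [NormedSpace ℝ X]
    (G : X → X →L[ℝ] X →L[ℝ] ℝ) (Γ : X → X →L[ℝ] X →L[ℝ] X) (U : Set X) : Prop where
  isOpen : IsOpen U
  G_smooth : ContDiffOn ℝ ∞ G U
  Γ_smooth : ContDiffOn ℝ ∞ Γ U
  symm : ∀ y ∈ U, ∀ u v, G y u v = G y v u
  nondeg : ∀ y ∈ U, ∀ u, (∀ v, G y u v = 0) → u = 0
  Γ_symm : ∀ y ∈ U, ∀ u v, Γ y u v = Γ y v u
  compat : ∀ y ∈ U, ∀ a u v, fderiv ℝ G y a u v = G y (Γ y a u) v + G y u (Γ y a v)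

section Cov

variable {X W W' : Type*} [NormedAddCommGroup X] [NormedSpace ℝ X]
  [NormedAddCommGroup W] [NormedSpace ℝ W] [NormedAddCommGroup W'] [NormedSpace ℝ W']

/-- The covariant derivative, in the direction `a`, of a vector field `Y` along a map `F`. -/
def cov (Γ : X → X →L[ℝ] X →L[ℝ] X) (F Y : W → X) (w a : W) : X :=
  fderiv ℝ Y w a + Γ (F w) (fderiv ℝ F w a) (Y w)

/-- The Riemann tensor of a connection. -/
def riem (Γ : X → X →L[ℝ] X →L[ℝ] X) (y u v z : X) : X :=
  fderiv ℝ Γ y u v z - fderiv ℝ Γ y v u z + Γ y u (Γ y v z) - Γ y v (Γ y u z)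

theorem ContDiffOn.dir {Y : Type*} [NormedAddCommGroup Y] [NormedSpace ℝ Y] {φ : W → Y}
    {O : Set W} (hφ : ContDiffOn ℝ ∞ φ O) (hO : IsOpen O) (a : W) :
    ContDiffOn ℝ ∞ (fun w => fderiv ℝ φ w a) O :=
  (hφ.fderiv_of_isOpen hO (by simp)).clm_apply contDiffOn_const

theorem ContDiffOn.diffAt {Y : Type*} [NormedAddCommGroup Y] [NormedSpace ℝ Y] {φ : W → Y}
    {O : Set W} (hφ : ContDiffOn ℝ ∞ φ O) (hO : IsOpen O) {w : W} (hw : w ∈ O) :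
    DifferentiableAt ℝ φ w :=
  ((hφ.contDiffAt (hO.mem_nhds hw)).differentiableAt (by simp))

theorem dir_dir_comm {Y : Type*} [NormedAddCommGroup Y] [NormedSpace ℝ Y] {φ : W → Y}
    {O : Set W} (hφ : ContDiffOn ℝ ∞ φ O) (hO : IsOpen O) {w : W} (hw : w ∈ O) (a b : W) :
    fderiv ℝ (fun w => fderiv ℝ φ w a) w b = fderiv ℝ (fun w => fderiv ℝ φ w b) w a := by
  have hd : DifferentiableAt ℝ (fderiv ℝ φ) w :=
    ContDiffOn.diffAt (hφ.fderiv_of_isOpen hO (by simp)) hO hw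
  have hs : IsSymmSndFDerivAt ℝ φ w :=
    (hφ.contDiffAt (hO.mem_nhds hw)).isSymmSndFDerivAt
      (by rw [minSmoothness_of_isRCLikeNormedField]; exact WithTop.coe_le_coe.mpr le_top)
  rw [fderiv_clm_apply hd (differentiableAt_const _),
    fderiv_clm_apply hd (differentiableAt_const _)]
  simpa using hs b a

variable {G : X → X →L[ℝ] X →L[ℝ] ℝ} {Γ : X → X →L[ℝ] X →L[ℝ] X} {U : Set X}
  {O : Set W} {F Y Z : W → X}

theorem LeviCivita.cov_smooth (h : LeviCivita G Γ U) (hO : IsOpen O) (hF : ContDiffOn ℝ ∞ F O)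
    (hFU : Set.MapsTo F O U) (hY : ContDiffOn ℝ ∞ Y O) (a : W) :
    ContDiffOn ℝ ∞ (fun w => cov Γ F Y w a) O :=
  (hY.dir hO a).add (((h.Γ_smooth.comp hF hFU).clm_apply (hF.dir hO a)).clm_apply hY)

theorem LeviCivita.pair_smooth (h : LeviCivita G Γ U) (hF : ContDiffOn ℝ ∞ F O)
    (hFU : Set.MapsTo F O U) (hY : ContDiffOn ℝ ∞ Y O) (hZ : ContDiffOn ℝ ∞ Z O) :
    ContDiffOn ℝ ∞ (fun w => G (F w) (Y w) (Z w)) O :=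
  ((h.G_smooth.comp hF hFU).clm_apply hY).clm_apply hZ

/-- Differentiation of `T(F)(Y)(Z)` for a field `T` of bilinear maps. -/
theorem fderiv_bilin_along {Q : Type*} [NormedAddCommGroup Q] [NormedSpace ℝ Q]
    {T : X → X →L[ℝ] X →L[ℝ] Q} {w : W}
    (hT : DifferentiableAt ℝ T (F w)) (hF : DifferentiableAt ℝ F w)
    (hY : DifferentiableAt ℝ Y w) (hZ : DifferentiableAt ℝ Z w) (a : W) :
    fderiv ℝ (fun w => T (F w) (Y w) (Z w)) w a =
      fderiv ℝ T (F w) (fderiv ℝ F w a) (Y w) (Z w) + T (F w) (fderiv ℝ Y w a) (Z w)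
        + T (F w) (Y w) (fderiv ℝ Z w a) := by
  have hTF : DifferentiableAt ℝ (fun w => T (F w)) w :=
    DifferentiableAt.comp (g := T) w hT hF
  have e : fderiv ℝ (fun w => T (F w)) w = (fderiv ℝ T (F w)).comp (fderiv ℝ F w) :=
    fderiv_comp (g := T) w hT hF
  rw [fderiv_clm_apply (hTF.clm_apply hY) hZ, fderiv_clm_apply hTF hY, e]
  simp
  abel

theorem LeviCivita.fderiv_pair (h : LeviCivita G Γ U) (hO : IsOpen O) (hF : ContDiffOn ℝ ∞ F O)
    (hFU : Set.MapsTo F O U) (hY : ContDiffOn ℝ ∞ Y O) (hZ : ContDiffOn ℝ ∞ Z O) {w : W}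
    (hw : w ∈ O) (a : W) :
    fderiv ℝ (fun w => G (F w) (Y w) (Z w)) w a =
      G (F w) (cov Γ F Y w a) (Z w) + G (F w) (Y w) (cov Γ F Z w a) := by
  rw [fderiv_bilin_along (h.G_smooth.diffAt h.isOpen (hFU hw)) (hF.diffAt hO hw)
    (hY.diffAt hO hw) (hZ.diffAt hO hw), h.compat _ (hFU hw)]
  simp only [cov, map_add, add_apply]
  ring

/-- Torsion-freeness along a map: ordinary second derivatives commute and Γ is symmetric. -/
theorem LeviCivita.cov_comm (h : LeviCivita G Γ U) (hO : IsOpen O) (hF : ContDiffOn ℝ ∞ F O)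
    (hFU : Set.MapsTo F O U) {w : W} (hw : w ∈ O) (a b : W) :
    cov Γ F (fun w => fderiv ℝ F w b) w a = cov Γ F (fun w => fderiv ℝ F w a) w b := by
  rw [cov, cov, dir_dir_comm hF hO hw, h.Γ_symm _ (hFU hw)]

/-- On expansion, the second derivatives of `Y` and of `F` are symmetric in `a`, `b`, and the two
terms Γ(∂F, ∂Y) exchange their roles; what remains after subtraction is the derivative of Γ and the
products ΓΓ, which is the Riemann tensor. -/
theorem LeviCivita.cov_cov (h : LeviCivita G Γ U) (hO : IsOpen O) (hF : ContDiffOn ℝ ∞ F O)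
    (hFU : Set.MapsTo F O U) (hY : ContDiffOn ℝ ∞ Y O) {w : W} (hw : w ∈ O) (a b : W) :
    cov Γ F (fun w => cov Γ F Y w b) w a = cov Γ F (fun w => cov Γ F Y w a) w b
      + riem Γ (F w) (fderiv ℝ F w a) (fderiv ℝ F w b) (Y w) := by
  have hΓ := h.Γ_smooth.diffAt h.isOpen (hFU hw)
  have key : ∀ a b : W, cov Γ F (fun w => cov Γ F Y w b) w a =
      fderiv ℝ (fun w => fderiv ℝ Y w b) w a
        + (fderiv ℝ Γ (F w) (fderiv ℝ F w a) (fderiv ℝ F w b) (Y w)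
        + Γ (F w) (fderiv ℝ (fun w => fderiv ℝ F w b) w a) (Y w)
        + Γ (F w) (fderiv ℝ F w b) (fderiv ℝ Y w a))
        + (Γ (F w) (fderiv ℝ F w a) (fderiv ℝ Y w b)
        + Γ (F w) (fderiv ℝ F w a) (Γ (F w) (fderiv ℝ F w b) (Y w))) := by
    intro a b
    have e : fderiv ℝ (fun w => cov Γ F Y w b) w a = fderiv ℝ (fun w => fderiv ℝ Y w b) w a
        + fderiv ℝ (fun w => Γ (F w) (fderiv ℝ F w b) (Y w)) w a := by
      have h1 := (hY.dir hO b).diffAt hO hw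
      have h2 : DifferentiableAt ℝ (fun w => Γ (F w) (fderiv ℝ F w b) (Y w)) w :=
        (((h.Γ_smooth.comp hF hFU).clm_apply (hF.dir hO b)).clm_apply hY).diffAt hO hw
      unfold cov
      rw [fderiv_fun_add h1 h2]
      rfl
    rw [cov, e, fderiv_bilin_along hΓ (hF.diffAt hO hw) ((hF.dir hO b).diffAt hO hw)
      (hY.diffAt hO hw)]
    simp only [cov, map_add]
  rw [key a b, key b a, dir_dir_comm hY hO hw b a, dir_dir_comm hF hO hw b a, riem]
  abel

theorem cov_comp {k : W' → W} {w : W'} (hF : DifferentiableAt ℝ F (k w))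
    (hY : DifferentiableAt ℝ Y (k w)) (hk : DifferentiableAt ℝ k w) (a : W') :
    cov Γ (fun z => F (k z)) (fun z => Y (k z)) w a = cov Γ F Y (k w) (fderiv ℝ k w a) := by
  have e1 : fderiv ℝ (fun z => F (k z)) w = (fderiv ℝ F (k w)).comp (fderiv ℝ k w) :=
    fderiv_comp w hF hk
  have e2 : fderiv ℝ (fun z => Y (k z)) w = (fderiv ℝ Y (k w)).comp (fderiv ℝ k w) :=
    fderiv_comp w hY hk
  simp [cov, e1, e2]

theorem cov_congr {F' Y' : W → X} {w : W} (hF : F =ᶠ[nhds w] F') (hY : Y =ᶠ[nhds w] Y') (a : W) :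
    cov Γ F Y w a = cov Γ F' Y' w a := by
  rw [cov, cov, hF.fderiv_eq, hY.fderiv_eq, hF.eq_of_nhds, hY.eq_of_nhds]

theorem cov_smul {r : W → ℝ} {w : W} (hr : DifferentiableAt ℝ r w) (hY : DifferentiableAt ℝ Y w)
    (a : W) : cov Γ F (fun w => r w • Y w) w a = fderiv ℝ r w a • Y w + r w • cov Γ F Y w a := by
  rw [cov, fderiv_fun_smul hr hY, cov]
  simp
  abel

theorem cov_add {w : W} (hY : DifferentiableAt ℝ Y w) (hZ : DifferentiableAt ℝ Z w)
    (a : W) : cov Γ F (fun w => Y w + Z w) w a = cov Γ F Y w a + cov Γ F Z w a := by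
  rw [cov, fderiv_fun_add hY hZ, cov, cov]
  simp
  abel

/-! ### Symmetries of the Riemann tensor -/

theorem riem_antisymm (Γ : X → X →L[ℝ] X →L[ℝ] X) (y u v z : X) :
    riem Γ y u v z = - riem Γ y v u z := by
  simp only [riem]; abel

/-- The derivative of Γ inherits the symmetry of Γ in its last two arguments, and then all terms
cancel in pairs. -/
theorem LeviCivita.bianchi (h : LeviCivita G Γ U) {y : X} (hy : y ∈ U) (u v z : X) :
    riem Γ y u v z + riem Γ y v z u + riem Γ y z u v = 0 := by
  have hs : ∀ a b c, fderiv ℝ Γ y a b c = fderiv ℝ Γ y a c b := by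
    intro a b c
    have hd := h.Γ_smooth.diffAt h.isOpen hy
    have e : ∀ b c, fderiv ℝ Γ y a b c = fderiv ℝ (fun z => Γ z b c) y a := by
      intro b c
      rw [fderiv_clm_apply (hd.clm_apply (differentiableAt_const _)) (differentiableAt_const _),
        fderiv_clm_apply hd (differentiableAt_const _)]
      simp
    rw [e, e]
    have : (fun z => Γ z b c) =ᶠ[nhds y] fun z => Γ z c b := by
      filter_upwards [h.isOpen.mem_nhds hy] with z hz using h.Γ_symm z hz _ _
    rw [this.fderiv_eq]
  simp only [riem]
  rw [hs u v z, hs v u z, hs z u v, h.Γ_symm y hy v z, h.Γ_symm y hy u z, h.Γ_symm y hy u v]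
  abel

/-- Differentiate `G(z, z')` twice with constant fields `z`, `z'`. Equality of the mixed derivatives
removes the products of first covariant derivatives and leaves the two curvature terms with sum
zero. -/
theorem LeviCivita.riem_skew (h : LeviCivita G Γ U) {y : X} (hy : y ∈ U) (u v z z' : X) :
    G y (riem Γ y u v z) z' = - G y (riem Γ y u v z') z := by
  have hO := h.isOpen
  have hF : ContDiffOn ℝ ∞ (fun w : X => w) U := contDiffOn_id
  have hFU : Set.MapsTo (fun w : X => w) U U := fun _ hx => hx
  have hc : ∀ c : X, ContDiffOn ℝ ∞ (fun _ : X => c) U := fun c => contDiffOn_const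
  have key : ∀ a b, fderiv ℝ (fun w => fderiv ℝ (fun w => G w z z') w b) y a =
      G y (cov Γ (fun w => w) (fun w => cov Γ (fun w => w) (fun _ => z) w b) y a) z'
      + G y (cov Γ (fun w => w) (fun _ => z) y b) (cov Γ (fun w => w) (fun _ => z') y a)
      + G y (cov Γ (fun w => w) (fun _ => z) y a) (cov Γ (fun w => w) (fun _ => z') y b)
      + G y z (cov Γ (fun w => w) (fun w => cov Γ (fun w => w) (fun _ => z') w b) y a) := by
    intro a b
    have e : (fun w => fderiv ℝ (fun w => G w z z') w b) =ᶠ[nhds y] fun w =>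
        G w (cov Γ (fun w => w) (fun _ => z) w b) z'
          + G w z (cov Γ (fun w => w) (fun _ => z') w b) := by
      filter_upwards [hO.mem_nhds hy] with w hw
      exact h.fderiv_pair hO hF hFU (hc z) (hc z') hw b
    have s1 := h.cov_smooth hO hF hFU (hc z) b
    have s2 := h.cov_smooth hO hF hFU (hc z') b
    rw [e.fderiv_eq, fderiv_fun_add ((h.pair_smooth hF hFU s1 (hc z')).diffAt hO hy)
      ((h.pair_smooth hF hFU (hc z) s2).diffAt hO hy), add_apply,
      h.fderiv_pair hO hF hFU s1 (hc z') hy, h.fderiv_pair hO hF hFU (hc z) s2 hy]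
    ring
  have hsm : ContDiffOn ℝ ∞ (fun w => G w z z') U := h.pair_smooth hF hFU (hc z) (hc z')
  have e := dir_dir_comm hsm hO hy v u
  rw [key, key, h.cov_cov hO hF hFU (hc z) hy u v, h.cov_cov hO hF hFU (hc z') hy u v] at e
  simp only [map_add, add_apply, fderiv_fun_id, ContinuousLinearMap.id_apply] at e
  rw [h.symm y hy (riem Γ y u v z') z]
  linarith

/-- The classical octahedron argument: four instances of the Bianchi identity, combined by the two
skew symmetries. -/
theorem LeviCivita.riem_pair (h : LeviCivita G Γ U) {y : X} (hy : y ∈ U) (u v z z' : X) :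
    G y (riem Γ y u v z) z' = G y (riem Γ y z z' u) v := by
  have a1 : ∀ u v z z', G y (riem Γ y u v z) z' = - G y (riem Γ y v u z) z' := by
    intro u v z z'; rw [riem_antisymm]; simp
  have b : ∀ u v z z', G y (riem Γ y u v z) z' + G y (riem Γ y v z u) z'
      + G y (riem Γ y z u v) z' = 0 := by
    intro u v z z'
    have := congrArg (fun t => G y t z') (h.bianchi hy u v z)
    simpa using this
  have s := fun u v z z' => h.riem_skew hy u v z z'
  have b1 := b u v z z'
  have b2 := b v z z' u
  have b3 := b z z' u v
  have b4 := b z' u v z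
  have := s v z z' u
  have := s z z' v u
  have := s z' v z u
  have := s z z' u v
  have := s z' u z v
  have := s u z z' v
  have := s z' u v z
  have := s u v z' z
  have := s v z' u z
  have := a1 u z v z'
  have := a1 v z' z u
  have := a1 v z' u z
  have := a1 u z z' v
  linarith [s z' v u z, s z u v z', a1 z u v z', a1 z' v z u, a1 z' v u z, s u v z z', a1 v z u z', s v z u z']

/-! ### Change of coordinates -/

/-- Uniqueness of the Levi-Civita connection. The failure `S` of the transformation law is symmetric
because both connections are torsion-free and skew because both are metric, so it vanishes. -/
theorem LeviCivita.transform {G₁ G₂ : X → X →L[ℝ] X →L[ℝ] ℝ} {Γ₁ Γ₂ : X → X →L[ℝ] X →L[ℝ] X}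
    {U₁ U₂ : Set X} (h₁ : LeviCivita G₁ Γ₁ U₁) (h₂ : LeviCivita G₂ Γ₂ U₂) {ϕ : X → X} {O : Set X}
    (hO : IsOpen O) (hϕ : ContDiffOn ℝ ∞ ϕ O) (hOU : O ⊆ U₁) (hϕU : Set.MapsTo ϕ O U₂)
    (hG : ∀ y ∈ O, ∀ u v, G₁ y u v = G₂ (ϕ y) (fderiv ℝ ϕ y u) (fderiv ℝ ϕ y v))
    {y : X} (hy : y ∈ O) (hsurj : Function.Surjective (fderiv ℝ ϕ y)) (u v : X) :
    fderiv ℝ ϕ y (Γ₁ y u v) = fderiv ℝ (fun z => fderiv ℝ ϕ z v) y u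
      + Γ₂ (ϕ y) (fderiv ℝ ϕ y u) (fderiv ℝ ϕ y v) := by
  set S : X → X → X := fun u v => fderiv ℝ ϕ y (Γ₁ y u v)
    - cov Γ₂ ϕ (fun z => fderiv ℝ ϕ z v) y u with hS
  have hsymm : ∀ u v, S u v = S v u := by
    intro u v
    simp only [hS]
    rw [h₁.Γ_symm y (hOU hy), h₂.cov_comm hO hϕ hϕU hy]
  have hskew : ∀ a u v, G₂ (ϕ y) (S a u) (fderiv ℝ ϕ y v)
      + G₂ (ϕ y) (fderiv ℝ ϕ y u) (S a v) = 0 := by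
    intro a u v
    have hc : ∀ c : X, ContDiffOn ℝ ∞ (fun _ : X => c) O := fun c => contDiffOn_const
    have hid : ContDiffOn ℝ ∞ (fun x : X => x) O := contDiffOn_id
    have e1 := h₁.fderiv_pair hO hid hOU (hc u) (hc v) hy a
    have e2 := h₂.fderiv_pair hO hϕ hϕU (hϕ.dir hO u) (hϕ.dir hO v) hy a
    have e3 : (fun w => G₁ w u v) =ᶠ[nhds y]
        fun w => G₂ (ϕ w) (fderiv ℝ ϕ w u) (fderiv ℝ ϕ w v) := by
      filter_upwards [hO.mem_nhds hy] with w hw using hG w hw u v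
    rw [e3.fderiv_eq, e2] at e1
    simp only [cov, fderiv_fun_const, Pi.zero_apply, zero_apply, zero_add,
      fderiv_fun_id, ContinuousLinearMap.id_apply] at e1
    rw [hG y hy, hG y hy] at e1
    simp only [hS, cov, map_sub, sub_apply]
    linarith
  -- A trilinear expression symmetric in its first two slots and skew in its last two is zero: three
  -- skew relations with permuted arguments make it equal to its own negative.
  have hzero : ∀ a u v, G₂ (ϕ y) (S a u) (fderiv ℝ ϕ y v) = 0 := by
    intro a u v
    have hy₂ := hϕU hy
    have t : ∀ a u v, G₂ (ϕ y) (S a u) (fderiv ℝ ϕ y v)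
        = - G₂ (ϕ y) (S a v) (fderiv ℝ ϕ y u) := by
      intro a u v
      have := hskew a u v
      rw [h₂.symm _ hy₂ (fderiv ℝ ϕ y u)] at this
      linarith
    have h1 := t a u v
    have h2 := t v a u
    have h3 := t u v a
    rw [hsymm v a] at h2
    rw [hsymm v u] at h2
    rw [hsymm u v, hsymm u a] at h3
    rw [hsymm v u] at h3
    linarith
  have : S u v = 0 := by
    refine h₂.nondeg _ (hϕU hy) _ fun w => ?_
    obtain ⟨w, rfl⟩ := hsurj w
    exact hzero u v w
  exact sub_eq_zero.mp this

/-- Covariant derivatives along maps do not depend on the coordinates. -/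
theorem LeviCivita.cov_transform {G₁ G₂ : X → X →L[ℝ] X →L[ℝ] ℝ}
    {Γ₁ Γ₂ : X → X →L[ℝ] X →L[ℝ] X}
    {U₁ U₂ : Set X} (h₁ : LeviCivita G₁ Γ₁ U₁) (h₂ : LeviCivita G₂ Γ₂ U₂) {ϕ : X → X} {O : Set X}
    (hO : IsOpen O) (hϕ : ContDiffOn ℝ ∞ ϕ O) (hOU : O ⊆ U₁) (hϕU : Set.MapsTo ϕ O U₂)
    (hG : ∀ y ∈ O, ∀ u v, G₁ y u v = G₂ (ϕ y) (fderiv ℝ ϕ y u) (fderiv ℝ ϕ y v))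
    {F Y : W → X} {w : W} (hw : F w ∈ O)
    (hsurj : Function.Surjective (fderiv ℝ ϕ (F w))) (hF : DifferentiableAt ℝ F w)
    (hY : DifferentiableAt ℝ Y w) (a : W) :
    cov Γ₂ (fun z => ϕ (F z)) (fun z => fderiv ℝ ϕ (F z) (Y z)) w a
      = fderiv ℝ ϕ (F w) (cov Γ₁ F Y w a) := by
  have hd : DifferentiableAt ℝ (fderiv ℝ ϕ) (F w) :=
    ContDiffOn.diffAt (hϕ.fderiv_of_isOpen hO (by simp)) hO hw
  have e1 : fderiv ℝ (fun z => ϕ (F z)) w = (fderiv ℝ ϕ (F w)).comp (fderiv ℝ F w) :=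
    fderiv_comp w (hϕ.diffAt hO hw) hF
  have e2 : fderiv ℝ (fun z => fderiv ℝ ϕ (F z)) w
      = (fderiv ℝ (fderiv ℝ ϕ) (F w)).comp (fderiv ℝ F w) := fderiv_comp w hd hF
  have e3 : ∀ u v, fderiv ℝ (fun z => fderiv ℝ ϕ z v) (F w) u
      = fderiv ℝ (fderiv ℝ ϕ) (F w) u v := by
    intro u v
    rw [fderiv_clm_apply hd (differentiableAt_const _)]
    simp
  have hd' : DifferentiableAt ℝ (fun z => fderiv ℝ ϕ (F z)) w :=
    DifferentiableAt.comp (g := fderiv ℝ ϕ) w hd hF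
  rw [cov, fderiv_clm_apply hd' hY, e1]
  change ((fderiv ℝ ϕ (F w)).comp (fderiv ℝ Y w)
    + (fderiv ℝ (fun z => fderiv ℝ ϕ (F z)) w).flip (Y w)) a + _ = _
  rw [e2, cov, map_add, h₁.transform h₂ hO hϕ hOU hϕU hG hw hsurj, e3]
  simp
  abel

end Cov


/-! ### Adapted frames -/

/-- The frame `A₀, A₁, F₁, F₂` is orthogonal except for the block `A₀, A₁`, whose Gram matrix is
`(p, r; r, s)`. -/
structure IsBlockFrame (G : E 4 →L[ℝ] E 4 →L[ℝ] ℝ) (A₀ A₁ F₁ F₂ : E 4) (p r s a b : ℝ) :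
    Prop where
  symm : ∀ u v, G u v = G v u
  h00 : G A₀ A₀ = p
  h01 : G A₀ A₁ = r
  h11 : G A₁ A₁ = s
  h0F1 : G A₀ F₁ = 0
  h0F2 : G A₀ F₂ = 0
  h1F1 : G A₁ F₁ = 0
  h1F2 : G A₁ F₂ = 0
  hF11 : G F₁ F₁ = a
  hF22 : G F₂ F₂ = b
  hF12 : G F₁ F₂ = 0
  d_ne : p * s - r ^ 2 ≠ 0
  a_ne : a ≠ 0
  b_ne : b ≠ 0

section Frame

variable {G : E 4 →L[ℝ] E 4 →L[ℝ] ℝ} {A₀ A₁ F₁ F₂ : E 4} {p r s a b : ℝ}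

theorem IsBlockFrame.inverse (h : IsBlockFrame G A₀ A₁ F₁ F₂ p r s a b) :
    !![s / (p * s - r ^ 2), -r / (p * s - r ^ 2), 0, 0;
      -r / (p * s - r ^ 2), p / (p * s - r ^ 2), 0, 0; 0, 0, a⁻¹, 0; 0, 0, 0, b⁻¹] *
      (Matrix.of fun i j => G ((![A₀, A₁, F₁, F₂] : Fin 4 → E 4) i)
        ((![A₀, A₁, F₁, F₂] : Fin 4 → E 4) j)) = 1 := by
  have h1 := h.symm F₁ A₀
  have h2 := h.symm F₂ A₀
  have h3 := h.symm F₁ A₁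
  have h4 := h.symm F₂ A₁
  have h5 := h.symm F₂ F₁
  have h6 := h.symm A₁ A₀
  rw [h.h0F1] at h1
  rw [h.h0F2] at h2
  rw [h.h1F1] at h3
  rw [h.h1F2] at h4
  rw [h.hF12] at h5
  rw [h.h01] at h6
  have := h.a_ne
  have := h.b_ne
  have hne := h.d_ne
  obtain ⟨d, hd⟩ : ∃ d, d = p * s - r ^ 2 := ⟨_, rfl⟩
  rw [← hd] at hne ⊢
  ext i j
  fin_cases i <;> fin_cases j <;>
    simp [Matrix.mul_apply, Fin.sum_univ_four, h.h00, h.h01, h.h11, h.h0F1, h.h0F2, h.h1F1,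
      h.h1F2, h.hF11, h.hF22, h.hF12, h1, h2, h3, h4, h5, h6] <;>
    field_simp <;> linarith

theorem IsBlockFrame.det_ne (h : IsBlockFrame G A₀ A₁ F₁ F₂ p r s a b) :
    IsUnit (gram fun u v => G u v).det :=
  (gram_inverse_of_frame (IsBilin.clm G) _ _ h.inverse).2

theorem IsBlockFrame.metricTrace_eq (h : IsBlockFrame G A₀ A₁ F₁ F₂ p r s a b)
    {B : E 4 → E 4 → ℝ} (hB : IsBilin B) :
    metricTrace (fun u v => G u v) B =
      (s * B A₀ A₀ - r * (B A₀ A₁ + B A₁ A₀) + p * B A₁ A₁) / (p * s - r ^ 2)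
        + B F₁ F₁ / a + B F₂ F₂ / b := by
  rw [metricTrace_frame (IsBilin.clm G) hB _ _ h.inverse]
  simp [Fin.sum_univ_four]
  ring

/-- Splits products such as g(∇_u∂_v, ∇_w L) into normal and tangential components. The general
block serves both the pair `L`, `X` with null `L` and the orthogonal pair of slice normal and
velocity. -/
theorem IsBlockFrame.pair (h : IsBlockFrame G A₀ A₁ F₁ F₂ p r s a b) (u v : E 4) :
    G u v = (s * (G u A₀ * G v A₀) - r * (G u A₀ * G v A₁ + G u A₁ * G v A₀)
        + p * (G u A₁ * G v A₁)) / (p * s - r ^ 2)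
        + G u F₁ * G v F₁ / a + G u F₂ * G v F₂ / b := by
  rw [← metricTrace_mul (IsBilin.clm G) h.det_ne h.symm u v, h.metricTrace_eq]
  constructor <;> intros <;> simp <;> ring

end Frame

/-! ### Slices of families -/

/-- The coordinate directions `∂_t`, `∂_x`, `∂_y`. -/
abbrev dirT : ℝ × ℝ × ℝ := (1, 0, 0)
/-- See `dirT`. -/
abbrev dirX : ℝ × ℝ × ℝ := (0, 1, 0)
/-- See `dirT`. -/
abbrev dirY : ℝ × ℝ × ℝ := (0, 0, 1)

theorem hasDerivAt_lineT {φ : ℝ × ℝ × ℝ → ℝ} {t x y : ℝ} (h : DifferentiableAt ℝ φ (t, x, y)) :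
    HasDerivAt (fun t => φ (t, x, y)) (fderiv ℝ φ (t, x, y) dirT) t := by
  have h1 : HasDerivAt (fun t : ℝ => ((t, x, y) : ℝ × ℝ × ℝ)) dirT t :=
    (hasDerivAt_id t).prodMk (hasDerivAt_const t (x, y))
  exact h.hasFDerivAt.comp_hasDerivAt t h1

theorem hasDerivAt_lineX {φ : ℝ × ℝ × ℝ → ℝ} {t x y : ℝ} (h : DifferentiableAt ℝ φ (t, x, y)) :
    HasDerivAt (fun x => φ (t, x, y)) (fderiv ℝ φ (t, x, y) dirX) x := by
  have h1 : HasDerivAt (fun x : ℝ => ((t, x, y) : ℝ × ℝ × ℝ)) dirX x :=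
    (hasDerivAt_const x t).prodMk ((hasDerivAt_id x).prodMk (hasDerivAt_const x y))
  exact h.hasFDerivAt.comp_hasDerivAt x h1

theorem hasDerivAt_lineY {φ : ℝ × ℝ × ℝ → ℝ} {t x y : ℝ} (h : DifferentiableAt ℝ φ (t, x, y)) :
    HasDerivAt (fun y => φ (t, x, y)) (fderiv ℝ φ (t, x, y) dirY) y := by
  have h1 : HasDerivAt (fun y : ℝ => ((t, x, y) : ℝ × ℝ × ℝ)) dirY y :=
    (hasDerivAt_const y t).prodMk ((hasDerivAt_const y x).prodMk (hasDerivAt_id y))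
  exact h.hasFDerivAt.comp_hasDerivAt y h1

section Slice

variable {O : Set (ℝ × ℝ × ℝ)} {φ : ℝ × ℝ × ℝ → ℝ} {ψ : ℝ → ℝ}

theorem eventually_sliceX (hO : IsOpen O) {t x y : ℝ} (hw : (t, x, y) ∈ O) :
    ∀ᶠ x' in nhds x, (t, x', y) ∈ O :=
  (Continuous.continuousAt (f := fun x' : ℝ => ((t, x', y) : ℝ × ℝ × ℝ)) (by fun_prop)).eventually
    (hO.mem_nhds hw)

theorem eventually_sliceY (hO : IsOpen O) {t x y : ℝ} (hw : (t, x, y) ∈ O) :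
    ∀ᶠ y' in nhds y, (t, x, y') ∈ O :=
  (Continuous.continuousAt (f := fun y' : ℝ => ((t, x, y') : ℝ × ℝ × ℝ)) (by fun_prop)).eventually
    (hO.mem_nhds hw)

/-- Values on the slice t = 0 suffice, because the direction of differentiation is tangent to it. -/
theorem slice_dirX (hO : IsOpen O) (hφ : ContDiffOn ℝ ∞ φ O)
    (h : ∀ x y, (0, x, y) ∈ O → φ (0, x, y) = ψ x) {x y : ℝ} (hw : (0, x, y) ∈ O) :
    fderiv ℝ φ (0, x, y) dirX = deriv ψ x := by
  rw [← (hasDerivAt_lineX (hφ.diffAt hO hw)).deriv]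
  refine Filter.EventuallyEq.deriv_eq ?_
  filter_upwards [eventually_sliceX hO hw] with x' hx' using h x' y hx'

theorem slice_dirY (hO : IsOpen O) (hφ : ContDiffOn ℝ ∞ φ O)
    (h : ∀ x y, (0, x, y) ∈ O → φ (0, x, y) = ψ x) {x y : ℝ} (hw : (0, x, y) ∈ O) :
    fderiv ℝ φ (0, x, y) dirY = 0 := by
  rw [← (hasDerivAt_lineY (hφ.diffAt hO hw)).deriv]
  have : (fun y => φ (0, x, y)) =ᶠ[nhds y] fun _ => ψ x := by
    filter_upwards [eventually_sliceY hO hw] with y' hy' using h x y' hy'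
  rw [this.deriv_eq, deriv_const]

end Slice

/-! ### The Gauss equation of an axisymmetric surface -/

section Gauss

variable {G : E 4 → E 4 →L[ℝ] E 4 →L[ℝ] ℝ} {Γ : E 4 → E 4 →L[ℝ] E 4 →L[ℝ] E 4} {U : Set (E 4)}
  {O : Set (ℝ × ℝ × ℝ)} {F : ℝ × ℝ × ℝ → E 4}

/-- A family of surfaces, parametrized by `(t, x, y)`, in the domain of a Levi-Civita connection;
for `t = 0` the induced metric is `a dx² + b dy²` with `a`, `b` depending on `x` only. -/
structure AxialFamily (G : E 4 → E 4 →L[ℝ] E 4 →L[ℝ] ℝ) (Γ : E 4 → E 4 →L[ℝ] E 4 →L[ℝ] E 4)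
    (U : Set (E 4)) (O : Set (ℝ × ℝ × ℝ)) (F : ℝ × ℝ × ℝ → E 4) (a b : ℝ → ℝ) : Prop where
  lc : LeviCivita G Γ U
  isOpen : IsOpen O
  smooth : ContDiffOn ℝ ∞ F O
  maps : Set.MapsTo F O U
  q11 : ∀ x y, (0, x, y) ∈ O →
    G (F (0, x, y)) (fderiv ℝ F (0, x, y) dirX) (fderiv ℝ F (0, x, y) dirX) = a x
  q12 : ∀ x y, (0, x, y) ∈ O →
    G (F (0, x, y)) (fderiv ℝ F (0, x, y) dirX) (fderiv ℝ F (0, x, y) dirY) = 0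
  q22 : ∀ x y, (0, x, y) ∈ O →
    G (F (0, x, y)) (fderiv ℝ F (0, x, y) dirY) (fderiv ℝ F (0, x, y) dirY) = b x

/-- The second derivatives `∇_u ∂_v F`. -/
def hessMap (Γ : E 4 → E 4 →L[ℝ] E 4 →L[ℝ] E 4) (F : ℝ × ℝ × ℝ → E 4) (u v w : ℝ × ℝ × ℝ) : E 4 :=
  cov Γ F (fun w => fderiv ℝ F w v) w u

variable {a b : ℝ → ℝ}

theorem AxialFamily.dir_smooth (A : AxialFamily G Γ U O F a b) (u : ℝ × ℝ × ℝ) :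
    ContDiffOn ℝ ∞ (fun w => fderiv ℝ F w u) O := A.smooth.dir A.isOpen u

theorem AxialFamily.hess_smooth (A : AxialFamily G Γ U O F a b) (u v : ℝ × ℝ × ℝ) :
    ContDiffOn ℝ ∞ (hessMap Γ F u v) O :=
  A.lc.cov_smooth A.isOpen A.smooth A.maps (A.dir_smooth v) u

theorem AxialFamily.hess_comm (A : AxialFamily G Γ U O F a b) {w : ℝ × ℝ × ℝ} (hw : w ∈ O)
    (u v : ℝ × ℝ × ℝ) : hessMap Γ F u v w = hessMap Γ F v u w :=
  A.lc.cov_comm A.isOpen A.smooth A.maps hw u v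

theorem AxialFamily.d_pair (A : AxialFamily G Γ U O F a b) {Y Z : ℝ × ℝ × ℝ → E 4}
    (hY : ContDiffOn ℝ ∞ Y O) (hZ : ContDiffOn ℝ ∞ Z O) {w : ℝ × ℝ × ℝ} (hw : w ∈ O)
    (u : ℝ × ℝ × ℝ) :
    fderiv ℝ (fun w => G (F w) (Y w) (Z w)) w u =
      G (F w) (cov Γ F Y w u) (Z w) + G (F w) (Y w) (cov Γ F Z w u) :=
  A.lc.fderiv_pair A.isOpen A.smooth A.maps hY hZ hw u

/-- The derivatives of the three metric components in `x` and `y` are six linear equations for these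
six products, once ∇_x∂_y = ∇_y∂_x is used. -/
theorem AxialFamily.christoffel_symbols (A : AxialFamily G Γ U O F a b) {x y : ℝ}
    (hw : (0, x, y) ∈ O) :
    let w : ℝ × ℝ × ℝ := (0, x, y)
    let F₁ := fderiv ℝ F w dirX
    let F₂ := fderiv ℝ F w dirY
    G (F w) (hessMap Γ F dirX dirX w) F₁ = deriv a x / 2 ∧
    G (F w) (hessMap Γ F dirX dirX w) F₂ = 0 ∧
    G (F w) (hessMap Γ F dirX dirY w) F₁ = 0 ∧
    G (F w) (hessMap Γ F dirX dirY w) F₂ = deriv b x / 2 ∧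
    G (F w) (hessMap Γ F dirY dirY w) F₁ = - deriv b x / 2 ∧
    G (F w) (hessMap Γ F dirY dirY w) F₂ = 0 := by
  intro w F₁ F₂
  have s1 := A.dir_smooth dirX
  have s2 := A.dir_smooth dirY
  have p11 := A.lc.pair_smooth A.smooth A.maps s1 s1
  have p12 := A.lc.pair_smooth A.smooth A.maps s1 s2
  have p22 := A.lc.pair_smooth A.smooth A.maps s2 s2
  have hs := A.lc.symm (F w) (A.maps hw)
  have e1 := slice_dirX A.isOpen p11 A.q11 hw
  have e2 := slice_dirY A.isOpen p11 A.q11 hw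
  have e3 := slice_dirX A.isOpen p12 (ψ := fun _ => 0) A.q12 hw
  have e4 := slice_dirY A.isOpen p12 (ψ := fun _ => 0) A.q12 hw
  have e5 := slice_dirX A.isOpen p22 A.q22 hw
  have e6 := slice_dirY A.isOpen p22 A.q22 hw
  rw [A.d_pair s1 s1 hw] at e1 e2
  rw [A.d_pair s1 s2 hw] at e3 e4
  rw [A.d_pair s2 s2 hw] at e5 e6
  change G (F w) (hessMap Γ F dirX dirX w) F₁ + G (F w) F₁ (hessMap Γ F dirX dirX w) = _ at e1
  change G (F w) (hessMap Γ F dirY dirX w) F₁ + G (F w) F₁ (hessMap Γ F dirY dirX w) = _ at e2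
  change G (F w) (hessMap Γ F dirX dirX w) F₂ + G (F w) F₁ (hessMap Γ F dirX dirY w) = _ at e3
  change G (F w) (hessMap Γ F dirY dirX w) F₂ + G (F w) F₁ (hessMap Γ F dirY dirY w) = _ at e4
  change G (F w) (hessMap Γ F dirX dirY w) F₂ + G (F w) F₂ (hessMap Γ F dirX dirY w) = _ at e5
  change G (F w) (hessMap Γ F dirY dirY w) F₂ + G (F w) F₂ (hessMap Γ F dirY dirY w) = _ at e6
  rw [A.hess_comm hw dirY dirX] at e2 e4
  rw [hs F₁] at e1 e2 e3 e4
  rw [hs F₂] at e5 e6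
  rw [deriv_const] at e3
  refine ⟨?_, ?_, ?_, ?_, ?_, ?_⟩ <;> linarith

/-- Differentiate g(∇_y∂_y, ∂_x) in `x` and g(∇_x∂_y, ∂_x) in `y`, both known from the Christoffel
symbols, and subtract: the third derivatives differ by the curvature. The products of second
derivatives are left unsplit, to be expanded later in the frame at hand. -/
theorem AxialFamily.gauss (A : AxialFamily G Γ U O F a b) {x y : ℝ} (hw : (0, x, y) ∈ O) :
    let w : ℝ × ℝ × ℝ := (0, x, y)
    let F₁ := fderiv ℝ F w dirX
    let F₂ := fderiv ℝ F w dirY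
    G (F w) (riem Γ (F w) F₁ F₂ F₂) F₁ = - deriv (deriv b) x / 2
      - G (F w) (hessMap Γ F dirY dirY w) (hessMap Γ F dirX dirX w)
      + G (F w) (hessMap Γ F dirX dirY w) (hessMap Γ F dirX dirY w) := by
  intro w F₁ F₂
  have s1 := A.dir_smooth dirX
  have s2 := A.dir_smooth dirY
  have s22 := A.hess_smooth dirY dirY
  have s12 := A.hess_smooth dirX dirY
  have e := A.lc.cov_cov A.isOpen A.smooth A.maps s2 hw dirX dirY
  have d1 := slice_dirX A.isOpen (A.lc.pair_smooth A.smooth A.maps s22 s1)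
    (ψ := fun x => - deriv b x / 2) (fun x y hw => (A.christoffel_symbols hw).2.2.2.2.1) hw
  have d2 := slice_dirY A.isOpen (A.lc.pair_smooth A.smooth A.maps s12 s1)
    (ψ := fun x => 0) (fun x y hw => (A.christoffel_symbols hw).2.2.1) hw
  rw [A.d_pair s22 s1 hw] at d1
  rw [A.d_pair s12 s1 hw] at d2
  have hd : deriv (fun x => - deriv b x / 2) x = - deriv (deriv b) x / 2 := by
    rw [deriv_div_const, deriv.fun_neg]
  rw [hd] at d1
  have e' := congrArg (fun v => G (F w) v F₁) e
  simp only [map_add, add_apply] at e'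
  change G (F w) (cov Γ F (hessMap Γ F dirY dirY) w dirX) F₁
    = G (F w) (cov Γ F (hessMap Γ F dirX dirY) w dirY) F₁
      + G (F w) (riem Γ (F w) F₁ F₂ F₂) F₁ at e'
  change G (F w) (cov Γ F (hessMap Γ F dirY dirY) w dirX) F₁
    + G (F w) (hessMap Γ F dirY dirY w) (hessMap Γ F dirX dirX w) = _ at d1
  change G (F w) (cov Γ F (hessMap Γ F dirX dirY) w dirY) F₁
    + G (F w) (hessMap Γ F dirX dirY w) (hessMap Γ F dirY dirX w) = _ at d2
  rw [A.hess_comm hw dirY dirX] at d2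
  linarith

end Gauss


/-! ### First variation of the expansion -/

section Expansion

variable {G : E 4 → E 4 →L[ℝ] E 4 →L[ℝ] ℝ} {Γ : E 4 → E 4 →L[ℝ] E 4 →L[ℝ] E 4} {U : Set (E 4)}
  {O : Set (ℝ × ℝ × ℝ)} {F : ℝ × ℝ × ℝ → E 4} {a b : ℝ → ℝ}

/-- The Gauss curvature of the metric `a(x) dx² + b(x) dy²`. -/
def axialCurvature (a b : ℝ → ℝ) (x : ℝ) : ℝ :=
  (- deriv (deriv b) x / 2 + deriv a x * deriv b x / (4 * a x) + deriv b x ^ 2 / (4 * b x))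
    / (a x * b x)

/-- The determinant of the first fundamental forms of a family of surfaces. -/
def detFirst (G : E 4 → E 4 →L[ℝ] E 4 →L[ℝ] ℝ) (F : ℝ × ℝ × ℝ → E 4) (w : ℝ × ℝ × ℝ) : ℝ :=
  G (F w) (fderiv ℝ F w dirX) (fderiv ℝ F w dirX) * G (F w) (fderiv ℝ F w dirY) (fderiv ℝ F w dirY)
    - G (F w) (fderiv ℝ F w dirX) (fderiv ℝ F w dirY) ^ 2

/-- The expansion along `L`, times the determinant of the first fundamental form. -/
def expansionNum (G : E 4 → E 4 →L[ℝ] E 4 →L[ℝ] ℝ) (Γ : E 4 → E 4 →L[ℝ] E 4 →L[ℝ] E 4)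
    (F L : ℝ × ℝ × ℝ → E 4) (w : ℝ × ℝ × ℝ) : ℝ :=
  G (F w) (fderiv ℝ F w dirY) (fderiv ℝ F w dirY) * G (F w) (cov Γ F L w dirX) (fderiv ℝ F w dirX)
    - G (F w) (fderiv ℝ F w dirX) (fderiv ℝ F w dirY)
      * (G (F w) (cov Γ F L w dirX) (fderiv ℝ F w dirY)
        + G (F w) (cov Γ F L w dirY) (fderiv ℝ F w dirX))
    + G (F w) (fderiv ℝ F w dirX) (fderiv ℝ F w dirX)
      * G (F w) (cov Γ F L w dirY) (fderiv ℝ F w dirY)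

/-- Algebraic identity behind the variation of the expansion of a marginally trapped surface. -/
theorem expansion_variation_algebra {a b β ρ P₁ P₂ Q Q' a' b' b'' tX h11 h12 h22 x11 x12 x22 R₁ R₂
    S C g1 g2 c1 c2 u1 u2 n1 n2 : ℝ} (ha : 0 < a) (hb : 0 < b) (hβ : 0 < β) (hρ : 0 ≤ ρ)
    (h0 : h11 * b + h22 * a = 0)
    (hg1 : g1 + c1 = Q') (hg2 : g2 + c2 = 0)
    (hc1 : c1 = (ρ * (0 * -h11) - β * (0 * -x11 + tX * -h11) + 0 * (tX * -x11)) / (0 * ρ - β ^ 2)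
      + Q * (a' / 2) / a + P₂ * 0 / b)
    (hc2 : c2 = (ρ * (0 * -h22) - β * (0 * -x22 + tX * -h22) + 0 * (tX * -x22)) / (0 * ρ - β ^ 2)
      + Q * (-b' / 2) / a + P₂ * 0 / b)
    (r1 r2 : ℝ)
    (hu1 : u1 = (ρ * (0 * (-Q)) - β * (0 * r1 + P₁ * (-Q)) + 0 * (P₁ * r1)) / (0 * ρ - β ^ 2)
      + h11 * x11 / a + h12 * x12 / b)
    (hu2 : u2 = (ρ * (0 * (-P₂)) - β * (0 * r2 + P₂ * (-P₂)) + 0 * (P₂ * r2)) / (0 * ρ - β ^ 2)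
      + h12 * x12 / a + h22 * x22 / b)
    (hn1 : n1 = (ρ * (-h22 * -h11) - β * (-h22 * -x11 + -x22 * -h11) + 0 * (-x22 * -x11))
      / (0 * ρ - β ^ 2) + (-b' / 2) * (a' / 2) / a + 0 * 0 / b)
    (hn2 : n2 = (ρ * (-h12 * -h12) - β * (-h12 * -x12 + -x12 * -h12) + 0 * (-x12 * -x12))
      / (0 * ρ - β ^ 2) + 0 * 0 / a + (b' / 2) * (b' / 2) / b)
    (hS : S = - b'' / 2 - n1 + n2)
    (hC : C ≤ β * (S / (a * b)) - (R₁ / a + R₂ / b)) :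
    (2 * x22 * h11 + b * (g1 + R₁ + u1) - 2 * x12 * (2 * h12) + 2 * x11 * h22
      + a * (g2 + R₂ + u2)) / (a * b)
      ≤ - C + β * ((- b'' / 2 + a' * b' / (4 * a) + b' ^ 2 / (4 * b)) / (a * b))
        + Q' / a + Q * (b' / (2 * a * b) - a' / (2 * a ^ 2))
        - P₁ * Q / (β * a) - P₂ ^ 2 / (β * b) := by
  -- Vanishing expansion makes the second fundamental form along `L` trace-free, so one component is
  -- eliminated.
  have hh : h22 = - b * h11 / a := by field_simp; linarith
  have e1 : g1 = Q' - c1 := by linarith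
  have e2 : g2 = - c2 := by linarith
  -- The exact identity. Its last term is the squared shear along `L` times `ρ / (2β)` with `ρ =
  -- g(X, X)`; it has a favourable sign and is dropped.
  have key : (2 * x22 * h11 + b * (g1 + R₁ + u1) - 2 * x12 * (2 * h12) + 2 * x11 * h22
      + a * (g2 + R₂ + u2)) / (a * b)
      = - (β * (S / (a * b)) - (R₁ / a + R₂ / b))
        + β * ((- b'' / 2 + a' * b' / (4 * a) + b' ^ 2 / (4 * b)) / (a * b))
        + Q' / a + Q * (b' / (2 * a * b) - a' / (2 * a ^ 2))
        - P₁ * Q / (β * a) - P₂ ^ 2 / (β * b)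
        - ρ / (β * a * b) * (b / a * h11 ^ 2 + h12 ^ 2) := by
    subst hS hn1 hn2 hu1 hu2 hc1 hc2 e1 e2 hh
    field_simp
    ring
  have : 0 ≤ ρ / (β * a * b) * (b / a * h11 ^ 2 + h12 ^ 2) := by positivity
  linarith

/-- Differentiate g(∇_a L, ∂_b) in `t` and exchange ∇_t with ∇_a, which produces the curvature and
∇_a∇_t L. Nullity and normality of `L` determine every component of ∇_t L except g(∇_t L, X), and
this one is multiplied by the expansion and disappears; hence the choice of `L` off the initial
surface is immaterial. The Gauss equation converts the tangential curvature into the intrinsic one.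
-/
theorem AxialFamily.expansion_variation (A : AxialFamily G Γ U O F a b) {L : ℝ × ℝ × ℝ → E 4}
    (hL : ContDiffOn ℝ ∞ L O) (hnull : ∀ w ∈ O, G (F w) (L w) (L w) = 0)
    (hn1 : ∀ w ∈ O, G (F w) (L w) (fderiv ℝ F w dirX) = 0)
    (hn2 : ∀ w ∈ O, G (F w) (L w) (fderiv ℝ F w dirY) = 0)
    {β ρ P₁ P₂ : ℝ → ℝ}
    (hβ : ∀ x y, (0, x, y) ∈ O → G (F (0, x, y)) (L (0, x, y)) (fderiv ℝ F (0, x, y) dirT) = β x)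
    (hρ : ∀ x y, (0, x, y) ∈ O →
      G (F (0, x, y)) (fderiv ℝ F (0, x, y) dirT) (fderiv ℝ F (0, x, y) dirT) = ρ x)
    (hX1 : ∀ x y, (0, x, y) ∈ O →
      G (F (0, x, y)) (fderiv ℝ F (0, x, y) dirT) (fderiv ℝ F (0, x, y) dirX) = 0)
    (hX2 : ∀ x y, (0, x, y) ∈ O →
      G (F (0, x, y)) (fderiv ℝ F (0, x, y) dirT) (fderiv ℝ F (0, x, y) dirY) = 0)
    (hP1 : ∀ x y, (0, x, y) ∈ O →
      G (F (0, x, y)) (cov Γ F L (0, x, y) dirX) (fderiv ℝ F (0, x, y) dirT) = P₁ x)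
    (hP2 : ∀ x y, (0, x, y) ∈ O →
      G (F (0, x, y)) (cov Γ F L (0, x, y) dirY) (fderiv ℝ F (0, x, y) dirT) = P₂ x)
    {x y : ℝ} (hw : (0, x, y) ∈ O) (ha : 0 < a x) (hb : 0 < b x) (hβ0 : 0 < β x) (hρ0 : 0 ≤ ρ x)
    (hθ : expansionNum G Γ F L (0, x, y) = 0) {C : ℝ}
    (hC : let w : ℝ × ℝ × ℝ := (0, x, y)
      C ≤ β x * (G (F w) (riem Γ (F w) (fderiv ℝ F w dirX) (fderiv ℝ F w dirY)
          (fderiv ℝ F w dirY)) (fderiv ℝ F w dirX) / (a x * b x))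
        - (G (F w) (riem Γ (F w) (fderiv ℝ F w dirT) (fderiv ℝ F w dirX) (L w))
            (fderiv ℝ F w dirX) / a x
          + G (F w) (riem Γ (F w) (fderiv ℝ F w dirT) (fderiv ℝ F w dirY) (L w))
            (fderiv ℝ F w dirY) / b x)) :
    ∃ θ', HasDerivAt (fun t => expansionNum G Γ F L (t, x, y) / detFirst G F (t, x, y)) θ' 0 ∧
      θ' ≤ - C + β x * axialCurvature a b x
        + deriv (fun x => P₁ x - deriv β x) x / a x
        + (P₁ x - deriv β x) * (deriv b x / (2 * a x * b x) - deriv a x / (2 * a x ^ 2))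
        - P₁ x * (P₁ x - deriv β x) / (β x * a x) - P₂ x ^ 2 / (β x * b x) := by
  have s0 := A.dir_smooth dirT
  have s1 := A.dir_smooth dirX
  have s2 := A.dir_smooth dirY
  have sc : ∀ u, ContDiffOn ℝ ∞ (fun w => cov Γ F L w u) O := fun u =>
    A.lc.cov_smooth A.isOpen A.smooth A.maps hL u
  have pr : ∀ {Y Z : ℝ × ℝ × ℝ → E 4}, ContDiffOn ℝ ∞ Y O → ContDiffOn ℝ ∞ Z O →
      ContDiffOn ℝ ∞ (fun w => G (F w) (Y w) (Z w)) O := fun hY hZ =>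
    A.lc.pair_smooth A.smooth A.maps hY hZ
  have sy : ∀ w ∈ O, ∀ u v, G (F w) u v = G (F w) v u := fun w hw => A.lc.symm (F w) (A.maps hw)
  -- derivatives of the orthogonality relations
  have fz : ∀ {φ : ℝ × ℝ × ℝ → ℝ}, (∀ w ∈ O, φ w = 0) → ∀ w ∈ O, ∀ u, fderiv ℝ φ w u = 0 := by
    intro φ hφ w hw u
    have : φ =ᶠ[nhds w] fun _ => 0 := by
      filter_upwards [A.isOpen.mem_nhds hw] with w hw using hφ w hw
    rw [this.fderiv_eq]
    simp
  have kL : ∀ w ∈ O, ∀ u, G (F w) (cov Γ F L w u) (L w) = 0 := by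
    intro w hw u
    have := fz hnull w hw u
    rw [A.d_pair hL hL hw, sy w hw (L w)] at this
    linarith
  have kF1 : ∀ w ∈ O, ∀ u, G (F w) (cov Γ F L w u) (fderiv ℝ F w dirX)
      = - G (F w) (hessMap Γ F u dirX w) (L w) := by
    intro w hw u
    have := fz hn1 w hw u
    rw [A.d_pair hL s1 hw, sy w hw (L w)] at this
    exact eq_neg_of_add_eq_zero_left this
  have kF2 : ∀ w ∈ O, ∀ u, G (F w) (cov Γ F L w u) (fderiv ℝ F w dirY)
      = - G (F w) (hessMap Γ F u dirY w) (L w) := by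
    intro w hw u
    have := fz hn2 w hw u
    rw [A.d_pair hL s2 hw, sy w hw (L w)] at this
    exact eq_neg_of_add_eq_zero_left this
  have lX1 : ∀ x y, (0, x, y) ∈ O → G (F (0, x, y)) (hessMap Γ F dirX dirT (0, x, y)) (L (0, x, y))
      = - (P₁ x - deriv β x) := by
    intro x y hw
    have := slice_dirX A.isOpen (pr hL s0) hβ hw
    rw [A.d_pair hL s0 hw, hP1 x y hw, sy _ hw (L _)] at this
    change P₁ x + G _ (hessMap Γ F dirX dirT (0, x, y)) _ = _ at this
    linarith
  have lX2 : ∀ x y, (0, x, y) ∈ O → G (F (0, x, y)) (hessMap Γ F dirY dirT (0, x, y)) (L (0, x, y))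
      = - P₂ x := by
    intro x y hw
    have := slice_dirY A.isOpen (pr hL s0) hβ hw
    rw [A.d_pair hL s0 hw, hP2 x y hw, sy _ hw (L _)] at this
    change P₂ x + G _ (hessMap Γ F dirY dirT (0, x, y)) _ = _ at this
    linarith
  -- The tangential part of ∇_t L is fixed by differentiating g(L, ∂_x) = 0 in `t` and g(L, X) = `β`
  -- in `x`; the derivative of `β` enters here.
  have tF1 : ∀ x y, (0, x, y) ∈ O → G (F (0, x, y)) (cov Γ F L (0, x, y) dirT)
      (fderiv ℝ F (0, x, y) dirX) = P₁ x - deriv β x := by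
    intro x y hw
    rw [kF1 _ hw, A.hess_comm hw, lX1 x y hw, neg_neg]
  have tF2 : ∀ x y, (0, x, y) ∈ O → G (F (0, x, y)) (cov Γ F L (0, x, y) dirT)
      (fderiv ℝ F (0, x, y) dirY) = P₂ x := by
    intro x y hw
    rw [kF2 _ hw, A.hess_comm hw, lX2 x y hw, neg_neg]
  obtain ⟨ch1, ch2, ch3, ch4, ch5, ch6⟩ := A.christoffel_symbols hw
  have hG := A.gauss hw
  have dg1 := slice_dirX A.isOpen (pr (sc dirT) s1) tF1 hw
  have dg2 := slice_dirY A.isOpen (pr (sc dirT) s2) tF2 hw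
  rw [A.d_pair (sc dirT) s1 hw] at dg1
  rw [A.d_pair (sc dirT) s2 hw] at dg2
  have x11 := slice_dirX A.isOpen (pr s0 s1) (ψ := fun _ => 0) hX1 hw
  have x12 := slice_dirX A.isOpen (pr s0 s2) (ψ := fun _ => 0) hX2 hw
  have x22 := slice_dirY A.isOpen (pr s0 s2) (ψ := fun _ => 0) hX2 hw
  have x21 := slice_dirY A.isOpen (pr s0 s1) (ψ := fun _ => 0) hX1 hw
  rw [A.d_pair s0 s1 hw] at x11 x21
  rw [A.d_pair s0 s2 hw] at x12 x22
  have cc1 := A.lc.cov_cov A.isOpen A.smooth A.maps hL hw dirT dirX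
  have cc2 := A.lc.cov_cov A.isOpen A.smooth A.maps hL hw dirT dirY
  -- derivatives in `t`
  have q11t := hasDerivAt_lineT ((pr s1 s1).diffAt A.isOpen hw)
  have q12t := hasDerivAt_lineT ((pr s1 s2).diffAt A.isOpen hw)
  have q22t := hasDerivAt_lineT ((pr s2 s2).diffAt A.isOpen hw)
  have h11t := hasDerivAt_lineT ((pr (sc dirX) s1).diffAt A.isOpen hw)
  have h12t := hasDerivAt_lineT ((pr (sc dirX) s2).diffAt A.isOpen hw)
  have h21t := hasDerivAt_lineT ((pr (sc dirY) s1).diffAt A.isOpen hw)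
  have h22t := hasDerivAt_lineT ((pr (sc dirY) s2).diffAt A.isOpen hw)
  rw [A.d_pair s1 s1 hw] at q11t
  rw [A.d_pair s1 s2 hw] at q12t
  rw [A.d_pair s2 s2 hw] at q22t
  rw [A.d_pair (sc dirX) s1 hw] at h11t
  rw [A.d_pair (sc dirY) s2 hw] at h22t
  have e11 := A.q11 x y hw
  have e12 := A.q12 x y hw
  have e22 := A.q22 x y hw
  have frame : IsBlockFrame (G (F (0, x, y))) (L (0, x, y)) (fderiv ℝ F (0, x, y) dirT)
      (fderiv ℝ F (0, x, y) dirX) (fderiv ℝ F (0, x, y) dirY) 0 (β x) (ρ x) (a x) (b x) :=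
    { symm := sy _ hw, h00 := hnull _ hw, h01 := hβ x y hw, h11 := hρ x y hw, h0F1 := hn1 _ hw,
      h0F2 := hn2 _ hw, h1F1 := hX1 x y hw, h1F2 := hX2 x y hw, hF11 := e11, hF22 := e22,
      hF12 := e12, d_ne := by simp [hβ0.ne'], a_ne := ha.ne', b_ne := hb.ne' }
  have pc := frame.pair
  have sy := sy _ hw
  have kL := kL _ hw
  have kF1 := kF1 _ hw
  have kF2 := kF2 _ hw
  have lX1 := lX1 x y hw
  have lX2 := lX2 x y hw
  have tF1 := tF1 x y hw
  have tF2 := tF2 x y hw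
  have hcomm := A.hess_comm hw
  rw [deriv_const] at x11 x12
  have eβ := hβ x y hw
  have eP1 := hP1 x y hw
  have eP2 := hP2 x y hw
  simp only [expansionNum] at hθ
  dsimp only at hC
  change _ + G _ _ (hessMap Γ F dirX dirX (0, x, y)) = _ at dg1
  change _ + G _ _ (hessMap Γ F dirY dirY (0, x, y)) = _ at dg2
  change G _ (hessMap Γ F dirX dirT (0, x, y)) _ + G _ _ (hessMap Γ F dirX dirX (0, x, y)) = _
    at x11
  change G _ (hessMap Γ F dirX dirT (0, x, y)) _ + G _ _ (hessMap Γ F dirX dirY (0, x, y)) = _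
    at x12
  change G _ (hessMap Γ F dirY dirT (0, x, y)) _ + G _ _ (hessMap Γ F dirY dirX (0, x, y)) = _
    at x21
  change G _ (hessMap Γ F dirY dirT (0, x, y)) _ + G _ _ (hessMap Γ F dirY dirY (0, x, y)) = _
    at x22
  change HasDerivAt _ (G _ (hessMap Γ F dirT dirX (0, x, y)) _
    + G _ _ (hessMap Γ F dirT dirX (0, x, y))) _ at q11t
  change HasDerivAt _ (G _ (hessMap Γ F dirT dirX (0, x, y)) _
    + G _ _ (hessMap Γ F dirT dirY (0, x, y))) _ at q12t
  change HasDerivAt _ (G _ (hessMap Γ F dirT dirY (0, x, y)) _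
    + G _ _ (hessMap Γ F dirT dirY (0, x, y))) _ at q22t
  change HasDerivAt _ (_ + G _ _ (hessMap Γ F dirT dirX (0, x, y))) _ at h11t
  change HasDerivAt _ (_ + G _ _ (hessMap Γ F dirT dirY (0, x, y))) _ at h22t
  rw [cc1, map_add, add_apply] at h11t
  rw [cc2, map_add, add_apply] at h22t
  dsimp only at hG
  rw [hcomm dirX dirT] at x11 x12 lX1
  rw [hcomm dirY dirT] at x21 x22 lX2
  rw [hcomm dirY dirX] at x21
  rw [sy (fderiv ℝ F (0, x, y) dirT)] at x11 x12 x22 x21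
  have kX1 := kF1 dirX
  have kX2 := kF2 dirX
  have kY1 := kF1 dirY
  have kY2 := kF2 dirY
  rw [hcomm dirY dirX] at kY1
  have hh : G (F (0, x, y)) (cov Γ F L (0, x, y) dirY) (fderiv ℝ F (0, x, y) dirX)
      = G (F (0, x, y)) (cov Γ F L (0, x, y) dirX) (fderiv ℝ F (0, x, y) dirY) := by
    rw [kX2, kY1]
  have hc1 := pc (cov Γ F L (0, x, y) dirT) (hessMap Γ F dirX dirX (0, x, y))
  have hc2 := pc (cov Γ F L (0, x, y) dirT) (hessMap Γ F dirY dirY (0, x, y))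
  have hu1 := pc (cov Γ F L (0, x, y) dirX) (hessMap Γ F dirT dirX (0, x, y))
  have hu2 := pc (cov Γ F L (0, x, y) dirY) (hessMap Γ F dirT dirY (0, x, y))
  have hn1 := pc (hessMap Γ F dirY dirY (0, x, y)) (hessMap Γ F dirX dirX (0, x, y))
  have hn2 := pc (hessMap Γ F dirX dirY (0, x, y)) (hessMap Γ F dirX dirY (0, x, y))
  have eF11 := neg_eq_of_add_eq_zero_right x11
  have eF12 := neg_eq_of_add_eq_zero_right x12
  have eF22 := neg_eq_of_add_eq_zero_right x22
  have eF21 := neg_eq_of_add_eq_zero_right x21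
  have eL11 := neg_eq_iff_eq_neg.mpr kX1
  have eL12 := neg_eq_iff_eq_neg.mpr kX2
  have eL22 := neg_eq_iff_eq_neg.mpr kY2
  have exx : G (F (0, x, y)) (hessMap Γ F dirT dirY (0, x, y)) (fderiv ℝ F (0, x, y) dirX)
      = G (F (0, x, y)) (hessMap Γ F dirT dirX (0, x, y)) (fderiv ℝ F (0, x, y) dirY) := by
    linarith
  rw [kL, ← eL11, ← eF11, tF1, tF2, ch1, ch2] at hc1
  rw [kL, ← eL22, ← eF22, tF1, tF2, ch5, ch6] at hc2
  rw [kL, lX1, eP1] at hu1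
  rw [kL, lX2, eP2, hh, exx] at hu2
  rw [← eL22, ← eL11, ← eF11, ← eF22, ch1, ch2, ch5, ch6] at hn1
  rw [← eL12, ← eF12, ch3, ch4] at hn2
  rw [hh, e12, zero_mul, sub_zero, e11, e22] at hθ
  have alg := expansion_variation_algebra ha hb hβ0 hρ0 (by linarith) dg1 dg2 hc1 hc2 _ _ hu1 hu2
    hn1 hn2 hG hC
  have hN : HasDerivAt (fun t => expansionNum G Γ F L (t, x, y)) _ 0 :=
    ((q22t.mul h11t).sub (q12t.mul (h12t.add h21t))).add (q11t.mul h22t)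
  have hD : HasDerivAt (fun t => detFirst G F (t, x, y)) _ 0 :=
    (q11t.mul q22t).sub (q12t.pow 2)
  have hD0 : detFirst G F (0, x, y) = a x * b x := by simp [detFirst, e11, e12, e22]
  have hN0 : expansionNum G Γ F L (0, x, y) = 0 := by
    rw [expansionNum, hh, e12, e11, e22]; linarith
  -- The numerator vanishes at t = 0, so the derivative of the determinant contributes nothing.
  have hdiv := hN.div hD (by rw [hD0]; positivity)
  refine ⟨_, hdiv, le_trans (le_of_eq ?_) (alg.trans (le_of_eq ?_))⟩
  · simp only [Pi.add_apply, hD0, hN0, e12, e11, e22, hh, zero_mul, sub_zero, sy (fderiv ℝ F (0, x, y) dirX),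
      sy (fderiv ℝ F (0, x, y) dirY), exx]
    field_simp
    ring
  · simp only [axialCurvature]

end Expansion


/-! ### Second variation of area -/

section Area

variable {G : E 4 → E 4 →L[ℝ] E 4 →L[ℝ] ℝ} {Γ : E 4 → E 4 →L[ℝ] E 4 →L[ℝ] E 4} {U : Set (E 4)}
  {O : Set (ℝ × ℝ × ℝ)} {F : ℝ × ℝ × ℝ → E 4} {a b : ℝ → ℝ}

theorem dir_det {W : Type*} [NormedAddCommGroup W] [NormedSpace ℝ W] {O : Set W}
    (hO : IsOpen O) {f g k : W → ℝ} (hf : ContDiffOn ℝ ∞ f O)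
    (hg : ContDiffOn ℝ ∞ g O) (hk : ContDiffOn ℝ ∞ k O) {w : W} (hw : w ∈ O) (u : W) :
    fderiv ℝ (fun w => f w * g w - k w ^ 2) w u =
      fderiv ℝ f w u * g w + f w * fderiv ℝ g w u - 2 * k w * fderiv ℝ k w u := by
  have h := ((hf.diffAt hO hw).hasFDerivAt.mul (hg.diffAt hO hw).hasFDerivAt).sub
    ((hk.diffAt hO hw).hasFDerivAt.pow 2)
  have e : fderiv ℝ (fun w => f w * g w - k w ^ 2) w = _ := h.fderiv
  rw [e]
  simp
  ring

theorem dir_dir_det {W : Type*} [NormedAddCommGroup W] [NormedSpace ℝ W] {O : Set W}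
    (hO : IsOpen O) {f g k : W → ℝ} (hf : ContDiffOn ℝ ∞ f O)
    (hg : ContDiffOn ℝ ∞ g O) (hk : ContDiffOn ℝ ∞ k O) {w : W} (hw : w ∈ O) (u : W) :
    fderiv ℝ (fun w => fderiv ℝ (fun w => f w * g w - k w ^ 2) w u) w u =
      fderiv ℝ (fun w => fderiv ℝ f w u) w u * g w + 2 * (fderiv ℝ f w u * fderiv ℝ g w u)
        + f w * fderiv ℝ (fun w => fderiv ℝ g w u) w u - 2 * fderiv ℝ k w u ^ 2
        - 2 * k w * fderiv ℝ (fun w => fderiv ℝ k w u) w u := by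
  have e : (fun w => fderiv ℝ (fun w => f w * g w - k w ^ 2) w u) =ᶠ[nhds w]
      fun w => fderiv ℝ f w u * g w + f w * fderiv ℝ g w u - 2 * k w * fderiv ℝ k w u := by
    filter_upwards [hO.mem_nhds hw] with w hw using dir_det hO hf hg hk hw u
  have d : ∀ {φ : W → ℝ}, ContDiffOn ℝ ∞ φ O → HasFDerivAt φ (fderiv ℝ φ w) w :=
    fun h => (h.diffAt hO hw).hasFDerivAt
  have h := (((d (hf.dir hO u)).mul (d hg)).add ((d hf).mul (d (hg.dir hO u)))).sub
    (((d hk).const_mul 2).mul (d (hk.dir hO u)))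
  have e2 : fderiv ℝ (fun w => fderiv ℝ f w u * g w + f w * fderiv ℝ g w u
    - 2 * k w * fderiv ℝ k w u) w = _ := h.fderiv
  rw [e.fderiv_eq, e2]
  simp
  ring

/-- The component `g(∇_t ∂_t F, ∂_v F)` of the acceleration, expressed by the pullback metric. -/
def accel (G : E 4 → E 4 →L[ℝ] E 4 →L[ℝ] ℝ) (F : ℝ × ℝ × ℝ → E 4) (v w : ℝ × ℝ × ℝ) : ℝ :=
  fderiv ℝ (fun w => G (F w) (fderiv ℝ F w dirT) (fderiv ℝ F w v)) w dirT
    - (1 / 2) * fderiv ℝ (fun w => G (F w) (fderiv ℝ F w dirT) (fderiv ℝ F w dirT)) w v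

/-- The surplus term g(∂_t F, ∇_t∂_v F) is half the derivative of g(∂_t F, ∂_t F). As `accel`
involves only the pulled-back metric, the acceleration terms are the same in every chart and can be
integrated over the whole surface. -/
theorem AxialFamily.accel_eq (A : AxialFamily G Γ U O F a b) {w : ℝ × ℝ × ℝ} (hw : w ∈ O)
    (v : ℝ × ℝ × ℝ) :
    accel G F v w = G (F w) (hessMap Γ F dirT dirT w) (fderiv ℝ F w v) := by
  rw [accel, A.d_pair (A.dir_smooth _) (A.dir_smooth _) hw,
    A.d_pair (A.dir_smooth _) (A.dir_smooth _) hw]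
  change G _ (hessMap Γ F dirT dirT w) _ + G _ _ (hessMap Γ F dirT v w)
    - (1 / 2) * (G _ (hessMap Γ F v dirT w) _ + G _ _ (hessMap Γ F v dirT w)) = _
  rw [A.hess_comm hw v dirT, A.lc.symm _ (A.maps hw) (hessMap Γ F dirT v w)]
  ring

/-- Here `h` is the second fundamental form along the velocity, `k` that along the slice normal with
`k0` its component along the velocity, and `z` the normal part g(∇_t∂_t F, ∂_t F) of the
acceleration. Minimality eliminates `h22` and with it `z`; maximality eliminates `k0`. -/
theorem area_variation_algebra {a b ρ P₁ P₂ a' b' b'' ρ' A₁ A₂ dA₁ dA₂ z h11 h12 h22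
    k0 k11 k12 k22 R1 R2 S C c1 c2 u1 u2 n1 n2 : ℝ} (ha : 0 < a) (hb : 0 < b) (hρ : 0 < ρ)
    (h0 : h11 * b + h22 * a = 0) (hk : k0 / ρ + k11 / a + k22 / b = 0)
    (hc1 : c1 = (ρ * (-k0 * -k11) - 0 * (-k0 * -h11 + z * -k11) + -1 * (z * -h11))
      / (-1 * ρ - 0 ^ 2) + A₁ * (a' / 2) / a + A₂ * 0 / b)
    (hc2 : c2 = (ρ * (-k0 * -k22) - 0 * (-k0 * -h22 + z * -k22) + -1 * (z * -h22))
      / (-1 * ρ - 0 ^ 2) + A₁ * (-b' / 2) / a + A₂ * 0 / b)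
    (hu1 : u1 = (ρ * (-P₁ * -P₁) - 0 * (-P₁ * (ρ' / 2) + ρ' / 2 * -P₁) + -1 * (ρ' / 2 * (ρ' / 2)))
      / (-1 * ρ - 0 ^ 2) + h11 * h11 / a + h12 * h12 / b)
    (hu2 : u2 = (ρ * (-P₂ * -P₂) - 0 * (-P₂ * 0 + 0 * -P₂) + -1 * (0 * 0))
      / (-1 * ρ - 0 ^ 2) + h12 * h12 / a + h22 * h22 / b)
    (hn1 : n1 = (ρ * (-k22 * -k11) - 0 * (-k22 * -h11 + -h22 * -k11) + -1 * (-h22 * -h11))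
      / (-1 * ρ - 0 ^ 2) + (-b' / 2) * (a' / 2) / a + 0 * 0 / b)
    (hn2 : n2 = (ρ * (-k12 * -k12) - 0 * (-k12 * -h12 + -h12 * -k12) + -1 * (-h12 * -h12))
      / (-1 * ρ - 0 ^ 2) + 0 * 0 / a + (b' / 2) * (b' / 2) / b)
    (hS : S = - b'' / 2 - n1 + n2)
    (hC : C ≤ R1 / (ρ * a) + R2 / (ρ * b) + S / (a * b)) :
    (2 * (dA₁ - c1 - R1 + u1) * b + 2 * (2 * h11 * (2 * h22)) + a * (2 * (dA₂ - c2 - R2 + u2))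
      - 2 * (2 * h12) ^ 2) / (2 * a * b)
      ≤ ρ' ^ 2 / (4 * ρ * a)
        + ρ * ((- b'' / 2 + a' * b' / (4 * a) + b' ^ 2 / (4 * b)) / (a * b) - C)
        - P₁ ^ 2 / a - P₂ ^ 2 / b + (dA₁ / a + dA₂ / b
          + A₁ * (b' / (2 * a * b) - a' / (2 * a ^ 2))) := by
  have hd : (-1 * ρ - 0 ^ 2) = - ρ := by ring
  rw [hd] at hc1 hc2 hu1 hu2 hn1 hn2
  have hh : h22 = - b * h11 / a := by field_simp; linarith
  have hk0 : k0 = - ρ * (k11 / a + k22 / b) := by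
    have : k0 / ρ = - (k11 / a + k22 / b) := by linarith
    rw [div_eq_iff hρ.ne'] at this
    linarith
  -- The exact identity. The bracket subtracted at the end, a sum of squares of the two second
  -- fundamental forms, is what the inequality discards.
  have key : (2 * (dA₁ - c1 - R1 + u1) * b + 2 * (2 * h11 * (2 * h22))
      + a * (2 * (dA₂ - c2 - R2 + u2)) - 2 * (2 * h12) ^ 2) / (2 * a * b)
      = ρ' ^ 2 / (4 * ρ * a)
        + ρ * ((- b'' / 2 + a' * b' / (4 * a) + b' ^ 2 / (4 * b)) / (a * b)
          - (R1 / (ρ * a) + R2 / (ρ * b) + S / (a * b)))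
        - P₁ ^ 2 / a - P₂ ^ 2 / b + (dA₁ / a + dA₂ / b
          + A₁ * (b' / (2 * a * b) - a' / (2 * a ^ 2)))
        - (h11 ^ 2 / a ^ 2 + h12 ^ 2 / (a * b) + ρ / 2 * (k11 / a + k22 / b) ^ 2
          + ρ / 2 * (k11 ^ 2 / a ^ 2 + 2 * k12 ^ 2 / (a * b) + k22 ^ 2 / b ^ 2)) := by
    subst hS hn1 hn2 hu1 hu2 hc1 hc2 hk0 hh
    field_simp
    ring
  have : 0 ≤ h11 ^ 2 / a ^ 2 + h12 ^ 2 / (a * b) + ρ / 2 * (k11 / a + k22 / b) ^ 2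
          + ρ / 2 * (k11 ^ 2 / a ^ 2 + 2 * k12 ^ 2 / (a * b) + k22 ^ 2 / b ^ 2) := by positivity
  have : ρ * C ≤ ρ * (R1 / (ρ * a) + R2 / (ρ * b) + S / (a * b)) :=
    mul_le_mul_of_nonneg_left hC hρ.le
  linarith

/-- The second derivative of the determinant of the first fundamental form. The sum of the three
sectional curvatures bounded below by `C` is the Einstein tensor in the direction of the slice
normal. The tangential acceleration survives only as a divergence, so no assumption on the family
beyond its velocity is needed. -/
theorem AxialFamily.area_variation (A : AxialFamily G Γ U O F a b) {n : ℝ × ℝ × ℝ → E 4}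
    (hn : ContDiffOn ℝ ∞ n O) (hunit : ∀ w ∈ O, G (F w) (n w) (n w) = -1)
    (hnF : ∀ w ∈ O, ∀ u, G (F w) (n w) (fderiv ℝ F w u) = 0)
    {ρ : ℝ → ℝ}
    (hρ : ∀ x y, (0, x, y) ∈ O →
      G (F (0, x, y)) (fderiv ℝ F (0, x, y) dirT) (fderiv ℝ F (0, x, y) dirT) = ρ x)
    (hX1 : ∀ x y, (0, x, y) ∈ O →
      G (F (0, x, y)) (fderiv ℝ F (0, x, y) dirT) (fderiv ℝ F (0, x, y) dirX) = 0)
    (hX2 : ∀ x y, (0, x, y) ∈ O →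
      G (F (0, x, y)) (fderiv ℝ F (0, x, y) dirT) (fderiv ℝ F (0, x, y) dirY) = 0)
    {x y P₁ P₂ : ℝ} (hw : (0, x, y) ∈ O) (ha : 0 < a x) (hb : 0 < b x) (hρ0 : 0 < ρ x)
    (hP1 : G (F (0, x, y)) (cov Γ F n (0, x, y) dirX) (fderiv ℝ F (0, x, y) dirT) = P₁)
    (hP2 : G (F (0, x, y)) (cov Γ F n (0, x, y) dirY) (fderiv ℝ F (0, x, y) dirT) = P₂)
    (hmin : G (F (0, x, y)) (hessMap Γ F dirX dirT (0, x, y)) (fderiv ℝ F (0, x, y) dirX) * b x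
      + G (F (0, x, y)) (hessMap Γ F dirY dirT (0, x, y)) (fderiv ℝ F (0, x, y) dirY) * a x = 0)
    (hmax : G (F (0, x, y)) (cov Γ F n (0, x, y) dirT) (fderiv ℝ F (0, x, y) dirT) / ρ x
      + G (F (0, x, y)) (cov Γ F n (0, x, y) dirX) (fderiv ℝ F (0, x, y) dirX) / a x
      + G (F (0, x, y)) (cov Γ F n (0, x, y) dirY) (fderiv ℝ F (0, x, y) dirY) / b x = 0) {C : ℝ}
    (hC : let w : ℝ × ℝ × ℝ := (0, x, y)
      C ≤ G (F w) (riem Γ (F w) (fderiv ℝ F w dirT) (fderiv ℝ F w dirX) (fderiv ℝ F w dirX))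
            (fderiv ℝ F w dirT) / (ρ x * a x)
          + G (F w) (riem Γ (F w) (fderiv ℝ F w dirT) (fderiv ℝ F w dirY) (fderiv ℝ F w dirY))
            (fderiv ℝ F w dirT) / (ρ x * b x)
          + G (F w) (riem Γ (F w) (fderiv ℝ F w dirX) (fderiv ℝ F w dirY) (fderiv ℝ F w dirY))
            (fderiv ℝ F w dirX) / (a x * b x)) :
    fderiv ℝ (detFirst G F) (0, x, y) dirT = 0 ∧
    fderiv ℝ (fun w => fderiv ℝ (detFirst G F) w dirT) (0, x, y) dirT / (2 * a x * b x)
      ≤ deriv ρ x ^ 2 / (4 * ρ x * a x) + ρ x * (axialCurvature a b x - C)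
        - P₁ ^ 2 / a x - P₂ ^ 2 / b x
        + (fderiv ℝ (accel G F dirX) (0, x, y) dirX / a x
          + fderiv ℝ (accel G F dirY) (0, x, y) dirY / b x
          + accel G F dirX (0, x, y) * (deriv b x / (2 * a x * b x)
            - deriv a x / (2 * a x ^ 2))) := by
  have s0 := A.dir_smooth dirT
  have s1 := A.dir_smooth dirX
  have s2 := A.dir_smooth dirY
  have pr : ∀ {Y Z : ℝ × ℝ × ℝ → E 4}, ContDiffOn ℝ ∞ Y O → ContDiffOn ℝ ∞ Z O →
      ContDiffOn ℝ ∞ (fun w => G (F w) (Y w) (Z w)) O := fun hY hZ =>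
    A.lc.pair_smooth A.smooth A.maps hY hZ
  have sy := A.lc.symm (F (0, x, y)) (A.maps hw)
  have fz : ∀ {φ : ℝ × ℝ × ℝ → ℝ} {r : ℝ}, (∀ w ∈ O, φ w = r) → ∀ w ∈ O, ∀ u,
      fderiv ℝ φ w u = 0 := by
    intro φ r hφ w hw u
    have : φ =ᶠ[nhds w] fun _ => r := by
      filter_upwards [A.isOpen.mem_nhds hw] with w hw using hφ w hw
    rw [this.fderiv_eq]
    simp
  have kF : ∀ u v, G (F (0, x, y)) (hessMap Γ F u v (0, x, y)) (n (0, x, y))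
      = - G (F (0, x, y)) (cov Γ F n (0, x, y) u) (fderiv ℝ F (0, x, y) v) := by
    intro u v
    have := fz (fun w hw => hnF w hw v) _ hw u
    rw [A.d_pair hn (A.dir_smooth v) hw, sy (n _)] at this
    exact eq_neg_of_add_eq_zero_right this
  have hcomm := A.hess_comm hw
  obtain ⟨ch1, ch2, ch3, ch4, ch5, ch6⟩ := A.christoffel_symbols hw
  have hG := A.gauss hw
  have x11 := slice_dirX A.isOpen (pr s0 s1) (ψ := fun _ => 0) hX1 hw
  have x12 := slice_dirX A.isOpen (pr s0 s2) (ψ := fun _ => 0) hX2 hw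
  have x22 := slice_dirY A.isOpen (pr s0 s2) (ψ := fun _ => 0) hX2 hw
  have x21 := slice_dirY A.isOpen (pr s0 s1) (ψ := fun _ => 0) hX1 hw
  have x10 := slice_dirX A.isOpen (pr s0 s0) hρ hw
  have x20 := slice_dirY A.isOpen (pr s0 s0) hρ hw
  rw [A.d_pair s0 s1 hw] at x11 x21
  rw [A.d_pair s0 s2 hw] at x12 x22
  rw [A.d_pair s0 s0 hw] at x10 x20
  change G _ (hessMap Γ F dirX dirT (0, x, y)) _ + G _ _ (hessMap Γ F dirX dirX (0, x, y)) = _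
    at x11
  change G _ (hessMap Γ F dirX dirT (0, x, y)) _ + G _ _ (hessMap Γ F dirX dirY (0, x, y)) = _
    at x12
  change G _ (hessMap Γ F dirY dirT (0, x, y)) _ + G _ _ (hessMap Γ F dirY dirX (0, x, y)) = _
    at x21
  change G _ (hessMap Γ F dirY dirT (0, x, y)) _ + G _ _ (hessMap Γ F dirY dirY (0, x, y)) = _
    at x22
  change G _ (hessMap Γ F dirX dirT (0, x, y)) _ + G _ _ (hessMap Γ F dirX dirT (0, x, y)) = _
    at x10
  change G _ (hessMap Γ F dirY dirT (0, x, y)) _ + G _ _ (hessMap Γ F dirY dirT (0, x, y)) = _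
    at x20
  rw [deriv_const] at x11 x12
  rw [hcomm dirY dirX] at x21
  rw [sy (fderiv ℝ F (0, x, y) dirT)] at x11 x12 x22 x21 x10 x20
  have e11 := A.q11 x y hw
  have e12 := A.q12 x y hw
  have e22 := A.q22 x y hw
  -- derivatives in `t` of the first fundamental form
  have qt : ∀ i j, fderiv ℝ (fun w => G (F w) (fderiv ℝ F w i) (fderiv ℝ F w j)) (0, x, y) dirT
      = G (F (0, x, y)) (hessMap Γ F i dirT (0, x, y)) (fderiv ℝ F (0, x, y) j)
        + G (F (0, x, y)) (hessMap Γ F j dirT (0, x, y)) (fderiv ℝ F (0, x, y) i) := by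
    intro i j
    rw [A.d_pair (A.dir_smooth i) (A.dir_smooth j) hw]
    change G _ (hessMap Γ F dirT i (0, x, y)) _ + G _ _ (hessMap Γ F dirT j (0, x, y)) = _
    rw [hcomm dirT i, hcomm dirT j, sy _ (hessMap Γ F j dirT (0, x, y))]
  -- Exchanging ∇_t and ∇_i turns ∇_t∇_i∂_t into ∇_i∇_t∂_t plus curvature, and the former is the
  -- derivative of an acceleration component minus a term in ∇_i∂_i.
  have qtt : ∀ i, fderiv ℝ (fun w => fderiv ℝ (fun w => G (F w) (fderiv ℝ F w i)
      (fderiv ℝ F w i)) w dirT) (0, x, y) dirT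
      = 2 * (fderiv ℝ (accel G F i) (0, x, y) i
        - G (F (0, x, y)) (hessMap Γ F dirT dirT (0, x, y)) (hessMap Γ F i i (0, x, y))
        - G (F (0, x, y)) (riem Γ (F (0, x, y)) (fderiv ℝ F (0, x, y) dirT)
          (fderiv ℝ F (0, x, y) i) (fderiv ℝ F (0, x, y) i)) (fderiv ℝ F (0, x, y) dirT)
        + G (F (0, x, y)) (hessMap Γ F i dirT (0, x, y)) (hessMap Γ F i dirT (0, x, y))) := by
    intro i
    have si := A.dir_smooth i
    have e : (fun w => fderiv ℝ (fun w => G (F w) (fderiv ℝ F w i) (fderiv ℝ F w i)) w dirT)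
        =ᶠ[nhds (0, x, y)] fun w => 2 * G (F w) (hessMap Γ F i dirT w) (fderiv ℝ F w i) := by
      filter_upwards [A.isOpen.mem_nhds hw] with w hw
      rw [A.d_pair si si hw]
      change G _ (hessMap Γ F dirT i w) _ + G _ _ (hessMap Γ F dirT i w) = _
      rw [A.hess_comm hw dirT i, A.lc.symm _ (A.maps hw) (fderiv ℝ F w i)]
      ring
    have sh := A.hess_smooth i dirT
    have d1 : DifferentiableAt ℝ (fun w => G (F w) (hessMap Γ F i dirT w) (fderiv ℝ F w i))
      (0, x, y) := (pr sh si).diffAt A.isOpen hw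
    have ea : accel G F i =ᶠ[nhds (0, x, y)]
        fun w => G (F w) (hessMap Γ F dirT dirT w) (fderiv ℝ F w i) := by
      filter_upwards [A.isOpen.mem_nhds hw] with w hw using A.accel_eq hw i
    have cc := A.lc.cov_cov A.isOpen A.smooth A.maps s0 hw dirT i
    change cov Γ F (hessMap Γ F i dirT) _ dirT = cov Γ F (hessMap Γ F dirT dirT) _ i + _ at cc
    rw [e.fderiv_eq, fderiv_const_mul d1, smul_apply, A.d_pair sh si hw, cc,
      ea.fderiv_eq, A.d_pair (A.hess_smooth dirT dirT) si hw, map_add, add_apply,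
      A.lc.riem_skew (A.maps hw) _ _ (fderiv ℝ F (0, x, y) dirT)]
    change 2 * (_ + G _ _ (hessMap Γ F dirT i (0, x, y))) =
      2 * (_ + G _ _ (hessMap Γ F i i (0, x, y)) - _ - _ + _)
    rw [hcomm dirT i]
    ring
  have frame : IsBlockFrame (G (F (0, x, y))) (n (0, x, y)) (fderiv ℝ F (0, x, y) dirT)
      (fderiv ℝ F (0, x, y) dirX) (fderiv ℝ F (0, x, y) dirY) (-1) 0 (ρ x) (a x) (b x) :=
    { symm := sy, h00 := hunit _ hw, h01 := hnF _ hw _, h11 := hρ x y hw, h0F1 := hnF _ hw _,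
      h0F2 := hnF _ hw _, h1F1 := hX1 x y hw, h1F2 := hX2 x y hw, hF11 := e11, hF22 := e22,
      hF12 := e12, d_ne := by simp [hρ0.ne'], a_ne := ha.ne', b_ne := hb.ne' }
  have pc := frame.pair
  have hc1 := pc (hessMap Γ F dirT dirT (0, x, y)) (hessMap Γ F dirX dirX (0, x, y))
  have hc2 := pc (hessMap Γ F dirT dirT (0, x, y)) (hessMap Γ F dirY dirY (0, x, y))
  have hu1 := pc (hessMap Γ F dirX dirT (0, x, y)) (hessMap Γ F dirX dirT (0, x, y))
  have hu2 := pc (hessMap Γ F dirY dirT (0, x, y)) (hessMap Γ F dirY dirT (0, x, y))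
  have hn1 := pc (hessMap Γ F dirY dirY (0, x, y)) (hessMap Γ F dirX dirX (0, x, y))
  have hn2 := pc (hessMap Γ F dirX dirY (0, x, y)) (hessMap Γ F dirX dirY (0, x, y))
  have eF11 := eq_neg_of_add_eq_zero_right x11
  have eF12 := eq_neg_of_add_eq_zero_right x12
  have eF22 := eq_neg_of_add_eq_zero_right x22
  have exx : G (F (0, x, y)) (hessMap Γ F dirY dirT (0, x, y)) (fderiv ℝ F (0, x, y) dirX)
      = G (F (0, x, y)) (hessMap Γ F dirX dirT (0, x, y)) (fderiv ℝ F (0, x, y) dirY) := by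
    linarith
  have e10 : G (F (0, x, y)) (hessMap Γ F dirX dirT (0, x, y)) (fderiv ℝ F (0, x, y) dirT)
      = deriv ρ x / 2 := by linarith
  have e20 : G (F (0, x, y)) (hessMap Γ F dirY dirT (0, x, y)) (fderiv ℝ F (0, x, y) dirT)
      = 0 := by linarith
  have eA1 := A.accel_eq hw dirX
  have eA2 := A.accel_eq hw dirY
  rw [kF, kF, eF11, ← eA1, ← eA2, ch1, ch2] at hc1
  rw [kF, kF, eF22, ← eA1, ← eA2, ch5, ch6] at hc2
  rw [kF, e10, hP1] at hu1
  rw [kF, e20, hP2, exx] at hu2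
  rw [kF, kF, eF11, eF22, ch1, ch2, ch5, ch6] at hn1
  rw [kF, eF12, ch3, ch4] at hn2
  have alg := area_variation_algebra (dA₁ := fderiv ℝ (accel G F dirX) (0, x, y) dirX)
    (dA₂ := fderiv ℝ (accel G F dirY) (0, x, y) dirY) ha hb hρ0 hmin hmax hc1 hc2 hu1 hu2
    hn1 hn2 hG hC
  have p11 := pr s1 s1
  have p12 := pr s1 s2
  have p22 := pr s2 s2
  constructor
  · unfold detFirst
    rw [dir_det A.isOpen p11 p22 p12 hw, qt, qt, e11, e12, e22]
    linarith
  · refine le_trans (le_of_eq ?_) (alg.trans (le_of_eq ?_))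
    · unfold detFirst
      rw [dir_dir_det A.isOpen p11 p22 p12 hw, qtt, qtt, qt, qt, qt, e11, e12, e22, exx]
      ring
    · rw [axialCurvature]

end Area


/-! ### Existence of the Levi-Civita connection -/

section Existence

variable {X : Type*} [NormedAddCommGroup X] [NormedSpace ℝ X]

/-- The Koszul expression `½ (T(u,v,w) + T(v,u,w) - T(w,u,v))`. -/
def koszul (T : X →L[ℝ] X →L[ℝ] X →L[ℝ] ℝ) : X →L[ℝ] X →L[ℝ] X →L[ℝ] ℝ :=
  (1 / 2 : ℝ) • (T + T.flip
    - ((ContinuousLinearMap.flipₗᵢ ℝ X X ℝ).toContinuousLinearEquiv :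
        (X →L[ℝ] X →L[ℝ] ℝ) →L[ℝ] (X →L[ℝ] X →L[ℝ] ℝ)) ∘L T.flip)

theorem koszul_apply (T : X →L[ℝ] X →L[ℝ] X →L[ℝ] ℝ) (u v w : X) :
    koszul T u v w = (1 / 2) * (T u v w + T v u w - T w u v) := by
  simp [koszul]

theorem koszul_smooth {W : Type*} [NormedAddCommGroup W] [NormedSpace ℝ W]
    {T : W → X →L[ℝ] X →L[ℝ] X →L[ℝ] ℝ} {O : Set W} (hT : ContDiffOn ℝ ∞ T O) :
    ContDiffOn ℝ ∞ (fun w => koszul (T w)) O := by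
  have hf : ContDiffOn ℝ ∞ (fun w => (T w).flip) O :=
    (ContinuousLinearMap.flipₗᵢ ℝ X X (X →L[ℝ] ℝ)).contDiff.comp_contDiffOn hT
  exact (contDiffOn_const (c := (1 / 2 : ℝ))).smul ((hT.add hf).sub (contDiffOn_const.clm_comp hf))

/-- The Levi-Civita connection of a metric. -/
def leviCivita (G : X → X →L[ℝ] X →L[ℝ] ℝ) (y : X) : X →L[ℝ] X →L[ℝ] X :=
  (ContinuousLinearMap.compL ℝ X (X →L[ℝ] ℝ) X (ContinuousLinearMap.inverse (G y)))
    ∘L koszul (fderiv ℝ G y)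

theorem isInvertible_of_nondeg [FiniteDimensional ℝ X] (B : X →L[ℝ] X →L[ℝ] ℝ)
    (h : ∀ u, (∀ v, B u v = 0) → u = 0) : B.IsInvertible := by
  have hinj : Function.Injective B := by
    rw [injective_iff_map_eq_zero]
    exact fun u hu => h u fun v => by rw [hu]; rfl
  have hdim : Module.finrank ℝ X = Module.finrank ℝ (X →L[ℝ] ℝ) := by
    rw [← (LinearMap.toContinuousLinearMap (𝕜 := ℝ) (E := X) (F' := ℝ)).finrank_eq]
    exact (Subspace.dual_finrank_eq (K := ℝ) (V := X)).symm
  refine ⟨(LinearEquiv.ofInjectiveOfFinrankEq (B : X →ₗ[ℝ] X →L[ℝ] ℝ) hinj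
    hdim).toContinuousLinearEquiv, ?_⟩
  ext u v
  rfl

theorem leviCivita_pair [FiniteDimensional ℝ X] {G : X → X →L[ℝ] X →L[ℝ] ℝ} {y : X}
    (h : ∀ u, (∀ v, G y u v = 0) → u = 0) (u v w : X) :
    G y (leviCivita G y u v) w
      = (1 / 2) * (fderiv ℝ G y u v w + fderiv ℝ G y v u w - fderiv ℝ G y w u v) := by
  have hi := isInvertible_of_nondeg (G y) h
  rw [← koszul_apply]
  simp only [leviCivita, ContinuousLinearMap.comp_apply, ContinuousLinearMap.compL_apply]
  have := hi.self_comp_inverse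
  exact congrArg (fun f => f w) (congrArg (fun f : (X →L[ℝ] ℝ) →L[ℝ] (X →L[ℝ] ℝ) =>
    f (koszul (fderiv ℝ G y) u v)) this)

/-- The Koszul formula defines Γ by inverting `G`; inversion is smooth at invertible maps, and
symmetry and compatibility are read off after pairing with an arbitrary vector. -/
theorem LeviCivita.of_metric [FiniteDimensional ℝ X] {G : X → X →L[ℝ] X →L[ℝ] ℝ} {U : Set X}
    (hU : IsOpen U) (hG : ContDiffOn ℝ ∞ G U) (hs : ∀ y ∈ U, ∀ u v, G y u v = G y v u)
    (hn : ∀ y ∈ U, ∀ u, (∀ v, G y u v = 0) → u = 0) : LeviCivita G (leviCivita G) U := by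
  have hds : ∀ y ∈ U, ∀ a u v, fderiv ℝ G y a u v = fderiv ℝ G y a v u := by
    intro y hy a u v
    have hd := hG.diffAt hU hy
    have e : ∀ b c, fderiv ℝ G y a b c = fderiv ℝ (fun z => G z b c) y a := by
      intro b c
      rw [fderiv_clm_apply (hd.clm_apply (differentiableAt_const _)) (differentiableAt_const _),
        fderiv_clm_apply hd (differentiableAt_const _)]
      simp
    rw [e, e]
    have : (fun z => G z u v) =ᶠ[nhds y] fun z => G z v u := by
      filter_upwards [hU.mem_nhds hy] with z hz using hs z hz _ _
    rw [this.fderiv_eq]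
  refine ⟨hU, hG, ?_, hs, hn, ?_, ?_⟩
  · have h1 : ContDiffOn ℝ ∞ (fun y => ContinuousLinearMap.inverse (G y)) U := fun y hy =>
      ((isInvertible_of_nondeg (G y) (hn y hy)).contDiffAt_map_inverse).comp_contDiffWithinAt y
        (hG y hy)
    have h2 := koszul_smooth (hG.fderiv_of_isOpen (m := ∞) hU (by simp))
    exact ((ContinuousLinearMap.compL ℝ X (X →L[ℝ] ℝ) X).contDiff.comp_contDiffOn h1).clm_comp h2
  · intro y hy u v
    rw [← sub_eq_zero]
    refine hn y hy _ fun w => ?_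
    rw [map_sub, sub_apply, leviCivita_pair (hn y hy), leviCivita_pair (hn y hy), hds y hy w v u]
    ring
  · intro y hy a u v
    rw [hs y hy u, leviCivita_pair (hn y hy), leviCivita_pair (hn y hy), hds y hy a v u]
    ring

end Existence

/-! ### The metric in a chart -/

section Chart

variable {V : Type*} [TopologicalSpace V] [ChartedSpace (E 4) V]

/-- The coordinate vectors at chart position `y`, in the preferred chart at `p`. -/
def coordMap (p : V) (y : E 4) : E 4 →L[ℝ] E 4 :=
  mfderiv 𝓘(ℝ, E 4) (𝓡 4) (extChartAt (𝓡 4) p).symm y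

/-- A bilinear form on a tangent space, as a bilinear form on `ℝ⁴`. -/
def bilinModel {x : V} (B : TangentSpace (𝓡 4) x →L[ℝ] TangentSpace (𝓡 4) x →L[ℝ] ℝ) :
    E 4 →L[ℝ] E 4 →L[ℝ] ℝ := B

/-- The metric components in the preferred chart at `p`. -/
def chartG (g : BilinField V) (p : V) (y : E 4) : E 4 →L[ℝ] E 4 →L[ℝ] ℝ :=
  (bilinModel (g ((extChartAt (𝓡 4) p).symm y))).bilinearComp (coordMap p y) (coordMap p y)

theorem chartG_apply (g : BilinField V) (p : V) (y u v : E 4) :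
    chartG g p y u v = chartMetric g p y u v := rfl

/-- The components of a tangent vector in the preferred chart at `p`. -/
def push (p x : V) : TangentSpace (𝓡 4) x →L[ℝ] E 4 :=
  mfderiv (𝓡 4) 𝓘(ℝ, E 4) (extChartAt (𝓡 4) p) x

/-- The curvature and covariant derivatives are defined in the preferred chart at the very point,
where the identification of the tangent space with ℝ⁴ is the identity. -/
theorem push_self [IsManifold (𝓡 4) ∞ V] (p : V) (v : TangentSpace (𝓡 4) p) : push p p v = v := by
  rw [push, mfderiv_extChartAt_self]; rfl

theorem chart_source_iff {p x : V} :
    x ∈ (extChartAt (𝓡 4) p).source ↔ x ∈ (chartAt (E 4) p).source := by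
  rw [extChartAt_source]

theorem coordVec_push [IsManifold (𝓡 4) ∞ V] {p x : V} (hx : x ∈ (chartAt (E 4) p).source)
    (v : TangentSpace (𝓡 4) x) :
    (coordVec p (extChartAt (𝓡 4) p x) (push p x v) : E 4) = v := by
  have h := mfderivWithin_extChartAt_symm_comp_mfderiv_extChartAt' (I := 𝓡 4)
    (chart_source_iff.mpr hx)
  rw [ModelWithCorners.range_eq_univ, mfderivWithin_univ] at h
  exact congrArg (fun f => f v) h

theorem push_coordVec [IsManifold (𝓡 4) ∞ V] {p : V} {y : E 4}
    (hy : y ∈ (extChartAt (𝓡 4) p).target) (v : E 4) :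
    push p ((extChartAt (𝓡 4) p).symm y) (coordVec p y v) = v := by
  have h := mfderiv_extChartAt_comp_mfderivWithin_extChartAt_symm (I := 𝓡 4) hy
  rw [ModelWithCorners.range_eq_univ, mfderivWithin_univ] at h
  exact congrArg (fun f => f v) h

theorem chartG_push [IsManifold (𝓡 4) ∞ V] (g : BilinField V) {p x : V}
    (hx : x ∈ (chartAt (E 4) p).source)
    (u v : TangentSpace (𝓡 4) x) :
    chartG g p (extChartAt (𝓡 4) p x) (push p x u) (push p x v) = g x u v := by
  -- The base points are equal but not syntactically so; generalizing the point lets the vectors be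
  -- compared as elements of ℝ⁴.
  have key : ∀ z : V, z = x → ∀ u' v' : E 4, u' = u → v' = v →
      g z u' v' = g x u v := by
    rintro z rfl u' v' rfl rfl; rfl
  exact key _ ((extChartAt (𝓡 4) p).left_inv (chart_source_iff.mpr hx)) _ _
    (coordVec_push hx u) (coordVec_push hx v)

/-- In the trivialization of the tangent bundle over the chart at `p` the field has the constant
value `u`. -/
theorem coordVec_smooth [IsManifold (𝓡 4) ∞ V] (p : V) (u : E 4) :
    ContMDiffOn 𝓘(ℝ, E 4) (𝓡 4).tangent ∞
      (fun y => (⟨(extChartAt (𝓡 4) p).symm y, coordVec p y u⟩ : TangentBundle (𝓡 4) V))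
      (extChartAt (𝓡 4) p).target := by
  set e := trivializationAt (E 4) (TangentSpace (𝓡 4) : V → Type _) p
  have h1 : ContMDiffOn 𝓘(ℝ, E 4) (𝓡 4) ∞ (extChartAt (𝓡 4) p).symm
      (extChartAt (𝓡 4) p).target := contMDiffOn_extChartAt_symm p
  refine (e.contMDiffOn_iff (IB := 𝓡 4) ?_).mpr ⟨h1, ?_⟩
  · intro y hy
    rw [TangentBundle.trivializationAt_source]
    exact chart_source_iff.mp ((extChartAt (𝓡 4) p).map_target hy)
  · refine (contMDiffOn_const (c := u)).congr fun y hy => ?_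
    have hx := chart_source_iff.mp ((extChartAt (𝓡 4) p).map_target hy)
    have e1 := Bundle.Trivialization.continuousLinearMapAt_apply_of_mem (R := ℝ) e
      (b := (extChartAt (𝓡 4) p).symm y) hx (coordVec p y u)
    rw [← e1, TangentBundle.continuousLinearMapAt_trivializationAt hx]
    exact push_coordVec hy u

theorem SmoothBilin.pair_smooth [IsManifold (𝓡 4) ∞ V] {g : BilinField V} (hg : SmoothBilin g)
    {W : Type*} [NormedAddCommGroup W] [NormedSpace ℝ W] {O : Set W} {f : W → V}
    {Y Z : ∀ w, TangentSpace (𝓡 4) (f w)}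
    (hY : ContMDiffOn 𝓘(ℝ, W) (𝓡 4).tangent ∞ (fun w => (⟨f w, Y w⟩ : TangentBundle (𝓡 4) V)) O)
    (hZ : ContMDiffOn 𝓘(ℝ, W) (𝓡 4).tangent ∞ (fun w => (⟨f w, Z w⟩ : TangentBundle (𝓡 4) V)) O) :
    ContDiffOn ℝ ∞ (fun w => g (f w) (Y w) (Z w)) O := by
  intro w hw
  rw [← contMDiffWithinAt_iff_contDiffWithinAt]
  have hb : ContMDiffWithinAt 𝓘(ℝ, W) (𝓡 4) ∞ f O w := by
    have := hY w hw
    rw [Bundle.contMDiffWithinAt_totalSpace] at this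
    exact this.1
  have : ContMDiffWithinAt 𝓘(ℝ, W) ((𝓡 4).prod 𝓘(ℝ, ℝ)) ∞
      (fun m ↦ Bundle.TotalSpace.mk' ℝ (E := Bundle.Trivial V ℝ) (f m) (g (f m) (Y m) (Z m)))
        O w := by
    apply ContMDiffWithinAt.clm_bundle_apply₂ (F₁ := E 4) (F₂ := E 4)
    · exact ContMDiffAt.comp_contMDiffWithinAt w hg.contMDiffAt hb
    · exact hY w hw
    · exact hZ w hw
  rw [Bundle.contMDiffWithinAt_totalSpace] at this
  exact this.2

theorem chartG_smooth [IsManifold (𝓡 4) ∞ V] {g : BilinField V} (hg : SmoothBilin g) (p : V) :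
    ContDiffOn ℝ ∞ (chartG g p) (extChartAt (𝓡 4) p).target := by
  rw [contDiffOn_clm_apply]
  intro u
  rw [contDiffOn_clm_apply]
  intro v
  exact hg.pair_smooth (coordVec_smooth p u) (coordVec_smooth p v)

/-- Smoothness of the components of a vector field along a map. -/
theorem push_smooth [IsManifold (𝓡 4) ∞ V] {W : Type*} [NormedAddCommGroup W] [NormedSpace ℝ W]
    {O : Set W} {f : W → V} {Y : ∀ w, TangentSpace (𝓡 4) (f w)} {p : V}
    (hY : ContMDiffOn 𝓘(ℝ, W) (𝓡 4).tangent ∞ (fun w => (⟨f w, Y w⟩ : TangentBundle (𝓡 4) V)) O)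
    (hO : ∀ w ∈ O, f w ∈ (chartAt (E 4) p).source) :
    ContDiffOn ℝ ∞ (fun w => push p (f w) (Y w)) O := by
  set e := trivializationAt (E 4) (TangentSpace (𝓡 4) : V → Type _) p
  have h := ((e.contMDiffOn_iff (IB := 𝓡 4) (fun w hw => by
    rw [TangentBundle.trivializationAt_source]; exact hO w hw)).mp hY).2
  rw [← contMDiffOn_iff_contDiffOn]
  refine h.congr fun w hw => ?_
  have e1 := Bundle.Trivialization.continuousLinearMapAt_apply_of_mem (R := ℝ) e
    (b := f w) (hO w hw) (Y w)
  rw [← e1, TangentBundle.continuousLinearMapAt_trivializationAt (hO w hw)]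
  rfl

end Chart


/-! ### Covariant derivatives in a chart -/

section ChartConnection

variable {V : Type*} [TopologicalSpace V] [ChartedSpace (E 4) V] [IsManifold (𝓡 4) ∞ V]

theorem EMSpacetime.nondeg (M : EMSpacetime V) (x : V) (u : TangentSpace (𝓡 4) x)
    (h : ∀ v, M.g x u v = 0) : u = 0 := by
  obtain ⟨t, -, ht⟩ := M.g_lorentz x
  by_contra hu
  have := ht u (by rw [M.g_symm]; exact h t) hu
  rw [h u] at this
  exact lt_irrefl _ this

theorem EMSpacetime.chart_nondeg (M : EMSpacetime V) (p : V) {y : E 4}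
    (hy : y ∈ (extChartAt (𝓡 4) p).target) (u : E 4) (h : ∀ v, chartG M.g p y u v = 0) :
    u = 0 := by
  have h0 : coordVec p y u = 0 := by
    refine M.nondeg _ _ fun v => ?_
    have hx := chart_source_iff.mp ((extChartAt (𝓡 4) p).map_target hy)
    have e := coordVec_push hx v
    rw [(extChartAt (𝓡 4) p).right_inv hy] at e
    have := h (push p _ v)
    rw [chartG_apply, chartMetric] at this
    exact (congrArg (fun v' : E 4 => M.g ((extChartAt (𝓡 4) p).symm y) (coordVec p y u) v')
      e.symm).trans this
  have := push_coordVec hy u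
  rw [h0, map_zero] at this
  exact this.symm

/-- The Levi-Civita connection in the preferred chart at `p`. -/
def EMSpacetime.chartΓ (M : EMSpacetime V) (p : V) : E 4 → E 4 →L[ℝ] E 4 →L[ℝ] E 4 :=
  leviCivita (chartG M.g p)

theorem EMSpacetime.leviCivita_chart (M : EMSpacetime V) (p : V) :
    LeviCivita (chartG M.g p) (M.chartΓ p) (extChartAt (𝓡 4) p).target :=
  LeviCivita.of_metric (isOpen_extChartAt_target p) (chartG_smooth M.g_smooth p)
    (fun _ _ _ _ => M.g_symm _ _ _) (fun _ hy => M.chart_nondeg p hy)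

theorem gram_det_ne_zero {n : ℕ} {q : E n → E n → ℝ} (hq : IsBilin q)
    (h : ∀ u, (∀ v, q u v = 0) → u = 0) : IsUnit (gram q).det := by
  rw [isUnit_iff_ne_zero]
  intro h0
  obtain ⟨x, hx, hx0⟩ := Matrix.exists_vecMul_eq_zero_iff.mpr h0
  apply hx
  have hu := h (∑ i, x i • basisVec i) fun v => ?_
  · funext j
    have := congrArg (fun w : E n => w j) hu
    simpa [basisVec, Pi.single_apply] using this
  · rw [hq.sum_left]
    conv_lhs => enter [2, i]; rw [← sum_basisVec v, hq.sum_right, Finset.mul_sum]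
    rw [Finset.sum_comm]
    refine Finset.sum_eq_zero fun j _ => ?_
    have := congrFun hx0 j
    simp only [Matrix.vecMul, dotProduct, gram, Matrix.of_apply, Pi.zero_apply] at this
    calc ∑ i, x i * (v j * q (basisVec i) (basisVec j))
        = v j * ∑ i, x i * q (basisVec i) (basisVec j) := by
          rw [Finset.mul_sum]; exact Finset.sum_congr rfl fun _ _ => by ring
      _ = 0 := by rw [this, mul_zero]

/-- Paired with any vector, both sides give the Koszul expression: the index formula because the
inverse Gram matrix cancels the Gram matrix, the other by construction. Nondegeneracy concludes. -/
theorem EMSpacetime.christoffel_eq (M : EMSpacetime V) (p : V) {y : E 4}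
    (hy : y ∈ (extChartAt (𝓡 4) p).target) (u v : E 4) :
    christoffel M.g p y u v = M.chartΓ p y u v := by
  have hd := (M.leviCivita_chart p).G_smooth.diffAt (M.leviCivita_chart p).isOpen hy
  have e : ∀ a b c, fderiv ℝ (fun z => chartMetric M.g p z b c) y a
      = fderiv ℝ (chartG M.g p) y a b c := by
    intro a b c
    change fderiv ℝ (fun z => chartG M.g p z b c) y a = _
    rw [fderiv_clm_apply (hd.clm_apply (differentiableAt_const _)) (differentiableAt_const _),
      fderiv_clm_apply hd (differentiableAt_const _)]
    simp
  have hbil : IsBilin (chartMetric M.g p y) := IsBilin.clm (chartG M.g p y)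
  have hdet := gram_det_ne_zero hbil (M.chart_nondeg p hy)
  rw [← sub_eq_zero]
  refine M.chart_nondeg p hy _ fun w => ?_
  rw [map_sub, sub_apply, EMSpacetime.chartΓ, leviCivita_pair (M.chart_nondeg p hy), sub_eq_zero]
  set k : E 4 → ℝ := fun w => (1 / 2) * (fderiv ℝ (chartG M.g p) y u v w
    + fderiv ℝ (chartG M.g p) y v u w - fderiv ℝ (chartG M.g p) y w u v) with hk
  have hlin : ∀ w : E 4, k w = ∑ j, w j * k (basisVec j) := by
    intro w
    have := congrArg (fun f : E 4 →L[ℝ] ℝ => f w) (rfl : koszul (fderiv ℝ (chartG M.g p) y) u v = _)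
    have e2 : ∀ w, k w = koszul (fderiv ℝ (chartG M.g p) y) u v w := by
      intro w; rw [koszul_apply]
    rw [e2]
    conv_lhs => rw [← sum_basisVec w]
    rw [map_sum]
    exact Finset.sum_congr rfl fun j _ => by rw [map_smul, e2, smul_eq_mul]
  change chartG M.g p y (christoffel M.g p y u v) w = k w
  have hc : christoffel M.g p y u v = ∑ i, (∑ j, (gram (chartMetric M.g p y))⁻¹ i j
      * k (basisVec j)) • basisVec i := by
    unfold christoffel
    refine Finset.sum_congr rfl fun i _ => ?_
    rw [Finset.sum_smul]
    refine Finset.sum_congr rfl fun j _ => ?_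
    rw [e, e, e]
  rw [hc, chartG_apply, hbil.sum_left, hlin]
  have hg : ∀ i, chartMetric M.g p y (basisVec i) w
      = ∑ l, w l * gram (chartMetric M.g p y) l i := by
    intro i
    conv_lhs => rw [← sum_basisVec w]
    rw [hbil.sum_right]
    refine Finset.sum_congr rfl fun l _ => ?_
    rw [gram, Matrix.of_apply]
    congr 1
    exact M.g_symm _ _ _
  calc ∑ i, (∑ j, (gram (chartMetric M.g p y))⁻¹ i j * k (basisVec j))
        * chartMetric M.g p y (basisVec i) w
      = ∑ l, w l * ∑ j, (∑ i, gram (chartMetric M.g p y) l i * (gram (chartMetric M.g p y))⁻¹ i j)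
          * k (basisVec j) := by
        simp only [hg, Fin.sum_univ_four]
        ring
    _ = ∑ l, w l * k (basisVec l) := by
        have h1 := Matrix.mul_nonsing_inv _ hdet
        refine Finset.sum_congr rfl fun l _ => ?_
        congr 1
        have : ∀ j, ∑ i, gram (chartMetric M.g p y) l i * (gram (chartMetric M.g p y))⁻¹ i j
            = (1 : Matrix (Fin 4) (Fin 4) ℝ) l j := by
          intro j; rw [← h1, Matrix.mul_apply]
        simp [this, Matrix.one_apply]

theorem EMSpacetime.riemann_eq (M : EMSpacetime V) (p : V) (u v w : E 4) :
    riemann M.g p u v w = riem (M.chartΓ p) (extChartAt (𝓡 4) p p) u v w := by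
  have hy : extChartAt (𝓡 4) p p ∈ (extChartAt (𝓡 4) p).target := mem_extChartAt_target p
  have lc := M.leviCivita_chart p
  have hd := lc.Γ_smooth.diffAt lc.isOpen hy
  have e : ∀ b c, (fun z => christoffel M.g p z b c) =ᶠ[nhds (extChartAt (𝓡 4) p p)]
      fun z => M.chartΓ p z b c := by
    intro b c
    filter_upwards [lc.isOpen.mem_nhds hy] with z hz using M.christoffel_eq p hz b c
  have e' : ∀ a b c, fderiv ℝ (fun z => M.chartΓ p z b c) (extChartAt (𝓡 4) p p) a
      = fderiv ℝ (M.chartΓ p) (extChartAt (𝓡 4) p p) a b c := by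
    intro a b c
    rw [fderiv_clm_apply (hd.clm_apply (differentiableAt_const _)) (differentiableAt_const _),
      fderiv_clm_apply hd (differentiableAt_const _)]
    simp
  simp only [riemann]
  rw [(e v w).fderiv_eq, (e u w).fderiv_eq, e', e', M.christoffel_eq p hy, M.christoffel_eq p hy,
    M.christoffel_eq p hy, M.christoffel_eq p hy, riem]

theorem chartG_transition (g : BilinField V) {p p' : V} {y : E 4}
    (hyp : (extChartAt (𝓡 4) p').symm y ∈ (chartAt (E 4) p).source) (u v : E 4) :
    chartG g p' y u v = chartG g p (extChartAt (𝓡 4) p ((extChartAt (𝓡 4) p').symm y))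
      (push p _ (coordVec p' y u)) (push p _ (coordVec p' y v)) := by
  rw [chartG_push g hyp]; rfl

/-- The coordinate change between two charts. -/
def transition (p' p : V) (y : E 4) : E 4 := extChartAt (𝓡 4) p ((extChartAt (𝓡 4) p').symm y)

/-- The domain of the coordinate change. -/
def transitionDomain (p' p : V) : Set (E 4) :=
  (extChartAt (𝓡 4) p').target ∩ (extChartAt (𝓡 4) p').symm ⁻¹' (chartAt (E 4) p).source

theorem isOpen_transitionDomain (p' p : V) : IsOpen (transitionDomain p' p) :=
  (continuousOn_extChartAt_symm p').isOpen_inter_preimage (isOpen_extChartAt_target p')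
    (chartAt (E 4) p).open_source

theorem transition_smooth (p' p : V) :
    ContDiffOn ℝ ∞ (transition p' p) (transitionDomain p' p) := by
  rw [← contMDiffOn_iff_contDiffOn]
  have h1 : ContMDiffOn 𝓘(ℝ, E 4) (𝓡 4) ∞ (extChartAt (𝓡 4) p').symm
      (extChartAt (𝓡 4) p').target := contMDiffOn_extChartAt_symm p'
  have h2 : ContMDiffOn (𝓡 4) 𝓘(ℝ, E 4) ∞ (extChartAt (𝓡 4) p) (chartAt (E 4) p).source :=
    contMDiffOn_extChartAt
  exact h2.comp (h1.mono Set.inter_subset_left) fun y hy => hy.2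

theorem fderiv_transition {p' p : V} {y : E 4} (hy : y ∈ transitionDomain p' p) (u : E 4) :
    fderiv ℝ (transition p' p) y u = push p _ (coordVec p' y u) := by
  have h1 : MDifferentiableAt 𝓘(ℝ, E 4) (𝓡 4) (extChartAt (𝓡 4) p').symm y := by
    have := mdifferentiableWithinAt_extChartAt_symm (I := 𝓡 4) hy.1
    rwa [ModelWithCorners.range_eq_univ, mdifferentiableWithinAt_univ] at this
  have h2 : MDifferentiableAt (𝓡 4) 𝓘(ℝ, E 4) (extChartAt (𝓡 4) p)
      ((extChartAt (𝓡 4) p').symm y) := mdifferentiableAt_extChartAt hy.2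
  rw [← mfderiv_eq_fderiv]
  exact congrArg (fun f => f u) (mfderiv_comp (I' := 𝓡 4) y h2 h1)

theorem fderiv_transition_push {p' p x : V} (hx' : x ∈ (chartAt (E 4) p').source)
    (hx : x ∈ (chartAt (E 4) p).source) (v : TangentSpace (𝓡 4) x) :
    fderiv ℝ (transition p' p) (extChartAt (𝓡 4) p' x) (push p' x v) = push p x v := by
  have hs := chart_source_iff.mpr hx'
  have hy : extChartAt (𝓡 4) p' x ∈ transitionDomain p' p :=
    ⟨(extChartAt (𝓡 4) p').map_source hs, by
      rwa [Set.mem_preimage, (extChartAt (𝓡 4) p').left_inv hs]⟩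
  rw [fderiv_transition hy]
  have key : ∀ z : V, z = x → ∀ u : E 4, u = v → (push p z u : E 4) = push p x v := by
    rintro z rfl u rfl; rfl
  exact key _ ((extChartAt (𝓡 4) p').left_inv hs) _ (coordVec_push hx' v)

theorem push_mfderiv {W : Type*} [NormedAddCommGroup W] [NormedSpace ℝ W] {f : W → V} {w : W}
    (hf : MDifferentiableAt 𝓘(ℝ, W) (𝓡 4) f w) {p : V} (hp : f w ∈ (chartAt (E 4) p).source)
    (a : W) :
    push p (f w) (mfderiv 𝓘(ℝ, W) (𝓡 4) f w a) = fderiv ℝ (fun z => extChartAt (𝓡 4) p (f z)) w a := by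
  have h2 : MDifferentiableAt (𝓡 4) 𝓘(ℝ, E 4) (extChartAt (𝓡 4) p) (f w) :=
    mdifferentiableAt_extChartAt hp
  rw [← mfderiv_eq_fderiv]
  exact (congrArg (fun f => f a) (mfderiv_comp (I' := 𝓡 4) w h2 hf)).symm

theorem push_mdifferentiableAt {HX EX X : Type*} [NormedAddCommGroup EX] [NormedSpace ℝ EX]
    [TopologicalSpace HX] {I : ModelWithCorners ℝ EX HX} [TopologicalSpace X] [ChartedSpace HX X]
    {f : X → V} {Y : ∀ x, TangentSpace (𝓡 4) (f x)} {x : X}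
    (hY : MDifferentiableAt I (𝓡 4).tangent (fun x => (⟨f x, Y x⟩ : TangentBundle (𝓡 4) V)) x)
    {p : V} (hp : f x ∈ (chartAt (E 4) p).source) :
    MDifferentiableAt I 𝓘(ℝ, E 4) (fun x => push p (f x) (Y x)) x := by
  set e := trivializationAt (E 4) (TangentSpace (𝓡 4) : V → Type _) p
  have hs : (⟨f x, Y x⟩ : TangentBundle (𝓡 4) V) ∈ e.source := by
    rw [TangentBundle.trivializationAt_source]; exact hp
  have he : MDifferentiableAt (𝓡 4).tangent ((𝓡 4).prod 𝓘(ℝ, E 4)) e ⟨f x, Y x⟩ :=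
    ((e.contMDiffOn (IB := 𝓡 4) (n := ∞)).contMDiffAt (e.open_source.mem_nhds hs)).mdifferentiableAt
      (by simp)
  have h1 := he.comp x hY
  have h2 := h1.snd
  have hf : ContinuousAt f x :=
    (FiberBundle.continuous_proj (E 4) (TangentSpace (𝓡 4) : V → Type _)).continuousAt.comp
      hY.continuousAt
  refine h2.congr_of_eventuallyEq ?_
  filter_upwards [hf.eventually ((chartAt (E 4) p).open_source.mem_nhds hp)] with z hz
  have e1 := Bundle.Trivialization.continuousLinearMapAt_apply_of_mem (R := ℝ) e
    (b := f z) hz (Y z)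
  rw [TangentBundle.continuousLinearMapAt_trivializationAt hz] at e1
  exact e1

/-- The covariant derivative along a map, in the preferred chart at `p`. -/
theorem EMSpacetime.covAlong_chart (M : EMSpacetime V) {m : ℕ} {X : Type*} [TopologicalSpace X]
    [ChartedSpace (E m) X] {W : Type*} [NormedAddCommGroup W] [NormedSpace ℝ W]
    {f : X → V} {Y : ∀ x, TangentSpace (𝓡 4) (f x)} {h : W → X} {w : W}
    (hf : MDifferentiableAt (𝓡 m) (𝓡 4) f (h w))
    (hY : MDifferentiableAt (𝓡 m) (𝓡 4).tangent
      (fun x => (⟨f x, Y x⟩ : TangentBundle (𝓡 4) V)) (h w))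
    (hh : MDifferentiableAt 𝓘(ℝ, W) (𝓡 m) h w) {p : V}
    (hp : f (h w) ∈ (chartAt (E 4) p).source) (a : W) :
    push p (f (h w)) (covAlong M.g f Y (h w) (mfderiv 𝓘(ℝ, W) (𝓡 m) h w a))
      = cov (M.chartΓ p) (fun z => extChartAt (𝓡 4) p (f (h z)))
        (fun z => push p (f (h z)) (Y (h z))) w a := by
  -- `covAlong` refers to the chart at the image point, so the derivative is first identified there
  -- and then carried to the chart at `p` by the transformation law.
  set p' := f (h w) with hp'
  have hpp : f (h w) ∈ (chartAt (E 4) p').source := mem_chart_source _ _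
  have hfh : MDifferentiableAt 𝓘(ℝ, W) (𝓡 4) (fun z => f (h z)) w := hf.comp w hh
  have hYh : MDifferentiableAt 𝓘(ℝ, W) (𝓡 4).tangent
      (fun z => (⟨f (h z), Y (h z)⟩ : TangentBundle (𝓡 4) V)) w := hY.comp w hh
  set F : W → E 4 := fun z => extChartAt (𝓡 4) p' (f (h z))
  set Z : W → E 4 := fun z => push p' (f (h z)) (Y (h z))
  have hF : DifferentiableAt ℝ F w := by
    rw [← mdifferentiableAt_iff_differentiableAt]
    exact (mdifferentiableAt_extChartAt hpp).comp w hfh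
  have hZ : DifferentiableAt ℝ Z w := by
    rw [← mdifferentiableAt_iff_differentiableAt]
    exact push_mdifferentiableAt hYh hpp
  have hmem : F w ∈ transitionDomain p' p :=
    ⟨mem_extChartAt_target _, by
      rw [Set.mem_preimage, extChartAt_to_inv]; exact hp⟩
  have hFU : F w ∈ (extChartAt (𝓡 4) p').target := hmem.1
  -- the covariant derivative in the chart at the base point
  have e0 : (covAlong M.g f Y (h w) (mfderiv 𝓘(ℝ, W) (𝓡 m) h w a) : E 4)
      = cov (M.chartΓ p') F Z w a := by
    have c1 : mfderiv (𝓡 m) 𝓘(ℝ, E 4) (fun x => push p' (f x) (Y x)) (h w)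
        (mfderiv 𝓘(ℝ, W) (𝓡 m) h w a) = fderiv ℝ Z w a := by
      rw [← mfderiv_eq_fderiv]
      exact (congrArg (fun f => f a) (mfderiv_comp (I' := 𝓡 m) w
        (push_mdifferentiableAt hY hpp) hh)).symm
    have c2 : (mfderiv (𝓡 m) (𝓡 4) f (h w) (mfderiv 𝓘(ℝ, W) (𝓡 m) h w a) : E 4)
        = fderiv ℝ F w a := by
      rw [← push_mfderiv hfh hpp]
      have := congrArg (fun f => f a) (mfderiv_comp (I' := 𝓡 m) w hf hh)
      exact this.symm.trans (push_self _ _).symm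
    have c3 : (Y (h w) : E 4) = Z w := (push_self _ _).symm
    set A : E 4 := mfderiv (𝓡 m) 𝓘(ℝ, E 4) (fun x => push p' (f x) (Y x)) (h w)
        (mfderiv 𝓘(ℝ, W) (𝓡 m) h w a)
    change A + christoffel M.g p' (F w) (mfderiv (𝓡 m) (𝓡 4) f (h w) (mfderiv 𝓘(ℝ, W) (𝓡 m) h w a))
        (Y (h w)) = _
    rw [c1, c2, c3, M.christoffel_eq p' hFU]
    rfl
  have e1 := (M.leviCivita_chart p').cov_transform (M.leviCivita_chart p)
    (isOpen_transitionDomain p' p) (transition_smooth p' p) Set.inter_subset_left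
    (fun y hy => (extChartAt (𝓡 4) p).map_source (chart_source_iff.mpr hy.2))
    (fun y hy u v => by
      rw [chartG_transition M.g hy.2, fderiv_transition hy, fderiv_transition hy]; rfl)
    hmem ?_ hF hZ a
  · rw [← e0] at e1
    have e2 := fderiv_transition_push hpp hp (covAlong M.g f Y (h w) (mfderiv 𝓘(ℝ, W) (𝓡 m) h w a))
    rw [push_self] at e2
    refine e2.symm.trans (e1.symm.trans ?_)
    have hev : ∀ᶠ z in nhds w, f (h z) ∈ (chartAt (E 4) p').source
        ∧ f (h z) ∈ (chartAt (E 4) p).source :=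
      (hfh.continuousAt.eventually ((chartAt (E 4) p').open_source.mem_nhds hpp)).and
        (hfh.continuousAt.eventually ((chartAt (E 4) p).open_source.mem_nhds hp))
    refine cov_congr ?_ ?_ a
    · filter_upwards [hev] with z hz
      exact congrArg (extChartAt (𝓡 4) p)
        ((extChartAt (𝓡 4) p').left_inv (chart_source_iff.mpr hz.1))
    · filter_upwards [hev] with z hz
      exact fderiv_transition_push hz.1 hz.2 (Y (h z))
  · intro v
    refine ⟨push p' (f (h w)) (coordVec p (extChartAt (𝓡 4) p (f (h w))) v), ?_⟩
    have hx := chart_source_iff.mpr hp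
    have key : ∀ z : V, z = f (h w) → ∀ v' : E 4, (push p z v' : E 4) = v →
        (push p (f (h w)) v' : E 4) = v := by
      rintro z rfl v' hv'
      exact hv'
    refine (fderiv_transition_push hpp hp _).trans ?_
    exact key _ ((extChartAt (𝓡 4) p).left_inv hx) _
      (push_coordVec ((extChartAt (𝓡 4) p).map_source hx) v)

end ChartConnection


/-! ### The Einstein equations in a null frame -/

section Einstein

variable {V : Type*} [TopologicalSpace V] [ChartedSpace (E 4) V] [IsManifold (𝓡 4) ∞ V]

theorem volume_linear {T : Type*} [AddCommGroup T] [Module ℝ T] (ε : T [⋀^Fin 4]→ₗ[ℝ] ℝ)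
    (u v : T) :
    (∀ a a' c, ε ![u, v, a + a', c] = ε ![u, v, a, c] + ε ![u, v, a', c]) ∧
    (∀ (r : ℝ) a c, ε ![u, v, r • a, c] = r * ε ![u, v, a, c]) ∧
    (∀ a c c', ε ![u, v, a, c + c'] = ε ![u, v, a, c] + ε ![u, v, a, c']) ∧
    (∀ (r : ℝ) a c, ε ![u, v, a, r • c] = r * ε ![u, v, a, c]) ∧
    (∀ a c, ε ![u, v, c, a] = - ε ![u, v, a, c]) ∧ (∀ a, ε ![u, v, u, a] = 0) ∧
    (∀ a, ε ![u, v, v, a] = 0) := by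
  have u2 : ∀ x a c : T, Function.update ![u, v, x, c] 2 a = ![u, v, a, c] := by
    intro x a c; ext i; fin_cases i <;> rfl
  have u3 : ∀ x a c : T, Function.update ![u, v, a, x] 3 c = ![u, v, a, c] := by
    intro x a c; ext i; fin_cases i <;> rfl
  refine ⟨?_, ?_, ?_, ?_, ?_, ?_, ?_⟩
  · intro a a' c
    have := ε.map_update_add ![u, v, a, c] 2 a a'
    simpa only [u2] using this
  · intro r a c
    have := ε.map_update_smul ![u, v, a, c] 2 r a
    simpa only [u2, smul_eq_mul] using this
  · intro a c c'
    have := ε.map_update_add ![u, v, a, c] 3 c c'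
    simpa only [u3] using this
  · intro r a c
    have := ε.map_update_smul ![u, v, a, c] 3 r c
    simpa only [u3, smul_eq_mul] using this
  · intro a c
    have := ε.map_swap ![u, v, a, c] (i := 2) (j := 3) (by decide)
    rw [← this]
    congr 1
    ext i; fin_cases i <;> rfl
  · intro a
    exact ε.map_eq_zero_of_eq _ (i := 0) (j := 2) rfl (by decide)
  · intro a
    exact ε.map_eq_zero_of_eq _ (i := 1) (j := 2) rfl (by decide)

/-- With `l` and `k` in the first two slots of the volume form only `f₁`, `f₂` can fill the others,
so the dual component is the volume of the frame times `Fm f₁ f₂ / (a * b)`. Squaring removes the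
orientation sign. -/
theorem IsBlockFrame.hodge_sq {G Fm : E 4 →L[ℝ] E 4 →L[ℝ] ℝ} {ε : E 4 [⋀^Fin 4]→ₗ[ℝ] ℝ}
    {l k f₁ f₂ : E 4} {a b : ℝ} (h : IsBlockFrame G l k f₁ f₂ 0 (-1) 0 a b)
    (hFa : ∀ u v, Fm u v = - Fm v u)
    (hε : ∀ v : Fin 4 → E 4, ε v ^ 2 = - Matrix.det (Matrix.of fun i j => G (v i) (v j))) :
    ((1 / 2) * metricTrace (fun a b : E 4 => G a b) (fun a a' => metricTrace (fun c d : E 4 => G c d)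
      (fun c c' => ε ![l, k, a, c] * Fm a' c'))) ^ 2 = Fm f₁ f₂ ^ 2 / (a * b) := by
  obtain ⟨v1, v2, v3, v4, v5, v6, v7⟩ := volume_linear ε l k
  have inner : ∀ a₁ a₂ : E 4, metricTrace (fun c d : E 4 => G c d)
      (fun c c' => ε ![l, k, a₁, c] * Fm a₂ c')
      = - (ε ![l, k, a₁, l] * Fm a₂ k + ε ![l, k, a₁, k] * Fm a₂ l)
        + ε ![l, k, a₁, f₁] * Fm a₂ f₁ / a + ε ![l, k, a₁, f₂] * Fm a₂ f₂ / b := by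
    intro a₁ a₂
    have hB : IsBilin fun c c' : E 4 => ε ![l, k, a₁, c] * Fm a₂ c' := by
      constructor
      · intro u u' v; beta_reduce; rw [v3]; ring
      · intro r u v; beta_reduce; rw [v4]; ring
      · intro u v v'; beta_reduce; rw [map_add]; ring
      · intro r u v; beta_reduce; rw [map_smul, smul_eq_mul]; ring
    rw [h.metricTrace_eq hB]
    ring
  have hB2 : IsBilin fun a₁ a₂ : E 4 => metricTrace (fun c d : E 4 => G c d)
      (fun c c' => ε ![l, k, a₁, c] * Fm a₂ c') := by
    simp only [inner]
    constructor
    · intro u u' v; simp only [v1]; ring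
    · intro r u v; simp only [v2]; ring
    · intro u v v'; simp only [map_add, add_apply]; ring
    · intro r u v; simp only [map_smul, smul_apply, smul_eq_mul]; ring
  have ha := h.a_ne
  have hb := h.b_ne
  have e0 : (1 / 2) * metricTrace (fun a b : E 4 => G a b) (fun a a' => metricTrace
      (fun c d : E 4 => G c d) (fun c c' => ε ![l, k, a, c] * Fm a' c'))
      = ε ![l, k, f₁, f₂] * Fm f₁ f₂ / (a * b) := by
    rw [h.metricTrace_eq hB2]
    simp only [inner]
    have w1 : ∀ c, ε ![l, k, c, l] = 0 := fun c => by rw [v5, v6, neg_zero]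
    have w2 : ∀ c, ε ![l, k, c, k] = 0 := fun c => by rw [v5, v7, neg_zero]
    have w3 : ε ![l, k, f₁, f₁] = 0 := by linarith [v5 f₁ f₁]
    have w4 : ε ![l, k, f₂, f₂] = 0 := by linarith [v5 f₂ f₂]
    simp only [w1, w2, w3, w4, v6, v7, v5 f₁ f₂, hFa f₂ f₁]
    field_simp
    ring
  -- The Gram determinant of the null frame is -ab, and the normalization of the volume form
  -- contains another minus sign.
  have hdet : ε ![l, k, f₁, f₂] ^ 2 = a * b := by
    have em : (Matrix.of fun i j => G ((![l, k, f₁, f₂] : Fin 4 → E 4) i)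
        ((![l, k, f₁, f₂] : Fin 4 → E 4) j)) = !![0, -1, 0, 0; -1, 0, 0, 0; 0, 0, a, 0; 0, 0, 0, b] := by
      ext i j
      fin_cases i <;> fin_cases j <;> simp only [Matrix.of_apply] <;>
      first
      | exact h.h00 | exact h.h01 | exact h.h0F1 | exact h.h0F2
      | exact (h.symm _ _).trans h.h01 | exact h.h11 | exact h.h1F1 | exact h.h1F2
      | exact (h.symm _ _).trans h.h0F1 | exact (h.symm _ _).trans h.h1F1 | exact h.hF11
      | exact h.hF12 | exact (h.symm _ _).trans h.h0F2 | exact (h.symm _ _).trans h.h1F2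
      | exact (h.symm _ _).trans h.hF12 | exact h.hF22
    rw [hε, em]
    simp [Matrix.det_succ_row_zero, Fin.sum_univ_succ, Fin.succAbove]
  rw [e0, div_pow, mul_pow, hdet]
  field_simp

variable (M : EMSpacetime V) {p : V} {l k f₁ f₂ : E 4} {a b : ℝ}

theorem EMSpacetime.hodgeDual_sq
    (h : IsBlockFrame (bilinModel (M.g p)) l k f₁ f₂ 0 (-1) 0 a b) :
    hodgeDual M.g M.F M.vol p l k ^ 2 = M.F p f₁ f₂ ^ 2 / (a * b) :=
  h.hodge_sq (Fm := bilinModel (M.F p)) (ε := M.vol p) (M.F_antisymm p) (M.vol_normalized p)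

theorem EMSpacetime.emStress_frame
    (h : IsBlockFrame (bilinModel (M.g p)) l k f₁ f₂ 0 (-1) 0 a b) (u v : E 4) :
    emStress M.g M.F p u v = 1 / (4 * Real.pi) *
      (-(M.F p u l * M.F p v k + M.F p u k * M.F p v l) + M.F p u f₁ * M.F p v f₁ / a
        + M.F p u f₂ * M.F p v f₂ / b
        - (1 / 4) * M.g p u v * (-2 * M.F p l k ^ 2
          - 4 * (M.F p l f₁ * M.F p k f₁ / a + M.F p l f₂ * M.F p k f₂ / b)
          + 2 * M.F p f₁ f₂ ^ 2 / (a * b))) := by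
  set B := bilinModel (M.F p) with hBdef
  have hFa : ∀ u v : E 4, B u v = - B v u := fun u v => M.F_antisymm p u v
  have hF0 : ∀ u : E 4, B u u = 0 := fun u => by linarith [hFa u u]
  have inner : ∀ u v : E 4, metricTrace (fun c d : E 4 => M.g p c d)
      (fun c d => B u c * B v d) = -(B u l * B v k + B u k * B v l) + B u f₁ * B v f₁ / a
        + B u f₂ * B v f₂ / b := by
    intro u v
    have hB : IsBilin fun c d : E 4 => B u c * B v d := by
      constructor <;> intros <;> simp <;> ring
    refine (h.metricTrace_eq hB).trans ?_
    ring
  have hB2 : IsBilin fun u v : E 4 => metricTrace (fun c d : E 4 => M.g p c d)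
      (fun c d => B u c * B v d) := by
    simp only [inner]
    constructor <;> intros <;> simp <;> ring
  have e2 := h.metricTrace_eq hB2
  simp only [inner] at e2
  have e3 : metricTrace (fun a b : E 4 => M.g p a b)
          (fun a b => metricTrace (fun c d : E 4 => M.g p c d) (fun c d => M.F p a c * M.F p b d))
      = -2 * B l k ^ 2 - 4 * (B l f₁ * B k f₁ / a + B l f₂ * B k f₂ / b)
          + 2 * B f₁ f₂ ^ 2 / (a * b) := by
    have : metricTrace (fun a b : E 4 => M.g p a b)
          (fun a b => metricTrace (fun c d : E 4 => M.g p c d) (fun c d => M.F p a c * M.F p b d))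
        = _ := (congrArg (metricTrace (fun a b : E 4 => M.g p a b))
          (funext fun a => funext fun b => inner a b)).trans e2
    rw [this]
    simp only [hF0, hFa k l, hFa f₁ l, hFa f₁ k, hFa f₂ l, hFa f₂ k, hFa f₂ f₁]
    have := h.a_ne
    have := h.b_ne
    field_simp
    ring
  unfold emStress
  rw [e3]
  exact congrArg (fun t => 1 / (4 * Real.pi) * (t - (1 / 4) * M.g p u v * _)) (inner u v)

/-- Energy conditions for the Einstein tensor in a null frame. -/
theorem EMSpacetime.einstein_bounds
    (h : IsBlockFrame (bilinModel (M.g p)) l k f₁ f₂ 0 (-1) 0 a b) (ha : 0 < a) (hb : 0 < b)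
    (hl : M.g p (M.T p) l < 0) (hk : M.g p (M.T p) k < 0) :
    (M.F p l k ^ 2 + hodgeDual M.g M.F M.vol p l k ^ 2 ≤ einsteinTensor M.g p l k) ∧
    0 ≤ einsteinTensor M.g p l l ∧ 0 ≤ einsteinTensor M.g p k k := by
  have g00 : M.g p l l = 0 := h.h00
  have g01 : M.g p l k = -1 := h.h01
  have g11 : M.g p k k = 0 := h.h11
  have hFa : ∀ u v : E 4, M.F p u v = - M.F p v u := fun u v => M.F_antisymm p u v
  have hF0 : ∀ u : E 4, M.F p u u = 0 := fun u => by linarith [hFa u u]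
  have hπ := Real.pi_pos
  refine ⟨?_, ?_, ?_⟩
  · have hT := M.dominant p l k g00.le hl g11.le hk
    have hΛ := M.Λ_nonneg
    have e := M.einstein p l k
    rw [M.hodgeDual_sq h]
    -- In 8π T^EM(ℓ,k) the components F(ℓ,f) F(k,f) cancel and only the two flux squares remain;
    -- since g(ℓ,k) = -1, the cosmological term contributes +Λ.
    have e' : einsteinTensor M.g p l k = M.F p l k ^ 2 + M.F p f₁ f₂ ^ 2 / (a * b)
        + 8 * Real.pi * M.TM p l k + M.Λ := by
      refine e.trans ?_
      rw [M.emStress_frame h, g01, hF0, hF0, hFa k l]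
      field_simp
      ring
    rw [e']
    have : 0 ≤ 8 * Real.pi * M.TM p l k := by positivity
    linarith
  · have hT := M.dominant p l l g00.le hl g00.le hl
    have e := M.einstein p l l
    -- For a null vector the trace part and Λ drop out, and the electromagnetic energy is a sum of
    -- squares.
    have e' : einsteinTensor M.g p l l = 2 * (M.F p l f₁ ^ 2 / a + M.F p l f₂ ^ 2 / b)
        + 8 * Real.pi * M.TM p l l := by
      refine e.trans ?_
      rw [M.emStress_frame h, g00, hF0]
      field_simp
      ring
    rw [e']
    positivity
  · have hT := M.dominant p k k g11.le hk g11.le hk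
    have e := M.einstein p k k
    have e' : einsteinTensor M.g p k k = 2 * (M.F p k f₁ ^ 2 / a + M.F p k f₂ ^ 2 / b)
        + 8 * Real.pi * M.TM p k k := by
      refine e.trans ?_
      rw [M.emStress_frame h, g11, hF0]
      field_simp
      ring
    rw [e']
    positivity

end Einstein


/-! ### Energy conditions as curvature inequalities. -/

section CurvatureBounds

variable {V : Type*} [TopologicalSpace V] [ChartedSpace (E 4) V] [IsManifold (𝓡 4) ∞ V]

theorem chartG_self (g : BilinField V) (p : V) :
    chartG g p (extChartAt (𝓡 4) p p) = bilinModel (g p) := by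
  ext u v
  exact (congrArg₂ (fun a b : E 4 => chartG g p (extChartAt (𝓡 4) p p) a b)
    (push_self p u) (push_self p v)).symm.trans (chartG_push g (mem_chart_source (E 4) p) u v)

/-- The energy conditions as bounds on the Riemann tensor in a null frame. -/
theorem EMSpacetime.curvature_bounds (M : EMSpacetime V) {p : V} {l k f₁ f₂ : E 4} {a b : ℝ}
    (h : IsBlockFrame (bilinModel (M.g p)) l k f₁ f₂ 0 (-1) 0 a b) (ha : 0 < a) (hb : 0 < b)
    (hl : M.g p (M.T p) l < 0) (hk : M.g p (M.T p) k < 0) :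
    let y := extChartAt (𝓡 4) p p
    let R : E 4 → E 4 → E 4 → E 4 → ℝ := fun u v w z =>
      chartG M.g p y (riem (M.chartΓ p) y u v w) z
    (M.F p l k ^ 2 + hodgeDual M.g M.F M.vol p l k ^ 2
      ≤ R f₁ f₂ f₂ f₁ / (a * b) + R k f₁ l f₁ / a + R k f₂ l f₂ / b) ∧
    R l f₁ l f₁ / a + R l f₂ l f₂ / b ≤ 0 ∧ R k f₁ k f₁ / a + R k f₂ k f₂ / b ≤ 0 := by
  intro y R
  obtain ⟨b1, b2, b3⟩ := M.einstein_bounds h ha hb hl hk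
  have hy : y ∈ (extChartAt (𝓡 4) p).target := mem_extChartAt_target p
  have lc := M.leviCivita_chart p
  rw [← chartG_self] at h
  have skew : ∀ u v z z', R u v z z' = - R u v z' z := fun u v z z' => lc.riem_skew hy u v z z'
  have pair : ∀ u v z z', R u v z z' = R z z' u v := fun u v z z' => lc.riem_pair hy u v z z'
  have anti : ∀ u v z z', R u v z z' = - R v u z z' := fun u v z z' => by
    simp only [R]; rw [riem_antisymm, map_neg, neg_apply]
  -- The trace defining the Ricci tensor, taken in the null frame; the minus sign comes from g(ℓ,k)
  -- = -1.
  have hric : ∀ v w : E 4, ricci M.g p v w =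
      - (R l v w k + R k v w l) + R f₁ v w f₁ / a + R f₂ v w f₂ / b := by
    intro v w
    have hB : IsBilin fun u z => chartG M.g p y (riem (M.chartΓ p) y u v w) z := by
      constructor <;> intros <;> simp [riem] <;> ring
    have e1 := trace_eq_metricTrace (IsBilin.clm (chartG M.g p y)) h.det_ne h.symm
      (fun u => riem (M.chartΓ p) y u v w)
    rw [h.metricTrace_eq hB] at e1
    have e2 : ricci M.g p v w = ∑ i, (riem (M.chartΓ p) y (basisVec i) v w) i := by
      unfold ricci
      exact Finset.sum_congr rfl fun i _ => by rw [M.riemann_eq]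
    rw [e2, e1]
    ring
  have hricB : IsBilin (ricci M.g p) := by
    have : ricci M.g p = fun v w =>
      - (R l v w k + R k v w l) + R f₁ v w f₁ / a + R f₂ v w f₂ / b := by
      funext v w; exact hric v w
    rw [this]
    constructor <;> intros <;> simp [R, riem] <;> ring
  have hscal : scalarCurv M.g p = - (ricci M.g p l k + ricci M.g p k l)
      + ricci M.g p f₁ f₁ / a + ricci M.g p f₂ f₂ / b := by
    have h' := h
    rw [chartG_self] at h'
    refine (h'.metricTrace_eq hricB).trans ?_
    ring
  have gl : M.g p l l = 0 := by have := h.h00; rwa [chartG_self] at this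
  have gk : M.g p k k = 0 := by have := h.h11; rwa [chartG_self] at this
  have glk : M.g p l k = -1 := by have := h.h01; rwa [chartG_self] at this
  refine ⟨b1.trans (le_of_eq ?_), ?_, ?_⟩
  -- As g(ℓ,k) = -1, Ric(ℓ,k) cancels against its share of the scalar curvature, and G(ℓ,k) is half
  -- the trace of Ric over the surface directions.
  · have e : einsteinTensor M.g p l k = ricci M.g p l k
        - (1 / 2) * scalarCurv M.g p * M.g p l k := rfl
    rw [e, glk, hscal, hric, hric, hric, hric]
    have z1 : ∀ u v z, R u v z z = 0 := fun u v z => by linarith [skew u v z z]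
    have z2 : ∀ u z z', R u u z z' = 0 := fun u z z' => by linarith [anti u u z z']
    have m1 : ∀ f, R f l k f = - R k f l f := fun f => by rw [pair, skew]
    have m2 : ∀ f, R f k l f = - R k f l f := fun f => by rw [anti]
    have m3 : ∀ f, R l f f k = - R k f l f := fun f => by rw [skew, pair]
    have m4 : ∀ f, R k f f l = - R k f l f := fun f => by rw [skew]
    have m5 : R f₂ f₁ f₁ f₂ = R f₁ f₂ f₂ f₁ := by rw [pair]
    have m6 : R k l k l = R l k l k := by rw [anti, skew, neg_neg]
    simp only [m1, m2, m3, m4, m5, m6, z1]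
    have := h.a_ne
    have := h.b_ne
    field_simp
    ring
  -- The metric term of the Einstein tensor vanishes on a null vector, so this is the Ricci bound of
  -- the Raychaudhuri equation.
  · have e : einsteinTensor M.g p l l = ricci M.g p l l
        - (1 / 2) * scalarCurv M.g p * M.g p l l := rfl
    rw [e, gl, hric] at b2
    have z1 : ∀ u v z, R u v z z = 0 := fun u v z => by linarith [skew u v z z]
    have z2 : ∀ u z z', R u u z z' = 0 := fun u z z' => by linarith [anti u u z z']
    rw [z1, z2, anti f₁ l, anti f₂ l] at b2
    simp only [neg_div] at b2
    linarith
  · have e : einsteinTensor M.g p k k = ricci M.g p k k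
        - (1 / 2) * scalarCurv M.g p * M.g p k k := rfl
    rw [e, gk, hric] at b3
    have z1 : ∀ u v z, R u v z z = 0 := fun u v z => by linarith [skew u v z z]
    have z2 : ∀ u z z', R u u z z' = 0 := fun u z z' => by linarith [anti u u z z']
    rw [z1, z2, anti f₁ k, anti f₂ k] at b3
    simp only [neg_div] at b3
    linarith

end CurvatureBounds


/-! ### Analysis on the interval of polar angles -/

section Interval

open Real

/-- The density of the functional in the polar angle, divided by `4`. -/
def profileDensity (σ τ ψ χ : ℝ → ℝ) (x : ℝ) : ℝ :=
  sin x * (σ x + deriv σ x ^ 2 / 4 + deriv τ x ^ 2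
    + (deriv ψ x ^ 2 + deriv χ x ^ 2) / (exp (σ x) * sin x ^ 2))

/-- The primitive of the total derivative in the curvature of an axisymmetric metric. -/
def poleTerm (σ : ℝ → ℝ) (x : ℝ) : ℝ :=
  - (1 / 2) * deriv σ x * sin x - cos x - σ x * cos x

variable {σ : ℝ → ℝ}

theorem deriv_smooth {f : ℝ → ℝ} (hf : ContDiff ℝ ∞ f) : ContDiff ℝ ∞ (deriv f) :=
  (contDiff_infty_iff_deriv.mp hf).2

theorem smooth_hasDerivAt {f : ℝ → ℝ} (hf : ContDiff ℝ ∞ f) (x : ℝ) :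
    HasDerivAt f (deriv f x) x :=
  (hf.differentiable (by simp) x).hasDerivAt

theorem poleTerm_smooth (hσ : ContDiff ℝ ∞ σ) : ContDiff ℝ ∞ (poleTerm σ) := by
  have := deriv_smooth hσ
  unfold poleTerm
  exact (((contDiff_const.mul this).mul contDiff_sin).sub contDiff_cos).sub (hσ.mul contDiff_cos)

theorem hasDerivAt_poleTerm (hσ : ContDiff ℝ ∞ σ) (x : ℝ) :
    HasDerivAt (poleTerm σ) (- (1 / 2) * (deriv (deriv σ) x * sin x + deriv σ x * cos x) + sin x
      - deriv σ x * cos x + σ x * sin x) x := by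
  have h0 := smooth_hasDerivAt hσ x
  have h1 := smooth_hasDerivAt (deriv_smooth hσ) x
  refine HasDerivAt.congr_deriv ((((h1.const_mul (- (1 / 2))).mul (hasDerivAt_sin x)).sub
    (hasDerivAt_cos x)).sub (h0.mul (hasDerivAt_cos x))) ?_
  ring

theorem hasDerivAt_radial (hσ : ContDiff ℝ ∞ σ) (c x : ℝ) :
    HasDerivAt (fun x => exp (2 * c - σ x)) (- deriv σ x * exp (2 * c - σ x)) x := by
  refine ((smooth_hasDerivAt hσ x).const_sub (2 * c)).exp.congr_deriv ?_
  ring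

theorem hasDerivAt_azimuthal (hσ : ContDiff ℝ ∞ σ) (x : ℝ) :
    HasDerivAt (fun x => exp (σ x) * sin x ^ 2)
      (exp (σ x) * (deriv σ x * sin x ^ 2 + 2 * sin x * cos x)) x := by
  refine ((smooth_hasDerivAt hσ x).exp.mul ((hasDerivAt_sin x).pow 2)).congr_deriv ?_
  simp
  ring

/-- The weight sin θ e^{2c-σ} is the one for which the curvature is a total derivative up to terms
without second derivatives of `σ`. -/
theorem axialCurvature_adapted (hσ : ContDiff ℝ ∞ σ) (c : ℝ) {x : ℝ} (hx : 0 < sin x) :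
    sin x * exp (2 * c - σ x)
      * axialCurvature (fun x => exp (2 * c - σ x)) (fun x => exp (σ x) * sin x ^ 2) x
      = deriv (poleTerm σ) x - sin x * (σ x + deriv σ x ^ 2 / 2) := by
  have e1 : deriv (fun x => exp (σ x) * sin x ^ 2)
      = fun x => exp (σ x) * (deriv σ x * sin x ^ 2 + 2 * sin x * cos x) :=
    funext fun y => (hasDerivAt_azimuthal hσ y).deriv
  have e2 : HasDerivAt (fun x => exp (σ x) * (deriv σ x * sin x ^ 2 + 2 * sin x * cos x))
      (exp (σ x) * (deriv σ x * (deriv σ x * sin x ^ 2 + 2 * sin x * cos x)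
        + (deriv (deriv σ) x * sin x ^ 2 + deriv σ x * (2 * sin x * cos x)
          + 2 * (cos x ^ 2 - sin x ^ 2)))) x := by
    refine ((smooth_hasDerivAt hσ x).exp.mul
      (((smooth_hasDerivAt (deriv_smooth hσ) x).mul ((hasDerivAt_sin x).pow 2)).add
        (((hasDerivAt_sin x).const_mul 2).mul (hasDerivAt_cos x)))).congr_deriv ?_
    simp
    ring
  rw [axialCurvature, e1, e2.deriv, (hasDerivAt_radial hσ c x).deriv,
    (hasDerivAt_poleTerm hσ x).deriv]
  have := (exp_pos (σ x)).ne'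
  have := (exp_pos (2 * c - σ x)).ne'
  field_simp
  ring

/-- A Lipschitz bound from the nearer endpoint, combined with Jordan's inequality 2y/π ≤ sin y on
[0, π/2]. -/
theorem abs_le_mul_sin {f : ℝ → ℝ} (hf : ContDiff ℝ ∞ f) (h0 : f 0 = 0) (hπ : f π = 0) :
    ∃ C, 0 ≤ C ∧ ∀ x ∈ Set.Icc 0 π, |f x| ≤ C * sin x := by
  obtain ⟨K, hK⟩ := (isCompact_Icc (a := (0 : ℝ)) (b := π)).exists_bound_of_continuousOn
    (deriv_smooth hf).continuous.continuousOn
  have hK0 : 0 ≤ K := (norm_nonneg _).trans (hK 0 ⟨le_rfl, pi_pos.le⟩)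
  have lip : ∀ x ∈ Set.Icc 0 π, ∀ y ∈ Set.Icc 0 π, ‖f y - f x‖ ≤ K * ‖y - x‖ := fun x hx y hy =>
    (convex_Icc 0 π).norm_image_sub_le_of_norm_deriv_le
      (fun z _ => hf.differentiable (by simp) z) hK hx hy
  refine ⟨K * (π / 2), by positivity, fun x hx => ?_⟩
  have key : ∀ y ∈ Set.Icc 0 (π / 2), y ≤ π / 2 * sin y := by
    intro y hy
    have := mul_le_sin hy.1 hy.2
    have hp := pi_pos
    calc y = π / 2 * (2 / π * y) := by field_simp
      _ ≤ _ := by gcongr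
  rcases le_total x (π / 2) with h | h
  · have := lip 0 ⟨le_rfl, pi_pos.le⟩ x hx
    rw [h0, sub_zero, sub_zero, norm_eq_abs, norm_eq_abs, abs_of_nonneg hx.1] at this
    have h2 := key x ⟨hx.1, h⟩
    calc |f x| ≤ K * x := this
      _ ≤ K * (π / 2 * sin x) := by gcongr
      _ = _ := by ring
  · have := lip π ⟨pi_pos.le, le_rfl⟩ x hx
    rw [hπ, sub_zero, norm_eq_abs, norm_eq_abs, abs_sub_comm x π,
      abs_of_nonneg (sub_nonneg.mpr hx.2)] at this
    have h2 := key (π - x) ⟨by linarith [hx.2], by linarith⟩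
    rw [sin_pi_sub] at h2
    calc |f x| ≤ K * (π - x) := this
      _ ≤ K * (π / 2 * sin x) := by gcongr
      _ = _ := by ring

/-- The quotient by sin² is harmless: `ψ'` and `χ'` vanish at the poles, hence are bounded by a
multiple of sin, and the density is dominated by a continuous function. -/
theorem profileDensity_integrable {τ ψ χ : ℝ → ℝ} (hσ : ContDiff ℝ ∞ σ) (hτ : ContDiff ℝ ∞ τ)
    (hψ : ContDiff ℝ ∞ ψ) (hχ : ContDiff ℝ ∞ χ) (hψ0 : deriv ψ 0 = 0) (hψπ : deriv ψ π = 0)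
    (hχ0 : deriv χ 0 = 0) (hχπ : deriv χ π = 0) :
    MeasureTheory.IntegrableOn (profileDensity σ τ ψ χ) (Set.Icc 0 π) := by
  obtain ⟨C, hC, h1⟩ := abs_le_mul_sin (deriv_smooth hψ) hψ0 hψπ
  obtain ⟨D, hD, h2⟩ := abs_le_mul_sin (deriv_smooth hχ) hχ0 hχπ
  have cσ := hσ.continuous
  have cσ' := (deriv_smooth hσ).continuous
  have cτ' := (deriv_smooth hτ).continuous
  have cψ' := (deriv_smooth hψ).continuous
  have cχ' := (deriv_smooth hχ).continuous
  have hb : Continuous fun x => sin x * (|σ x| + deriv σ x ^ 2 / 4 + deriv τ x ^ 2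
      + (C ^ 2 + D ^ 2) / exp (σ x)) := by
    have : ∀ x, exp (σ x) ≠ 0 := fun x => (exp_pos _).ne'
    fun_prop (disch := assumption)
  refine MeasureTheory.Integrable.mono' (hb.continuousOn.integrableOn_Icc) ?_ ?_
  · refine Measurable.aestronglyMeasurable ?_
    unfold profileDensity
    fun_prop
  · refine (MeasureTheory.ae_restrict_iff' measurableSet_Icc).mpr (Filter.Eventually.of_forall ?_)
    intro x hx
    have hs : 0 ≤ sin x := sin_nonneg_of_nonneg_of_le_pi hx.1 hx.2
    have q1 : deriv ψ x ^ 2 ≤ C ^ 2 * sin x ^ 2 := by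
      rw [← mul_pow, ← sq_abs]; exact pow_le_pow_left₀ (abs_nonneg _) (h1 x hx) 2
    have q2 : deriv χ x ^ 2 ≤ D ^ 2 * sin x ^ 2 := by
      rw [← mul_pow, ← sq_abs]; exact pow_le_pow_left₀ (abs_nonneg _) (h2 x hx) 2
    have q3 : (deriv ψ x ^ 2 + deriv χ x ^ 2) / (exp (σ x) * sin x ^ 2)
        ≤ (C ^ 2 + D ^ 2) / exp (σ x) := by
      rcases hs.eq_or_lt with h | h
      · rw [← h]; simp; positivity
      · rw [div_le_div_iff₀ (by positivity) (by positivity)]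
        nlinarith [mul_le_mul_of_nonneg_right (add_le_add q1 q2) (exp_pos (σ x)).le]
    have q4 : 0 ≤ (deriv ψ x ^ 2 + deriv χ x ^ 2) / (exp (σ x) * sin x ^ 2) := by positivity
    rw [profileDensity, norm_mul, norm_eq_abs, abs_of_nonneg hs]
    gcongr
    rw [norm_eq_abs]
    have := abs_add_le (σ x) (deriv σ x ^ 2 / 4 + deriv τ x ^ 2
      + (deriv ψ x ^ 2 + deriv χ x ^ 2) / (exp (σ x) * sin x ^ 2))
    rw [abs_of_nonneg (a := deriv σ x ^ 2 / 4 + _ + _) (by positivity)] at this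
    rw [← add_assoc, ← add_assoc] at this
    linarith

/-- At the poles the factor sin removes `g`, and `poleTerm` contributes 1 + c at each end. An
inequality on the open interval is enough. -/
theorem integral_profileDensity_le {τ ψ χ g : ℝ → ℝ} {c : ℝ} (hσ : ContDiff ℝ ∞ σ)
    (hg : ContDiff ℝ ∞ g)
    (hi : MeasureTheory.IntegrableOn (profileDensity σ τ ψ χ) (Set.Icc 0 π))
    (h0 : σ 0 = c) (hπ : σ π = c)
    (h : ∀ x ∈ Set.Ioo 0 π, profileDensity σ τ ψ χ x
      ≤ deriv (fun x => sin x * g x + poleTerm σ x) x) :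
    ∫ x in 0..π, profileDensity σ τ ψ χ x ≤ 2 + 2 * c := by
  have hs : ContDiff ℝ ∞ fun x => sin x * g x + poleTerm σ x :=
    (contDiff_sin.mul hg).add (poleTerm_smooth hσ)
  refine (intervalIntegral.integral_le_sub_of_hasDeriv_right_of_le pi_pos.le
    hs.continuous.continuousOn (fun x _ => (smooth_hasDerivAt hs x).hasDerivWithinAt) hi h).trans
    (le_of_eq ?_)
  simp [poleTerm, h0, hπ]
  ring

end Interval


/-! ### Vector fields along maps -/

section AlongMaps

variable {W W' : Type*} [NormedAddCommGroup W] [NormedSpace ℝ W]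
  [NormedAddCommGroup W'] [NormedSpace ℝ W']
  {EN HN N : Type*} [NormedAddCommGroup EN] [NormedSpace ℝ EN] [TopologicalSpace HN]
  {I : ModelWithCorners ℝ EN HN} [TopologicalSpace N] [ChartedSpace HN N]

theorem mfderiv_comp_hasFDerivAt {h : W → N} {γ : W' → W} {γ' : W' →L[ℝ] W} {t : W'}
    (hh : MDifferentiableAt 𝓘(ℝ, W) I h (γ t)) (hγ : HasFDerivAt γ γ' t) (u : W') :
    mfderiv 𝓘(ℝ, W') I (fun t => h (γ t)) t u = mfderiv 𝓘(ℝ, W) I h (γ t) (γ' u) :=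
  congrArg (fun f => f u) (hh.hasMFDerivAt.comp t hγ.hasMFDerivAt).mfderiv

theorem mfderiv_comp_hasDerivAt {h : W → N} {γ : ℝ → W} {γ' : W} {t : ℝ}
    (hh : MDifferentiableAt 𝓘(ℝ, W) I h (γ t)) (hγ : HasDerivAt γ γ' t) :
    mfderiv 𝓘(ℝ, ℝ) I (fun t => h (γ t)) t (1 : ℝ) = mfderiv 𝓘(ℝ, W) I h (γ t) γ' := by
  refine (mfderiv_comp_hasFDerivAt hh hγ.hasFDerivAt 1).trans ?_
  simp

theorem mfderiv_smooth [IsManifold I ∞ N] {f : W → N} (hf : ContMDiff 𝓘(ℝ, W) I ∞ f) (a : W) :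
    ContMDiff 𝓘(ℝ, W) I.tangent ∞
      (fun w => (⟨f w, mfderiv 𝓘(ℝ, W) I f w a⟩ : TangentBundle I N)) := by
  have h1 : ContMDiff 𝓘(ℝ, W) 𝓘(ℝ, W).tangent ∞
      (fun w => (⟨w, a⟩ : TangentBundle 𝓘(ℝ, W) W)) :=
    contMDiff_vectorSpace_iff_contDiff.mpr contDiff_const
  exact (hf.contMDiff_tangentMap (by simp)).comp h1

theorem mfderiv_line_smooth [IsManifold I ∞ N] {R : ℝ × W → N}
    (hR : ContMDiff 𝓘(ℝ, ℝ × W) I ∞ R) :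
    ContMDiff 𝓘(ℝ, W) I.tangent ∞ (fun w =>
      (⟨R (0, w), mfderiv 𝓘(ℝ, ℝ) I (fun s => R (s, w)) 0 (1 : ℝ)⟩ : TangentBundle I N)) := by
  have h1 : ContMDiff 𝓘(ℝ, W) 𝓘(ℝ, ℝ × W) ∞ fun w : W => ((0 : ℝ), w) :=
    (contDiff_const.prodMk contDiff_id).contMDiff
  refine ((mfderiv_smooth hR (1, 0)).comp h1).congr fun w => ?_
  have : HasDerivAt (fun s : ℝ => (s, w)) ((1 : ℝ), (0 : W)) 0 :=
    (hasDerivAt_id _).prodMk (hasDerivAt_const _ _)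
  exact congrArg (fun v => (⟨R (0, w), v⟩ : TangentBundle I N))
    (mfderiv_comp_hasDerivAt (hR.mdifferentiableAt (by simp)) this)

end AlongMaps

/-! ### Spherical coordinates -/

section Sphere

open Real

/-- The point at arc length `s` from the point with spherical coordinates `(θ, φ)`, on the great
circle in the azimuthal direction. -/
def azimuthalArc (w : ℝ × ℝ × ℝ) : Metric.sphere (0 : E 3) 1 :=
  ⟨!₂[cos w.1 * (sin w.2.1 * cos w.2.2) - sin w.1 * sin w.2.2,
      cos w.1 * (sin w.2.1 * sin w.2.2) + sin w.1 * cos w.2.2, cos w.1 * cos w.2.1], by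
    have h : (cos w.1 * (sin w.2.1 * cos w.2.2) - sin w.1 * sin w.2.2) ^ 2
        + (cos w.1 * (sin w.2.1 * sin w.2.2) + sin w.1 * cos w.2.2) ^ 2
        + (cos w.1 * cos w.2.1) ^ 2 = 1 := by
      have h1 := sin_sq_add_cos_sq w.1
      have h2 := sin_sq_add_cos_sq w.2.1
      have h3 := sin_sq_add_cos_sq w.2.2
      linear_combination (cos w.1 ^ 2 * sin w.2.1 ^ 2 + sin w.1 ^ 2) * h3 + cos w.1 ^ 2 * h2 + h1
    simp [EuclideanSpace.norm_eq, Fin.sum_univ_three, h]⟩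

theorem azimuthalArc_zero (θ φ : ℝ) : azimuthalArc (0, θ, φ) = spherePoint θ φ := by
  simp [azimuthalArc, spherePoint]

theorem azimuthalArc_north (s φ : ℝ) : azimuthalArc (s, 0, φ) = spherePoint s (φ + π / 2) := by
  simp [azimuthalArc, spherePoint, cos_add_pi_div_two, sin_add_pi_div_two]

theorem azimuthalArc_south (s φ : ℝ) :
    azimuthalArc (s, π, φ) = spherePoint (π + s) (φ - π / 2) := by
  simp [azimuthalArc, spherePoint, cos_sub_pi_div_two, sin_sub_pi_div_two, add_comm π]

theorem finrank_fact : Fact (Module.finrank ℝ (E 3) = 2 + 1) := ⟨finrank_euclideanSpace_fin⟩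

theorem azimuthalArc_smooth : ContMDiff 𝓘(ℝ, ℝ × ℝ × ℝ) (𝓡 2) ∞ azimuthalArc := by
  have := finrank_fact
  refine ContMDiff.codRestrict_sphere (n := 2) (f := fun w => (azimuthalArc w : E 3)) ?_
    (fun w => (azimuthalArc w).2)
  rw [contMDiff_iff_contDiff]
  have : ContDiff ℝ ∞ fun w : ℝ × ℝ × ℝ => WithLp.toLp 2
      ![cos w.1 * (sin w.2.1 * cos w.2.2) - sin w.1 * sin w.2.2,
      cos w.1 * (sin w.2.1 * sin w.2.2) + sin w.1 * cos w.2.2, cos w.1 * cos w.2.1] := by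
    rw [contDiff_euclidean]
    intro i
    fin_cases i <;> simp <;> fun_prop
  exact this

theorem spherePoint_add_pi (θ φ : ℝ) : spherePoint (π + θ) φ = spherePoint (π - θ) (φ + π) := by
  simp [spherePoint, sin_add, cos_add, sin_sub, cos_sub]

theorem spherePoint_neg (θ φ : ℝ) : spherePoint (-θ) φ = spherePoint θ (φ + π) := by
  simp [spherePoint]

theorem spherePoint_zero (φ : ℝ) : spherePoint 0 φ = spherePoint 0 0 := by
  simp [spherePoint]

theorem spherePoint_two_pi (θ φ : ℝ) : spherePoint θ (φ + 2 * π) = spherePoint θ φ := by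
  simp [spherePoint]

/-- The inclusion of the sphere in ℝ³ is an immersion, so the identity ∂_φ = sin θ · (unit azimuthal
vector) may be checked on Cartesian coordinates. It holds at the poles too. -/
theorem mfderiv_azimuthalArc (θ φ : ℝ) :
    mfderiv 𝓘(ℝ, ℝ × ℝ × ℝ) (𝓡 2) azimuthalArc (0, θ, φ) dirY
      = sin θ • mfderiv 𝓘(ℝ, ℝ × ℝ × ℝ) (𝓡 2) azimuthalArc (0, θ, φ) dirT := by
  have := finrank_fact
  have hd := azimuthalArc_smooth.mdifferentiableAt (x := (0, θ, φ)) (by simp)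
  have hc : MDifferentiableAt (𝓡 2) 𝓘(ℝ, E 3) ((↑) : Metric.sphere (0 : E 3) 1 → E 3)
      (azimuthalArc (0, θ, φ)) :=
    (contMDiff_coe_sphere (m := 1) (n := 2)).mdifferentiableAt (by simp)
  refine injective_mvfderiv_subtypeVal_sphere (n := 2) (azimuthalArc (0, θ, φ)) ?_
  have e : ∀ a : ℝ × ℝ × ℝ, mfderiv (𝓡 2) 𝓘(ℝ, E 3) ((↑) : Metric.sphere (0 : E 3) 1 → E 3)
      (azimuthalArc (0, θ, φ)) (mfderiv 𝓘(ℝ, ℝ × ℝ × ℝ) (𝓡 2) azimuthalArc (0, θ, φ) a)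
      = fderiv ℝ (fun w => (azimuthalArc w : E 3)) (0, θ, φ) a := fun a => by
    rw [← mfderiv_eq_fderiv]
    exact (congrArg (fun f => f a) (mfderiv_comp (0, θ, φ) hc hd)).symm
  have hdiff : DifferentiableAt ℝ (fun w => (azimuthalArc w : E 3)) (0, θ, φ) :=
    (hc.comp (0, θ, φ) hd).differentiableAt
  have hc : ∀ (i : Fin 3) (a : ℝ × ℝ × ℝ),
      fderiv ℝ (fun w => (azimuthalArc w : E 3)) (0, θ, φ) a i
      = fderiv ℝ (fun w => (azimuthalArc w : E 3) i) (0, θ, φ) a := fun i a => by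
    exact (congrArg (fun f => f a)
      ((EuclideanSpace.proj (𝕜 := ℝ) i).hasFDerivAt.comp _ hdiff.hasFDerivAt).fderiv).symm
  have hci : ∀ i : Fin 3, DifferentiableAt ℝ (fun w => (azimuthalArc w : E 3) i) (0, θ, φ) :=
    fun i => (EuclideanSpace.proj (𝕜 := ℝ) i).differentiableAt.comp _ hdiff
  refine (e dirY).trans ?_
  refine Eq.trans ?_ (map_smul (mfderiv (𝓡 2) 𝓘(ℝ, E 3) _ _) (sin θ) _).symm
  refine Eq.trans ?_ (congrArg (fun v => sin θ • v) (e dirT)).symm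
  change fderiv ℝ (fun w => (azimuthalArc w : E 3)) (0, θ, φ) dirY
    = sin θ • fderiv ℝ (fun w => (azimuthalArc w : E 3)) (0, θ, φ) dirT
  ext i
  rw [hc, PiLp.smul_apply, hc]
  have hY := hasDerivAt_lineY (hci i)
  have hT := hasDerivAt_lineT (hci i)
  have d1 := hasDerivAt_sin φ
  have d2 := hasDerivAt_cos φ
  have d3 := hasDerivAt_sin 0
  have d4 := hasDerivAt_cos 0
  fin_cases i
  · rw [hY.unique (((d2.const_mul (sin θ)).const_mul (cos 0)).sub (d1.const_mul (sin 0))),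
      hT.unique ((d4.mul_const (sin θ * cos φ)).sub (d3.mul_const (sin φ)))]
    simp
  · rw [hY.unique (((d1.const_mul (sin θ)).const_mul (cos 0)).add (d2.const_mul (sin 0))),
      hT.unique ((d4.mul_const (sin θ * sin φ)).add (d3.mul_const (cos φ)))]
    simp
  · rw [hY.unique (hasDerivAt_const φ (cos 0 * cos θ)), hT.unique (d4.mul_const (cos θ))]
    simp

end Sphere


/-! ### Functions and fields in spherical coordinates -/

section SphereCoordinates

open Real

variable {S : Type*} [TopologicalSpace S] [ChartedSpace (E 2) S] (Ψ : SphereParam S)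

/-- Spherical coordinates, with an additional parameter on which the point does not depend. -/
def SphereParam.coords (w : ℝ × ℝ × ℝ) : S := SphereParam.pt Ψ w.2.1 w.2.2

/-- The unit azimuthal vector `∂_φ / sin θ` of the round metric, which extends to the poles for
fixed `φ`. -/
def SphereParam.azimuthal (θ φ : ℝ) : TangentSpace (𝓡 2) (SphereParam.pt Ψ θ φ) :=
  let v : E 2 := mfderiv 𝓘(ℝ, ℝ) (𝓡 2) (fun s => Ψ (azimuthalArc (s, θ, φ))) 0 (1 : ℝ)
  v

theorem SphereParam.arc_smooth :
    ContMDiff 𝓘(ℝ, ℝ × ℝ × ℝ) (𝓡 2) ∞ (fun w => Ψ (azimuthalArc w)) :=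
  Ψ.contMDiff.comp azimuthalArc_smooth

theorem SphereParam.coords_eq :
    SphereParam.coords Ψ = fun w => Ψ (azimuthalArc (0, w.2)) := by
  funext w
  rw [show (0, w.2) = ((0 : ℝ), w.2.1, w.2.2) from rfl, azimuthalArc_zero]
  rfl

theorem SphereParam.coords_smooth :
    ContMDiff 𝓘(ℝ, ℝ × ℝ × ℝ) (𝓡 2) ∞ (SphereParam.coords Ψ) := by
  rw [SphereParam.coords_eq]
  have : ContDiff ℝ ∞ fun w : ℝ × ℝ × ℝ => ((0 : ℝ), w.2) := by fun_prop
  exact (SphereParam.arc_smooth Ψ).comp this.contMDiff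

theorem hasDerivAt_dirT (t x y : ℝ) :
    HasDerivAt (fun t : ℝ => ((t, x, y) : ℝ × ℝ × ℝ)) dirT t :=
  (hasDerivAt_id _).prodMk (hasDerivAt_const _ _)

theorem hasDerivAt_dirX (t x y : ℝ) :
    HasDerivAt (fun x : ℝ => ((t, x, y) : ℝ × ℝ × ℝ)) dirX x :=
  (hasDerivAt_const _ _).prodMk ((hasDerivAt_id _).prodMk (hasDerivAt_const _ _))

theorem hasDerivAt_dirY (t x y : ℝ) :
    HasDerivAt (fun y : ℝ => ((t, x, y) : ℝ × ℝ × ℝ)) dirY y :=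
  (hasDerivAt_const _ _).prodMk ((hasDerivAt_const _ _).prodMk (hasDerivAt_id _))

theorem SphereParam.coords_dirX (w : ℝ × ℝ × ℝ) :
    mfderiv 𝓘(ℝ, ℝ × ℝ × ℝ) (𝓡 2) (SphereParam.coords Ψ) w dirX
      = SphereParam.dθ Ψ w.2.1 w.2.2 :=
  (mfderiv_comp_hasDerivAt (h := SphereParam.coords Ψ)
    ((SphereParam.coords_smooth Ψ).mdifferentiableAt (by simp))
    (hasDerivAt_dirX w.1 w.2.1 w.2.2)).symm

theorem SphereParam.coords_dirY (w : ℝ × ℝ × ℝ) :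
    mfderiv 𝓘(ℝ, ℝ × ℝ × ℝ) (𝓡 2) (SphereParam.coords Ψ) w dirY
      = SphereParam.dφ Ψ w.2.1 w.2.2 :=
  (mfderiv_comp_hasDerivAt (h := SphereParam.coords Ψ)
    ((SphereParam.coords_smooth Ψ).mdifferentiableAt (by simp))
    (hasDerivAt_dirY w.1 w.2.1 w.2.2)).symm

theorem mfderiv_one_congr {f h : ℝ → S} (e : f = h) (t : ℝ) :
    (mfderiv 𝓘(ℝ, ℝ) (𝓡 2) f t (1 : ℝ) : E 2) = mfderiv 𝓘(ℝ, ℝ) (𝓡 2) h t (1 : ℝ) := by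
  rw [e]

theorem SphereParam.dφ_eq (θ φ : ℝ) :
    SphereParam.dφ Ψ θ φ = sin θ • SphereParam.azimuthal Ψ θ φ := by
  have hd := azimuthalArc_smooth.mdifferentiableAt (x := (0, θ, φ)) (by simp)
  have hΨ := (SphereParam.arc_smooth Ψ).mdifferentiableAt (x := (0, θ, φ)) (by simp)
  have h1 : mfderiv 𝓘(ℝ, ℝ × ℝ × ℝ) (𝓡 2) (fun w => Ψ (azimuthalArc w)) (0, θ, φ) dirY
      = sin θ • mfderiv 𝓘(ℝ, ℝ × ℝ × ℝ) (𝓡 2) (fun w => Ψ (azimuthalArc w)) (0, θ, φ) dirT := by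
    have hc : ∀ a, mfderiv 𝓘(ℝ, ℝ × ℝ × ℝ) (𝓡 2) (fun w => Ψ (azimuthalArc w)) (0, θ, φ) a
        = mfderiv (𝓡 2) (𝓡 2) Ψ (azimuthalArc (0, θ, φ))
          (mfderiv 𝓘(ℝ, ℝ × ℝ × ℝ) (𝓡 2) azimuthalArc (0, θ, φ) a) := fun a =>
      congrArg (fun f => f a)
        (mfderiv_comp (0, θ, φ) (Ψ.contMDiff.mdifferentiableAt (by simp)) hd)
    exact (hc dirY).trans ((congrArg (mfderiv (𝓡 2) (𝓡 2) Ψ (azimuthalArc (0, θ, φ)))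
      (mfderiv_azimuthalArc θ φ)).trans ((map_smul _ _ _).trans
        (congrArg (fun v => sin θ • v) (hc dirT)).symm))
  have e1 : (SphereParam.dφ Ψ θ φ : E 2)
      = mfderiv 𝓘(ℝ, ℝ × ℝ × ℝ) (𝓡 2) (fun w => Ψ (azimuthalArc w)) (0, θ, φ) dirY := by
    have : (fun t => SphereParam.pt Ψ θ t) = fun t => Ψ (azimuthalArc (0, θ, t)) := by
      funext t; rw [azimuthalArc_zero]; rfl
    exact (mfderiv_one_congr this φ).trans
      (mfderiv_comp_hasDerivAt (h := fun w => Ψ (azimuthalArc w)) hΨ (hasDerivAt_dirY 0 θ φ))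
  have e2 : (SphereParam.azimuthal Ψ θ φ : E 2)
      = mfderiv 𝓘(ℝ, ℝ × ℝ × ℝ) (𝓡 2) (fun w => Ψ (azimuthalArc w)) (0, θ, φ) dirT :=
    mfderiv_comp_hasDerivAt (h := fun w => Ψ (azimuthalArc w)) hΨ (hasDerivAt_dirT 0 θ φ)
  refine e1.trans (h1.trans ?_)
  exact congrArg (fun v : E 2 => sin θ • v) e2.symm

/-- At a pole the azimuthal great circle is itself a meridian, a quarter turn away. Comparing the
metric on the two fields there yields the value of `σ` at the pole. -/
theorem SphereParam.azimuthal_north (φ : ℝ) :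
    (SphereParam.azimuthal Ψ 0 φ : E 2) = SphereParam.dθ Ψ 0 (φ + π / 2) := by
  refine mfderiv_one_congr (h := fun s => SphereParam.pt Ψ s (φ + π / 2)) ?_ 0
  funext s
  rw [azimuthalArc_north]
  rfl

theorem SphereParam.azimuthal_south (φ : ℝ) :
    (SphereParam.azimuthal Ψ π φ : E 2) = SphereParam.dθ Ψ π (φ - π / 2) := by
  have h := mfderiv_comp_hasDerivAt (h := fun t => SphereParam.pt Ψ t (φ - π / 2))
    (γ := fun s => π + s) (t := (0 : ℝ)) (γ' := 1) (I := 𝓡 2) (by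
      have h1 := (SphereParam.coords_smooth Ψ).comp (contMDiff_iff_contDiff.mpr
        (show ContDiff ℝ ∞ fun t : ℝ => ((0 : ℝ), t, φ - π / 2) by fun_prop))
      exact h1.mdifferentiableAt (by simp)) ((hasDerivAt_id _).const_add π)
  refine (mfderiv_one_congr (h := fun s => SphereParam.pt Ψ (π + s) (φ - π / 2)) ?_ 0).trans ?_
  · funext s
    rw [azimuthalArc_south]
    rfl
  refine h.trans ?_
  have key : ∀ z : ℝ, z = π → (mfderiv 𝓘(ℝ, ℝ) (𝓡 2)
      (fun t => SphereParam.pt Ψ t (φ - π / 2)) z (1 : ℝ) : E 2)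
      = mfderiv 𝓘(ℝ, ℝ) (𝓡 2) (fun t => SphereParam.pt Ψ t (φ - π / 2)) π (1 : ℝ) := by
    rintro z rfl; rfl
  exact key _ (add_zero π)

section Families

variable {EN HN N : Type*} [NormedAddCommGroup EN] [NormedSpace ℝ EN] [TopologicalSpace HN]
  {I : ModelWithCorners ℝ EN HN} [TopologicalSpace N] [ChartedSpace HN N] {f : ℝ → S → N}

theorem family_smooth (hf : ContMDiff (𝓘(ℝ, ℝ).prod (𝓡 2)) I ∞ (fun z : ℝ × S => f z.1 z.2)) :
    ContMDiff 𝓘(ℝ, ℝ × ℝ × ℝ) I ∞ (fun w : ℝ × ℝ × ℝ => f w.1 (SphereParam.coords Ψ w)) :=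
  hf.comp ((contDiff_fst.contMDiff).prodMk (SphereParam.coords_smooth Ψ))

theorem family_slice_smooth
    (hf : ContMDiff (𝓘(ℝ, ℝ).prod (𝓡 2)) I ∞ (fun z : ℝ × S => f z.1 z.2)) (t : ℝ) :
    ContMDiff (𝓡 2) I ∞ (f t) :=
  hf.comp (contMDiff_const.prodMk contMDiff_id)

theorem family_dirX (hf : ContMDiff (𝓘(ℝ, ℝ).prod (𝓡 2)) I ∞ (fun z : ℝ × S => f z.1 z.2))
    (w : ℝ × ℝ × ℝ) :
    mfderiv 𝓘(ℝ, ℝ × ℝ × ℝ) I (fun w => f w.1 (SphereParam.coords Ψ w)) w dirX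
      = mfderiv (𝓡 2) I (f w.1) (SphereParam.coords Ψ w) (SphereParam.dθ Ψ w.2.1 w.2.2) := by
  have h1 := mfderiv_comp_hasDerivAt (h := fun w => f w.1 (SphereParam.coords Ψ w))
    ((family_smooth Ψ hf).mdifferentiableAt (by simp)) (hasDerivAt_dirX w.1 w.2.1 w.2.2)
  refine h1.symm.trans ?_
  rw [← SphereParam.coords_dirX]
  have h2 := mfderiv_comp_hasDerivAt (h := fun z => f w.1 (SphereParam.coords Ψ z))
    (((family_slice_smooth hf w.1).comp (SphereParam.coords_smooth Ψ)).mdifferentiableAt (by simp))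
    (hasDerivAt_dirX w.1 w.2.1 w.2.2)
  refine h2.trans ?_
  exact congrArg (fun f => f dirX) (mfderiv_comp w
    ((family_slice_smooth hf w.1).mdifferentiableAt (by simp))
    ((SphereParam.coords_smooth Ψ).mdifferentiableAt (by simp)))

theorem family_dirY (hf : ContMDiff (𝓘(ℝ, ℝ).prod (𝓡 2)) I ∞ (fun z : ℝ × S => f z.1 z.2))
    (w : ℝ × ℝ × ℝ) :
    mfderiv 𝓘(ℝ, ℝ × ℝ × ℝ) I (fun w => f w.1 (SphereParam.coords Ψ w)) w dirY
      = mfderiv (𝓡 2) I (f w.1) (SphereParam.coords Ψ w) (SphereParam.dφ Ψ w.2.1 w.2.2) := by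
  have h1 := mfderiv_comp_hasDerivAt (h := fun w => f w.1 (SphereParam.coords Ψ w))
    ((family_smooth Ψ hf).mdifferentiableAt (by simp)) (hasDerivAt_dirY w.1 w.2.1 w.2.2)
  refine h1.symm.trans ?_
  rw [← SphereParam.coords_dirY]
  have h2 := mfderiv_comp_hasDerivAt (h := fun z => f w.1 (SphereParam.coords Ψ z))
    (((family_slice_smooth hf w.1).comp (SphereParam.coords_smooth Ψ)).mdifferentiableAt (by simp))
    (hasDerivAt_dirY w.1 w.2.1 w.2.2)
  refine h2.trans ?_
  exact congrArg (fun f => f dirY) (mfderiv_comp w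
    ((family_slice_smooth hf w.1).mdifferentiableAt (by simp))
    ((SphereParam.coords_smooth Ψ).mdifferentiableAt (by simp)))

theorem family_dirT (hf : ContMDiff (𝓘(ℝ, ℝ).prod (𝓡 2)) I ∞ (fun z : ℝ × S => f z.1 z.2))
    (w : ℝ × ℝ × ℝ) :
    mfderiv 𝓘(ℝ, ℝ × ℝ × ℝ) I (fun w => f w.1 (SphereParam.coords Ψ w)) w dirT
      = mfderiv 𝓘(ℝ, ℝ) I (fun t => f t (SphereParam.coords Ψ w)) w.1 (1 : ℝ) :=
  (mfderiv_comp_hasDerivAt (h := fun w => f w.1 (SphereParam.coords Ψ w))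
    ((family_smooth Ψ hf).mdifferentiableAt (by simp)) (hasDerivAt_dirT w.1 w.2.1 w.2.2)).symm

/-- The field is the velocity at arc length 0 of a smooth map with one more parameter, so it is
smooth in the coordinates across sin θ = 0, where dividing ∂_φ by sin θ would fail. -/
theorem family_azimuthal_smooth [IsManifold I ∞ N]
    (hf : ContMDiff (𝓘(ℝ, ℝ).prod (𝓡 2)) I ∞ (fun z : ℝ × S => f z.1 z.2)) :
    ContMDiff 𝓘(ℝ, ℝ × ℝ × ℝ) I.tangent ∞ (fun w : ℝ × ℝ × ℝ =>
      (⟨f w.1 (SphereParam.coords Ψ w), mfderiv (𝓡 2) I (f w.1) (SphereParam.coords Ψ w)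
        (SphereParam.azimuthal Ψ w.2.1 w.2.2)⟩ : TangentBundle I N)) := by
  have hR : ContMDiff 𝓘(ℝ, ℝ × ℝ × ℝ × ℝ) I ∞
      (fun z : ℝ × ℝ × ℝ × ℝ => f z.2.1 (Ψ (azimuthalArc (z.1, z.2.2)))) := by
    have h1 : ContDiff ℝ ∞ fun z : ℝ × ℝ × ℝ × ℝ => (z.1, z.2.2) := by fun_prop
    have h2 : ContDiff ℝ ∞ fun z : ℝ × ℝ × ℝ × ℝ => z.2.1 := by fun_prop
    exact hf.comp (h2.contMDiff.prodMk ((SphereParam.arc_smooth Ψ).comp h1.contMDiff))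
  refine (mfderiv_line_smooth hR).congr fun w => ?_
  have hz : Ψ (azimuthalArc (0, w.2)) = SphereParam.coords Ψ w := by
    rw [SphereParam.coords_eq]
  have hγ : MDifferentiableAt 𝓘(ℝ, ℝ) (𝓡 2) (fun s => Ψ (azimuthalArc (s, w.2))) 0 := by
    have h1 : ContDiff ℝ ∞ fun s : ℝ => (s, w.2) := by fun_prop
    exact ((SphereParam.arc_smooth Ψ).comp h1.contMDiff).mdifferentiableAt (by simp)
  have hc : mfderiv 𝓘(ℝ, ℝ) I (fun s => f w.1 (Ψ (azimuthalArc (s, w.2)))) 0 (1 : ℝ)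
      = mfderiv (𝓡 2) I (f w.1) (Ψ (azimuthalArc (0, w.2)))
        (mfderiv 𝓘(ℝ, ℝ) (𝓡 2) (fun s => Ψ (azimuthalArc (s, w.2))) 0 (1 : ℝ)) :=
    congrArg (fun f => f (1 : ℝ)) (mfderiv_comp (0 : ℝ)
      ((family_slice_smooth hf w.1).mdifferentiableAt (by simp)) hγ)
  have key : ∀ (s : S) (v : E 2), s = SphereParam.coords Ψ w →
      v = SphereParam.azimuthal Ψ w.2.1 w.2.2 →
      (⟨f w.1 s, mfderiv (𝓡 2) I (f w.1) s v⟩ : TangentBundle I N)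
      = ⟨f w.1 (SphereParam.coords Ψ w), mfderiv (𝓡 2) I (f w.1) (SphereParam.coords Ψ w)
        (SphereParam.azimuthal Ψ w.2.1 w.2.2)⟩ := by
    rintro s v rfl rfl; rfl
  refine (key _ _ hz rfl).symm.trans ?_
  exact congrArg (fun v => (⟨f w.1 (Ψ (azimuthalArc (0, w.2))), v⟩ : TangentBundle I N)) hc.symm

end Families

end SphereCoordinates


/-! ### Restriction of axisymmetric functions to a meridian. -/

section Profiles

open Real

variable {S : Type*} [TopologicalSpace S] [ChartedSpace (E 2) S] (Ψ : SphereParam S)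

/-- The restriction of a function to a meridian. -/
def SphereParam.profile (f : S → ℝ) (θ : ℝ) : ℝ := f (SphereParam.pt Ψ θ 0)

theorem SphereParam.comp_coords_smooth {f : S → ℝ} (hf : ContMDiff (𝓡 2) 𝓘(ℝ, ℝ) ∞ f) :
    ContDiff ℝ ∞ fun w : ℝ × ℝ × ℝ => f (SphereParam.pt Ψ w.2.1 w.2.2) :=
  contMDiff_iff_contDiff.mp (hf.comp (SphereParam.coords_smooth Ψ))

theorem SphereParam.meridian_smooth {f : S → ℝ} (hf : ContMDiff (𝓡 2) 𝓘(ℝ, ℝ) ∞ f) (φ : ℝ) :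
    ContDiff ℝ ∞ fun θ => f (SphereParam.pt Ψ θ φ) := by
  have h : ContDiff ℝ ∞ fun θ : ℝ => ((0 : ℝ), θ, φ) := by fun_prop
  have h2 := (SphereParam.comp_coords_smooth Ψ hf).comp h
  rwa [Function.comp_def] at h2

theorem SphereParam.parallel_smooth {f : S → ℝ} (hf : ContMDiff (𝓡 2) 𝓘(ℝ, ℝ) ∞ f) (θ : ℝ) :
    ContDiff ℝ ∞ fun φ => f (SphereParam.pt Ψ θ φ) := by
  have h : ContDiff ℝ ∞ fun φ : ℝ => ((0 : ℝ), θ, φ) := by fun_prop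
  have h2 := (SphereParam.comp_coords_smooth Ψ hf).comp h
  rwa [Function.comp_def] at h2

theorem SphereParam.profile_smooth {f : S → ℝ} (hf : ContMDiff (𝓡 2) 𝓘(ℝ, ℝ) ∞ f) :
    ContDiff ℝ ∞ (SphereParam.profile Ψ f) := SphereParam.meridian_smooth Ψ hf 0

variable {Ψ}

theorem SphereParam.pθ_eq {f : S → ℝ}
    (h : ∀ θ φ, 0 < θ → θ < π → f (SphereParam.pt Ψ θ φ) = SphereParam.profile Ψ f θ)
    {θ : ℝ} (φ : ℝ) (h0 : 0 < θ) (hπ : θ < π) :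
    SphereParam.pθ Ψ f θ φ = deriv (SphereParam.profile Ψ f) θ := by
  refine Filter.EventuallyEq.deriv_eq ?_
  filter_upwards [Ioo_mem_nhds h0 hπ] with t ht using h t φ ht.1 ht.2

theorem SphereParam.pφ_eq {f : S → ℝ}
    (h : ∀ θ φ, 0 < θ → θ < π → f (SphereParam.pt Ψ θ φ) = SphereParam.profile Ψ f θ)
    {θ : ℝ} (φ : ℝ) (h0 : 0 < θ) (hπ : θ < π) : SphereParam.pφ Ψ f θ φ = 0 := by
  have : (fun t => f (SphereParam.pt Ψ θ t)) = fun _ => SphereParam.profile Ψ f θ :=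
    funext fun t => h θ t h0 hπ
  unfold SphereParam.pφ
  rw [this, deriv_const]

/-- Continuing a meridian through the pole leads to the opposite meridian, so the profile of an
axisymmetric function is even there. -/
theorem SphereParam.deriv_profile_zero {f : S → ℝ}
    (h : ∀ θ φ, f (SphereParam.pt Ψ θ φ) = SphereParam.profile Ψ f θ) :
    deriv (SphereParam.profile Ψ f) 0 = 0 := by
  have e : SphereParam.profile Ψ f = fun θ => SphereParam.profile Ψ f (-θ) := by
    funext θ
    rw [← h θ (0 + π), SphereParam.pt, ← spherePoint_neg]
    rfl
  have := congrArg (fun f => deriv f 0) e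
  simp only [deriv_comp_neg, neg_zero] at this
  linarith

theorem SphereParam.deriv_profile_pi {f : S → ℝ}
    (h : ∀ θ φ, f (SphereParam.pt Ψ θ φ) = SphereParam.profile Ψ f θ) :
    deriv (SphereParam.profile Ψ f) π = 0 := by
  have e : (fun θ => SphereParam.profile Ψ f (π + θ))
      = fun θ => SphereParam.profile Ψ f (π - θ) := by
    funext θ
    rw [← h (π - θ) (0 + π), SphereParam.pt, ← spherePoint_add_pi]
    rfl
  have := congrArg (fun f => deriv f 0) e
  simp only [deriv_comp_const_add, deriv_comp_const_sub, sub_zero, add_zero] at this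
  linarith

end Profiles

/-! ### Smoothness of the pulled-back metric up to the poles. -/

section Families

variable {V : Type*} [TopologicalSpace V] [ChartedSpace (E 4) V] [IsManifold (𝓡 4) ∞ V]
  {S : Type*} [TopologicalSpace S] [ChartedSpace (E 2) S] (Ψ : SphereParam S) {f : ℝ → S → V}
  {g : BilinField V}

theorem family_dθ_smooth
    (hf : ContMDiff (𝓘(ℝ, ℝ).prod (𝓡 2)) (𝓡 4) ∞ (fun z : ℝ × S => f z.1 z.2)) :
    ContMDiff 𝓘(ℝ, ℝ × ℝ × ℝ) (𝓡 4).tangent ∞ (fun w : ℝ × ℝ × ℝ =>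
      (⟨f w.1 (SphereParam.coords Ψ w), mfderiv (𝓡 2) (𝓡 4) (f w.1) (SphereParam.coords Ψ w)
        (SphereParam.dθ Ψ w.2.1 w.2.2)⟩ : TangentBundle (𝓡 4) V)) :=
  (mfderiv_smooth (family_smooth Ψ hf) dirX).congr fun w =>
    congrArg (fun v => (⟨f w.1 (SphereParam.coords Ψ w), v⟩ : TangentBundle (𝓡 4) V))
      (family_dirX Ψ hf w).symm

/-- The azimuthal vector replaces ∂_φ so that the components do not degenerate at the poles. -/
theorem family_metric_smooth (hg : SmoothBilin g)
    (hf : ContMDiff (𝓘(ℝ, ℝ).prod (𝓡 2)) (𝓡 4) ∞ (fun z : ℝ × S => f z.1 z.2)) :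
    ContDiff ℝ ∞ (fun w : ℝ × ℝ × ℝ => inducedMetric g (f w.1) (SphereParam.coords Ψ w)
      (SphereParam.dθ Ψ w.2.1 w.2.2) (SphereParam.dθ Ψ w.2.1 w.2.2)) ∧
    ContDiff ℝ ∞ (fun w : ℝ × ℝ × ℝ => inducedMetric g (f w.1) (SphereParam.coords Ψ w)
      (SphereParam.dθ Ψ w.2.1 w.2.2) (SphereParam.azimuthal Ψ w.2.1 w.2.2)) ∧
    ContDiff ℝ ∞ (fun w : ℝ × ℝ × ℝ => inducedMetric g (f w.1) (SphereParam.coords Ψ w)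
      (SphereParam.azimuthal Ψ w.2.1 w.2.2) (SphereParam.azimuthal Ψ w.2.1 w.2.2)) := by
  have h1 := (family_dθ_smooth Ψ hf).contMDiffOn (s := Set.univ)
  have h2 := (family_azimuthal_smooth Ψ hf).contMDiffOn (s := Set.univ)
  exact ⟨contDiffOn_univ.mp (hg.pair_smooth h1 h1), contDiffOn_univ.mp (hg.pair_smooth h1 h2),
    contDiffOn_univ.mp (hg.pair_smooth h2 h2)⟩

end Families

/-! ### Axisymmetry of the potentials and regularity at the poles. -/

section Adapted

open Real

variable {V : Type*} [TopologicalSpace V] [ChartedSpace (E 4) V] [IsManifold (𝓡 4) ∞ V]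
  {M : EMSpacetime V} {S : Type*} [TopologicalSpace S] [ChartedSpace (E 2) S]
  [IsManifold (𝓡 2) ∞ S] {P : FramedSurface M S} {A : AxialSymmetry P} {Ψ : SphereParam S}
  {c : ℝ} {σ τ lam om ψ χ : S → ℝ}

theorem IsAdapted.axisymmetric (h : IsAdapted P A Ψ c σ) {f : S → ℝ} (hf : A.SmoothAxisymmetric f)
    (θ φ : ℝ) : f (SphereParam.pt Ψ θ φ) = SphereParam.profile Ψ f θ := by
  have := hf.2 φ (SphereParam.pt Ψ θ 0)
  rwa [h.flow_eq, zero_add] at this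

theorem emb_family_smooth (P : FramedSurface M S) :
    ContMDiff (𝓘(ℝ, ℝ).prod (𝓡 2)) (𝓡 4) ∞ (fun z : ℝ × S => (fun _ : ℝ => P.emb) z.1 z.2) :=
  P.emb_smooth.comp contMDiff_snd

theorem IsAdapted.closed_eqOn {f g : ℝ → ℝ} (hf : Continuous f) (hg : Continuous g)
    (h : ∀ θ, 0 < θ → θ < π → f θ = g θ) : Set.EqOn f g (Set.Icc 0 π) := by
  have : Set.EqOn f g (Set.Ioo 0 π) := fun θ hθ => h θ hθ.1 hθ.2
  have := this.closure hf hg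
  rwa [closure_Ioo pi_pos.ne] at this

/-- Off the poles the factors sin θ are divided out; both sides are continuous in θ, so the formulas
persist at 0 and π. -/
theorem IsAdapted.q_eq (h : IsAdapted P A Ψ c σ) {θ : ℝ} (hθ : θ ∈ Set.Icc 0 π) (φ : ℝ) :
    P.q (SphereParam.pt Ψ θ φ) (SphereParam.dθ Ψ θ φ) (SphereParam.dθ Ψ θ φ)
      = exp (2 * c - SphereParam.profile Ψ σ θ) ∧
    P.q (SphereParam.pt Ψ θ φ) (SphereParam.dθ Ψ θ φ) (SphereParam.azimuthal Ψ θ φ) = 0 ∧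
    P.q (SphereParam.pt Ψ θ φ) (SphereParam.azimuthal Ψ θ φ) (SphereParam.azimuthal Ψ θ φ)
      = exp (SphereParam.profile Ψ σ θ) := by
  obtain ⟨h1, h2, h3⟩ := family_metric_smooth Ψ (f := fun _ => P.emb) M.g_smooth (emb_family_smooth P)
  have cl : Continuous fun θ : ℝ => ((0 : ℝ), θ, φ) := by fun_prop
  have cσ := (SphereParam.profile_smooth Ψ h.smooth.1).continuous
  refine ⟨IsAdapted.closed_eqOn (h1.continuous.comp cl) (g := fun θ =>
      exp (2 * c - SphereParam.profile Ψ σ θ)) (by fun_prop) (fun θ h0 hπ => ?_) hθ,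
    IsAdapted.closed_eqOn (h2.continuous.comp cl) (g := fun _ => 0)
      (by fun_prop) (fun θ h0 hπ => ?_) hθ,
    IsAdapted.closed_eqOn (h3.continuous.comp cl) (g := fun θ =>
      exp (SphereParam.profile Ψ σ θ)) (by fun_prop) (fun θ h0 hπ => ?_) hθ⟩
  · exact (h.q_θθ θ φ h0 hπ).trans (by rw [h.axisymmetric h.smooth])
  · have e := h.q_θφ θ φ h0 hπ
    have hs := sin_pos_of_pos_of_lt_pi h0 hπ
    rw [SphereParam.dφ_eq] at e
    unfold FramedSurface.q inducedMetric at e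
    rw [map_smul, map_smul, smul_eq_mul] at e
    exact (mul_eq_zero.mp e).resolve_left hs.ne'
  · have e := h.q_φφ θ φ h0 hπ
    have hs := sin_pos_of_pos_of_lt_pi h0 hπ
    rw [SphereParam.dφ_eq] at e
    unfold FramedSurface.q inducedMetric at e
    rw [map_smul, map_smul, map_smul, smul_apply, smul_eq_mul, smul_eq_mul, ← mul_assoc, ← sq,
      mul_comm, h.axisymmetric h.smooth] at e
    exact mul_right_cancel₀ (pow_ne_zero 2 hs.ne') e

/-- Absence of a conical singularity: at a pole the azimuthal vector of one meridian is the
coordinate vector ∂_θ of the perpendicular one, so e^σ = e^{2c-σ}. -/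
theorem IsAdapted.profile_pole (h : IsAdapted P A Ψ c σ) :
    SphereParam.profile Ψ σ 0 = c ∧ SphereParam.profile Ψ σ π = c := by
  have key : ∀ (s s' : S) (u u' : E 2), s = s' → u = u' → P.q s u u = P.q s' u' u' := by
    rintro s _ u _ rfl rfl; rfl
  constructor
  · have h1 := (h.q_eq (θ := 0) ⟨le_rfl, pi_pos.le⟩ (0 + π / 2)).1
    have h2 := (h.q_eq (θ := 0) ⟨le_rfl, pi_pos.le⟩ 0).2.2
    have e : SphereParam.pt Ψ 0 0 = SphereParam.pt Ψ 0 (0 + π / 2) :=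
      congrArg Ψ (spherePoint_zero _).symm
    have := exp_injective (h2.symm.trans ((key _ _ _ _ e (SphereParam.azimuthal_north Ψ 0)).trans h1))
    linarith
  · have h1 := (h.q_eq (θ := π) ⟨pi_pos.le, le_rfl⟩ (0 - π / 2)).1
    have h2 := (h.q_eq (θ := π) ⟨pi_pos.le, le_rfl⟩ 0).2.2
    have e : SphereParam.pt Ψ π 0 = SphereParam.pt Ψ π (0 - π / 2) := by
      simp [SphereParam.pt, spherePoint]
    have := exp_injective (h2.symm.trans ((key _ _ _ _ e (SphereParam.azimuthal_south Ψ 0)).trans h1))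
    linarith

/-- Symmetry of `τ` is not part of the hypotheses. The equation for ω' expresses η ∂_θτ by
axisymmetric quantities, so ∂_θτ does not depend on φ, and all meridians start at the same pole. -/
theorem IsPotentials.axisymmetric_τ (h : IsPotentials P A Ψ c σ τ lam om ψ χ) (θ φ : ℝ) (h0 : 0 < θ)
    (hπ : θ < π) : τ (SphereParam.pt Ψ θ φ) = SphereParam.profile Ψ τ θ := by
  have ax := fun {f} (hf : A.SmoothAxisymmetric f) => h.adapted.axisymmetric hf
  have e : ∀ x, 0 < x → x < π → SphereParam.pθ Ψ τ x φ = SphereParam.pθ Ψ τ x 0 := by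
    intro x hx0 hxπ
    have e1 := h.om_eq x φ hx0 hxπ
    have e2 := h.om_eq x 0 hx0 hxπ
    have hf : ∀ {f}, A.SmoothAxisymmetric f →
        SphereParam.pθ Ψ f x φ = SphereParam.pθ Ψ f x 0 := fun hf => by
      rw [SphereParam.pθ_eq (fun _ _ _ _ => ax hf _ _) _ hx0 hxπ,
        SphereParam.pθ_eq (fun _ _ _ _ => ax hf _ _) _ hx0 hxπ]
    rw [hf h.om_smooth, hf h.ψ_smooth, hf h.χ_smooth, ax h.adapted.smooth x φ, ax h.χ_smooth x φ,
      ax h.ψ_smooth x φ] at e1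
    rw [ax h.adapted.smooth x 0, ax h.χ_smooth x 0, ax h.ψ_smooth x 0] at e2
    have hs := sin_pos_of_pos_of_lt_pi hx0 hxπ
    have : 2 * (exp (SphereParam.profile Ψ σ x) * sin x ^ 2) ≠ 0 := by positivity
    exact mul_left_cancel₀ this (by linarith)
  have hs := fun φ => SphereParam.meridian_smooth Ψ h.τ_smooth φ
  have hd : ∀ x ∈ Set.Icc 0 π, deriv (fun t => τ (SphereParam.pt Ψ t φ)) x
      = deriv (fun t => τ (SphereParam.pt Ψ t 0)) x :=
    IsAdapted.closed_eqOn (deriv_smooth (hs φ)).continuous (deriv_smooth (hs 0)).continuous e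
  have hc := constant_of_has_deriv_right_zero (a := 0) (b := π)
    (f := fun t => τ (SphereParam.pt Ψ t φ) - τ (SphereParam.pt Ψ t 0))
    ((hs φ).sub (hs 0)).continuous.continuousOn (fun x hx => by
      have := ((smooth_hasDerivAt (hs φ) x).sub (smooth_hasDerivAt (hs 0) x))
      rw [hd x ⟨hx.1, hx.2.le⟩, sub_self] at this
      exact this.hasDerivWithinAt) θ ⟨h0.le, hπ.le⟩
  have hz : SphereParam.pt Ψ 0 φ = SphereParam.pt Ψ 0 0 := congrArg Ψ (spherePoint_zero _)
  simp only [hz, sub_self] at hc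
  exact sub_eq_zero.mp hc

/-- On a parallel Ω_φ equals a constant plus ∂_φλ. Invariance of Ω under the flow gives ∂_φ²λ = 0,
and a periodic affine function is constant. -/
theorem IsPotentials.axisymmetric_lam (h : IsPotentials P A Ψ c σ τ lam om ψ χ) (θ φ : ℝ)
    (h0 : 0 < θ) (hπ : θ < π) : lam (SphereParam.pt Ψ θ φ) = SphereParam.profile Ψ lam θ := by
  set l : ℝ → ℝ := fun t => lam (SphereParam.pt Ψ θ t) with hl
  have hls : ContDiff ℝ ∞ l := SphereParam.parallel_smooth Ψ h.lam_smooth θ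
  obtain ⟨K, hK⟩ : ∃ K, ∀ t, P.Omega (SphereParam.pt Ψ θ t) (SphereParam.dφ Ψ θ t)
      = K + deriv l t := by
    refine ⟨- (exp c * sin θ * (deriv (SphereParam.profile Ψ τ) θ
      / exp (2 * c - SphereParam.profile Ψ σ θ))), fun t => ?_⟩
    have := h.hodge_φ θ t h0 hπ
    rwa [SphereParam.pθ_eq h.axisymmetric_τ _ h0 hπ, h.adapted.axisymmetric h.adapted.smooth] at this
  have hdd : ∀ t, deriv (deriv l) t = 0 := by
    intro t
    have h1 := A.lie_Omega (SphereParam.pt Ψ θ t) (SphereParam.dφ Ψ θ t)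
    have e : (fun r => P.Omega (A.flow r (SphereParam.pt Ψ θ t)) (mfderiv (𝓡 2) (𝓡 2) (A.flow r)
        (SphereParam.pt Ψ θ t) (SphereParam.dφ Ψ θ t))) = fun r => K + deriv l (t + r) := by
      funext r
      rw [← hK]
      have key : ∀ (s s' : S) (u u' : E 2), s = s' → u = u' → P.Omega s u = P.Omega s' u' := by
        rintro s _ u _ rfl rfl; rfl
      refine key _ _ _ _ (h.adapted.flow_eq r θ t) ?_
      have hc : ∀ t, MDifferentiableAt 𝓘(ℝ, ℝ) (𝓡 2) (fun t => SphereParam.pt Ψ θ t) t := by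
        intro t
        have h1 := (SphereParam.coords_smooth Ψ).comp (contMDiff_iff_contDiff.mpr
          (show ContDiff ℝ ∞ fun t : ℝ => ((0 : ℝ), θ, t) by fun_prop))
        exact h1.mdifferentiableAt (by simp)
      have hfl : MDifferentiableAt (𝓡 2) (𝓡 2) (A.flow r) (SphereParam.pt Ψ θ t) :=
        (family_slice_smooth A.flow_smooth r).mdifferentiableAt (by simp)
      have e1 : (mfderiv 𝓘(ℝ, ℝ) (𝓡 2) (fun t => A.flow r (SphereParam.pt Ψ θ t)) t (1 : ℝ) : E 2)
          = mfderiv (𝓡 2) (𝓡 2) (A.flow r) (SphereParam.pt Ψ θ t) (SphereParam.dφ Ψ θ t) :=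
        congrArg (fun f => f (1 : ℝ)) (mfderiv_comp t hfl (hc t))
      refine e1.symm.trans ((mfderiv_one_congr (h := fun t => SphereParam.pt Ψ θ (t + r))
        (funext fun t => h.adapted.flow_eq r θ t) t).trans ?_)
      exact mfderiv_comp_hasDerivAt (h := fun t => SphereParam.pt Ψ θ t) (γ := fun t => t + r)
        (hc _) ((hasDerivAt_id t).add_const r)
    rw [e, deriv_const_add, deriv_comp_const_add, add_zero] at h1
    exact h1
  have hconst := fun x y => is_const_of_deriv_eq_zero
    ((deriv_smooth hls).differentiable (by simp)) hdd x y
  have hper : l (2 * π) = l 0 := by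
    simp only [hl]
    rw [← zero_add (2 * π), SphereParam.pt, spherePoint_two_pi]
    rfl
  -- Rolle's theorem over one period makes the constant derivative zero.
  obtain ⟨z, -, hz⟩ := exists_deriv_eq_zero (f := l) (a := 0) (b := 2 * π) (by positivity)
    hls.continuous.continuousOn hper.symm
  exact is_const_of_deriv_eq_zero (hls.differentiable (by simp))
    (fun x => (hconst x z).trans hz) φ 0

theorem IsPotentials.Omega_eq (h : IsPotentials P A Ψ c σ τ lam om ψ χ) (θ φ : ℝ)
    (h0 : 0 < θ) (hπ : θ < π) :
    P.Omega (SphereParam.pt Ψ θ φ) (SphereParam.dθ Ψ θ φ) = deriv (SphereParam.profile Ψ lam) θ ∧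
    P.Omega (SphereParam.pt Ψ θ φ) (SphereParam.dφ Ψ θ φ)
      = - (exp c * sin θ * (deriv (SphereParam.profile Ψ τ) θ
        / exp (2 * c - SphereParam.profile Ψ σ θ))) := by
  have h1 := h.hodge_θ θ φ h0 hπ
  have h2 := h.hodge_φ θ φ h0 hπ
  rw [SphereParam.pφ_eq h.axisymmetric_τ φ h0 hπ, SphereParam.pθ_eq h.axisymmetric_lam φ h0 hπ,
    zero_div, mul_zero, zero_add] at h1
  rw [SphereParam.pφ_eq h.axisymmetric_lam φ h0 hπ, SphereParam.pθ_eq h.axisymmetric_τ φ h0 hπ,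
    h.adapted.axisymmetric h.adapted.smooth, add_zero] at h2
  exact ⟨h1, h2⟩

end Adapted


/-! ### Reduction of the functional and the area to one variable. -/

section Functional

open Real MeasureTheory

theorem integrableOn_coordDomain {h : ℝ → ℝ} (hh : IntegrableOn h (Set.Icc 0 π)) :
    IntegrableOn (fun z : ℝ × ℝ => h z.1) coordDomain := by
  have h1 : IntegrableOn h (Set.Ioo 0 π) := hh.mono_set Set.Ioo_subset_Icc_self
  have := Integrable.comp_fst h1 (volume.restrict (Set.Ioo 0 (2 * π)))
  rwa [Measure.prod_restrict] at this

theorem integral_coordDomain (h : ℝ → ℝ) :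
    ∫ z in coordDomain, h z.1 = 2 * π * ∫ x in 0..π, h x := by
  have := integral_fun_fst (μ := volume.restrict (Set.Ioo 0 π))
    (ν := volume.restrict (Set.Ioo 0 (2 * π))) h
  rw [Measure.prod_restrict] at this
  refine this.trans ?_
  rw [intervalIntegral.integral_of_le pi_pos.le, integral_Ioc_eq_integral_Ioo]
  simp [Measure.real, pi_pos.le]

variable {V : Type*} [TopologicalSpace V] [ChartedSpace (E 4) V] [IsManifold (𝓡 4) ∞ V]
  {M : EMSpacetime V} {S : Type*} [TopologicalSpace S] [ChartedSpace (E 2) S]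
  [IsManifold (𝓡 2) ∞ S] {P : FramedSurface M S} {A : AxialSymmetry P} {Ψ : SphereParam S}
  {c : ℝ} {σ τ lam om ψ χ : S → ℝ}

theorem measurableSet_coordDomain : MeasurableSet coordDomain :=
  measurableSet_Ioo.prod measurableSet_Ioo

/-- The combination Dω + 2χDψ - 2ψDχ equals 2ηDτ, so its squared norm over η² is 4τ'²; derivatives
in φ vanish. -/
theorem IsPotentials.functionalIntegrand_eq (h : IsPotentials P A Ψ c σ τ lam om ψ χ) {z : ℝ × ℝ}
    (hz : z ∈ coordDomain) :
    functionalIntegrand Ψ σ om ψ χ z = 4 * profileDensity (SphereParam.profile Ψ σ)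
      (SphereParam.profile Ψ τ) (SphereParam.profile Ψ ψ) (SphereParam.profile Ψ χ) z.1 := by
  obtain ⟨θ, φ⟩ := z
  obtain ⟨⟨h0, hπ⟩, -⟩ := hz
  have hs := sin_pos_of_pos_of_lt_pi h0 hπ
  have ax := fun {f} (hf : A.SmoothAxisymmetric f) => h.adapted.axisymmetric hf
  have e1 := h.om_eq θ φ h0 hπ
  have hf : ∀ {f}, A.SmoothAxisymmetric f → SphereParam.pθ Ψ f θ φ
      = deriv (SphereParam.profile Ψ f) θ ∧ SphereParam.pφ Ψ f θ φ = 0 := fun hf =>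
    ⟨SphereParam.pθ_eq (fun _ _ _ _ => ax hf _ _) _ h0 hπ,
      SphereParam.pφ_eq (fun _ _ _ _ => ax hf _ _) _ h0 hπ⟩
  simp only [functionalIntegrand, profileDensity, roundNormSq]
  rw [e1, (hf h.om_smooth).2, (hf h.ψ_smooth).2, (hf h.χ_smooth).2, (hf h.adapted.smooth).2,
    SphereParam.pθ_eq h.axisymmetric_τ φ h0 hπ, (hf h.ψ_smooth).1, (hf h.χ_smooth).1,
    (hf h.adapted.smooth).1, ax h.adapted.smooth θ φ]
  have := (exp_pos (SphereParam.profile Ψ σ θ)).ne'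
  change 0 < sin θ at hs
  field_simp
  ring

theorem IsPotentials.density_integrable (h : IsPotentials P A Ψ c σ τ lam om ψ χ) :
    IntegrableOn (profileDensity (SphereParam.profile Ψ σ) (SphereParam.profile Ψ τ)
      (SphereParam.profile Ψ ψ) (SphereParam.profile Ψ χ)) (Set.Icc 0 π) :=
  profileDensity_integrable (SphereParam.profile_smooth Ψ h.adapted.smooth.1)
    (SphereParam.profile_smooth Ψ h.τ_smooth) (SphereParam.profile_smooth Ψ h.ψ_smooth.1)
    (SphereParam.profile_smooth Ψ h.χ_smooth.1)
    (SphereParam.deriv_profile_zero (h.adapted.axisymmetric h.ψ_smooth))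
    (SphereParam.deriv_profile_pi (h.adapted.axisymmetric h.ψ_smooth))
    (SphereParam.deriv_profile_zero (h.adapted.axisymmetric h.χ_smooth))
    (SphereParam.deriv_profile_pi (h.adapted.axisymmetric h.χ_smooth))

/-- In the determinant of q the function `σ` cancels, leaving the area density e^c sin θ. -/
theorem IsAdapted.area_eq (h : IsAdapted P A Ψ c σ) : area Ψ P.q = 4 * π * exp c := by
  have e : area Ψ P.q = ∫ z in coordDomain, exp c * sin z.1 := by
    refine setIntegral_congr_fun measurableSet_coordDomain ?_
    rintro ⟨θ, φ⟩ ⟨⟨h0, hπ⟩, -⟩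
    change 0 < θ at h0
    change θ < π at hπ
    have hs := sin_pos_of_pos_of_lt_pi h0 hπ
    change √(_ * _ - _ * _) = exp c * sin θ
    rw [h.q_θθ θ φ h0 hπ, h.q_φφ θ φ h0 hπ, h.q_θφ θ φ h0 hπ, zero_mul, sub_zero,
      show exp (2 * c - σ (SphereParam.pt Ψ θ φ)) * (exp (σ (SphereParam.pt Ψ θ φ)) * sin θ ^ 2)
        = (exp c * sin θ) ^ 2 by rw [← mul_assoc, ← exp_add, mul_pow, ← exp_nat_mul]; congr 2; simp]
    exact sqrt_sq (by positivity)
  rw [e, integral_coordDomain (fun x => exp c * sin x), intervalIntegral.integral_const_mul,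
    integral_sin]
  simp
  ring

/-- The area bound, reduced to an estimate for the profiles of the potentials. -/
theorem IsPotentials.area_bound (h : IsPotentials P A Ψ c σ τ lam om ψ χ)
    (hN : ∫ x in 0..π, profileDensity (SphereParam.profile Ψ σ) (SphereParam.profile Ψ τ)
      (SphereParam.profile Ψ ψ) (SphereParam.profile Ψ χ) x ≤ 2 + 2 * c) :
    IntegrableOn (functionalIntegrand Ψ σ om ψ χ) coordDomain ∧
    4 * π * exp ((functionalM Ψ σ om ψ χ - 8) / 8) ≤ area Ψ P.q := by
  constructor
  · refine IntegrableOn.congr_fun (integrableOn_coordDomain (h.density_integrable.const_mul 4))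
      (fun z hz => (h.functionalIntegrand_eq hz).symm) measurableSet_coordDomain
  · rw [h.adapted.area_eq]
    have e : functionalM Ψ σ om ψ χ = 4 * ∫ x in 0..π, profileDensity (SphereParam.profile Ψ σ)
        (SphereParam.profile Ψ τ) (SphereParam.profile Ψ ψ) (SphereParam.profile Ψ χ) x := by
      rw [functionalM, setIntegral_congr_fun measurableSet_coordDomain
        (fun z hz => h.functionalIntegrand_eq hz), integral_coordDomain
        (fun x => 4 * profileDensity (SphereParam.profile Ψ σ)
        (SphereParam.profile Ψ τ) (SphereParam.profile Ψ ψ) (SphereParam.profile Ψ χ) x),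
        intervalIntegral.integral_const_mul]
      have := pi_ne_zero
      field_simp
    rw [e]
    gcongr
    linarith

end Functional


/-! ### Families of surfaces in a chart -/

section ChartView

variable {V : Type*} [TopologicalSpace V] [ChartedSpace (E 4) V] [IsManifold (𝓡 4) ∞ V]
  {W : Type*} [NormedAddCommGroup W] [NormedSpace ℝ W]

/-- A map into the spacetime, read in the preferred chart at `p`. -/
def chartView (p : V) (f : W → V) (w : W) : E 4 := extChartAt (𝓡 4) p (f w)

theorem chartView_smooth {f : W → V} (hf : ContMDiff 𝓘(ℝ, W) (𝓡 4) ∞ f) {p : V} {O : Set W}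
    (hO : ∀ w ∈ O, f w ∈ (chartAt (E 4) p).source) : ContDiffOn ℝ ∞ (chartView p f) O := by
  rw [← contMDiffOn_iff_contDiffOn]
  exact (contMDiffOn_extChartAt (n := ∞)).comp hf.contMDiffOn hO

theorem chartView_fderiv {f : W → V} (hf : ContMDiff 𝓘(ℝ, W) (𝓡 4) ∞ f) {p : V} {w : W}
    (hw : f w ∈ (chartAt (E 4) p).source) (a : W) :
    fderiv ℝ (chartView p f) w a = push p (f w) (mfderiv 𝓘(ℝ, W) (𝓡 4) f w a) :=
  (push_mfderiv (hf.mdifferentiableAt (by simp)) hw a).symm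

theorem chartView_mapsTo {f : W → V} {p : V} {O : Set W}
    (hO : ∀ w ∈ O, f w ∈ (chartAt (E 4) p).source) :
    Set.MapsTo (chartView p f) O (extChartAt (𝓡 4) p).target := fun w hw =>
  (extChartAt (𝓡 4) p).map_source (chart_source_iff.mpr (hO w hw))

/-- Linearity in the direction is hidden by the index formula for the Christoffel symbols; it is
needed to evaluate metric traces in a frame. -/
theorem EMSpacetime.covAlong_linear (M : EMSpacetime V) {m : ℕ} {X : Type*} [TopologicalSpace X]
    [ChartedSpace (E m) X] (f : X → V) (Y : ∀ x, TangentSpace (𝓡 4) (f x)) (x : X) :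
    ∃ T : E m →L[ℝ] E 4, ∀ v : E m, (covAlong M.g f Y x v : E 4) = T v := by
  let A : E m →L[ℝ] E 4 := mfderiv (𝓡 m) 𝓘(ℝ, E 4)
    (fun z => (mfderiv (𝓡 4) 𝓘(ℝ, E 4) (extChartAt (𝓡 4) (f x)) (f z) (Y z) : E 4)) x
  let B : E m →L[ℝ] E 4 := mfderiv (𝓡 m) (𝓡 4) f x
  let y : E 4 := Y x
  refine ⟨A + ((M.chartΓ (f x) (extChartAt (𝓡 4) (f x) (f x))).flip y).comp B, fun v => ?_⟩
  exact congrArg (fun z => A v + z) (M.christoffel_eq (f x) (mem_extChartAt_target _) (B v) y)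

theorem metricTrace_two {q B : E 2 → E 2 → ℝ} (hq : IsBilin q) (hB : IsBilin B) (u v : E 2)
    (hs : q u v = q v u) (h : q u u * q v v - q u v ^ 2 ≠ 0) :
    metricTrace q B = (q v v * B u u - q u v * (B u v + B v u) + q u u * B v v)
      / (q u u * q v v - q u v ^ 2) := by
  set Δ := q u u * q v v - q u v ^ 2
  rw [metricTrace_frame hq hB ![u, v] !![q v v / Δ, - q u v / Δ; - q u v / Δ, q u u / Δ]]
  · simp [Fin.sum_univ_two]
    field_simp
    ring
  · ext i j
    fin_cases i <;> fin_cases j <;> simp [Matrix.mul_apply, Fin.sum_univ_two, ← hs] <;>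
      field_simp <;> simp only [Δ] <;> ring

theorem inducedMetric_bilin (g : BilinField V) {m : ℕ} {X : Type*} [TopologicalSpace X]
    [ChartedSpace (E m) X] (f : X → V) (x : X) :
    IsBilin (n := m) fun u v => inducedMetric g f x u v := by
  let B : E m →L[ℝ] E 4 := mfderiv (𝓡 m) (𝓡 4) f x
  exact IsBilin.clm ((bilinModel (g (f x))).bilinearComp B B)

theorem EMSpacetime.covAlong_bilin (M : EMSpacetime V) {m : ℕ} {X : Type*} [TopologicalSpace X]
    [ChartedSpace (E m) X] (f : X → V) (Y : ∀ x, TangentSpace (𝓡 4) (f x)) (x : X) :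
    IsBilin (fun u v : E m => M.g (f x) (covAlong M.g (m := m) f Y x u)
      (mfderiv (𝓡 m) (𝓡 4) f x v)) := by
  obtain ⟨T, hT⟩ := M.covAlong_linear (m := m) f Y x
  let B : E m →L[ℝ] E 4 := mfderiv (𝓡 m) (𝓡 4) f x
  have e : (fun u v : E m => M.g (f x) (covAlong M.g (m := m) f Y x u) (mfderiv (𝓡 m) (𝓡 4) f x v))
      = fun u v => (bilinModel (M.g (f x))).bilinearComp T B u v := by
    funext u v
    exact congrArg (fun z => bilinModel (M.g (f x)) z (B v)) (hT u)
  rw [e]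
  exact IsBilin.clm _

section Families

variable {S : Type*} [TopologicalSpace S] [ChartedSpace (E 2) S]
  (Ψ : SphereParam S) (M : EMSpacetime V)
  {f : ℝ → S → V} {L : ∀ t s, TangentSpace (𝓡 4) (f t s)} {p : V}

/-- A family of surfaces in spherical coordinates. -/
def familyMap (f : ℝ → S → V) (w : ℝ × ℝ × ℝ) : V := f w.1 (SphereParam.coords Ψ w)

/-- The components of a vector field along a family of surfaces. -/
def familyField (p : V) (f : ℝ → S → V) (L : ∀ t s, TangentSpace (𝓡 4) (f t s)) (w : ℝ × ℝ × ℝ) :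
    E 4 := push p (familyMap Ψ f w) (L w.1 (SphereParam.coords Ψ w))

theorem familyField_smooth
    (hL : ContMDiff (𝓘(ℝ, ℝ).prod (𝓡 2)) (𝓡 4).tangent ∞
      (fun z : ℝ × S => (⟨f z.1 z.2, L z.1 z.2⟩ : TangentBundle (𝓡 4) V))) {O : Set (ℝ × ℝ × ℝ)}
    (hO : ∀ w ∈ O, familyMap Ψ f w ∈ (chartAt (E 4) p).source) :
    ContDiffOn ℝ ∞ (familyField Ψ p f L) O := by
  have h : ContMDiff 𝓘(ℝ, ℝ × ℝ × ℝ) (𝓡 4).tangent ∞ (fun w : ℝ × ℝ × ℝ =>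
      (⟨f w.1 (SphereParam.coords Ψ w), L w.1 (SphereParam.coords Ψ w)⟩ : TangentBundle (𝓡 4) V)) :=
    hL.comp ((contDiff_fst.contMDiff).prodMk (SphereParam.coords_smooth Ψ))
  exact push_smooth h.contMDiffOn hO

/-- A direction with no `t` component sees only the slice of constant `t`, so `t` may be frozen by
the chain rule before the covariant derivative is computed. -/
theorem cov_family (hf : ContMDiff (𝓘(ℝ, ℝ).prod (𝓡 2)) (𝓡 4) ∞ (fun z : ℝ × S => f z.1 z.2))
    (hL : ContMDiff (𝓘(ℝ, ℝ).prod (𝓡 2)) (𝓡 4).tangent ∞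
      (fun z : ℝ × S => (⟨f z.1 z.2, L z.1 z.2⟩ : TangentBundle (𝓡 4) V))) {w : ℝ × ℝ × ℝ}
    (hp : familyMap Ψ f w ∈ (chartAt (E 4) p).source) {a : ℝ × ℝ × ℝ} (ha : a.1 = 0) :
    cov (M.chartΓ p) (chartView p (familyMap Ψ f)) (familyField Ψ p f L) w a
      = push p (f w.1 (SphereParam.coords Ψ w)) (covAlong M.g (f w.1) (L w.1)
        (SphereParam.coords Ψ w) (mfderiv 𝓘(ℝ, ℝ × ℝ × ℝ) (𝓡 2) (SphereParam.coords Ψ) w a)) := by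
  have hsl : ContMDiff (𝓡 2) (𝓡 4).tangent ∞
      (fun s => (⟨f w.1 s, L w.1 s⟩ : TangentBundle (𝓡 4) V)) :=
    hL.comp (contMDiff_const.prodMk contMDiff_id)
  have h1 := M.covAlong_chart (h := SphereParam.coords Ψ) (w := w)
    ((family_slice_smooth hf w.1).mdifferentiableAt (by simp))
    (hsl.mdifferentiableAt (by simp)) ((SphereParam.coords_smooth Ψ).mdifferentiableAt (by simp))
    hp a
  refine Eq.trans ?_ h1.symm
  set O := familyMap Ψ f ⁻¹' (chartAt (E 4) p).source
  have hO : IsOpen O := (chartAt (E 4) p).open_source.preimage (family_smooth Ψ hf).continuous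
  have hk : HasFDerivAt (fun z : ℝ × ℝ × ℝ => (w.1, z.2))
      ((0 : ℝ × ℝ × ℝ →L[ℝ] ℝ).prod (ContinuousLinearMap.snd ℝ ℝ (ℝ × ℝ))) w :=
    (hasFDerivAt_const _ _).prodMk hasFDerivAt_snd
  have h2 := cov_comp (Γ := M.chartΓ p) (F := chartView p (familyMap Ψ f))
    (Y := familyField Ψ p f L) (k := fun z : ℝ × ℝ × ℝ => (w.1, z.2)) (w := w)
    ((chartView_smooth (family_smooth Ψ hf) (fun _ h => h)).diffAt (O := O) hO hp)
    ((familyField_smooth Ψ hL (fun _ h => h)).diffAt (O := O) hO hp) hk.differentiableAt a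
  rw [hk.fderiv] at h2
  have e : ((0 : ℝ × ℝ × ℝ →L[ℝ] ℝ).prod (ContinuousLinearMap.snd ℝ ℝ (ℝ × ℝ))) a = a :=
    Prod.ext ha.symm rfl
  rw [e] at h2
  exact h2.symm

theorem familyMap_dirX (hf : ContMDiff (𝓘(ℝ, ℝ).prod (𝓡 2)) (𝓡 4) ∞ (fun z : ℝ × S => f z.1 z.2))
    {w : ℝ × ℝ × ℝ} (hp : familyMap Ψ f w ∈ (chartAt (E 4) p).source) :
    fderiv ℝ (chartView p (familyMap Ψ f)) w dirX = push p (familyMap Ψ f w)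
      (mfderiv (𝓡 2) (𝓡 4) (f w.1) (SphereParam.coords Ψ w) (SphereParam.dθ Ψ w.2.1 w.2.2)) :=
  (chartView_fderiv (family_smooth Ψ hf) hp dirX).trans
    (congrArg (push p (familyMap Ψ f w)) (family_dirX Ψ hf w))

theorem familyMap_dirY (hf : ContMDiff (𝓘(ℝ, ℝ).prod (𝓡 2)) (𝓡 4) ∞ (fun z : ℝ × S => f z.1 z.2))
    {w : ℝ × ℝ × ℝ} (hp : familyMap Ψ f w ∈ (chartAt (E 4) p).source) :
    fderiv ℝ (chartView p (familyMap Ψ f)) w dirY = push p (familyMap Ψ f w)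
      (mfderiv (𝓡 2) (𝓡 4) (f w.1) (SphereParam.coords Ψ w) (SphereParam.dφ Ψ w.2.1 w.2.2)) :=
  (chartView_fderiv (family_smooth Ψ hf) hp dirY).trans
    (congrArg (push p (familyMap Ψ f w)) (family_dirY Ψ hf w))

theorem familyMap_dirT (hf : ContMDiff (𝓘(ℝ, ℝ).prod (𝓡 2)) (𝓡 4) ∞ (fun z : ℝ × S => f z.1 z.2))
    {w : ℝ × ℝ × ℝ} (hp : familyMap Ψ f w ∈ (chartAt (E 4) p).source) :
    fderiv ℝ (chartView p (familyMap Ψ f)) w dirT = push p (familyMap Ψ f w)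
      (mfderiv 𝓘(ℝ, ℝ) (𝓡 4) (fun t => f t (SphereParam.coords Ψ w)) w.1 (1 : ℝ)) :=
  (chartView_fderiv (family_smooth Ψ hf) hp dirT).trans
    (congrArg (push p (familyMap Ψ f w)) (family_dirT Ψ hf w))

theorem detFirst_family
    (hf : ContMDiff (𝓘(ℝ, ℝ).prod (𝓡 2)) (𝓡 4) ∞ (fun z : ℝ × S => f z.1 z.2)) (g : BilinField V)
    {w : ℝ × ℝ × ℝ} (hp : familyMap Ψ f w ∈ (chartAt (E 4) p).source) :
    detFirst (chartG g p) (chartView p (familyMap Ψ f)) w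
      = inducedMetric g (f w.1) (SphereParam.coords Ψ w)
          (SphereParam.dθ Ψ w.2.1 w.2.2) (SphereParam.dθ Ψ w.2.1 w.2.2)
        * inducedMetric g (f w.1) (SphereParam.coords Ψ w)
          (SphereParam.dφ Ψ w.2.1 w.2.2) (SphereParam.dφ Ψ w.2.1 w.2.2)
        - inducedMetric g (f w.1) (SphereParam.coords Ψ w)
          (SphereParam.dθ Ψ w.2.1 w.2.2) (SphereParam.dφ Ψ w.2.1 w.2.2) ^ 2 := by
  have pr := fun u v => chartG_push g hp u v
  rw [detFirst, familyMap_dirX Ψ hf hp, familyMap_dirY Ψ hf hp]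
  exact congrArg₂ (· - ·) (congrArg₂ (· * ·) (pr _ _) (pr _ _)) (congrArg (· ^ 2) (pr _ _))

/-- Cramer's rule for the inverse of the first fundamental form presents the expansion as a quotient
of functions that are differentiable in `t`. -/
theorem expansion_family
    (hf : ContMDiff (𝓘(ℝ, ℝ).prod (𝓡 2)) (𝓡 4) ∞ (fun z : ℝ × S => f z.1 z.2))
    (hL : ContMDiff (𝓘(ℝ, ℝ).prod (𝓡 2)) (𝓡 4).tangent ∞
      (fun z : ℝ × S => (⟨f z.1 z.2, L z.1 z.2⟩ : TangentBundle (𝓡 4) V))) {w : ℝ × ℝ × ℝ}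
    (hp : familyMap Ψ f w ∈ (chartAt (E 4) p).source)
    (hΔ : detFirst (chartG M.g p) (chartView p (familyMap Ψ f)) w ≠ 0) :
    expansion M.g (f w.1) (L w.1) (SphereParam.coords Ψ w)
      = expansionNum (chartG M.g p) (M.chartΓ p) (chartView p (familyMap Ψ f))
        (familyField Ψ p f L) w / detFirst (chartG M.g p) (chartView p (familyMap Ψ f)) w := by
  have eX := familyMap_dirX Ψ hf hp
  have eY := familyMap_dirY Ψ hf hp
  have cX := cov_family Ψ M hf hL hp (a := dirX) rfl
  have cY := cov_family Ψ M hf hL hp (a := dirY) rfl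
  rw [SphereParam.coords_dirX] at cX
  rw [SphereParam.coords_dirY] at cY
  have pr := fun u v => chartG_push M.g hp u v
  rw [detFirst_family Ψ hf M.g hp] at hΔ ⊢
  rw [expansionNum, eX, eY, cX, cY]
  have h2 := metricTrace_two (inducedMetric_bilin M.g (f w.1) (SphereParam.coords Ψ w))
    (M.covAlong_bilin (f w.1) (L w.1) (SphereParam.coords Ψ w))
    (SphereParam.dθ Ψ w.2.1 w.2.2) (SphereParam.dφ Ψ w.2.1 w.2.2) (M.g_symm _ _ _)
  refine (h2 hΔ).trans (congrArg₂ (· / ·) ?_ rfl)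
  refine congrArg₂ (· + ·) (congrArg₂ (· - ·) (congrArg₂ (· * ·) ?_ ?_)
    (congrArg₂ (· * ·) ?_ (congrArg₂ (· + ·) ?_ ?_))) (congrArg₂ (· * ·) ?_ ?_) <;>
  exact (pr _ _).symm

end Families

end ChartView


/-! ### The stability inequality of a marginally outer trapped surface. -/

section Families

open Real

variable {V : Type*} [TopologicalSpace V] [ChartedSpace (E 4) V] [IsManifold (𝓡 4) ∞ V]
  {S : Type*} [TopologicalSpace S] [ChartedSpace (E 2) S]
  (Ψ : SphereParam S) (M : EMSpacetime V)
  {f : ℝ → S → V} {L : ∀ t s, TangentSpace (𝓡 4) (f t s)} {p : V} {a b : ℝ → ℝ}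

/-- The coordinates of points of a family of surfaces off the poles, in a chart at `p`. -/
def familyDomain (f : ℝ → S → V) (p : V) : Set (ℝ × ℝ × ℝ) :=
  {w | familyMap Ψ f w ∈ (chartAt (E 4) p).source ∧ 0 < w.2.1 ∧ w.2.1 < π}

/-- The map `f` induces the metric `a(θ) dθ² + b(θ) dφ²` in spherical coordinates. -/
structure InducesAxialMetric (f : S → V) (a b : ℝ → ℝ) : Prop where
  a_pos : ∀ x, 0 < x → x < π → 0 < a x
  b_pos : ∀ x, 0 < x → x < π → 0 < b x
  q11 : ∀ x y, 0 < x → x < π → inducedMetric M.g f (SphereParam.pt Ψ x y)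
    (SphereParam.dθ Ψ x y) (SphereParam.dθ Ψ x y) = a x
  q12 : ∀ x y, 0 < x → x < π → inducedMetric M.g f (SphereParam.pt Ψ x y)
    (SphereParam.dθ Ψ x y) (SphereParam.dφ Ψ x y) = 0
  q22 : ∀ x y, 0 < x → x < π → inducedMetric M.g f (SphereParam.pt Ψ x y)
    (SphereParam.dφ Ψ x y) (SphereParam.dφ Ψ x y) = b x

variable {Ψ M}

theorem InducesAxialMetric.axialFamily (h : InducesAxialMetric Ψ M (f 0) a b)
    (hf : ContMDiff (𝓘(ℝ, ℝ).prod (𝓡 2)) (𝓡 4) ∞ (fun z : ℝ × S => f z.1 z.2)) (p : V) :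
    AxialFamily (chartG M.g p) (M.chartΓ p) (extChartAt (𝓡 4) p).target (familyDomain Ψ f p)
      (chartView p (familyMap Ψ f)) a b where
  lc := M.leviCivita_chart p
  isOpen := by
    have h1 : IsOpen (familyMap Ψ f ⁻¹' (chartAt (E 4) p).source) :=
      (chartAt (E 4) p).open_source.preimage (family_smooth Ψ hf).continuous
    have h2 : IsOpen {w : ℝ × ℝ × ℝ | 0 < w.2.1} :=
      isOpen_lt continuous_const (continuous_fst.comp continuous_snd)
    have h3 : IsOpen {w : ℝ × ℝ × ℝ | w.2.1 < π} :=
      isOpen_lt (continuous_fst.comp continuous_snd) continuous_const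
    exact h1.inter (h2.inter h3)
  smooth := chartView_smooth (family_smooth Ψ hf) fun _ hw => hw.1
  maps := chartView_mapsTo fun _ hw => hw.1
  q11 x y hw := by
    rw [familyMap_dirX Ψ hf hw.1]
    exact (chartG_push M.g hw.1 _ _).trans (h.q11 x y hw.2.1 hw.2.2)
  q12 x y hw := by
    rw [familyMap_dirX Ψ hf hw.1, familyMap_dirY Ψ hf hw.1]
    exact (chartG_push M.g hw.1 _ _).trans (h.q12 x y hw.2.1 hw.2.2)
  q22 x y hw := by
    rw [familyMap_dirY Ψ hf hw.1]
    exact (chartG_push M.g hw.1 _ _).trans (h.q22 x y hw.2.1 hw.2.2)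

theorem riem_sub_smul {X : Type*} [NormedAddCommGroup X] [NormedSpace ℝ X]
    (Γ : X → X →L[ℝ] X →L[ℝ] X) (y l k v z : X) (r s : ℝ) :
    riem Γ y (r • l - s • k) v z = r • riem Γ y l v z - s • riem Γ y k v z := by
  simp only [riem, map_sub, map_smul, sub_apply, smul_apply]
  module

set_option maxHeartbeats 800000 in
/-- The pointwise form of the stability inequality for marginally outer trapped surfaces. -/
theorem InducesAxialMetric.stability (h : InducesAxialMetric Ψ M (f 0) a b)
    (hf : ContMDiff (𝓘(ℝ, ℝ).prod (𝓡 2)) (𝓡 4) ∞ (fun z : ℝ × S => f z.1 z.2))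
    (hL : ContMDiff (𝓘(ℝ, ℝ).prod (𝓡 2)) (𝓡 4).tangent ∞
      (fun z : ℝ × S => (⟨f z.1 z.2, L z.1 z.2⟩ : TangentBundle (𝓡 4) V)))
    (hnull : ∀ t s, M.g (f t s) (L t s) (L t s) = 0)
    (hnorm : ∀ t s v, M.g (f t s) (L t s) (mfderiv (𝓡 2) (𝓡 4) (f t) s v) = 0)
    {k : ∀ s, TangentSpace (𝓡 4) (f 0 s)} (hk : ∀ s, M.g (f 0 s) (k s) (k s) = 0)
    (hkn : ∀ s v, M.g (f 0 s) (k s) (mfderiv (𝓡 2) (𝓡 4) (f 0) s v) = 0)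
    (hlk : ∀ s, M.g (f 0 s) (L 0 s) (k s) = -1)
    (hlf : ∀ s, M.g (f 0 s) (M.T (f 0 s)) (L 0 s) < 0)
    (hkf : ∀ s, M.g (f 0 s) (M.T (f 0 s)) (k s) < 0) {β γ ω₁ ω₂ : ℝ → ℝ}
    (hX : ∀ x y, mfderiv 𝓘(ℝ, ℝ) (𝓡 4) (fun t => f t (SphereParam.pt Ψ x y)) 0 (1 : ℝ)
      = γ x • L 0 (SphereParam.pt Ψ x y) - β x • k (SphereParam.pt Ψ x y))
    (hγ : ∀ x, 0 ≤ γ x) (hβ : ∀ x, 0 < β x)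
    (hω₁ : ∀ x y, 0 < x → x < π → - M.g (f 0 (SphereParam.pt Ψ x y)) (k (SphereParam.pt Ψ x y))
      (covAlong M.g (f 0) (L 0) (SphereParam.pt Ψ x y) (SphereParam.dθ Ψ x y)) = ω₁ x)
    (hω₂ : ∀ x y, 0 < x → x < π → - M.g (f 0 (SphereParam.pt Ψ x y)) (k (SphereParam.pt Ψ x y))
      (covAlong M.g (f 0) (L 0) (SphereParam.pt Ψ x y) (SphereParam.dφ Ψ x y)) = ω₂ x)
    (hexp : ∀ s, expansion M.g (f 0) (L 0) s = 0) {x : ℝ} (h0 : 0 < x) (hπ : x < π)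
    (hstab : 0 ≤ deriv (fun t => expansion M.g (f t) (L t) (SphereParam.pt Ψ x 0)) 0) :
    0 ≤ - (β x * (M.F (f 0 (SphereParam.pt Ψ x 0)) (L 0 (SphereParam.pt Ψ x 0))
            (k (SphereParam.pt Ψ x 0)) ^ 2
          + hodgeDual M.g M.F M.vol (f 0 (SphereParam.pt Ψ x 0)) (L 0 (SphereParam.pt Ψ x 0))
            (k (SphereParam.pt Ψ x 0)) ^ 2)) + β x * axialCurvature a b x
        + deriv (fun x => β x * ω₁ x - deriv β x) x / a x
        + (β x * ω₁ x - deriv β x) * (deriv b x / (2 * a x * b x) - deriv a x / (2 * a x ^ 2))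
        - β x * ω₁ x * (β x * ω₁ x - deriv β x) / (β x * a x)
        - (β x * ω₂ x) ^ 2 / (β x * b x) := by
  set s₀ := SphereParam.pt Ψ x 0 with hs₀
  set p : V := f 0 s₀ with hp
  set w₀ : ℝ × ℝ × ℝ := (0, x, 0) with hw₀
  have hm : w₀ ∈ familyDomain Ψ f p := ⟨mem_chart_source (E 4) p, h0, hπ⟩
  have A := h.axialFamily hf p
  have hLs : ContDiffOn ℝ ∞ (familyField Ψ p f L) (familyDomain Ψ f p) :=
    familyField_smooth Ψ hL fun _ hw => hw.1
  have pr : ∀ {w}, w ∈ familyDomain Ψ f p → ∀ u v, chartG M.g p (chartView p (familyMap Ψ f) w)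
      (push p (familyMap Ψ f w) u) (push p (familyMap Ψ f w) v) = M.g (familyMap Ψ f w) u v :=
    fun hw u v => chartG_push M.g hw.1 u v
  have hnull' : ∀ w ∈ familyDomain Ψ f p, chartG M.g p (chartView p (familyMap Ψ f) w)
      (familyField Ψ p f L w) (familyField Ψ p f L w) = 0 := fun w hw =>
    (pr hw _ _).trans (hnull _ _)
  have dT : ∀ x y, (0, x, y) ∈ familyDomain Ψ f p →
      fderiv ℝ (chartView p (familyMap Ψ f)) (0, x, y) dirT = push p (familyMap Ψ f (0, x, y))
        (γ x • L 0 (SphereParam.pt Ψ x y) - β x • k (SphereParam.pt Ψ x y)) := fun x y hw =>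
    (familyMap_dirT Ψ hf hw.1).trans (congrArg (push p (familyMap Ψ f (0, x, y))) (hX x y))
  -- The derivative of g(L, L) = 0.
  have covL : ∀ w ∈ familyDomain Ψ f p, ∀ d, chartG M.g p (chartView p (familyMap Ψ f) w)
      (cov (M.chartΓ p) (chartView p (familyMap Ψ f)) (familyField Ψ p f L) w d)
      (familyField Ψ p f L w) = 0 := by
    intro w hw d
    have e1 := A.d_pair hLs hLs hw d
    have e2 : (fun w => chartG M.g p (chartView p (familyMap Ψ f) w)
        (familyField Ψ p f L w) (familyField Ψ p f L w)) =ᶠ[nhds w] fun _ => 0 := by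
      filter_upwards [A.isOpen.mem_nhds hw] with z hz using hnull' z hz
    rw [e2.fderiv_eq, A.lc.symm _ (A.maps hw) (familyField Ψ p f L w)] at e1
    simp at e1
    linarith
  -- Since ∇L is orthogonal to L and X = γℓ - βk, only the k part of X counts: g(∇_a L, X) = βΩ_a.
  have hP : ∀ x y, (0, x, y) ∈ familyDomain Ψ f p → ∀ (d : ℝ × ℝ × ℝ)
      (u : TangentSpace (𝓡 2) (SphereParam.pt Ψ x y)) (r : ℝ), d.1 = 0 →
      mfderiv 𝓘(ℝ, ℝ × ℝ × ℝ) (𝓡 2) (SphereParam.coords Ψ) (0, x, y) d = u →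
      - M.g (f 0 (SphereParam.pt Ψ x y)) (k (SphereParam.pt Ψ x y))
        (covAlong M.g (f 0) (L 0) (SphereParam.pt Ψ x y) u) = r →
      chartG M.g p (chartView p (familyMap Ψ f) (0, x, y))
        (cov (M.chartΓ p) (chartView p (familyMap Ψ f)) (familyField Ψ p f L) (0, x, y) d)
        (fderiv ℝ (chartView p (familyMap Ψ f)) (0, x, y) dirT) = β x * r := by
    intro x y hw d u r hd hu hr
    have e1 := covL _ hw d
    have cv := cov_family Ψ M hf hL hw.1 hd
    have e2 := (congrArg (fun z => chartG M.g p (chartView p (familyMap Ψ f) (0, x, y)) z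
      (push p (familyMap Ψ f (0, x, y)) (k (SphereParam.pt Ψ x y)))) cv).trans (pr hw _ _)
    have e3 : M.g (familyMap Ψ f (0, x, y)) (covAlong M.g (f 0) (L 0) (SphereParam.pt Ψ x y)
        (mfderiv 𝓘(ℝ, ℝ × ℝ × ℝ) (𝓡 2) (SphereParam.coords Ψ) (0, x, y) d))
        (k (SphereParam.pt Ψ x y)) = - r := by
      rw [hu]
      exact (M.g_symm (f 0 (SphereParam.pt Ψ x y)) _ _).trans (by rw [← hr, neg_neg])
    have dT' : fderiv ℝ (chartView p (familyMap Ψ f)) (0, x, y) dirT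
        = γ x • familyField Ψ p f L (0, x, y)
          - β x • push p (familyMap Ψ f (0, x, y)) (k (SphereParam.pt Ψ x y)) :=
      (dT x y hw).trans (((push p (familyMap Ψ f (0, x, y))).map_sub _ _).trans
        (congrArg₂ (· - ·) ((push p (familyMap Ψ f (0, x, y))).map_smul _ _)
          ((push p (familyMap Ψ f (0, x, y))).map_smul _ _)))
    rw [dT', map_sub, map_smul, map_smul, e1, e2.trans e3]
    simp
  have hlkX : ∀ x y, M.g (f 0 (SphereParam.pt Ψ x y)) (L 0 (SphereParam.pt Ψ x y))
      (γ x • L 0 (SphereParam.pt Ψ x y) - β x • k (SphereParam.pt Ψ x y)) = β x := by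
    intro x y
    rw [map_sub, map_smul, map_smul, hnull, hlk]
    simp
  have hkX : ∀ x y, M.g (f 0 (SphereParam.pt Ψ x y)) (k (SphereParam.pt Ψ x y))
      (γ x • L 0 (SphereParam.pt Ψ x y) - β x • k (SphereParam.pt Ψ x y)) = - γ x := by
    intro x y
    rw [map_sub, map_smul, map_smul, hk, M.g_symm, hlk]
    simp
  have hXn : ∀ x y (v : TangentSpace (𝓡 2) (SphereParam.pt Ψ x y)),
      M.g (f 0 (SphereParam.pt Ψ x y))
      (γ x • L 0 (SphereParam.pt Ψ x y) - β x • k (SphereParam.pt Ψ x y))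
      (mfderiv (𝓡 2) (𝓡 4) (f 0) (SphereParam.pt Ψ x y) v) = 0 := by
    intro x y v
    rw [map_sub, map_smul, map_smul, sub_apply, smul_apply, smul_apply, hnorm, hkn]
    simp
  have hax := h.a_pos x h0 hπ
  have hbx := h.b_pos x h0 hπ
  have hdet : detFirst (chartG M.g p) (chartView p (familyMap Ψ f)) w₀ = a x * b x := by
    rw [detFirst_family Ψ hf M.g hm.1]
    have e1 := h.q11 x 0 h0 hπ
    have e2 := h.q12 x 0 h0 hπ
    have e3 := h.q22 x 0 h0 hπ
    refine (congrArg₂ (· - ·) (congrArg₂ (· * ·) e1 e3) (congrArg (· ^ 2) e2)).trans ?_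
    ring
  have hdet0 : detFirst (chartG M.g p) (chartView p (familyMap Ψ f)) w₀ ≠ 0 := by
    rw [hdet]; positivity
  -- The quotient formula needs a nonzero determinant; it persists for small t by continuity.
  have hev : (fun t => expansion M.g (f t) (L t) s₀) =ᶠ[nhds 0] fun t =>
      expansionNum (chartG M.g p) (M.chartΓ p) (chartView p (familyMap Ψ f))
        (familyField Ψ p f L) (t, x, 0)
      / detFirst (chartG M.g p) (chartView p (familyMap Ψ f)) (t, x, 0) := by
    have hc : ContinuousAt (fun t : ℝ => ((t, x, 0) : ℝ × ℝ × ℝ)) 0 := by fun_prop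
    have hcd : ContinuousOn (detFirst (chartG M.g p) (chartView p (familyMap Ψ f)))
        (familyDomain Ψ f p) := by
      have hs := A.dir_smooth
      have hp := fun u v => (A.lc.pair_smooth A.smooth A.maps (hs u) (hs v)).continuousOn
      exact ((hp dirX dirX).mul (hp dirY dirY)).sub ((hp dirX dirY).pow 2)
    have hcd0 := ContinuousAt.comp (f := fun t : ℝ => ((t, x, 0) : ℝ × ℝ × ℝ)) (x := 0)
      (hcd.continuousAt (A.isOpen.mem_nhds hm)) hc
    filter_upwards [hc (A.isOpen.mem_nhds hm), hcd0.eventually_ne hdet0] with t ht1 ht2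
    have ht : detFirst (chartG M.g p) (chartView p (familyMap Ψ f)) (t, x, 0) ≠ 0 := ht2
    exact expansion_family (w := (t, x, 0)) Ψ M hf hL ht1.1 ht
  have hθ : expansionNum (chartG M.g p) (M.chartΓ p) (chartView p (familyMap Ψ f))
      (familyField Ψ p f L) w₀ = 0 := by
    have := expansion_family Ψ M hf hL hm.1 hdet0
    have h2 := this.symm.trans (hexp (SphereParam.coords Ψ w₀))
    exact (div_eq_zero_iff.mp h2).resolve_right hdet0
  have hframe : IsBlockFrame (bilinModel (M.g p)) (L 0 s₀) (k s₀)
      (mfderiv (𝓡 2) (𝓡 4) (f 0) s₀ (SphereParam.dθ Ψ x 0))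
      (mfderiv (𝓡 2) (𝓡 4) (f 0) s₀ (SphereParam.dφ Ψ x 0)) 0 (-1) 0 (a x) (b x) :=
    { symm := M.g_symm p
      h00 := hnull 0 s₀
      h01 := hlk s₀
      h11 := hk s₀
      h0F1 := hnorm 0 s₀ _
      h0F2 := hnorm 0 s₀ _
      h1F1 := hkn s₀ _
      h1F2 := hkn s₀ _
      hF11 := h.q11 x 0 h0 hπ
      hF22 := h.q22 x 0 h0 hπ
      hF12 := h.q12 x 0 h0 hπ
      d_ne := by norm_num
      a_ne := hax.ne'
      b_ne := hbx.ne' }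
  obtain ⟨k1, k2, -⟩ := M.curvature_bounds hframe hax hbx (hlf s₀) (hkf s₀)
  obtain ⟨θ', hθ', hle⟩ := A.expansion_variation hLs hnull'
    (fun w hw => by
      rw [familyMap_dirX Ψ hf hw.1]; exact (pr hw _ _).trans (hnorm _ _ _))
    (fun w hw => by
      rw [familyMap_dirY Ψ hf hw.1]; exact (pr hw _ _).trans (hnorm _ _ _))
    (β := β) (ρ := fun x => 2 * γ x * β x) (P₁ := fun x => β x * ω₁ x)
    (P₂ := fun x => β x * ω₂ x)
    (fun x y hw => by rw [dT x y hw]; exact (pr hw _ _).trans (hlkX x y))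
    (fun x y hw => by
      rw [dT x y hw]
      refine (pr hw _ _).trans ?_
      have e := hlkX x y
      have e' := hkX x y
      have gX : ∀ Y, M.g (f 0 (SphereParam.pt Ψ x y))
          (γ x • L 0 (SphereParam.pt Ψ x y) - β x • k (SphereParam.pt Ψ x y)) Y
          = γ x * M.g (f 0 (SphereParam.pt Ψ x y)) (L 0 (SphereParam.pt Ψ x y)) Y
            - β x * M.g (f 0 (SphereParam.pt Ψ x y)) (k (SphereParam.pt Ψ x y)) Y := by
        intro Y
        rw [map_sub, map_smul, map_smul]
        rfl
      refine (gX _).trans ?_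
      rw [e, e']
      ring)
    (fun x y hw => by
      rw [dT x y hw, familyMap_dirX Ψ hf hw.1]; exact (pr hw _ _).trans (hXn x y _))
    (fun x y hw => by
      rw [dT x y hw, familyMap_dirY Ψ hf hw.1]; exact (pr hw _ _).trans (hXn x y _))
    (fun x y hw => hP x y hw dirX _ _ rfl (SphereParam.coords_dirX Ψ (0, x, y))
      (hω₁ x y hw.2.1 hw.2.2))
    (fun x y hw => hP x y hw dirY _ _ rfl (SphereParam.coords_dirY Ψ (0, x, y))
      (hω₂ x y hw.2.1 hw.2.2))
    hm hax hbx (hβ x) (by have := hγ x; have := hβ x; positivity) hθ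
    (C := β x * (M.F p (L 0 s₀) (k s₀) ^ 2 + hodgeDual M.g M.F M.vol p (L 0 s₀) (k s₀) ^ 2)) (by
      intro w
      have e1 : fderiv ℝ (chartView p (familyMap Ψ f)) w dirX
          = mfderiv (𝓡 2) (𝓡 4) (f 0) s₀ (SphereParam.dθ Ψ x 0) :=
        (familyMap_dirX Ψ hf hm.1).trans (push_self p _)
      have e2 : fderiv ℝ (chartView p (familyMap Ψ f)) w dirY
          = mfderiv (𝓡 2) (𝓡 4) (f 0) s₀ (SphereParam.dφ Ψ x 0) :=
        (familyMap_dirY Ψ hf hm.1).trans (push_self p _)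
      set f₁ : E 4 := mfderiv (𝓡 2) (𝓡 4) (f 0) s₀ (SphereParam.dθ Ψ x 0)
      set f₂ : E 4 := mfderiv (𝓡 2) (𝓡 4) (f 0) s₀ (SphereParam.dφ Ψ x 0)
      set l₀ : E 4 := L 0 s₀
      set k₀ : E 4 := k s₀
      have e3 : fderiv ℝ (chartView p (familyMap Ψ f)) w dirT = γ x • l₀ - β x • k₀ :=
        (dT x 0 hm).trans (push_self p _)
      have e4 : familyField Ψ p f L w = l₀ := push_self p _
      have e5 : chartView p (familyMap Ψ f) w = extChartAt (𝓡 4) p p := rfl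
      rw [e1, e2, e3, e4, e5, riem_sub_smul, riem_sub_smul]
      simp only [map_sub, map_smul, sub_apply, smul_apply, smul_eq_mul]
      -- The curvature term is linear in X = γℓ - βk: its k part is controlled by G(ℓ,k) ≥ E_⊥² +
      -- B_⊥², and its ℓ part has a sign because γ ≥ 0 and G(ℓ,ℓ) ≥ 0.
      have hβ' := mul_le_mul_of_nonneg_left k1 (hβ x).le
      have hγ' := mul_nonpos_of_nonneg_of_nonpos (hγ x) k2
      refine hβ'.trans ?_
      ring_nf at hγ' ⊢
      linarith)
  have hd : deriv (fun t => expansion M.g (f t) (L t) s₀) 0 = θ' := by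
    rw [hev.deriv_eq, hθ'.deriv]
  exact (hd ▸ hstab).trans hle

end Families


/-! ### The integral estimate for stable marginally outer trapped surfaces. -/

section StableMOTS

open Real

/-- Read q = e^c, h = e^σ, s = sin, co = cos, B = β, w = λ', E = E_⊥² + B_⊥², Φ' the derivative of
`poleTerm`. Multiplying the stability inequality by s q²/(hB) and completing the square in w - B'/B
- σ'/2 leaves a total derivative; the square lowers the coefficient of σ'² from 1/2 to 1/4. -/
theorem stability_algebra {q h s co B B' B'' w w' σ σ' τ' K E Φ' : ℝ} (hq : 0 < q) (hh : 0 < h)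
    (hs : 0 < s) (hB : 0 < B)
    (hK : s * (q ^ 2 / h) * K = Φ' - s * (σ + σ' ^ 2 / 2))
    (hI : 0 ≤ - (B * E) + B * K + (B' * w + B * w' - B'') / (q ^ 2 / h)
      + (B * w - B') * (h * (σ' * s ^ 2 + 2 * s * co) / (2 * (q ^ 2 / h) * (h * s ^ 2))
        - (- σ' * (q ^ 2 / h)) / (2 * (q ^ 2 / h) ^ 2))
      - B * w * (B * w - B') / (B * (q ^ 2 / h))
      - (B * (- (q * s * (τ' / (q ^ 2 / h))))) ^ 2 / (B * (h * s ^ 2))) :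
    s * (σ + σ' ^ 2 / 4 + τ' ^ 2 + E * (q * s) ^ 2 / (h * s ^ 2))
      ≤ co * (w - B' / B) + s * (w' - (B'' * B - B' * B') / B ^ 2) + Φ' := by
  have e : co * (w - B' / B) + s * (w' - (B'' * B - B' * B') / B ^ 2) + Φ'
      - s * (σ + σ' ^ 2 / 4 + τ' ^ 2 + E * (q * s) ^ 2 / (h * s ^ 2))
      = s * (q ^ 2 / h) / B * (- (B * E) + B * K + (B' * w + B * w' - B'') / (q ^ 2 / h)
      + (B * w - B') * (h * (σ' * s ^ 2 + 2 * s * co) / (2 * (q ^ 2 / h) * (h * s ^ 2))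
        - (- σ' * (q ^ 2 / h)) / (2 * (q ^ 2 / h) ^ 2))
      - B * w * (B * w - B') / (B * (q ^ 2 / h))
      - (B * (- (q * s * (τ' / (q ^ 2 / h))))) ^ 2 / (B * (h * s ^ 2)))
      + s * (w - B' / B - σ' / 2) ^ 2 := by
    rw [show Φ' = s * (q ^ 2 / h) * K + s * (σ + σ' ^ 2 / 2) by linarith]
    field_simp
    ring
  have h1 : 0 ≤ s * (q ^ 2 / h) / B := by positivity
  have h2 : 0 ≤ s * (w - B' / B - σ' / 2) ^ 2 := by positivity
  linarith [mul_nonneg h1 hI]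

variable {V : Type*} [TopologicalSpace V] [ChartedSpace (E 4) V] [IsManifold (𝓡 4) ∞ V]
  {M : EMSpacetime V} {S : Type*} [TopologicalSpace S] [ChartedSpace (E 2) S]

/-- Transport of a statement about a surface with normals to the initial surface of a family. -/
theorem normals_transport {f : S → V} {L X : ∀ s, TangentSpace (𝓡 4) (f s)}
    (Q : ∀ emb : S → V, (∀ s, TangentSpace (𝓡 4) (emb s)) → (∀ s, TangentSpace (𝓡 4) (emb s)) → Prop)
    (γ β : S → ℝ) {emb : S → V} {ell k : ∀ s, TangentSpace (𝓡 4) (emb s)}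
    (hL : ∀ s, (⟨f s, L s⟩ : TangentBundle (𝓡 4) V) = ⟨emb s, ell s⟩)
    (hX : ∀ s, (⟨f s, X s⟩ : TangentBundle (𝓡 4) V) = ⟨emb s, γ s • ell s - β s • k s⟩)
    (h : Q emb ell k) :
    ∃ k', Q f L k' ∧ ∀ s, X s = γ s • L s - β s • k' s := by
  have he : f = emb := funext fun s => congrArg Bundle.TotalSpace.proj (hL s)
  subst he
  have hl : L = ell := funext fun s => by
    have := hL s
    rwa [Bundle.TotalSpace.mk_inj] at this
  subst hl
  refine ⟨k, h, fun s => ?_⟩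
  have := hX s
  rwa [Bundle.TotalSpace.mk_inj] at this

variable [IsManifold (𝓡 2) ∞ S] {P : FramedSurface M S} {A : AxialSymmetry P} {Ψ : SphereParam S}
  {c : ℝ} {σ τ lam om ψ χ : S → ℝ}

theorem IsAdapted.inducesAxialMetric (h : IsAdapted P A Ψ c σ) :
    InducesAxialMetric Ψ M P.emb (fun x => exp (2 * c - SphereParam.profile Ψ σ x))
      (fun x => exp (SphereParam.profile Ψ σ x) * sin x ^ 2) where
  a_pos x _ _ := exp_pos _
  b_pos x h0 hπ := by have := sin_pos_of_pos_of_lt_pi h0 hπ; positivity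
  q11 x y h0 hπ := (h.q_θθ x y h0 hπ).trans (by rw [h.axisymmetric h.smooth])
  q12 x y h0 hπ := h.q_θφ x y h0 hπ
  q22 x y h0 hπ := (h.q_φφ x y h0 hπ).trans (by rw [h.axisymmetric h.smooth])

theorem IsPotentials.flux_sq (h : IsPotentials P A Ψ c σ τ lam om ψ χ) {x : ℝ} (y : ℝ) (h0 : 0 < x)
    (hπ : x < π) :
    (P.Eperp (SphereParam.pt Ψ x y) ^ 2 + P.Bperp (SphereParam.pt Ψ x y) ^ 2) * (exp c * sin x) ^ 2
      = deriv (SphereParam.profile Ψ ψ) x ^ 2 + deriv (SphereParam.profile Ψ χ) x ^ 2 := by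
  have e1 := h.ψ_eq x y h0 hπ
  have e2 := h.χ_eq x y h0 hπ
  rw [SphereParam.pθ_eq (fun _ _ _ _ => h.adapted.axisymmetric h.ψ_smooth _ _) _ h0 hπ] at e1
  rw [SphereParam.pθ_eq (fun _ _ _ _ => h.adapted.axisymmetric h.χ_smooth _ _) _ h0 hπ] at e2
  rw [e1, e2]
  ring

/-- The density is bounded by the derivative of sin θ (λ' - β'/β) + Φ. Only the values of the
stability inequality along one meridian are used. -/
theorem IsPotentials.estimate_of_stableMOTS (h : IsPotentials P A Ψ c σ τ lam om ψ χ)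
    (hI : IsStableMOTS P A) :
    ∫ x in 0..π, profileDensity (SphereParam.profile Ψ σ) (SphereParam.profile Ψ τ)
      (SphereParam.profile Ψ ψ) (SphereParam.profile Ψ χ) x ≤ 2 + 2 * c := by
  obtain ⟨hexp, γ, β, hγs, hβs, hγ, hβ, f, L, hf, hL, hL0, hX, hnull, hnorm, hstab⟩ := hI
  set σ' := SphereParam.profile Ψ σ
  set τ' := SphereParam.profile Ψ τ
  set ψ' := SphereParam.profile Ψ ψ
  set χ' := SphereParam.profile Ψ χ
  set l' := SphereParam.profile Ψ lam
  set β' := SphereParam.profile Ψ β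
  have sσ : ContDiff ℝ ∞ σ' := SphereParam.profile_smooth Ψ h.adapted.smooth.1
  have sβ : ContDiff ℝ ∞ β' := SphereParam.profile_smooth Ψ hβs.1
  have sl : ContDiff ℝ ∞ l' := SphereParam.profile_smooth Ψ h.lam_smooth
  have hβ0 : ∀ x, 0 < β' x := fun x => hβ _
  -- The initial data of the family agree with `P.emb` and `P.ell` only as points of the tangent
  -- bundle, so everything known about `P` is gathered in one predicate and transported at once.
  obtain ⟨k, ⟨hk, hkn, hlk, hlf, hkf, hind, hω₁, hω₂, hexp0, hEB⟩, hX'⟩ := normals_transport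
    (X := fun s => mfderiv 𝓘(ℝ, ℝ) (𝓡 4) (fun t => f t s) 0 (1 : ℝ))
    (fun emb ell k => (∀ s, M.g (emb s) (k s) (k s) = 0) ∧
      (∀ s v, M.g (emb s) (k s) (mfderiv (𝓡 2) (𝓡 4) emb s v) = 0) ∧
      (∀ s, M.g (emb s) (ell s) (k s) = -1) ∧
      (∀ s, M.g (emb s) (M.T (emb s)) (ell s) < 0) ∧
      (∀ s, M.g (emb s) (M.T (emb s)) (k s) < 0) ∧
      InducesAxialMetric Ψ M emb (fun x => exp (2 * c - σ' x)) (fun x => exp (σ' x) * sin x ^ 2) ∧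
      (∀ x y, 0 < x → x < π → - M.g (emb (SphereParam.pt Ψ x y)) (k (SphereParam.pt Ψ x y))
        (covAlong M.g emb ell (SphereParam.pt Ψ x y) (SphereParam.dθ Ψ x y)) = deriv l' x) ∧
      (∀ x y, 0 < x → x < π → - M.g (emb (SphereParam.pt Ψ x y)) (k (SphereParam.pt Ψ x y))
        (covAlong M.g emb ell (SphereParam.pt Ψ x y) (SphereParam.dφ Ψ x y))
        = - (exp c * sin x * (deriv τ' x / exp (2 * c - σ' x)))) ∧
      (∀ s, expansion M.g emb ell s = 0) ∧
      (∀ x, 0 < x → x < π → (M.F (emb (SphereParam.pt Ψ x 0)) (ell (SphereParam.pt Ψ x 0))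
          (k (SphereParam.pt Ψ x 0)) ^ 2
        + hodgeDual M.g M.F M.vol (emb (SphereParam.pt Ψ x 0)) (ell (SphereParam.pt Ψ x 0))
          (k (SphereParam.pt Ψ x 0)) ^ 2) * (exp c * sin x) ^ 2
        = deriv ψ' x ^ 2 + deriv χ' x ^ 2))
    γ β hL0 hX
    ⟨P.k_null, P.k_normal, P.ell_k, P.ell_future, P.k_future, h.adapted.inducesAxialMetric,
      fun x y h0 hπ => (h.Omega_eq x y h0 hπ).1, fun x y h0 hπ => (h.Omega_eq x y h0 hπ).2, hexp,
      fun x h0 hπ => h.flux_sq 0 h0 hπ⟩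
  have hg : ContDiff ℝ ∞ fun x => deriv l' x - deriv β' x / β' x :=
    (deriv_smooth sl).sub ((deriv_smooth sβ).div sβ fun x => (hβ0 x).ne')
  refine integral_profileDensity_le sσ hg h.density_integrable h.adapted.profile_pole.1
    h.adapted.profile_pole.2 fun x hx => ?_
  have hs := sin_pos_of_pos_of_lt_pi hx.1 hx.2
  have hst := hind.stability hf hL hnull hnorm hk hkn hlk hlf hkf (β := β')
    (γ := SphereParam.profile Ψ γ) (fun x y => by
      rw [hX', h.adapted.axisymmetric hγs, h.adapted.axisymmetric hβs])
    (fun x => hγ _) hβ0 hω₁ hω₂ hexp0 hx.1 hx.2 (hstab _)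
  have e1 : deriv (fun x => sin x * (deriv l' x - deriv β' x / β' x) + poleTerm σ' x) x
      = cos x * (deriv l' x - deriv β' x / β' x) + sin x * (deriv (deriv l') x
        - (deriv (deriv β') x * β' x - deriv β' x * deriv β' x) / β' x ^ 2)
        + deriv (poleTerm σ') x :=
    (((hasDerivAt_sin x).mul ((smooth_hasDerivAt (deriv_smooth sl) x).sub
      ((smooth_hasDerivAt (deriv_smooth sβ) x).div (smooth_hasDerivAt sβ x) (hβ0 x).ne'))).add
      (smooth_hasDerivAt (poleTerm_smooth sσ) x)).deriv
  have e2 : deriv (fun x => β' x * deriv l' x - deriv β' x) x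
      = deriv β' x * deriv l' x + β' x * deriv (deriv l') x - deriv (deriv β') x :=
    (((smooth_hasDerivAt sβ x).mul (smooth_hasDerivAt (deriv_smooth sl) x)).sub
      (smooth_hasDerivAt (deriv_smooth sβ) x)).deriv
  have ea : exp (2 * c - σ' x) = exp c ^ 2 / exp (σ' x) := by
    rw [exp_sub, ← exp_nat_mul]
    norm_num
  have hK := axialCurvature_adapted sσ c hs
  rw [e2, (hasDerivAt_radial sσ c x).deriv, (hasDerivAt_azimuthal sσ x).deriv] at hst
  simp only [ea] at hst hK
  rw [e1, profileDensity, ← hEB x hx.1 hx.2]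
  exact stability_algebra (exp_pos c) (exp_pos _) hs (hβ0 x) hK hst

end StableMOTS


/-! ### Covariant derivatives of fields along a fixed surface. -/

section InitialSurface

open Real

variable {V : Type*} [TopologicalSpace V] [ChartedSpace (E 4) V] [IsManifold (𝓡 4) ∞ V]
  {S : Type*} [TopologicalSpace S] [ChartedSpace (E 2) S]
  (Ψ : SphereParam S) (M : EMSpacetime V)

section Fixed

variable {f : S → V} {Y Z : ∀ s, TangentSpace (𝓡 4) (f s)}

theorem const_family_smooth (hf : ContMDiff (𝓡 2) (𝓡 4) ∞ f) :
    ContMDiff (𝓘(ℝ, ℝ).prod (𝓡 2)) (𝓡 4) ∞ (fun z : ℝ × S => (fun _ : ℝ => f) z.1 z.2) :=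
  hf.comp contMDiff_snd

theorem const_field_smooth
    (hY : ContMDiff (𝓡 2) (𝓡 4).tangent ∞ (fun s => (⟨f s, Y s⟩ : TangentBundle (𝓡 4) V))) :
    ContMDiff (𝓘(ℝ, ℝ).prod (𝓡 2)) (𝓡 4).tangent ∞
      (fun z : ℝ × S => (⟨f z.2, Y z.2⟩ : TangentBundle (𝓡 4) V)) :=
  hY.comp contMDiff_snd

variable (hf : ContMDiff (𝓡 2) (𝓡 4) ∞ f)
  (hY : ContMDiff (𝓡 2) (𝓡 4).tangent ∞ (fun s => (⟨f s, Y s⟩ : TangentBundle (𝓡 4) V)))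
  (hZ : ContMDiff (𝓡 2) (𝓡 4).tangent ∞ (fun s => (⟨f s, Z s⟩ : TangentBundle (𝓡 4) V)))

include hf hY in
theorem cov_fixed {p : V} {w : ℝ × ℝ × ℝ}
    (hp : f (SphereParam.coords Ψ w) ∈ (chartAt (E 4) p).source) {a : ℝ × ℝ × ℝ} (ha : a.1 = 0) :
    cov (M.chartΓ p) (chartView p (familyMap Ψ fun _ => f))
      (familyField Ψ p (fun _ => f) fun _ => Y) w a
      = push p (f (SphereParam.coords Ψ w)) (covAlong M.g f Y
        (SphereParam.coords Ψ w) (mfderiv 𝓘(ℝ, ℝ × ℝ × ℝ) (𝓡 2) (SphereParam.coords Ψ) w a)) :=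
  cov_family (f := fun _ => f) (L := fun _ => Y) Ψ M (const_family_smooth hf)
    (const_field_smooth hY) hp ha

include hf in
theorem fixedDomain_open (p : V) :
    IsOpen (familyMap Ψ (fun _ => f) ⁻¹' (chartAt (E 4) p).source) :=
  (chartAt (E 4) p).open_source.preimage
    (family_smooth Ψ (f := fun _ => f) (const_family_smooth hf)).continuous

include hf hY in
theorem fixedField_diffAt {p : V} {w : ℝ × ℝ × ℝ}
    (hp : f (SphereParam.coords Ψ w) ∈ (chartAt (E 4) p).source) :
    DifferentiableAt ℝ (familyField Ψ p (fun _ => f) fun _ => Y) w :=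
  (familyField_smooth Ψ (f := fun _ => f) (L := fun _ => Y) (const_field_smooth hY)
    (fun _ h => h)).diffAt (fixedDomain_open Ψ hf p) hp

include hf hY hZ in
theorem EMSpacetime.covAlong_add (hYZ : ContMDiff (𝓡 2) (𝓡 4).tangent ∞
      (fun s => (⟨f s, Y s + Z s⟩ : TangentBundle (𝓡 4) V))) (w : ℝ × ℝ × ℝ)
    {a : ℝ × ℝ × ℝ} (ha : a.1 = 0) :
    let u := mfderiv 𝓘(ℝ, ℝ × ℝ × ℝ) (𝓡 2) (SphereParam.coords Ψ) w a
    covAlong M.g f (fun s => Y s + Z s) (SphereParam.coords Ψ w) u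
      = covAlong M.g f Y (SphereParam.coords Ψ w) u + covAlong M.g f Z (SphereParam.coords Ψ w) u := by
  intro u
  set p := f (SphereParam.coords Ψ w)
  have hp : p ∈ (chartAt (E 4) p).source := mem_chart_source (E 4) p
  have e1 := cov_fixed Ψ M hf hY hp ha
  have e2 := cov_fixed Ψ M hf hZ hp ha
  have e3 := cov_fixed Ψ M hf hYZ hp ha
  have e4 : familyField Ψ p (fun _ => f) (fun _ s => Y s + Z s)
      = fun w => familyField Ψ p (fun _ => f) (fun _ => Y) w
        + familyField Ψ p (fun _ => f) (fun _ => Z) w :=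
    funext fun w => (push p (f (SphereParam.coords Ψ w))).map_add _ _
  rw [e4, cov_add (fixedField_diffAt Ψ hf hY hp) (fixedField_diffAt Ψ hf hZ hp), e1, e2] at e3
  exact (push_self p _).symm.trans (e3.symm.trans
    (congrArg₂ (fun a b : E 4 => a + b) (push_self p _) (push_self p _)))

-- Compatibility of the metric, applied to a pair of fields whose inner product is constant.
include hf hY hZ in
theorem EMSpacetime.covAlong_skew {r : ℝ} (hr : ∀ s, M.g (f s) (Y s) (Z s) = r)
    (w : ℝ × ℝ × ℝ) {a : ℝ × ℝ × ℝ} (ha : a.1 = 0) :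
    let u := mfderiv 𝓘(ℝ, ℝ × ℝ × ℝ) (𝓡 2) (SphereParam.coords Ψ) w a
    let s := SphereParam.coords Ψ w
    M.g (f s) (covAlong M.g f Y s u) (Z s) + M.g (f s) (Y s) (covAlong M.g f Z s u) = 0 := by
  intro u s
  set p := f s
  have hp : p ∈ (chartAt (E 4) p).source := mem_chart_source (E 4) p
  have e1 := cov_fixed Ψ M hf hY hp ha
  have e2 := cov_fixed Ψ M hf hZ hp ha
  set O := familyMap Ψ (fun _ => f) ⁻¹' (chartAt (E 4) p).source
  have hO : IsOpen O := fixedDomain_open Ψ hf p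
  have hfs : ContMDiff 𝓘(ℝ, ℝ × ℝ × ℝ) (𝓡 4) ∞ (familyMap Ψ fun _ => f) :=
    family_smooth Ψ (f := fun _ => f) (const_family_smooth hf)
  have hYs := familyField_smooth Ψ (p := p) (f := fun _ => f) (L := fun _ => Y) (O := O)
    (const_field_smooth hY) fun _ h => h
  have hZs := familyField_smooth Ψ (p := p) (f := fun _ => f) (L := fun _ => Z) (O := O)
    (const_field_smooth hZ) fun _ h => h
  have e3 := (M.leviCivita_chart p).fderiv_pair hO
    (chartView_smooth hfs (fun _ h => h)) (chartView_mapsTo fun _ h => h) hYs hZs (w := w) hp a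
  have e4 : (fun w => chartG M.g p (chartView p (familyMap Ψ fun _ => f) w)
      (familyField Ψ p (fun _ => f) (fun _ => Y) w) (familyField Ψ p (fun _ => f) (fun _ => Z) w))
      =ᶠ[nhds w] fun _ => r := by
    filter_upwards [hO.mem_nhds hp] with z hz
    exact (chartG_push M.g hz _ _).trans (hr _)
  rw [e4.fderiv_eq, e1, e2] at e3
  have e5 := (congrArg₂ (· + ·) (chartG_push M.g hp _ _) (chartG_push M.g hp _ _)).symm.trans
    e3.symm
  exact e5.trans (by rw [fderiv_fun_const]; rfl)

end Fixed

variable {f : ℝ → S → V} {e : ∀ s, TangentSpace (𝓡 4) (f 0 s)} {α : S → ℝ} {p : V}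

/-- The covariant derivative of the velocity `α e` of a family, at the initial surface. -/
theorem hess_initial (hf : ContMDiff (𝓘(ℝ, ℝ).prod (𝓡 2)) (𝓡 4) ∞ (fun z : ℝ × S => f z.1 z.2))
    (he : ContMDiff (𝓡 2) (𝓡 4).tangent ∞ (fun s => (⟨f 0 s, e s⟩ : TangentBundle (𝓡 4) V)))
    (hα : ContMDiff (𝓡 2) 𝓘(ℝ, ℝ) ∞ α)
    (hX : ∀ s, mfderiv 𝓘(ℝ, ℝ) (𝓡 4) (fun t => f t s) 0 (1 : ℝ) = α s • e s) {x y : ℝ}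
    (hp : familyMap Ψ f (0, x, y) ∈ (chartAt (E 4) p).source) {a : ℝ × ℝ × ℝ} (ha : a.1 = 0) :
    ∃ r : ℝ, hessMap (M.chartΓ p) (chartView p (familyMap Ψ f)) a dirT (0, x, y)
      = r • push p (f 0 (SphereParam.pt Ψ x y)) (e (SphereParam.pt Ψ x y))
        + α (SphereParam.pt Ψ x y) • push p (f 0 (SphereParam.pt Ψ x y))
          (covAlong M.g (f 0) e (SphereParam.pt Ψ x y)
            (mfderiv 𝓘(ℝ, ℝ × ℝ × ℝ) (𝓡 2) (SphereParam.coords Ψ) (0, x, y) a)) := by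
  have hf0 := family_slice_smooth hf 0
  set w : ℝ × ℝ × ℝ := (0, x, y)
  have e1 := cov_fixed Ψ M hf0 he (w := w) hp ha
  set O := familyMap Ψ f ⁻¹' (chartAt (E 4) p).source
  have hO : IsOpen O := (chartAt (E 4) p).open_source.preimage (family_smooth Ψ hf).continuous
  have hF := chartView_smooth (family_smooth Ψ hf) (p := p) (O := O) fun _ h => h
  have hk : HasFDerivAt (fun z : ℝ × ℝ × ℝ => ((0 : ℝ), z.2))
      ((0 : ℝ × ℝ × ℝ →L[ℝ] ℝ).prod (ContinuousLinearMap.snd ℝ ℝ (ℝ × ℝ))) w :=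
    (hasFDerivAt_const _ _).prodMk hasFDerivAt_snd
  have e2 := cov_comp (Γ := M.chartΓ p) (F := chartView p (familyMap Ψ f))
    (Y := fun w => fderiv ℝ (chartView p (familyMap Ψ f)) w dirT)
    (k := fun z : ℝ × ℝ × ℝ => ((0 : ℝ), z.2)) (w := w)
    (hF.diffAt hO hp) ((hF.dir hO dirT).diffAt hO hp) hk.differentiableAt a
  have ea : ((0 : ℝ × ℝ × ℝ →L[ℝ] ℝ).prod (ContinuousLinearMap.snd ℝ ℝ (ℝ × ℝ))) a = a :=
    Prod.ext ha.symm rfl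
  rw [hk.fderiv, ea] at e2
  have e3 : (fun z : ℝ × ℝ × ℝ => fderiv ℝ (chartView p (familyMap Ψ f)) (0, z.2) dirT)
      =ᶠ[nhds w] fun z => α (SphereParam.coords Ψ z)
        • familyField Ψ p (fun _ => f 0) (fun _ => e) z := by
    filter_upwards [(fixedDomain_open Ψ hf0 p).mem_nhds (x := w) hp] with z hz
    refine (familyMap_dirT Ψ hf (w := (0, z.2)) hz).trans ?_
    refine (congrArg (push p (f 0 (SphereParam.coords Ψ z))) (hX (SphereParam.coords Ψ z))).trans ?_
    exact (push p (f 0 (SphereParam.coords Ψ z))).map_smul _ _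
  have hαd : DifferentiableAt ℝ (fun z => α (SphereParam.coords Ψ z)) w :=
    (SphereParam.comp_coords_smooth Ψ hα).differentiable (by simp) w
  have e4 := cov_congr (Γ := M.chartΓ p) (F := chartView p (familyMap Ψ fun _ => f 0))
    Filter.EventuallyEq.rfl e3 a
  rw [cov_smul hαd (fixedField_diffAt Ψ hf0 he hp), e1] at e4
  -- The coefficient is the derivative of `α` along the surface; it stays anonymous since `e` will
  -- be paired with vectors orthogonal to it.
  exact ⟨_, e2.symm.trans e4⟩

end InitialSurface


/-! ### Pointwise second variation of area in a maximal slice. -/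

section SecondVariation

open Real

variable {V : Type*} [TopologicalSpace V] [ChartedSpace (E 4) V] [IsManifold (𝓡 4) ∞ V]
  {S : Type*} [TopologicalSpace S] [ChartedSpace (E 2) S]
  (Ψ : SphereParam S) (g : BilinField V) {f : ℝ → S → V}

/-- The components of the metric pulled back by a family of surfaces. -/
def familyPair (f : ℝ → S → V) (u v w : ℝ × ℝ × ℝ) : ℝ :=
  g (familyMap Ψ f w) (mfderiv 𝓘(ℝ, ℝ × ℝ × ℝ) (𝓡 4) (familyMap Ψ f) w u)
    (mfderiv 𝓘(ℝ, ℝ × ℝ × ℝ) (𝓡 4) (familyMap Ψ f) w v)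

/-- The determinant of the first fundamental forms of a family of surfaces. -/
def familyDet (f : ℝ → S → V) (w : ℝ × ℝ × ℝ) : ℝ :=
  familyPair Ψ g f dirX dirX w * familyPair Ψ g f dirY dirY w - familyPair Ψ g f dirX dirY w ^ 2

/-- The components of the acceleration of a family of surfaces. -/
def familyAccel (f : ℝ → S → V) (v w : ℝ × ℝ × ℝ) : ℝ :=
  fderiv ℝ (familyPair Ψ g f dirT v) w dirT - (1 / 2) * fderiv ℝ (familyPair Ψ g f dirT dirT) w v

variable {Ψ g}

theorem familyPair_smooth (hg : SmoothBilin g)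
    (hf : ContMDiff (𝓘(ℝ, ℝ).prod (𝓡 2)) (𝓡 4) ∞ (fun z : ℝ × S => f z.1 z.2)) (u v : ℝ × ℝ × ℝ) :
    ContDiff ℝ ∞ (familyPair Ψ g f u v) := by
  have h : ContMDiff 𝓘(ℝ, ℝ × ℝ × ℝ) (𝓡 4) ∞ (familyMap Ψ f) := family_smooth Ψ hf
  exact contDiffOn_univ.mp (hg.pair_smooth (mfderiv_smooth h u).contMDiffOn
    (mfderiv_smooth h v).contMDiffOn)

theorem dir_smooth_global {φ : ℝ × ℝ × ℝ → ℝ} (h : ContDiff ℝ ∞ φ) (u : ℝ × ℝ × ℝ) :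
    ContDiff ℝ ∞ fun w => fderiv ℝ φ w u :=
  contDiffOn_univ.mp (h.contDiffOn.dir isOpen_univ u)

theorem familyAccel_smooth (hg : SmoothBilin g)
    (hf : ContMDiff (𝓘(ℝ, ℝ).prod (𝓡 2)) (𝓡 4) ∞ (fun z : ℝ × S => f z.1 z.2)) (v : ℝ × ℝ × ℝ) :
    ContDiff ℝ ∞ (familyAccel Ψ g f v) :=
  (dir_smooth_global (familyPair_smooth hg hf _ _) _).sub
    (contDiff_const.mul (dir_smooth_global (familyPair_smooth hg hf _ _) _))

theorem chartG_familyPair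
    (hf : ContMDiff (𝓘(ℝ, ℝ).prod (𝓡 2)) (𝓡 4) ∞ (fun z : ℝ × S => f z.1 z.2)) {p : V}
    {w : ℝ × ℝ × ℝ} (hp : familyMap Ψ f w ∈ (chartAt (E 4) p).source) (u v : ℝ × ℝ × ℝ) :
    chartG g p (chartView p (familyMap Ψ f) w) (fderiv ℝ (chartView p (familyMap Ψ f)) w u)
      (fderiv ℝ (chartView p (familyMap Ψ f)) w v) = familyPair Ψ g f u v w := by
  have h : ContMDiff 𝓘(ℝ, ℝ × ℝ × ℝ) (𝓡 4) ∞ (familyMap Ψ f) := family_smooth Ψ hf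
  rw [chartView_fderiv h hp, chartView_fderiv h hp]
  exact chartG_push g hp _ _

theorem chart_familyAccel
    (hf : ContMDiff (𝓘(ℝ, ℝ).prod (𝓡 2)) (𝓡 4) ∞ (fun z : ℝ × S => f z.1 z.2)) {p : V}
    {w : ℝ × ℝ × ℝ} (hp : familyMap Ψ f w ∈ (chartAt (E 4) p).source) (v : ℝ × ℝ × ℝ) :
    accel (chartG g p) (chartView p (familyMap Ψ f)) v w = familyAccel Ψ g f v w := by
  have hO : IsOpen (familyMap Ψ f ⁻¹' (chartAt (E 4) p).source) :=
    (chartAt (E 4) p).open_source.preimage (family_smooth Ψ hf).continuous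
  have ev : ∀ u v, (fun w => chartG g p (chartView p (familyMap Ψ f) w)
      (fderiv ℝ (chartView p (familyMap Ψ f)) w u) (fderiv ℝ (chartView p (familyMap Ψ f)) w v))
      =ᶠ[nhds w] familyPair Ψ g f u v := fun u v => by
    filter_upwards [hO.mem_nhds hp] with z hz using chartG_familyPair hf hz u v
  rw [accel, (ev _ _).fderiv_eq, (ev _ _).fderiv_eq, familyAccel]

variable {M : EMSpacetime V} {a b : ℝ → ℝ} {n : ∀ t s, TangentSpace (𝓡 4) (f t s)}
  {e : ∀ s, TangentSpace (𝓡 4) (f 0 s)} {α : S → ℝ} {α' : ℝ → ℝ}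

/-- The unit normal in the slice is e₁ = ℓ/2 - k, so its sectional curvatures expand into components
in the null frame; the mixed ones agree by pair symmetry. -/
theorem riem_unit_sum {p : V} (M : EMSpacetime V) (l k F : E 4) :
    let y := extChartAt (𝓡 4) p p
    let R : E 4 → E 4 → E 4 → E 4 → ℝ := fun u v w z =>
      chartG M.g p y (riem (M.chartΓ p) y u v w) z
    R ((1 / 2 : ℝ) • l - k) F F ((1 / 2 : ℝ) • l - k)
      = R k F l F - (1 / 4) * R l F l F - R k F k F := by
  intro y R
  have hy : y ∈ (extChartAt (𝓡 4) p).target := mem_extChartAt_target p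
  have lc := M.leviCivita_chart p
  have skew : R ((1 / 2 : ℝ) • l - k) F F ((1 / 2 : ℝ) • l - k)
      = - R ((1 / 2 : ℝ) • l - k) F ((1 / 2 : ℝ) • l - k) F := lc.riem_skew hy _ _ _ _
  have pair : R l F k F = R k F l F := lc.riem_pair hy _ _ _ _
  have ex : R ((1 / 2 : ℝ) • l - k) F ((1 / 2 : ℝ) • l - k) F
      = (1 / 4) * R l F l F - (1 / 2) * R l F k F - (1 / 2) * R k F l F + R k F k F := by
    simp only [R, riem, map_sub, map_add, map_smul, sub_apply, add_apply, smul_apply, smul_eq_mul]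
    ring
  rw [skew, ex, pair]
  ring

set_option maxHeartbeats 1600000 in
/-- The pointwise form of the second variation of area of a minimal surface in a maximal slice. -/
theorem InducesAxialMetric.second_variation (h : InducesAxialMetric Ψ M (f 0) a b)
    (hf : ContMDiff (𝓘(ℝ, ℝ).prod (𝓡 2)) (𝓡 4) ∞ (fun z : ℝ × S => f z.1 z.2))
    (hn : ContMDiff (𝓘(ℝ, ℝ).prod (𝓡 2)) (𝓡 4).tangent ∞
      (fun z : ℝ × S => (⟨f z.1 z.2, n z.1 z.2⟩ : TangentBundle (𝓡 4) V)))
    (hunit : ∀ t s, M.g (f t s) (n t s) (n t s) = -1)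
    (hnF : ∀ w u, M.g (familyMap Ψ f w) (n w.1 (SphereParam.coords Ψ w))
      (mfderiv 𝓘(ℝ, ℝ × ℝ × ℝ) (𝓡 4) (familyMap Ψ f) w u) = 0)
    (he : ContMDiff (𝓡 2) (𝓡 4).tangent ∞ (fun s => (⟨f 0 s, e s⟩ : TangentBundle (𝓡 4) V)))
    (hα : ContMDiff (𝓡 2) 𝓘(ℝ, ℝ) ∞ α)
    (hX : ∀ s, mfderiv 𝓘(ℝ, ℝ) (𝓡 4) (fun t => f t s) 0 (1 : ℝ) = α s • e s)
    (hα' : ∀ x y, α (SphereParam.pt Ψ x y) = α' x) (hα0 : ∀ x, 0 < α' x)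
    (hee : ∀ s, M.g (f 0 s) (e s) (e s) = 1) (hne : ∀ s, M.g (f 0 s) (n 0 s) (e s) = 0)
    (hen : ∀ s v, M.g (f 0 s) (e s) (mfderiv (𝓡 2) (𝓡 4) (f 0) s v) = 0)
    (hell : ContMDiff (𝓡 2) (𝓡 4).tangent ∞
      (fun s => (⟨f 0 s, n 0 s + e s⟩ : TangentBundle (𝓡 4) V)))
    (hlf : ∀ s, M.g (f 0 s) (M.T (f 0 s)) (n 0 s + e s) < 0)
    (hkf : ∀ s, M.g (f 0 s) (M.T (f 0 s)) ((1 / 2 : ℝ) • (n 0 s - e s)) < 0)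
    {x y ω₁ ω₂ : ℝ} (h0 : 0 < x) (hπ : x < π)
    (hω₁ : - M.g (f 0 (SphereParam.pt Ψ x y))
      ((1 / 2 : ℝ) • (n 0 (SphereParam.pt Ψ x y) - e (SphereParam.pt Ψ x y)))
      (covAlong M.g (f 0) (fun s => n 0 s + e s) (SphereParam.pt Ψ x y) (SphereParam.dθ Ψ x y)) = ω₁)
    (hω₂ : - M.g (f 0 (SphereParam.pt Ψ x y))
      ((1 / 2 : ℝ) • (n 0 (SphereParam.pt Ψ x y) - e (SphereParam.pt Ψ x y)))
      (covAlong M.g (f 0) (fun s => n 0 s + e s) (SphereParam.pt Ψ x y) (SphereParam.dφ Ψ x y)) = ω₂)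
    (hexp : ∀ s, expansion M.g (f 0) e s = 0)
    (hmax : let p := f 0 (SphereParam.pt Ψ x y)
      let G := chartG M.g p
      let F := chartView p (familyMap Ψ f)
      let w : ℝ × ℝ × ℝ := (0, x, y)
      G (F w) (cov (M.chartΓ p) F (familyField Ψ p f n) w dirT) (fderiv ℝ F w dirT) / α' x ^ 2
      + G (F w) (cov (M.chartΓ p) F (familyField Ψ p f n) w dirX) (fderiv ℝ F w dirX) / a x
      + G (F w) (cov (M.chartΓ p) F (familyField Ψ p f n) w dirY) (fderiv ℝ F w dirY) / b x = 0) :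
    let s := SphereParam.pt Ψ x y
    let C := M.F (f 0 s) (n 0 s + e s) ((1 / 2 : ℝ) • (n 0 s - e s)) ^ 2
      + hodgeDual M.g M.F M.vol (f 0 s) (n 0 s + e s) ((1 / 2 : ℝ) • (n 0 s - e s)) ^ 2
    fderiv ℝ (familyDet Ψ M.g f) (0, x, y) dirT = 0 ∧
    fderiv ℝ (fun w => fderiv ℝ (familyDet Ψ M.g f) w dirT) (0, x, y) dirT / (2 * a x * b x)
      ≤ deriv (fun x => α' x ^ 2) x ^ 2 / (4 * α' x ^ 2 * a x)
        + α' x ^ 2 * (axialCurvature a b x - C)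
        - (α' x * ω₁) ^ 2 / a x - (α' x * ω₂) ^ 2 / b x
        + (fderiv ℝ (familyAccel Ψ M.g f dirX) (0, x, y) dirX / a x
          + fderiv ℝ (familyAccel Ψ M.g f dirY) (0, x, y) dirY / b x
          + familyAccel Ψ M.g f dirX (0, x, y) * (deriv b x / (2 * a x * b x)
            - deriv a x / (2 * a x ^ 2))) := by
  intro s₀ C
  set p : V := f 0 s₀ with hp
  set w₀ : ℝ × ℝ × ℝ := (0, x, y) with hw₀
  have hm : w₀ ∈ familyDomain Ψ f p := ⟨mem_chart_source (E 4) p, h0, hπ⟩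
  have A := h.axialFamily hf p
  have hns : ContDiffOn ℝ ∞ (familyField Ψ p f n) (familyDomain Ψ f p) :=
    familyField_smooth Ψ hn fun _ hw => hw.1
  have hfm : ContMDiff 𝓘(ℝ, ℝ × ℝ × ℝ) (𝓡 4) ∞ (familyMap Ψ f) := family_smooth Ψ hf
  have hf0 : ContMDiff (𝓡 2) (𝓡 4) ∞ (f 0) := family_slice_smooth hf 0
  have hn0 : ContMDiff (𝓡 2) (𝓡 4).tangent ∞
      (fun s => (⟨f 0 s, n 0 s⟩ : TangentBundle (𝓡 4) V)) :=
    hn.comp (contMDiff_const.prodMk contMDiff_id)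
  have pr : ∀ {w}, w ∈ familyDomain Ψ f p → ∀ u v, chartG M.g p (chartView p (familyMap Ψ f) w)
      (push p (familyMap Ψ f w) u) (push p (familyMap Ψ f w) v) = M.g (familyMap Ψ f w) u v :=
    fun hw u v => chartG_push M.g hw.1 u v
  have hax := h.a_pos x h0 hπ
  have hbx := h.b_pos x h0 hπ
  have hαx := hα0 x
  have dT : ∀ x y, (0, x, y) ∈ familyDomain Ψ f p →
      fderiv ℝ (chartView p (familyMap Ψ f)) (0, x, y) dirT
        = α' x • push p (familyMap Ψ f (0, x, y)) (e (SphereParam.pt Ψ x y)) := fun x y hw =>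
    (familyMap_dirT Ψ hf hw.1).trans ((congrArg (push p (familyMap Ψ f (0, x, y)))
      (hX (SphereParam.pt Ψ x y))).trans (((push p (familyMap Ψ f (0, x, y))).map_smul _ _).trans
        (by rw [hα'])))
  -- the normal fundamental form
  have hP : ∀ (d : ℝ × ℝ × ℝ) (u : TangentSpace (𝓡 2) s₀) (r : ℝ), d.1 = 0 →
      mfderiv 𝓘(ℝ, ℝ × ℝ × ℝ) (𝓡 2) (SphereParam.coords Ψ) w₀ d = u →
      - M.g (f 0 s₀) ((1 / 2 : ℝ) • (n 0 s₀ - e s₀))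
        (covAlong M.g (f 0) (fun s => n 0 s + e s) s₀ u) = r →
      chartG M.g p (chartView p (familyMap Ψ f) w₀)
        (cov (M.chartΓ p) (chartView p (familyMap Ψ f)) (familyField Ψ p f n) w₀ d)
        (fderiv ℝ (chartView p (familyMap Ψ f)) w₀ dirT) = α' x * r := by
    intro d u r hd hu hr
    have k1 := M.covAlong_add Ψ hf0 hn0 he hell w₀ hd
    have k2 := M.covAlong_skew Ψ hf0 hn0 hn0 (hunit 0) w₀ hd
    have k3 := M.covAlong_skew Ψ hf0 he he hee w₀ hd
    have k4 := M.covAlong_skew Ψ hf0 hn0 he hne w₀ hd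
    rw [hu] at k1 k2 k3 k4
    change covAlong M.g (f 0) (fun s => n 0 s + e s) s₀ u
      = covAlong M.g (f 0) (n 0) s₀ u + covAlong M.g (f 0) e s₀ u at k1
    change M.g (f 0 s₀) (covAlong M.g (f 0) (n 0) s₀ u) (n 0 s₀)
      + M.g (f 0 s₀) (n 0 s₀) (covAlong M.g (f 0) (n 0) s₀ u) = 0 at k2
    change M.g (f 0 s₀) (covAlong M.g (f 0) e s₀ u) (e s₀)
      + M.g (f 0 s₀) (e s₀) (covAlong M.g (f 0) e s₀ u) = 0 at k3
    change M.g (f 0 s₀) (covAlong M.g (f 0) (n 0) s₀ u) (e s₀)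
      + M.g (f 0 s₀) (n 0 s₀) (covAlong M.g (f 0) e s₀ u) = 0 at k4
    rw [M.g_symm _ (covAlong M.g (f 0) (n 0) s₀ u) (n 0 s₀)] at k2
    rw [M.g_symm _ (covAlong M.g (f 0) e s₀ u) (e s₀)] at k3
    -- With k = (n - e)/2 and ℓ = n + e, the constancy of g(n,n), g(e,e) and g(n,e) reduces -g(k,
    -- ∇ℓ) to g(∇n, e).
    have k5 : M.g (f 0 s₀) (covAlong M.g (f 0) (n 0) s₀ u) (e s₀) = r := by
      rw [← hr, k1, map_add, map_smul, map_sub]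
      have k6 := M.g_symm (f 0 s₀) (e s₀) (covAlong M.g (f 0) (n 0) s₀ u)
      set N₀ : E 4 := n 0 s₀
      set e₀ : E 4 := e s₀
      set c₁ : E 4 := covAlong M.g (f 0) (n 0) s₀ u
      set c₂ : E 4 := covAlong M.g (f 0) e s₀ u
      set B : E 4 →L[ℝ] E 4 →L[ℝ] ℝ := M.g (f 0 s₀)
      change B c₁ e₀ = - (((1 / 2 : ℝ) • (B N₀ - B e₀)) c₁ + ((1 / 2 : ℝ) • (B N₀ - B e₀)) c₂)
      change B N₀ c₁ + B N₀ c₁ = 0 at k2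
      change B e₀ c₂ + B e₀ c₂ = 0 at k3
      change B c₁ e₀ + B N₀ c₂ = 0 at k4
      change B e₀ c₁ = B c₁ e₀ at k6
      simp only [smul_apply, sub_apply, smul_eq_mul]
      linarith
    have cv := cov_family Ψ M hf hn hm.1 hd
    rw [hu] at cv
    rw [cv, dT x y hm, map_smul, smul_eq_mul]
    exact congrArg (α' x * ·) ((pr hm _ _).trans k5)
  have hmin : chartG M.g p (chartView p (familyMap Ψ f) w₀)
        (hessMap (M.chartΓ p) (chartView p (familyMap Ψ f)) dirX dirT w₀)
        (fderiv ℝ (chartView p (familyMap Ψ f)) w₀ dirX) * b x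
      + chartG M.g p (chartView p (familyMap Ψ f) w₀)
        (hessMap (M.chartΓ p) (chartView p (familyMap Ψ f)) dirY dirT w₀)
        (fderiv ℝ (chartView p (familyMap Ψ f)) w₀ dirY) * a x = 0 := by
    have q11 := h.q11 x y h0 hπ
    have q12 := h.q12 x y h0 hπ
    have q22 := h.q22 x y h0 hπ
    have h2 := metricTrace_two (inducedMetric_bilin M.g (f 0) s₀) (M.covAlong_bilin (f 0) e s₀)
      (SphereParam.dθ Ψ x y) (SphereParam.dφ Ψ x y) (M.g_symm _ _ _) (by
        simp only [s₀]
        rw [q11, q12, q22]; simp; exact ⟨hax.ne', hbx.ne'⟩)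
    have h3 := h2.symm.trans (hexp s₀)
    simp only [s₀] at h3
    rw [q11, q12, q22] at h3
    have hab : a x * b x - 0 ^ 2 ≠ 0 := by simp; exact ⟨hax.ne', hbx.ne'⟩
    have h4 := (div_eq_zero_iff.mp h3).resolve_right hab
    -- The velocity is αe, so its derivative is a multiple of e plus α∇e, and the first term is
    -- orthogonal to the surface.
    have key : ∀ (d : ℝ × ℝ × ℝ) (u : TangentSpace (𝓡 2) s₀), d.1 = 0 →
        mfderiv 𝓘(ℝ, ℝ × ℝ × ℝ) (𝓡 2) (SphereParam.coords Ψ) w₀ d = u →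
        fderiv ℝ (chartView p (familyMap Ψ f)) w₀ d
          = push p (familyMap Ψ f w₀) (mfderiv (𝓡 2) (𝓡 4) (f 0) s₀ u) →
        chartG M.g p (chartView p (familyMap Ψ f) w₀)
        (hessMap (M.chartΓ p) (chartView p (familyMap Ψ f)) d dirT w₀)
        (fderiv ℝ (chartView p (familyMap Ψ f)) w₀ d)
        = α' x * M.g (f 0 s₀) (covAlong M.g (f 0) e s₀ u)
          (mfderiv (𝓡 2) (𝓡 4) (f 0) s₀ u) := by
      intro d u hd hu hF
      obtain ⟨r, hr⟩ := hess_initial Ψ M hf he hα hX hm.1 hd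
      rw [hu] at hr
      rw [hr, hF, map_add, map_smul, map_smul, add_apply, smul_apply, smul_apply, smul_eq_mul,
        smul_eq_mul, hα']
      have t1 := (congrArg (r * ·) ((pr hm _ _).trans (hen s₀ u))).trans (mul_zero r)
      have t2 := congrArg (α' x * ·) (pr hm (covAlong M.g (f 0) e s₀ u)
        (mfderiv (𝓡 2) (𝓡 4) (f 0) s₀ u))
      exact (congrArg₂ (· + ·) t1 t2).trans (zero_add _)
    rw [key dirX _ rfl (SphereParam.coords_dirX Ψ w₀) (familyMap_dirX Ψ hf hm.1),
      key dirY _ rfl (SphereParam.coords_dirY Ψ w₀) (familyMap_dirY Ψ hf hm.1)]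
    change b x * M.g (f 0 s₀) (covAlong M.g (f 0) e s₀ (SphereParam.dθ Ψ x y))
        (mfderiv (𝓡 2) (𝓡 4) (f 0) s₀ (SphereParam.dθ Ψ x y)) - 0 * _
      + a x * M.g (f 0 s₀) (covAlong M.g (f 0) e s₀ (SphereParam.dφ Ψ x y))
        (mfderiv (𝓡 2) (𝓡 4) (f 0) s₀ (SphereParam.dφ Ψ x y)) = 0 at h4
    rw [zero_mul, sub_zero] at h4
    refine Eq.trans ?_ ((congrArg (α' x * ·) h4).trans (mul_zero _))
    change α' x * M.g (f 0 s₀) (covAlong M.g (f 0) e s₀ (SphereParam.dθ Ψ x y))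
        (mfderiv (𝓡 2) (𝓡 4) (f 0) s₀ (SphereParam.dθ Ψ x y)) * b x
      + α' x * M.g (f 0 s₀) (covAlong M.g (f 0) e s₀ (SphereParam.dφ Ψ x y))
        (mfderiv (𝓡 2) (𝓡 4) (f 0) s₀ (SphereParam.dφ Ψ x y)) * a x = _
    ring
  have hll : M.g p (n 0 s₀ + e s₀) (n 0 s₀ + e s₀) = 0 ∧
      M.g p (n 0 s₀ + e s₀) ((1 / 2 : ℝ) • (n 0 s₀ - e s₀)) = -1 ∧
      M.g p ((1 / 2 : ℝ) • (n 0 s₀ - e s₀)) ((1 / 2 : ℝ) • (n 0 s₀ - e s₀)) = 0 := by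
    have t1 := hunit 0 s₀
    have t2 := hee s₀
    have t3 := hne s₀
    have t4 := M.g_symm (f 0 s₀) (e s₀) (n 0 s₀)
    set N₀ : E 4 := n 0 s₀
    set e₀ : E 4 := e s₀
    set B : E 4 →L[ℝ] E 4 →L[ℝ] ℝ := M.g (f 0 s₀)
    change B N₀ N₀ = _ at t1
    change B e₀ e₀ = _ at t2
    change B N₀ e₀ = _ at t3
    change B e₀ N₀ = B N₀ e₀ at t4
    change B (N₀ + e₀) (N₀ + e₀) = 0 ∧ B (N₀ + e₀) ((1 / 2 : ℝ) • (N₀ - e₀)) = -1 ∧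
      B ((1 / 2 : ℝ) • (N₀ - e₀)) ((1 / 2 : ℝ) • (N₀ - e₀)) = 0
    simp only [map_add, map_sub, map_smul, add_apply, sub_apply, smul_apply, smul_eq_mul, t1, t2,
      t3, t4]
    norm_num
  have hnS : M.g p (n 0 s₀) (mfderiv (𝓡 2) (𝓡 4) (f 0) s₀ (SphereParam.dθ Ψ x y)) = 0 ∧
      M.g p (n 0 s₀) (mfderiv (𝓡 2) (𝓡 4) (f 0) s₀ (SphereParam.dφ Ψ x y)) = 0 :=
    ⟨(congrArg (M.g p (n 0 s₀)) (family_dirX Ψ hf w₀)).symm.trans (hnF w₀ dirX),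
      (congrArg (M.g p (n 0 s₀)) (family_dirY Ψ hf w₀)).symm.trans (hnF w₀ dirY)⟩
  have hframe : IsBlockFrame (bilinModel (M.g p)) (n 0 s₀ + e s₀)
      ((1 / 2 : ℝ) • (n 0 s₀ - e s₀))
      (mfderiv (𝓡 2) (𝓡 4) (f 0) s₀ (SphereParam.dθ Ψ x y))
      (mfderiv (𝓡 2) (𝓡 4) (f 0) s₀ (SphereParam.dφ Ψ x y)) 0 (-1) 0 (a x) (b x) := by
    have e1 := hen s₀ (SphereParam.dθ Ψ x y)
    have e2 := hen s₀ (SphereParam.dφ Ψ x y)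
    have e3 := hnS.1
    have e4 := hnS.2
    have q1 : ∀ F : E 4, bilinModel (M.g p) (n 0 s₀) F = 0 → bilinModel (M.g p) (e s₀) F = 0 →
        bilinModel (M.g p) (n 0 s₀ + e s₀) F = 0 ∧
        bilinModel (M.g p) ((1 / 2 : ℝ) • (n 0 s₀ - e s₀)) F = 0 := by
      intro F h1 h2
      set N₀ : E 4 := n 0 s₀
      set e₀ : E 4 := e s₀
      set B : E 4 →L[ℝ] E 4 →L[ℝ] ℝ := bilinModel (M.g p)
      change B (N₀ + e₀) F = 0 ∧ B ((1 / 2 : ℝ) • (N₀ - e₀)) F = 0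
      simp [h1, h2]
    exact
    { symm := M.g_symm p
      h00 := hll.1
      h01 := hll.2.1
      h11 := hll.2.2
      h0F1 := (q1 _ e3 e1).1
      h0F2 := (q1 _ e4 e2).1
      h1F1 := (q1 _ e3 e1).2
      h1F2 := (q1 _ e4 e2).2
      hF11 := h.q11 x y h0 hπ
      hF22 := h.q22 x y h0 hπ
      hF12 := h.q12 x y h0 hπ
      d_ne := by norm_num
      a_ne := hax.ne'
      b_ne := hbx.ne' }
  obtain ⟨k1, k2, k3⟩ := M.curvature_bounds hframe hax hbx (hlf s₀) (hkf s₀)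
  have hρ : ∀ x y, (0, x, y) ∈ familyDomain Ψ f p →
      chartG M.g p (chartView p (familyMap Ψ f) (0, x, y))
        (fderiv ℝ (chartView p (familyMap Ψ f)) (0, x, y) dirT)
        (fderiv ℝ (chartView p (familyMap Ψ f)) (0, x, y) dirT) = α' x ^ 2 := fun x y hw => by
    rw [dT x y hw, map_smul, map_smul, smul_apply, smul_eq_mul, smul_eq_mul]
    refine (congrArg (fun z => α' x * (α' x * z)) ((pr hw _ _).trans (hee _))).trans ?_
    ring
  have hX' : ∀ x y, (0, x, y) ∈ familyDomain Ψ f p →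
      ∀ v, chartG M.g p (chartView p (familyMap Ψ f) (0, x, y))
        (fderiv ℝ (chartView p (familyMap Ψ f)) (0, x, y) dirT)
        (push p (familyMap Ψ f (0, x, y))
          (mfderiv (𝓡 2) (𝓡 4) (f 0) (SphereParam.pt Ψ x y) v)) = 0 := fun x y hw v => by
    rw [dT x y hw, map_smul, smul_apply, smul_eq_mul]
    exact (congrArg (α' x * ·) ((pr hw _ _).trans (hen _ _))).trans (mul_zero _)
  have hmain := A.area_variation hns (fun w hw => (pr hw _ _).trans (hunit _ _))
    (fun w hw u => by
      rw [chartView_fderiv hfm hw.1]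
      exact (pr hw _ _).trans (hnF w u))
    (ρ := fun x => α' x ^ 2) hρ
    (fun x y hw => by rw [familyMap_dirX Ψ hf hw.1]; exact hX' x y hw _)
    (fun x y hw => by rw [familyMap_dirY Ψ hf hw.1]; exact hX' x y hw _)
    hm hax hbx (pow_pos hαx 2)
    (hP dirX _ _ rfl (SphereParam.coords_dirX Ψ w₀) hω₁)
    (hP dirY _ _ rfl (SphereParam.coords_dirY Ψ w₀) hω₂) hmin hmax (C := C) (by
      intro w
      have e1 : fderiv ℝ (chartView p (familyMap Ψ f)) w dirX
          = mfderiv (𝓡 2) (𝓡 4) (f 0) s₀ (SphereParam.dθ Ψ x y) :=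
        (familyMap_dirX Ψ hf hm.1).trans (push_self p _)
      have e2 : fderiv ℝ (chartView p (familyMap Ψ f)) w dirY
          = mfderiv (𝓡 2) (𝓡 4) (f 0) s₀ (SphereParam.dφ Ψ x y) :=
        (familyMap_dirY Ψ hf hm.1).trans (push_self p _)
      set f₁ : E 4 := mfderiv (𝓡 2) (𝓡 4) (f 0) s₀ (SphereParam.dθ Ψ x y)
      set f₂ : E 4 := mfderiv (𝓡 2) (𝓡 4) (f 0) s₀ (SphereParam.dφ Ψ x y)
      set N₀ : E 4 := n 0 s₀
      set e₀ : E 4 := e s₀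
      set l₀ : E 4 := N₀ + e₀ with hl₀
      set k₀ : E 4 := (1 / 2 : ℝ) • (N₀ - e₀) with hk₀
      -- The velocity in terms of the null frame, in which the curvature bounds are stated.
      have e0 : e₀ = (1 / 2 : ℝ) • l₀ - k₀ := by rw [hl₀, hk₀]; module
      have e3 : fderiv ℝ (chartView p (familyMap Ψ f)) w dirT = α' x • ((1 / 2 : ℝ) • l₀ - k₀) := by
        rw [← e0]
        exact (dT x y hm).trans (congrArg (α' x • ·) (push_self p _))
      have e5 : chartView p (familyMap Ψ f) w = extChartAt (𝓡 4) p p := rfl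
      have r1 := riem_unit_sum M (p := p) l₀ k₀ f₁
      have r2 := riem_unit_sum M (p := p) l₀ k₀ f₂
      have sc : ∀ u f : E 4, chartG M.g p (extChartAt (𝓡 4) p p)
          (riem (M.chartΓ p) (extChartAt (𝓡 4) p p) (α' x • u) f f) (α' x • u)
          = α' x ^ 2 * chartG M.g p (extChartAt (𝓡 4) p p)
          (riem (M.chartΓ p) (extChartAt (𝓡 4) p p) u f f) u := by
        intro u f
        simp only [riem, map_sub, map_add, map_smul, sub_apply, add_apply, smul_apply, smul_eq_mul]
        ring
      let R : E 4 → E 4 → E 4 → E 4 → ℝ := fun u v w z =>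
        chartG M.g p (extChartAt (𝓡 4) p p) (riem (M.chartΓ p) (extChartAt (𝓡 4) p p) u v w) z
      have k1' : C ≤ R f₁ f₂ f₂ f₁ / (a x * b x) + R k₀ f₁ l₀ f₁ / a x + R k₀ f₂ l₀ f₂ / b x := k1
      have k2' : R l₀ f₁ l₀ f₁ / a x + R l₀ f₂ l₀ f₂ / b x ≤ 0 := k2
      have k3' : R k₀ f₁ k₀ f₁ / a x + R k₀ f₂ k₀ f₂ / b x ≤ 0 := k3
      have hα2 := (pow_pos hαx 2).ne'
      rw [e1, e2, e3, e5, sc, sc, mul_div_mul_left _ _ hα2, mul_div_mul_left _ _ hα2]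
      change C ≤ R ((1 / 2 : ℝ) • l₀ - k₀) f₁ f₁ ((1 / 2 : ℝ) • l₀ - k₀) / a x
        + R ((1 / 2 : ℝ) • l₀ - k₀) f₂ f₂ ((1 / 2 : ℝ) • l₀ - k₀) / b x
        + R f₁ f₂ f₂ f₁ / (a x * b x)
      change R ((1 / 2 : ℝ) • l₀ - k₀) f₁ f₁ ((1 / 2 : ℝ) • l₀ - k₀)
        = R k₀ f₁ l₀ f₁ - (1 / 4) * R l₀ f₁ l₀ f₁ - R k₀ f₁ k₀ f₁ at r1
      change R ((1 / 2 : ℝ) • l₀ - k₀) f₂ f₂ ((1 / 2 : ℝ) • l₀ - k₀)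
        = R k₀ f₂ l₀ f₂ - (1 / 4) * R l₀ f₂ l₀ f₂ - R k₀ f₂ k₀ f₂ at r2
      -- As n = ℓ/2 + k, the sum is G(n,n) = G(ℓ,k) + G(ℓ,ℓ)/4 + G(k,k): the first term dominates
      -- the fluxes and the others are nonnegative.
      rw [r1, r2]
      refine k1'.trans ?_
      ring_nf at k2' k3' ⊢
      linarith)
  -- The determinant and the acceleration are replaced by their chart-free versions, so that the
  -- pointwise inequalities can be integrated together.
  have evD : detFirst (chartG M.g p) (chartView p (familyMap Ψ f)) =ᶠ[nhds w₀]
      familyDet Ψ M.g f := by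
    filter_upwards [A.isOpen.mem_nhds hm] with z hz
    rw [detFirst, chartG_familyPair hf hz.1, chartG_familyPair hf hz.1,
      chartG_familyPair hf hz.1, familyDet]
  have evA : ∀ v, accel (chartG M.g p) (chartView p (familyMap Ψ f)) v =ᶠ[nhds w₀]
      familyAccel Ψ M.g f v := fun v => by
    filter_upwards [A.isOpen.mem_nhds hm] with z hz using chart_familyAccel hf hz.1 v
  have evDD : (fun w => fderiv ℝ (detFirst (chartG M.g p) (chartView p (familyMap Ψ f))) w dirT)
      =ᶠ[nhds w₀] fun w => fderiv ℝ (familyDet Ψ M.g f) w dirT := by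
    filter_upwards [evD.eventuallyEq_nhds] with z hz
    rw [hz.fderiv_eq]
  rw [evD.fderiv_eq, evDD.fderiv_eq, (evA dirX).fderiv_eq, (evA dirY).fderiv_eq,
    (evA dirX).self_of_nhds] at hmain
  exact hmain

end SecondVariation


/-! ### Families of surfaces inside a maximal slice. -/

section Slices

open Real

theorem metricTrace_three_diagonal {q B : E 3 → E 3 → ℝ} (hq : IsBilin q) (hB : IsBilin B)
    {u v w : E 3} {r a b : ℝ} (hr : r ≠ 0) (ha : a ≠ 0) (hb : b ≠ 0) (huu : q u u = r)
    (hvv : q v v = a) (hww : q w w = b) (huv : q u v = 0) (huw : q u w = 0) (hvw : q v w = 0)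
    (hs : ∀ x y, q x y = q y x) :
    metricTrace q B = B u u / r + B v v / a + B w w / b := by
  rw [metricTrace_frame hq hB ![u, v, w] (Matrix.diagonal ![r⁻¹, a⁻¹, b⁻¹])]
  · simp [Fin.sum_univ_three, Matrix.diagonal]
    ring
  · have hvu := (hs v u).trans huv
    have hwu := (hs w u).trans huw
    have hwv := (hs w v).trans hvw
    ext i j
    fin_cases i <;> fin_cases j <;>
      simp [Matrix.diagonal_mul, huu, hvv, hww, huv, huw, hvw, hvu, hwu, hwv, hr, ha, hb]

variable {V : Type*} [TopologicalSpace V] [ChartedSpace (E 4) V] [IsManifold (𝓡 4) ∞ V]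
  {S : Type*} [TopologicalSpace S] [ChartedSpace (E 2) S] (Ψ : SphereParam S)
  {M : EMSpacetime V} {N : Type*} [TopologicalSpace N] [ChartedSpace (E 3) N] [IsManifold (𝓡 3) ∞ N]
  (H : MaximalSlice M N) {J : ℝ → S → N}
  (hJ : ContMDiff (𝓘(ℝ, ℝ).prod (𝓡 2)) (𝓡 3) ∞ (fun z : ℝ × S => J z.1 z.2))

include hJ

theorem MaximalSlice.family_smooth :
    ContMDiff (𝓘(ℝ, ℝ).prod (𝓡 2)) (𝓡 4) ∞
      (fun z : ℝ × S => (fun t s => H.emb (J t s)) z.1 z.2) :=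
  H.emb_smooth.comp hJ

theorem MaximalSlice.normal_smooth :
    ContMDiff (𝓘(ℝ, ℝ).prod (𝓡 2)) (𝓡 4).tangent ∞
      (fun z : ℝ × S => (⟨H.emb (J z.1 z.2), H.n (J z.1 z.2)⟩ : TangentBundle (𝓡 4) V)) :=
  H.n_smooth.comp hJ

theorem MaximalSlice.mfderiv_family (w u : ℝ × ℝ × ℝ) :
    mfderiv 𝓘(ℝ, ℝ × ℝ × ℝ) (𝓡 4) (familyMap Ψ fun t s => H.emb (J t s)) w u
      = mfderiv (𝓡 3) (𝓡 4) H.emb (J w.1 (SphereParam.coords Ψ w))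
        (mfderiv 𝓘(ℝ, ℝ × ℝ × ℝ) (𝓡 3) (fun w => J w.1 (SphereParam.coords Ψ w)) w u) := by
  have h1 := (H.emb_smooth.mdifferentiableAt (x := J w.1 (SphereParam.coords Ψ w))
    (by simp)).hasMFDerivAt
  have h2 := ((_root_.family_smooth Ψ hJ).mdifferentiableAt (x := w) (by simp)).hasMFDerivAt
  exact congrArg (fun f => f u) (h1.comp w h2).mfderiv

theorem MaximalSlice.normal_family (w u : ℝ × ℝ × ℝ) :
    M.g (familyMap Ψ (fun t s => H.emb (J t s)) w) (H.n (J w.1 (SphereParam.coords Ψ w)))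
      (mfderiv 𝓘(ℝ, ℝ × ℝ × ℝ) (𝓡 4) (familyMap Ψ fun t s => H.emb (J t s)) w u) = 0 :=
  (congrArg (M.g (H.emb (J w.1 (SphereParam.coords Ψ w)))
    (H.n (J w.1 (SphereParam.coords Ψ w)))) (H.mfderiv_family Ψ hJ w u)).trans (H.n_normal _ _)

/-- A family of surfaces is a map from (t, x, y) into the slice. At a point where its coordinate
vectors are orthogonal with nonzero squares they form a frame of the slice, and the vanishing trace
becomes a sum of three quotients. -/
theorem MaximalSlice.trace_family {p : V} {w : ℝ × ℝ × ℝ}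
    (hp : familyMap Ψ (fun t s => H.emb (J t s)) w ∈ (chartAt (E 4) p).source) {r a b : ℝ}
    (hr : r ≠ 0) (ha : a ≠ 0) (hb : b ≠ 0)
    (hTT : familyPair Ψ M.g (fun t s => H.emb (J t s)) dirT dirT w = r)
    (hXX : familyPair Ψ M.g (fun t s => H.emb (J t s)) dirX dirX w = a)
    (hYY : familyPair Ψ M.g (fun t s => H.emb (J t s)) dirY dirY w = b)
    (hTX : familyPair Ψ M.g (fun t s => H.emb (J t s)) dirT dirX w = 0)
    (hTY : familyPair Ψ M.g (fun t s => H.emb (J t s)) dirT dirY w = 0)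
    (hXY : familyPair Ψ M.g (fun t s => H.emb (J t s)) dirX dirY w = 0) :
    let G := chartG M.g p
    let F := chartView p (familyMap Ψ fun t s => H.emb (J t s))
    let n := familyField Ψ p (fun t s => H.emb (J t s)) fun t s => H.n (J t s)
    G (F w) (cov (M.chartΓ p) F n w dirT) (fderiv ℝ F w dirT) / r
      + G (F w) (cov (M.chartΓ p) F n w dirX) (fderiv ℝ F w dirX) / a
      + G (F w) (cov (M.chartΓ p) F n w dirY) (fderiv ℝ F w dirY) / b = 0 := by
  intro G F n
  set y := J w.1 (SphereParam.coords Ψ w) with hy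
  set d : ℝ × ℝ × ℝ → E 3 := fun u =>
    mfderiv 𝓘(ℝ, ℝ × ℝ × ℝ) (𝓡 3) (fun w => J w.1 (SphereParam.coords Ψ w)) w u with hd
  have hfm : ContMDiff 𝓘(ℝ, ℝ × ℝ × ℝ) (𝓡 4) ∞ (familyMap Ψ fun t s => H.emb (J t s)) :=
    _root_.family_smooth Ψ (f := fun t s => H.emb (J t s)) (H.family_smooth hJ)
  have pr := fun u v => chartG_push M.g hp u v
  have hI : ∀ u v, inducedMetric M.g H.emb y (d u) (d v)
      = familyPair Ψ M.g (fun t s => H.emb (J t s)) u v w := fun u v =>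
    (congrArg₂ (fun a b => M.g (H.emb y) a b) (H.mfderiv_family Ψ hJ w u)
      (H.mfderiv_family Ψ hJ w v)).symm
  have hK : ∀ u, G (F w) (cov (M.chartΓ p) F n w u) (fderiv ℝ F w u)
      = M.g (H.emb y) (covAlong M.g (m := 3) H.emb H.n y (d u))
        (mfderiv (𝓡 3) (𝓡 4) H.emb y (d u)) := by
    intro u
    have e1 := M.covAlong_chart (f := H.emb) (Y := H.n)
      (h := fun w => J w.1 (SphereParam.coords Ψ w)) (w := w)
      (H.emb_smooth.mdifferentiableAt (by simp)) (H.n_smooth.mdifferentiableAt (by simp))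
      ((_root_.family_smooth Ψ hJ).mdifferentiableAt (by simp)) hp u
    have e2 := (chartView_fderiv hfm hp u).trans
      (congrArg (push p (familyMap Ψ (fun t s => H.emb (J t s)) w)) (H.mfderiv_family Ψ hJ w u))
    exact (congrArg₂ (fun a b => G (F w) a b) e1.symm e2).trans (pr _ _)
  have hB := M.covAlong_bilin (m := 3) H.emb H.n y
  have hB' : IsBilin fun u v : E 3 => - M.g (H.emb y) (covAlong M.g (m := 3) H.emb H.n y u)
      (mfderiv (𝓡 3) (𝓡 4) H.emb y v) :=
    ⟨fun u u' v => by have := hB.add_left u u' v; linarith,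
      fun r u v => by have := hB.smul_left r u v; linarith,
      fun u v v' => by have := hB.add_right u v v'; linarith,
      fun r u v => by have := hB.smul_right r u v; linarith⟩
  have h1 := metricTrace_three_diagonal (inducedMetric_bilin M.g H.emb y) hB'
    (u := d dirT) (v := d dirX) (w := d dirY) hr ha hb
    ((hI _ _).trans hTT) ((hI _ _).trans hXX) ((hI _ _).trans hYY) ((hI _ _).trans hTX)
    ((hI _ _).trans hTY) ((hI _ _).trans hXY) (fun _ _ => M.g_symm _ _ _)
  have h2 := h1.symm.trans (H.maximal y)
  rw [hK, hK, hK]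
  simp only [neg_div] at h2
  linarith

end Slices


/-! ### Integrals depending on a parameter, and divergences on the coordinate rectangle. -/

section ParametricIntegrals

open Real MeasureTheory

variable {u : ℝ × ℝ × ℝ → ℝ} {Ω : Set (ℝ × ℝ × ℝ)} {K s : Set (ℝ × ℝ)} {ε : ℝ}

theorem slice_integrableOn (hu : ContinuousOn u Ω) (hK : IsCompact K) (hs : s ⊆ K) {t : ℝ}
    (ht : ∀ z ∈ K, (t, z) ∈ Ω) : IntegrableOn (fun z => u (t, z)) s := by
  have h : ContinuousOn (fun z : ℝ × ℝ => u (t, z)) K :=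
    hu.comp (f := fun z : ℝ × ℝ => (t, z)) (by fun_prop) ht
  exact (h.integrableOn_compact hK).mono_set hs

/-- The integrand is smooth near a compact set containing the domain, so its derivative is uniformly
bounded for nearby parameters and dominates. -/
theorem hasDerivAt_setIntegral (hΩ : IsOpen Ω) (hu : ContDiffOn ℝ ∞ u Ω) (hK : IsCompact K)
    (hs : s ⊆ K) (hsm : MeasurableSet s) (hε : ∀ t ∈ Metric.ball (0 : ℝ) ε, ∀ z ∈ K, (t, z) ∈ Ω)
    {t : ℝ} (ht : t ∈ Metric.ball (0 : ℝ) ε) :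
    HasDerivAt (fun t => ∫ z in s, u (t, z)) (∫ z in s, fderiv ℝ u (t, z) dirT) t := by
  obtain ⟨δ, hδ, hδε⟩ := Metric.nhds_basis_closedBall.mem_iff.mp (Metric.isOpen_ball.mem_nhds ht)
  have hc : IsCompact (Metric.closedBall t δ ×ˢ K) := (isCompact_closedBall t δ).prod hK
  have hcΩ : ∀ w ∈ Metric.closedBall t δ ×ˢ K, w ∈ Ω := fun w hw => hε _ (hδε hw.1) _ hw.2
  obtain ⟨C, hC⟩ := hc.exists_bound_of_continuousOn
    ((hu.dir hΩ dirT).continuousOn.mono hcΩ)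
  have hfin : IsFiniteMeasure (volume.restrict s) :=
    ⟨by simpa using (measure_mono hs).trans_lt hK.measure_lt_top⟩
  refine (hasDerivAt_integral_of_dominated_loc_of_deriv_le (μ := volume.restrict s)
    (F := fun t z => u (t, z)) (bound := fun _ => C)
    (F' := fun t z => fderiv ℝ u (t, z) dirT)
    (Metric.closedBall_mem_nhds t hδ) ?_ (slice_integrableOn hu.continuousOn hK hs (hε t ht))
    (slice_integrableOn (hu.dir hΩ dirT).continuousOn hK hs (hε t ht)).aestronglyMeasurable
    ?_ (integrable_const C) ?_).2
  · filter_upwards [Metric.isOpen_ball.mem_nhds ht] with r hr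
    exact (slice_integrableOn hu.continuousOn hK hs (hε r hr)).aestronglyMeasurable
  · filter_upwards [ae_restrict_mem hsm] with z hz r hr using hC (r, z) ⟨hr, hs hz⟩
  · filter_upwards [ae_restrict_mem hsm] with z hz r hr
    exact hasDerivAt_lineT (hu.diffAt hΩ (hcΩ (r, z) ⟨hr, hs hz⟩))

/-- The tube lemma provides one interval of parameters on which differentiation under the integral
is valid for all points; this is needed to differentiate twice. -/
theorem iteratedDeriv_two_setIntegral (hΩ : IsOpen Ω) (hu : ContDiffOn ℝ ∞ u Ω) (hK : IsCompact K)
    (hs : s ⊆ K) (hsm : MeasurableSet s) (h0 : ∀ z ∈ K, ((0 : ℝ), z) ∈ Ω) :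
    iteratedDeriv 2 (fun t => ∫ z in s, u (t, z)) 0
      = ∫ z in s, fderiv ℝ (fun w => fderiv ℝ u w dirT) (0, z) dirT := by
  obtain ⟨v, w, hv, -, h0v, hKw, hvw⟩ := generalized_tube_lemma (s := {(0 : ℝ)}) (t := K)
    isCompact_singleton hK hΩ (by rintro ⟨t, z⟩ ⟨ht, hz⟩; cases ht; exact h0 z hz)
  obtain ⟨ε, hε, hb⟩ := Metric.isOpen_iff.mp hv 0 (h0v rfl)
  have hεΩ : ∀ t ∈ Metric.ball (0 : ℝ) ε, ∀ z ∈ K, (t, z) ∈ Ω := fun t ht z hz =>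
    hvw ⟨hb ht, hKw hz⟩
  have e : deriv (fun t => ∫ z in s, u (t, z)) =ᶠ[nhds 0]
      fun t => ∫ z in s, fderiv ℝ u (t, z) dirT := by
    filter_upwards [Metric.ball_mem_nhds (0 : ℝ) hε] with t ht
    exact (hasDerivAt_setIntegral hΩ hu hK hs hsm hεΩ ht).deriv
  rw [iteratedDeriv_succ, iteratedDeriv_one, e.deriv_eq]
  exact (hasDerivAt_setIntegral hΩ (hu.dir hΩ dirT) hK hs hsm hεΩ
    (Metric.mem_ball_self hε)).deriv

/-- The θ part of the divergence vanishes at the poles and the φ part is periodic, so both integrate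
to zero. The φ part may be singular at the poles and is not assumed integrable over the rectangle.
-/
theorem integral_le_of_divergence_bound {h U : ℝ × ℝ → ℝ} {ν : ℝ → ℝ} {W : ℝ → ℝ → ℝ}
    (hh : IntegrableOn h coordDomain) (hν : IntegrableOn ν (Set.Icc 0 π)) (hU : ContDiff ℝ ∞ U)
    (hU0 : ∀ y, U (0, y) = 0) (hUπ : ∀ y, U (π, y) = 0)
    (hW : ∀ x ∈ Set.Ioo 0 π, ContDiff ℝ ∞ (W x)) (hper : ∀ x ∈ Set.Ioo 0 π, W x (2 * π) = W x 0)
    (hle : ∀ x ∈ Set.Ioo 0 π, ∀ y ∈ Set.Ioo 0 (2 * π),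
      h (x, y) ≤ ν x + deriv (fun x => U (x, y)) x + deriv (W x) y) :
    ∫ z in coordDomain, h z ≤ 2 * π * ∫ x in 0..π, ν x := by
  have hpp : (0 : ℝ) ≤ 2 * π := by positivity
  have hUy : ∀ y, ContDiff ℝ ∞ fun x => U (x, y) := fun y => hU.comp (by fun_prop)
  have hdU : Continuous fun z : ℝ × ℝ => deriv (fun x => U (x, z.2)) z.1 := by
    have e : (fun z : ℝ × ℝ => deriv (fun x => U (x, z.2)) z.1)
        = fun z => fderiv ℝ U z (1, 0) := by
      funext z
      exact ((hU.differentiable (by simp) (z.1, z.2)).hasFDerivAt.comp_hasDerivAt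
        (f := fun x => (x, z.2)) z.1
        ((hasDerivAt_id z.1).prodMk (hasDerivAt_const z.1 z.2))).deriv
    rw [e]
    exact (hU.continuous_fderiv (by simp)).clm_apply continuous_const
  have hDi : IntegrableOn (fun z : ℝ × ℝ => deriv (fun x => U (x, z.2)) z.1) coordDomain :=
    (hdU.continuousOn.integrableOn_compact (isCompact_Icc.prod isCompact_Icc)).mono_set
      (Set.prod_mono Set.Ioo_subset_Icc_self Set.Ioo_subset_Icc_self)
  have hνi := integrableOn_coordDomain hν
  have hμ : volume.restrict coordDomain
      = (volume.restrict (Set.Ioo 0 π)).prod (volume.restrict (Set.Ioo 0 (2 * π))) :=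
    (Measure.prod_restrict _ _).symm
  have hD0 : ∫ z in coordDomain, deriv (fun x => U (x, z.2)) z.1 = 0 := by
    rw [IntegrableOn, hμ] at hDi
    rw [hμ, integral_prod_symm _ hDi]
    have e : ∀ y, ∫ x in Set.Ioo 0 π, deriv (fun x => U (x, y)) x = 0 := by
      intro y
      rw [← integral_Ioc_eq_integral_Ioo, ← intervalIntegral.integral_of_le pi_pos.le,
        intervalIntegral.integral_deriv_eq_sub (fun x _ => (smooth_hasDerivAt (hUy y) x).differentiableAt)
          ((deriv_smooth (hUy y)).continuous.intervalIntegrable _ _), hU0, hUπ, sub_zero]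
    simp only [e, integral_zero]
  have hk := (hh.sub hνi).sub hDi
  -- For this reason the inequality is integrated over φ first, at fixed θ, and the known integrable
  -- terms are kept on one side.
  have hk0 : ∫ z in coordDomain, (h z - ν z.1 - deriv (fun x => U (x, z.2)) z.1) ≤ 0 := by
    have hk' := hk
    rw [IntegrableOn, hμ] at hk'
    rw [hμ]
    refine (integral_prod _ hk').trans_le ?_
    refine setIntegral_nonpos measurableSet_Ioo fun x hx => ?_
    by_cases hi : IntegrableOn (fun y => h (x, y) - ν x - deriv (fun x => U (x, y)) x)
        (Set.Ioo 0 (2 * π))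
    · have hWi : IntervalIntegrable (deriv (W x)) volume 0 (2 * π) :=
        (deriv_smooth (hW x hx)).continuous.intervalIntegrable _ _
      have e : ∫ y in Set.Ioo 0 (2 * π), deriv (W x) y = 0 := by
        rw [← integral_Ioc_eq_integral_Ioo, ← intervalIntegral.integral_of_le hpp,
          intervalIntegral.integral_deriv_eq_sub
            (fun y _ => (smooth_hasDerivAt (hW x hx) y).differentiableAt) hWi, hper x hx, sub_self]
      refine (setIntegral_mono_on hi ?_ measurableSet_Ioo fun y hy => ?_).trans_eq e
      · exact ((intervalIntegrable_iff_integrableOn_Ioc_of_le hpp).mp hWi).mono_set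
          Set.Ioo_subset_Ioc_self
      · have := hle x hx y hy
        linarith
    -- On parallels where the integrand is not integrable the inner integral is 0 by convention,
    -- which is still nonpositive.
    · exact (integral_undef hi).le
  have e2 : ∫ z in coordDomain, (h z - ν z.1 - deriv (fun x => U (x, z.2)) z.1)
      = (∫ z in coordDomain, h z) - 2 * π * ∫ x in 0..π, ν x := by
    have e3 := integral_sub (hh.sub hνi) hDi
    have e4 := integral_sub hh hνi
    rw [integral_coordDomain] at e4
    rw [hD0, sub_zero] at e3
    exact e3.trans e4
  linarith

end ParametricIntegrals


/-! ### Second variation of the area as an integral. -/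

section AreaVariation

open Real MeasureTheory

variable {V : Type*} [TopologicalSpace V] [ChartedSpace (E 4) V] [IsManifold (𝓡 4) ∞ V]
  {S : Type*} [TopologicalSpace S] [ChartedSpace (E 2) S] (Ψ : SphereParam S)

/-- The determinant of the first fundamental forms of a family of surfaces, relative to the area
form of the round sphere. -/
def roundDet (g : BilinField V) (f : ℝ → S → V) (w : ℝ × ℝ × ℝ) : ℝ :=
  inducedMetric g (f w.1) (SphereParam.coords Ψ w)
      (SphereParam.dθ Ψ w.2.1 w.2.2) (SphereParam.dθ Ψ w.2.1 w.2.2)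
    * inducedMetric g (f w.1) (SphereParam.coords Ψ w)
      (SphereParam.azimuthal Ψ w.2.1 w.2.2) (SphereParam.azimuthal Ψ w.2.1 w.2.2)
    - inducedMetric g (f w.1) (SphereParam.coords Ψ w)
      (SphereParam.dθ Ψ w.2.1 w.2.2) (SphereParam.azimuthal Ψ w.2.1 w.2.2) ^ 2

variable {f : ℝ → S → V}

theorem roundDet_smooth {g : BilinField V} (hg : SmoothBilin g)
    (hf : ContMDiff (𝓘(ℝ, ℝ).prod (𝓡 2)) (𝓡 4) ∞ (fun z : ℝ × S => f z.1 z.2)) :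
    ContDiff ℝ ∞ (roundDet Ψ g f) := by
  obtain ⟨h1, h2, h3⟩ := family_metric_smooth Ψ hg hf
  exact (h1.mul h3).sub (h2.pow 2)

omit [IsManifold (𝓡 4) ∞ V] in
theorem familyPair_eq (g : BilinField V)
    (hf : ContMDiff (𝓘(ℝ, ℝ).prod (𝓡 2)) (𝓡 4) ∞ (fun z : ℝ × S => f z.1 z.2)) (w : ℝ × ℝ × ℝ) :
    familyPair Ψ g f dirX dirX w = inducedMetric g (f w.1) (SphereParam.coords Ψ w)
        (SphereParam.dθ Ψ w.2.1 w.2.2) (SphereParam.dθ Ψ w.2.1 w.2.2) ∧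
    familyPair Ψ g f dirX dirY w = inducedMetric g (f w.1) (SphereParam.coords Ψ w)
        (SphereParam.dθ Ψ w.2.1 w.2.2) (SphereParam.dφ Ψ w.2.1 w.2.2) ∧
    familyPair Ψ g f dirY dirY w = inducedMetric g (f w.1) (SphereParam.coords Ψ w)
        (SphereParam.dφ Ψ w.2.1 w.2.2) (SphereParam.dφ Ψ w.2.1 w.2.2) := by
  have eX := family_dirX Ψ hf w
  have eY := family_dirY Ψ hf w
  exact ⟨congrArg₂ (fun a b => g (familyMap Ψ f w) a b) eX eX,
    congrArg₂ (fun a b => g (familyMap Ψ f w) a b) eX eY,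
    congrArg₂ (fun a b => g (familyMap Ψ f w) a b) eY eY⟩

/-- The factor sin²θ in the determinant comes from ∂_φ alone. Taking it out before the square root
keeps the area density smooth up to the poles. -/
theorem det_round (g : BilinField V) (w : ℝ × ℝ × ℝ) :
    inducedMetric g (f w.1) (SphereParam.coords Ψ w)
        (SphereParam.dθ Ψ w.2.1 w.2.2) (SphereParam.dθ Ψ w.2.1 w.2.2)
      * inducedMetric g (f w.1) (SphereParam.coords Ψ w)
        (SphereParam.dφ Ψ w.2.1 w.2.2) (SphereParam.dφ Ψ w.2.1 w.2.2)
      - inducedMetric g (f w.1) (SphereParam.coords Ψ w)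
        (SphereParam.dθ Ψ w.2.1 w.2.2) (SphereParam.dφ Ψ w.2.1 w.2.2) ^ 2
      = sin w.2.1 ^ 2 * roundDet Ψ g f w := by
  have hB := inducedMetric_bilin (m := 2) g (f w.1) (SphereParam.coords Ψ w)
  have h1 := hB.smul_right (sin w.2.1) (SphereParam.dθ Ψ w.2.1 w.2.2)
    (SphereParam.azimuthal Ψ w.2.1 w.2.2)
  have h2 := hB.smul_right (sin w.2.1) (SphereParam.dφ Ψ w.2.1 w.2.2)
    (SphereParam.azimuthal Ψ w.2.1 w.2.2)
  have h3 := hB.smul_left (sin w.2.1) (SphereParam.azimuthal Ψ w.2.1 w.2.2)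
    (SphereParam.azimuthal Ψ w.2.1 w.2.2)
  have e : (SphereParam.dφ Ψ w.2.1 w.2.2 : E 2)
      = sin w.2.1 • (SphereParam.azimuthal Ψ w.2.1 w.2.2 : E 2) := SphereParam.dφ_eq Ψ w.2.1 w.2.2
  set q : E 2 → E 2 → ℝ := fun u v => inducedMetric g (f w.1) (SphereParam.coords Ψ w) u v
  set X : E 2 := SphereParam.dθ Ψ w.2.1 w.2.2
  set Y : E 2 := SphereParam.dφ Ψ w.2.1 w.2.2
  set Z : E 2 := SphereParam.azimuthal Ψ w.2.1 w.2.2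
  change q X X * q Y Y - q X Y ^ 2 = sin w.2.1 ^ 2 * (q X X * q Z Z - q X Z ^ 2)
  have h1' : q X Y = sin w.2.1 * q X Z := (congrArg (q X) e).trans h1
  have h2' : q Y Y = sin w.2.1 * q Y Z := (congrArg (q Y) e).trans h2
  have h3' : q Y Z = sin w.2.1 * q Z Z := (congrArg (fun v => q v Z) e).trans h3
  rw [h1', h2', h3']
  ring

theorem familyDet_eq (g : BilinField V)
    (hf : ContMDiff (𝓘(ℝ, ℝ).prod (𝓡 2)) (𝓡 4) ∞ (fun z : ℝ × S => f z.1 z.2)) (w : ℝ × ℝ × ℝ) :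
    familyDet Ψ g f w = sin w.2.1 ^ 2 * roundDet Ψ g f w := by
  obtain ⟨e1, e2, e3⟩ := familyPair_eq Ψ g hf w
  rw [familyDet, e1, e2, e3, det_round]

theorem area_family (M : EMSpacetime V) (f : ℝ → S → V) (t : ℝ) :
    area Ψ (inducedMetric M.g (f t))
      = ∫ z in coordDomain, sin z.1 * √(roundDet Ψ M.g f (t, z)) := by
  refine setIntegral_congr_fun measurableSet_coordDomain fun z hz => ?_
  have hs := sin_pos_of_pos_of_lt_pi hz.1.1 hz.1.2
  have e : inducedMetric M.g (f t) (SphereParam.pt Ψ z.1 z.2) (SphereParam.dφ Ψ z.1 z.2)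
      (SphereParam.dθ Ψ z.1 z.2) = inducedMetric M.g (f t) (SphereParam.pt Ψ z.1 z.2)
      (SphereParam.dθ Ψ z.1 z.2) (SphereParam.dφ Ψ z.1 z.2) := M.g_symm _ _ _
  have e2 := det_round Ψ (f := f) M.g (t, z)
  change √(_ * _ - _ * _) = _
  rw [e, ← pow_two]
  refine (congrArg sqrt e2).trans ?_
  rw [sqrt_mul (sq_nonneg _), sqrt_sq hs.le]

/-- The second variation of area in terms of the second variation of the determinant. -/
theorem area_second_variation (M : EMSpacetime V)
    (hf : ContMDiff (𝓘(ℝ, ℝ).prod (𝓡 2)) (𝓡 4) ∞ (fun z : ℝ × S => f z.1 z.2)) {r : ℝ}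
    (hr : 0 < r)
    (hD : ∀ z ∈ Set.Icc 0 π ×ˢ Set.Icc 0 (2 * π), roundDet Ψ M.g f (0, z) = r ^ 2)
    (hD' : ∀ z ∈ coordDomain, fderiv ℝ (familyDet Ψ M.g f) (0, z) dirT = 0) :
    IntegrableOn (fun z : ℝ × ℝ => fderiv ℝ (fun w => fderiv ℝ (familyDet Ψ M.g f) w dirT) (0, z)
      dirT / (2 * (sin z.1 * r))) coordDomain ∧
    iteratedDeriv 2 (fun t => area Ψ (inducedMetric M.g (f t))) 0
      = ∫ z in coordDomain, fderiv ℝ (fun w => fderiv ℝ (familyDet Ψ M.g f) w dirT) (0, z) dirT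
        / (2 * (sin z.1 * r)) := by
  have hsm := roundDet_smooth Ψ M.g_smooth hf
  set u : ℝ × ℝ × ℝ → ℝ := fun w => sin w.2.1 * √(roundDet Ψ M.g f w) with hu
  -- The square root is smooth only where the determinant is positive; this open set contains the
  -- closed rectangle at t = 0, poles included.
  set Ω : Set (ℝ × ℝ × ℝ) := {w | 0 < roundDet Ψ M.g f w} with hΩd
  have hΩ : IsOpen Ω := isOpen_lt continuous_const hsm.continuous
  have hus : ContDiffOn ℝ ∞ u Ω := by
    have h1 : ContDiff ℝ ∞ fun w : ℝ × ℝ × ℝ => sin w.2.1 := by fun_prop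
    exact h1.contDiffOn.mul (hsm.contDiffOn.sqrt fun w hw => ne_of_gt (show 0 < roundDet Ψ M.g f w from hw))
  have hK : IsCompact (Set.Icc 0 π ×ˢ Set.Icc 0 (2 * π)) := isCompact_Icc.prod isCompact_Icc
  have hKs : coordDomain ⊆ Set.Icc 0 π ×ˢ Set.Icc 0 (2 * π) :=
    Set.prod_mono Set.Ioo_subset_Icc_self Set.Ioo_subset_Icc_self
  have h0 : ∀ z ∈ Set.Icc 0 π ×ˢ Set.Icc 0 (2 * π), ((0 : ℝ), z) ∈ Ω := fun z hz => by
    change 0 < roundDet Ψ M.g f (0, z)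
    rw [hD z hz]
    positivity
  -- The superfluous `0 ^ 2` gives u² the shape f g - k², for which the derivatives of determinants
  -- were computed.
  have hsq : ∀ w ∈ Ω, u w * u w - 0 ^ 2 = familyDet Ψ M.g f w := fun w hw => by
    rw [familyDet_eq Ψ M.g hf]
    have := sq_sqrt (show 0 < roundDet Ψ M.g f w from hw).le
    simp only [hu]
    linear_combination sin w.2.1 ^ 2 * this
  -- From u² = det: the first derivative of det vanishes, hence so does that of u, and then 2 u u''
  -- = det''.
  have key : ∀ z ∈ coordDomain, fderiv ℝ (fun w => fderiv ℝ u w dirT) (0, z) dirT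
      = fderiv ℝ (fun w => fderiv ℝ (familyDet Ψ M.g f) w dirT) (0, z) dirT
        / (2 * (sin z.1 * r)) := by
    intro z hz
    have hs := sin_pos_of_pos_of_lt_pi hz.1.1 hz.1.2
    have hz0 := h0 z (hKs hz)
    have ev : familyDet Ψ M.g f =ᶠ[nhds ((0 : ℝ), z)] fun w => u w * u w - 0 ^ 2 := by
      filter_upwards [hΩ.mem_nhds hz0] with w hw using (hsq w hw).symm
    have ev2 : (fun w => fderiv ℝ (familyDet Ψ M.g f) w dirT) =ᶠ[nhds ((0 : ℝ), z)]
        fun w => fderiv ℝ (fun w => u w * u w - 0 ^ 2) w dirT := by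
      filter_upwards [ev.eventuallyEq_nhds] with w hw
      rw [hw.fderiv_eq]
    have u0 : u (0, z) = sin z.1 * r := by
      simp only [hu]
      rw [hD z (hKs hz), sqrt_sq hr.le]
    have d1 := dir_det hΩ hus hus (contDiffOn_const (c := (0 : ℝ))) hz0 dirT
    have d2 := dir_dir_det hΩ hus hus (contDiffOn_const (c := (0 : ℝ))) hz0 dirT
    rw [← ev.fderiv_eq, hD' z hz, u0] at d1
    rw [← ev2.fderiv_eq, u0] at d2
    have hsr : 0 < sin z.1 * r := mul_pos hs hr
    have u1 : fderiv ℝ u (0, z) dirT = 0 := by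
      have : 2 * (sin z.1 * r) * fderiv ℝ u (0, z) dirT = 0 := by linarith
      exact (mul_eq_zero.mp this).resolve_left (by positivity)
    rw [d2, u1, eq_div_iff (by positivity)]
    simp
    ring
  have hint := slice_integrableOn (t := 0) (((hus.dir hΩ dirT).dir hΩ dirT).continuousOn) hK hKs h0
  refine ⟨hint.congr_fun key measurableSet_coordDomain, ?_⟩
  have e : (fun t => area Ψ (inducedMetric M.g (f t))) = fun t => ∫ z in coordDomain, u (t, z) :=
    funext fun t => area_family Ψ M f t
  rw [e, iteratedDeriv_two_setIntegral hΩ hus hK hKs measurableSet_coordDomain h0]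
  exact setIntegral_congr_fun measurableSet_coordDomain key

end AreaVariation


/-! ### From the second variation to the one-dimensional inequality. -/

section StableMinimal

open Real MeasureTheory

/-- Here q = e^c, h = e^σ, s = sin, and the lapse r satisfies r² = q_θθ, so that |Dα|² is σ'²/4.
Multiplication by the area density q s makes the acceleration terms exact derivatives in θ and φ;
the square of Ω_θ is discarded. -/
theorem minimal_algebra {q h s co r σ σ' τ' K C Φ' D w₁ A₁ d₁ d₂ : ℝ} (hq : 0 < q) (hh : 0 < h)
    (hs : 0 < s) (hr : r ^ 2 = q ^ 2 / h) (hK : s * (q ^ 2 / h) * K = Φ' - s * (σ + σ' ^ 2 / 2))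
    (hI : D / (2 * (q ^ 2 / h) * (h * s ^ 2)) ≤ (- σ' * (q ^ 2 / h)) ^ 2 / (4 * r ^ 2 * (q ^ 2 / h))
      + r ^ 2 * (K - C) - (r * w₁) ^ 2 / (q ^ 2 / h)
      - (r * (- (q * s * (τ' / (q ^ 2 / h))))) ^ 2 / (h * s ^ 2)
      + (d₁ / (q ^ 2 / h) + d₂ / (h * s ^ 2)
        + A₁ * (h * (σ' * s ^ 2 + 2 * s * co) / (2 * (q ^ 2 / h) * (h * s ^ 2))
          - (- σ' * (q ^ 2 / h)) / (2 * (q ^ 2 / h) ^ 2)))) :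
    D / (2 * (s * q)) ≤ q * (Φ' - s * (σ + σ' ^ 2 / 4 + τ' ^ 2 + C * (q * s) ^ 2 / (h * s ^ 2)))
      + (((h * σ') * s + h * co) * A₁ + h * s * d₁) / q + q / (h * s) * d₂ := by
  rw [mul_pow r w₁, mul_pow r (- _), hr] at hI
  have e : q * (Φ' - s * (σ + σ' ^ 2 / 4 + τ' ^ 2 + C * (q * s) ^ 2 / (h * s ^ 2)))
      + (((h * σ') * s + h * co) * A₁ + h * s * d₁) / q + q / (h * s) * d₂ - D / (2 * (s * q))
      = q * s * ((- σ' * (q ^ 2 / h)) ^ 2 / (4 * (q ^ 2 / h) * (q ^ 2 / h))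
      + q ^ 2 / h * (K - C) - q ^ 2 / h * w₁ ^ 2 / (q ^ 2 / h)
      - q ^ 2 / h * (- (q * s * (τ' / (q ^ 2 / h)))) ^ 2 / (h * s ^ 2)
      + (d₁ / (q ^ 2 / h) + d₂ / (h * s ^ 2)
        + A₁ * (h * (σ' * s ^ 2 + 2 * s * co) / (2 * (q ^ 2 / h) * (h * s ^ 2))
          - (- σ' * (q ^ 2 / h)) / (2 * (q ^ 2 / h) ^ 2)))
      - D / (2 * (q ^ 2 / h) * (h * s ^ 2))) + q * s * w₁ ^ 2 := by
    rw [show Φ' = s * (q ^ 2 / h) * K + s * (σ + σ' ^ 2 / 2) by linarith]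
    field_simp
    ring
  have h1 : 0 ≤ q * s * w₁ ^ 2 := by positivity
  have h2 := mul_nonneg (mul_pos hq hs).le (sub_nonneg.mpr hI)
  linarith

variable {V : Type*} [TopologicalSpace V] [ChartedSpace (E 4) V]

/-- As `normals_transport`, but with both normals prescribed. -/
theorem frame_transport {S : Type*} {f : S → V} {L K : ∀ s, TangentSpace (𝓡 4) (f s)}
    (Q : ∀ emb : S → V, (∀ s, TangentSpace (𝓡 4) (emb s)) → (∀ s, TangentSpace (𝓡 4) (emb s)) → Prop)
    {emb : S → V} {ell k : ∀ s, TangentSpace (𝓡 4) (emb s)}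
    (hL : ∀ s, (⟨f s, L s⟩ : TangentBundle (𝓡 4) V) = ⟨emb s, ell s⟩)
    (hK : ∀ s, (⟨f s, K s⟩ : TangentBundle (𝓡 4) V) = ⟨emb s, k s⟩)
    (h : Q emb ell k) : Q f L K := by
  have he : f = emb := funext fun s => congrArg Bundle.TotalSpace.proj (hL s)
  subst he
  have hl : L = ell := funext fun s => by
    have := hL s
    rwa [Bundle.TotalSpace.mk_inj] at this
  have hk : K = k := funext fun s => by
    have := hK s
    rwa [Bundle.TotalSpace.mk_inj] at this
  rw [hl, hk]
  exact h

variable [IsManifold (𝓡 4) ∞ V] {S : Type*} [TopologicalSpace S] [ChartedSpace (E 2) S]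
  {Ψ : SphereParam S}

section Periodicity

variable {g : BilinField V} {f : ℝ → S → V}
  (hf : ContMDiff (𝓘(ℝ, ℝ).prod (𝓡 2)) (𝓡 4) ∞ (fun z : ℝ × S => f z.1 z.2))

include hf

omit [IsManifold (𝓡 4) ∞ V] in
theorem familyPair_periodic (u v w : ℝ × ℝ × ℝ) :
    familyPair Ψ g f u v (w + (0, 0, 2 * π)) = familyPair Ψ g f u v w := by
  have hfm : ContMDiff 𝓘(ℝ, ℝ × ℝ × ℝ) (𝓡 4) ∞ (familyMap Ψ f) := family_smooth Ψ hf
  have e : (fun w => familyMap Ψ f (w + (0, 0, 2 * π))) = familyMap Ψ f := by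
    funext w
    simp [familyMap, SphereParam.coords, SphereParam.pt, spherePoint]
  have hd : ∀ u, mfderiv 𝓘(ℝ, ℝ × ℝ × ℝ) (𝓡 4) (fun w => familyMap Ψ f (w + (0, 0, 2 * π))) w u
      = mfderiv 𝓘(ℝ, ℝ × ℝ × ℝ) (𝓡 4) (familyMap Ψ f) (w + (0, 0, 2 * π)) u := fun u =>
    mfderiv_comp_hasFDerivAt (γ := fun w => w + (0, 0, 2 * π)) (hfm.mdifferentiableAt (by simp))
      ((hasFDerivAt_id w).add_const _) u
  exact (congrArg₂ (fun a b => g (familyMap Ψ f (w + (0, 0, 2 * π))) a b) (hd u) (hd v)).symm.trans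
    (congrArg (fun F : ℝ × ℝ × ℝ → V => g (F w) (mfderiv 𝓘(ℝ, ℝ × ℝ × ℝ) (𝓡 4) F w u)
      (mfderiv 𝓘(ℝ, ℝ × ℝ × ℝ) (𝓡 4) F w v)) e)

omit [IsManifold (𝓡 4) ∞ V] in
theorem familyAccel_periodic (v w : ℝ × ℝ × ℝ) :
    familyAccel Ψ g f v (w + (0, 0, 2 * π)) = familyAccel Ψ g f v w := by
  have e : ∀ u v, fderiv ℝ (familyPair Ψ g f u v) (w + (0, 0, 2 * π))
      = fderiv ℝ (familyPair Ψ g f u v) w := by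
    intro u v
    rw [← fderiv_comp_add_right]
    exact congrArg (fun φ => fderiv ℝ φ w) (funext fun w => familyPair_periodic hf u v w)
  rw [familyAccel, e, e, familyAccel]

end Periodicity

/-- The second fundamental form of a hypersurface containing a family of surfaces has vanishing
trace, expressed in an orthogonal frame consisting of the velocity and the coordinate vectors. -/
def IsTraceFree (Ψ : SphereParam S) (M : EMSpacetime V) (f : ℝ → S → V)
    (n : ∀ t s, TangentSpace (𝓡 4) (f t s)) : Prop :=
  ∀ (p : V) (w : ℝ × ℝ × ℝ), familyMap Ψ f w ∈ (chartAt (E 4) p).source → ∀ r a b : ℝ,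
    r ≠ 0 → a ≠ 0 → b ≠ 0 → familyPair Ψ M.g f dirT dirT w = r →
    familyPair Ψ M.g f dirX dirX w = a → familyPair Ψ M.g f dirY dirY w = b →
    familyPair Ψ M.g f dirT dirX w = 0 → familyPair Ψ M.g f dirT dirY w = 0 →
    familyPair Ψ M.g f dirX dirY w = 0 →
    let G := chartG M.g p
    let F := chartView p (familyMap Ψ f)
    G (F w) (cov (M.chartΓ p) F (familyField Ψ p f n) w dirT) (fderiv ℝ F w dirT) / r
      + G (F w) (cov (M.chartΓ p) F (familyField Ψ p f n) w dirX) (fderiv ℝ F w dirX) / a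
      + G (F w) (cov (M.chartΓ p) F (familyField Ψ p f n) w dirY) (fderiv ℝ F w dirY) / b = 0

theorem MaximalSlice.isTraceFree {M : EMSpacetime V} {N : Type*} [TopologicalSpace N]
    [ChartedSpace (E 3) N] [IsManifold (𝓡 3) ∞ N] (H : MaximalSlice M N) {J : ℝ → S → N}
    (hJ : ContMDiff (𝓘(ℝ, ℝ).prod (𝓡 2)) (𝓡 3) ∞ (fun z : ℝ × S => J z.1 z.2)) :
    IsTraceFree Ψ M (fun t s => H.emb (J t s)) fun t s => H.n (J t s) :=
  fun _ _ hp _ _ _ hr ha hb h1 h2 h3 h4 h5 h6 => H.trace_family Ψ hJ hp hr ha hb h1 h2 h3 h4 h5 h6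

/-- A family of surfaces in a maximal slice with unit normal `n`, whose velocity at `t = 0` is the
multiple `α e` of the unit normal `e` of a minimal surface inducing an axisymmetric metric. -/
structure IsMinimalFamily (Ψ : SphereParam S) (M : EMSpacetime V) (f : ℝ → S → V)
    (n : ∀ t s, TangentSpace (𝓡 4) (f t s)) (e : ∀ s, TangentSpace (𝓡 4) (f 0 s)) (α : S → ℝ)
    (α' a b ω₁ ω₂ : ℝ → ℝ) : Prop where
  metric : InducesAxialMetric Ψ M (f 0) a b
  smooth : ContMDiff (𝓘(ℝ, ℝ).prod (𝓡 2)) (𝓡 4) ∞ (fun z : ℝ × S => f z.1 z.2)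
  normal_smooth : ContMDiff (𝓘(ℝ, ℝ).prod (𝓡 2)) (𝓡 4).tangent ∞
    (fun z : ℝ × S => (⟨f z.1 z.2, n z.1 z.2⟩ : TangentBundle (𝓡 4) V))
  unit : ∀ t s, M.g (f t s) (n t s) (n t s) = -1
  normal : ∀ w u, M.g (familyMap Ψ f w) (n w.1 (SphereParam.coords Ψ w))
    (mfderiv 𝓘(ℝ, ℝ × ℝ × ℝ) (𝓡 4) (familyMap Ψ f) w u) = 0
  traceFree : IsTraceFree Ψ M f n
  dir_smooth : ContMDiff (𝓡 2) (𝓡 4).tangent ∞ (fun s => (⟨f 0 s, e s⟩ : TangentBundle (𝓡 4) V))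
  lapse_smooth : ContMDiff (𝓡 2) 𝓘(ℝ, ℝ) ∞ α
  velocity : ∀ s, mfderiv 𝓘(ℝ, ℝ) (𝓡 4) (fun t => f t s) 0 (1 : ℝ) = α s • e s
  lapse_eq : ∀ x y, α (SphereParam.pt Ψ x y) = α' x
  lapse_pos : ∀ x, 0 < α' x
  dir_unit : ∀ s, M.g (f 0 s) (e s) (e s) = 1
  normal_dir : ∀ s, M.g (f 0 s) (n 0 s) (e s) = 0
  dir_normal : ∀ s v, M.g (f 0 s) (e s) (mfderiv (𝓡 2) (𝓡 4) (f 0) s v) = 0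
  null_smooth : ContMDiff (𝓡 2) (𝓡 4).tangent ∞
    (fun s => (⟨f 0 s, n 0 s + e s⟩ : TangentBundle (𝓡 4) V))
  ell_future : ∀ s, M.g (f 0 s) (M.T (f 0 s)) (n 0 s + e s) < 0
  k_future : ∀ s, M.g (f 0 s) (M.T (f 0 s)) ((1 / 2 : ℝ) • (n 0 s - e s)) < 0
  form_θ : ∀ x y, 0 < x → x < π → - M.g (f 0 (SphereParam.pt Ψ x y))
    ((1 / 2 : ℝ) • (n 0 (SphereParam.pt Ψ x y) - e (SphereParam.pt Ψ x y)))
    (covAlong M.g (f 0) (fun s => n 0 s + e s) (SphereParam.pt Ψ x y) (SphereParam.dθ Ψ x y)) = ω₁ x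
  form_φ : ∀ x y, 0 < x → x < π → - M.g (f 0 (SphereParam.pt Ψ x y))
    ((1 / 2 : ℝ) • (n 0 (SphereParam.pt Ψ x y) - e (SphereParam.pt Ψ x y)))
    (covAlong M.g (f 0) (fun s => n 0 s + e s) (SphereParam.pt Ψ x y) (SphereParam.dφ Ψ x y)) = ω₂ x
  minimal : ∀ s, expansion M.g (f 0) e s = 0

variable {M : EMSpacetime V}

/-- The remaining hypothesis of the pointwise formula is maximality: at t = 0 the velocity and the
coordinate vectors are orthogonal with squares α², a, b, so the trace-free condition applies in this
frame. -/
theorem IsMinimalFamily.second_variation {f : ℝ → S → V} {n : ∀ t s, TangentSpace (𝓡 4) (f t s)}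
    {e : ∀ s, TangentSpace (𝓡 4) (f 0 s)} {α : S → ℝ} {α' a b ω₁ ω₂ : ℝ → ℝ}
    (h : IsMinimalFamily Ψ M f n e α α' a b ω₁ ω₂) {x : ℝ} (y : ℝ) (h0 : 0 < x) (hπ : x < π) :
    let s := SphereParam.pt Ψ x y
    let C := M.F (f 0 s) (n 0 s + e s) ((1 / 2 : ℝ) • (n 0 s - e s)) ^ 2
      + hodgeDual M.g M.F M.vol (f 0 s) (n 0 s + e s) ((1 / 2 : ℝ) • (n 0 s - e s)) ^ 2
    fderiv ℝ (familyDet Ψ M.g f) (0, x, y) dirT = 0 ∧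
    fderiv ℝ (fun w => fderiv ℝ (familyDet Ψ M.g f) w dirT) (0, x, y) dirT / (2 * a x * b x)
      ≤ deriv (fun x => α' x ^ 2) x ^ 2 / (4 * α' x ^ 2 * a x)
        + α' x ^ 2 * (axialCurvature a b x - C)
        - (α' x * ω₁ x) ^ 2 / a x - (α' x * ω₂ x) ^ 2 / b x
        + (fderiv ℝ (familyAccel Ψ M.g f dirX) (0, x, y) dirX / a x
          + fderiv ℝ (familyAccel Ψ M.g f dirY) (0, x, y) dirY / b x
          + familyAccel Ψ M.g f dirX (0, x, y) * (deriv b x / (2 * a x * b x)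
            - deriv a x / (2 * a x ^ 2))) := by
  refine h.metric.second_variation h.smooth h.normal_smooth h.unit h.normal h.dir_smooth
    h.lapse_smooth h.velocity h.lapse_eq h.lapse_pos h.dir_unit h.normal_dir h.dir_normal
    h.null_smooth h.ell_future h.k_future h0 hπ (h.form_θ x y h0 hπ) (h.form_φ x y h0 hπ) h.minimal ?_
  have p0 : mfderiv 𝓘(ℝ, ℝ × ℝ × ℝ) (𝓡 4) (familyMap Ψ f) (0, x, y) dirT
      = α' x • e (SphereParam.pt Ψ x y) :=
    (family_dirT Ψ h.smooth (0, x, y)).trans ((h.velocity _).trans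
      (congrArg (fun r : ℝ => r • e (SphereParam.pt Ψ x y)) (h.lapse_eq x y)))
  obtain ⟨p1, p2, p3⟩ := familyPair_eq Ψ M.g h.smooth (0, x, y)
  have pT : ∀ u, familyPair Ψ M.g f dirT u (0, x, y)
      = α' x * M.g (f 0 (SphereParam.pt Ψ x y)) (e (SphereParam.pt Ψ x y))
        (mfderiv 𝓘(ℝ, ℝ × ℝ × ℝ) (𝓡 4) (familyMap Ψ f) (0, x, y) u) := fun u => by
    let B : E 4 →L[ℝ] E 4 →L[ℝ] ℝ := M.g (f 0 (SphereParam.pt Ψ x y))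
    let v : E 4 := mfderiv 𝓘(ℝ, ℝ × ℝ × ℝ) (𝓡 4) (familyMap Ψ f) (0, x, y) u
    let e₀ : E 4 := e (SphereParam.pt Ψ x y)
    refine (congrArg (fun z : E 4 => B z v) p0).trans ?_
    change B (α' x • e₀) v = α' x * B e₀ v
    simp
  refine h.traceFree _ (0, x, y) (mem_chart_source (E 4) _) _ _ _
    (pow_pos (h.lapse_pos x) 2).ne' (h.metric.a_pos x h0 hπ).ne' (h.metric.b_pos x h0 hπ).ne' ?_
    (p1.trans (h.metric.q11 x y h0 hπ)) (p3.trans (h.metric.q22 x y h0 hπ)) ?_ ?_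
    (p2.trans (h.metric.q12 x y h0 hπ))
  · refine (pT dirT).trans ?_
    let B : E 4 →L[ℝ] E 4 →L[ℝ] ℝ := M.g (f 0 (SphereParam.pt Ψ x y))
    let e₀ : E 4 := e (SphereParam.pt Ψ x y)
    refine (congrArg (fun z : E 4 => α' x * B e₀ z) p0).trans ?_
    change α' x * B e₀ (α' x • e₀) = _
    have : B e₀ e₀ = 1 := h.dir_unit _
    rw [map_smul, this, smul_eq_mul]
    ring
  · exact (pT dirX).trans ((congrArg (fun z => α' x * M.g (f 0 (SphereParam.pt Ψ x y))
      (e (SphereParam.pt Ψ x y)) z) (family_dirX Ψ h.smooth (0, x, y))).trans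
      ((congrArg (α' x * ·) (h.dir_normal _ _)).trans (mul_zero _)))
  · exact (pT dirY).trans ((congrArg (fun z => α' x * M.g (f 0 (SphereParam.pt Ψ x y))
      (e (SphereParam.pt Ψ x y)) z) (family_dirY Ψ h.smooth (0, x, y))).trans
      ((congrArg (α' x * ·) (h.dir_normal _ _)).trans (mul_zero _)))

end StableMinimal


/-! ### The integral estimate for stable minimal surfaces. -/

section StableMinimalEstimate

open Real MeasureTheory

variable {V : Type*} [TopologicalSpace V] [ChartedSpace (E 4) V] [IsManifold (𝓡 4) ∞ V]
  {S : Type*} [TopologicalSpace S] [ChartedSpace (E 2) S] {Ψ : SphereParam S} {M : EMSpacetime V}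

/-- The second variation is at most 2π e^c (2 + 2c - N), with N the integral of the density. It is
nonnegative, and the positive factor can be cancelled. -/
theorem IsMinimalFamily.integral_profileDensity_le {f : ℝ → S → V}
    {n : ∀ t s, TangentSpace (𝓡 4) (f t s)} {e : ∀ s, TangentSpace (𝓡 4) (f 0 s)} {α : S → ℝ}
    {c : ℝ} {σ τ ψ χ ω₁ : ℝ → ℝ}
    (h : IsMinimalFamily Ψ M f n e α (fun x => exp (c - σ x / 2)) (fun x => exp (2 * c - σ x))
      (fun x => exp (σ x) * sin x ^ 2) ω₁
      (fun x => - (exp c * sin x * (deriv τ x / exp (2 * c - σ x)))))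
    (hσ : ContDiff ℝ ∞ σ) (hi : IntegrableOn (profileDensity σ τ ψ χ) (Set.Icc 0 π))
    (h0 : σ 0 = c) (hπ : σ π = c)
    (hEB : ∀ x y, 0 < x → x < π → (M.F (f 0 (SphereParam.pt Ψ x y))
          (n 0 (SphereParam.pt Ψ x y) + e (SphereParam.pt Ψ x y))
          ((1 / 2 : ℝ) • (n 0 (SphereParam.pt Ψ x y) - e (SphereParam.pt Ψ x y))) ^ 2
        + hodgeDual M.g M.F M.vol (f 0 (SphereParam.pt Ψ x y))
          (n 0 (SphereParam.pt Ψ x y) + e (SphereParam.pt Ψ x y))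
          ((1 / 2 : ℝ) • (n 0 (SphereParam.pt Ψ x y) - e (SphereParam.pt Ψ x y))) ^ 2)
        * (exp c * sin x) ^ 2 = deriv ψ x ^ 2 + deriv χ x ^ 2)
    (hD : ∀ z ∈ Set.Icc 0 π ×ˢ Set.Icc 0 (2 * π), roundDet Ψ M.g f (0, z) = exp c ^ 2)
    (harea : 0 ≤ iteratedDeriv 2 (fun t => area Ψ (inducedMetric M.g (f t))) 0) :
    ∫ x in 0..π, profileDensity σ τ ψ χ x ≤ 2 + 2 * c := by
  obtain ⟨hint, hA⟩ := area_second_variation Ψ M h.smooth (exp_pos c) hD fun z hz =>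
    (h.second_variation z.2 hz.1.1 hz.1.2).1
  have sA := fun v => familyAccel_smooth (Ψ := Ψ) M.g_smooth h.smooth v
  have dA := fun v w => (sA v).differentiable (by simp) w
  have ea : ∀ x, exp (2 * c - σ x) = exp c ^ 2 / exp (σ x) := fun x => by
    rw [exp_sub, ← exp_nat_mul]
    norm_num
  have hP := poleTerm_smooth hσ
  -- `U` and `W` are the contravariant components of the tangential acceleration times the area
  -- density e^c sin θ; `U` carries a factor sin θ and vanishes at the poles, while `W` has one in
  -- its denominator.
  have key := integral_le_of_divergence_bound (ν := fun x => exp c * (deriv (poleTerm σ) x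
      - profileDensity σ τ ψ χ x))
    (U := fun z => exp (σ z.1) * sin z.1 * familyAccel Ψ M.g f dirX (0, z) / exp c)
    (W := fun x y => exp c / (exp (σ x) * sin x) * familyAccel Ψ M.g f dirY (0, x, y))
    hint ((((deriv_smooth hP).continuous.continuousOn.integrableOn_Icc).sub hi).const_mul _)
    (by
      have h1 : ContDiff ℝ ∞ fun z : ℝ × ℝ => σ z.1 := hσ.comp contDiff_fst
      have h2 : ContDiff ℝ ∞ fun z : ℝ × ℝ => familyAccel Ψ M.g f dirX (0, z) :=
        (sA dirX).comp (by fun_prop)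
      have h3 : ContDiff ℝ ∞ fun z : ℝ × ℝ => sin z.1 := by fun_prop
      exact ((h1.exp.mul h3).mul h2).div_const _)
    (fun y => by simp) (fun y => by simp)
    (fun x hx => contDiff_const.mul ((sA dirY).comp (by fun_prop)))
    (fun x hx => by
      have := familyAccel_periodic (Ψ := Ψ) (g := M.g) h.smooth dirY (0, x, 0)
      rw [show ((0 : ℝ), x, (0 : ℝ)) + (0, 0, 2 * π) = (0, x, 2 * π) by simp] at this
      rw [this])
    (fun x hx y hy => by
      have hs := sin_pos_of_pos_of_lt_pi hx.1 hx.2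
      have hv := (h.second_variation y hx.1 hx.2).2
      have hK := axialCurvature_adapted hσ c hs
      have hα : ∀ x, exp (c - σ x / 2) ^ 2 = exp (2 * c - σ x) := fun x => by
        rw [← exp_nat_mul]
        congr 1
        push_cast
        ring
      have e1 : deriv (fun x => exp (σ x) * sin x * familyAccel Ψ M.g f dirX (0, x, y) / exp c) x
          = ((exp (σ x) * deriv σ x * sin x + exp (σ x) * cos x)
              * familyAccel Ψ M.g f dirX (0, x, y)
            + exp (σ x) * sin x * fderiv ℝ (familyAccel Ψ M.g f dirX) (0, x, y) dirX) / exp c :=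
        (((((smooth_hasDerivAt hσ x).exp.mul (hasDerivAt_sin x)).mul
          (hasDerivAt_lineX (dA dirX (0, x, y)))).div_const _)).deriv
      have e2 : deriv (fun y => exp c / (exp (σ x) * sin x) * familyAccel Ψ M.g f dirY (0, x, y)) y
          = exp c / (exp (σ x) * sin x) * fderiv ℝ (familyAccel Ψ M.g f dirY) (0, x, y) dirY :=
        ((hasDerivAt_lineY (dA dirY (0, x, y))).const_mul _).deriv
      rw [funext hα, (hasDerivAt_radial hσ c x).deriv, (hasDerivAt_azimuthal hσ x).deriv] at hv
      have hα' := hα x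
      rw [ea] at hα'
      simp only [ea] at hv hK
      change _ ≤ _ + deriv (fun x => exp (σ x) * sin x * familyAccel Ψ M.g f dirX (0, x, y)
        / exp c) x + _
      rw [e1, e2, profileDensity, ← hEB x y hx.1 hx.2]
      exact minimal_algebra (exp_pos c) (exp_pos _) hs hα' hK hv)
  rw [hA] at harea
  have hI : ∫ x in 0..π, exp c * (deriv (poleTerm σ) x - profileDensity σ τ ψ χ x)
      = exp c * (2 + 2 * c - ∫ x in 0..π, profileDensity σ τ ψ χ x) := by
    rw [intervalIntegral.integral_const_mul, intervalIntegral.integral_sub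
      ((deriv_smooth hP).continuous.intervalIntegrable _ _)
      ((intervalIntegrable_iff_integrableOn_Icc_of_le pi_pos.le).mpr hi),
      intervalIntegral.integral_deriv_eq_sub (fun x _ => (smooth_hasDerivAt hP x).differentiableAt)
        ((deriv_smooth hP).continuous.intervalIntegrable _ _)]
    simp [poleTerm, h0, hπ]
    ring
  rw [hI] at key
  have h1 := harea.trans key
  have h2 : 0 < 2 * π * exp c := by positivity
  rw [← mul_assoc] at h1
  linarith [nonneg_of_mul_nonneg_right h1 h2]

variable [IsManifold (𝓡 2) ∞ S] {P : FramedSurface M S} {A : AxialSymmetry P}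
  {c : ℝ} {σ τ lam om ψ χ : S → ℝ}

/-- Stability is used for a single lapse, and for whatever family with that velocity the hypothesis
provides. -/
theorem IsPotentials.estimate_of_stableMinimal (h : IsPotentials P A Ψ c σ τ lam om ψ χ)
    (hI : IsStableMinimal.{w} P A Ψ) :
    ∫ x in 0..π, profileDensity (SphereParam.profile Ψ σ) (SphereParam.profile Ψ τ)
      (SphereParam.profile Ψ ψ) (SphereParam.profile Ψ χ) x ≤ 2 + 2 * c := by
  obtain ⟨N, _, _, _, H, j, ν, hj, hν, hee, hen, hL, hK, hexp, hstab⟩ := hI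
  -- The lapse with α² = e^{2c-σ}, which makes the curvature term in the second variation a total
  -- derivative up to lower order.
  set α : S → ℝ := fun s => exp (c - σ s / 2) with hα
  have hαs : A.SmoothAxisymmetric α := by
    refine ⟨?_, fun t s => by simp only [hα]; rw [h.adapted.smooth.2]⟩
    have h1 : ContDiff ℝ ∞ fun x : ℝ => exp (c - x / 2) := by fun_prop
    exact h1.contMDiff.comp h.adapted.smooth.1
  obtain ⟨J, hJ, hJ0, hJX, hnn⟩ := hstab α hαs
  have hj0 : j = J 0 := (funext hJ0).symm
  subst hj0
  have hνJ : ∀ s, mfderiv 𝓘(ℝ, ℝ) (𝓡 3) (fun t => J t s) 0 (1 : ℝ) = α s • ν s := fun s => by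
    have := hJX s
    rwa [Bundle.TotalSpace.mk_inj] at this
  set f : ℝ → S → V := fun t s => H.emb (J t s) with hfd
  set n : ∀ t s, TangentSpace (𝓡 4) (f t s) := fun t s => H.n (J t s) with hnd
  set e : ∀ s, TangentSpace (𝓡 4) (f 0 s) := fun s => mfderiv (𝓡 3) (𝓡 4) H.emb (J 0 s) (ν s)
    with hed
  have hf : ContMDiff (𝓘(ℝ, ℝ).prod (𝓡 2)) (𝓡 4) ∞ (fun z : ℝ × S => f z.1 z.2) :=
    H.family_smooth hJ
  have hn : ContMDiff (𝓘(ℝ, ℝ).prod (𝓡 2)) (𝓡 4).tangent ∞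
      (fun z : ℝ × S => (⟨f z.1 z.2, n z.1 z.2⟩ : TangentBundle (𝓡 4) V)) := H.normal_smooth hJ
  have he : ContMDiff (𝓡 2) (𝓡 4).tangent ∞
      (fun s => (⟨f 0 s, e s⟩ : TangentBundle (𝓡 4) V)) :=
    (H.emb_smooth.contMDiff_tangentMap (m := ∞) (by simp)).comp hν
  have hX : ∀ s, mfderiv 𝓘(ℝ, ℝ) (𝓡 4) (fun t => f t s) 0 (1 : ℝ) = α s • e s := by
    intro s
    have h1 := (H.emb_smooth.mdifferentiableAt (x := J 0 s) (by simp)).hasMFDerivAt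
    have h2 : ContMDiff 𝓘(ℝ, ℝ) (𝓡 3) ∞ fun t => J t s :=
      hJ.comp (contMDiff_id.prodMk contMDiff_const)
    have h3 := (h2.mdifferentiableAt (x := 0) (by simp)).hasMFDerivAt
    refine (congrArg (fun f => f (1 : ℝ)) (h1.comp (0 : ℝ) h3).mfderiv).trans ?_
    refine (congrArg (mfderiv (𝓡 3) (𝓡 4) H.emb (J 0 s)) (hνJ s)).trans ?_
    exact (mfderiv (𝓡 3) (𝓡 4) H.emb (J 0 s)).map_smul _ _
  set σ' := SphereParam.profile Ψ σ
  set τ' := SphereParam.profile Ψ τ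
  set ψ' := SphereParam.profile Ψ ψ
  set χ' := SphereParam.profile Ψ χ
  set l' := SphereParam.profile Ψ lam
  have sσ : ContDiff ℝ ∞ σ' := SphereParam.profile_smooth Ψ h.adapted.smooth.1
  -- The normals n + e and (n - e)/2 agree with those of `P` only in the tangent bundle. The metric
  -- on the closed interval is included, since the determinant is needed at the poles as well.
  obtain ⟨hell, hlf, hkf, hind, hω₁, hω₂, hEB, hq⟩ := frame_transport
    (f := f 0) (L := fun s => n 0 s + e s) (K := fun s => (1 / 2 : ℝ) • (n 0 s - e s))
    (fun emb ell k =>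
      ContMDiff (𝓡 2) (𝓡 4).tangent ∞ (fun s => (⟨emb s, ell s⟩ : TangentBundle (𝓡 4) V)) ∧
      (∀ s, M.g (emb s) (M.T (emb s)) (ell s) < 0) ∧
      (∀ s, M.g (emb s) (M.T (emb s)) (k s) < 0) ∧
      InducesAxialMetric Ψ M emb (fun x => exp (2 * c - σ' x)) (fun x => exp (σ' x) * sin x ^ 2) ∧
      (∀ x y, 0 < x → x < π → - M.g (emb (SphereParam.pt Ψ x y)) (k (SphereParam.pt Ψ x y))
        (covAlong M.g emb ell (SphereParam.pt Ψ x y) (SphereParam.dθ Ψ x y)) = deriv l' x) ∧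
      (∀ x y, 0 < x → x < π → - M.g (emb (SphereParam.pt Ψ x y)) (k (SphereParam.pt Ψ x y))
        (covAlong M.g emb ell (SphereParam.pt Ψ x y) (SphereParam.dφ Ψ x y))
        = - (exp c * sin x * (deriv τ' x / exp (2 * c - σ' x)))) ∧
      (∀ x y, 0 < x → x < π → (M.F (emb (SphereParam.pt Ψ x y)) (ell (SphereParam.pt Ψ x y))
          (k (SphereParam.pt Ψ x y)) ^ 2
        + hodgeDual M.g M.F M.vol (emb (SphereParam.pt Ψ x y)) (ell (SphereParam.pt Ψ x y))
          (k (SphereParam.pt Ψ x y)) ^ 2) * (exp c * sin x) ^ 2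
        = deriv ψ' x ^ 2 + deriv χ' x ^ 2) ∧
      (∀ x ∈ Set.Icc 0 π, ∀ y,
        inducedMetric M.g emb (SphereParam.pt Ψ x y) (SphereParam.dθ Ψ x y) (SphereParam.dθ Ψ x y)
          = exp (2 * c - σ' x) ∧
        inducedMetric M.g emb (SphereParam.pt Ψ x y) (SphereParam.dθ Ψ x y)
          (SphereParam.azimuthal Ψ x y) = 0 ∧
        inducedMetric M.g emb (SphereParam.pt Ψ x y) (SphereParam.azimuthal Ψ x y)
          (SphereParam.azimuthal Ψ x y) = exp (σ' x))) hL hK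
    ⟨P.ell_smooth, P.ell_future, P.k_future, h.adapted.inducesAxialMetric,
      fun x y h0 hπ => (h.Omega_eq x y h0 hπ).1, fun x y h0 hπ => (h.Omega_eq x y h0 hπ).2,
      fun x y h0 hπ => h.flux_sq y h0 hπ, fun x hx y => h.adapted.q_eq hx y⟩
  have hαα : ∀ x y, α (SphereParam.pt Ψ x y) = exp (c - σ' x / 2) := fun x y => by
    simp only [hα]
    rw [h.adapted.axisymmetric h.adapted.smooth]
  have hfam : IsMinimalFamily Ψ M f n e α (fun x => exp (c - σ' x / 2))
      (fun x => exp (2 * c - σ' x)) (fun x => exp (σ' x) * sin x ^ 2) (deriv l')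
      (fun x => - (exp c * sin x * (deriv τ' x / exp (2 * c - σ' x)))) :=
    { metric := hind
      smooth := hf
      normal_smooth := hn
      unit := fun t s => H.n_unit (J t s)
      normal := H.normal_family Ψ hJ
      traceFree := H.isTraceFree hJ
      dir_smooth := he
      lapse_smooth := hαs.1
      velocity := hX
      lapse_eq := hαα
      lapse_pos := fun x => exp_pos _
      dir_unit := hee
      normal_dir := fun s => H.n_normal (J 0 s) (ν s)
      dir_normal := hen
      null_smooth := hell
      ell_future := hlf
      k_future := hkf
      form_θ := hω₁
      form_φ := hω₂
      minimal := hexp }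
  refine hfam.integral_profileDensity_le sσ h.density_integrable h.adapted.profile_pole.1
    h.adapted.profile_pole.2 hEB (fun z hz => ?_) hnn
  obtain ⟨q1, q2, q3⟩ := hq z.1 hz.1 z.2
  refine (congrArg₂ (· - ·) (congrArg₂ (· * ·) q1 q3) (congrArg (· ^ 2) q2)).trans ?_
  rw [← exp_add, ← exp_nat_mul]
  norm_num

end StableMinimalEstimate

end

/-! ### The area inequality for both kinds of stable surfaces. -/

theorem lemma1 {V : Type v} [TopologicalSpace V] [ChartedSpace (E 4) V]
    [IsManifold (𝓡 4) ∞ V] (M : EMSpacetime V)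
    {S : Type s} [TopologicalSpace S] [ChartedSpace (E 2) S] [IsManifold (𝓡 2) ∞ S]
    (P : FramedSurface M S) (A : AxialSymmetry P) (Ψ : SphereParam S)
    (h : IsStableMOTS P A ∨ IsStableMinimal.{w} P A Ψ)
    (c : ℝ) (σ τ lam om ψ χ : S → ℝ) (hpot : IsPotentials P A Ψ c σ τ lam om ψ χ) :
    MeasureTheory.IntegrableOn (functionalIntegrand Ψ σ om ψ χ) coordDomain ∧
    4 * Real.pi * Real.exp ((functionalM Ψ σ om ψ χ - 8) / 8) ≤ area Ψ P.q := by
  refine hpot.area_bound ?_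
  rcases h with h | h
  · exact hpot.estimate_of_stableMOTS h
  · exact hpot.estimate_of_stableMinimal h
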